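/- **Notation.** For $g:\mathbb R^2\to\mathbb R$ write $g^{(i,j)}=\partial_1^i\partial_2^j g$, let $\nabla g$, $\nabla^2 g$ be the gradient and Hessian, and let $d^2g=(g^{(2,0)},g^{(1,1)},g^{(0,2)})^T$. Let $$G(u,v,w)=\begin{pmatrix}2u-2w+2v-2\sqrt{(w-u)^2+4v^2}\\ w-u+4v-\sqrt{(w-u)^2+4v^2}\end{pmatrix},\qquad J(u,v,w)=\tfrac12\Big(u+w-\sqrt{(u-w)^2+4v^2}\Big),$$ and $V_g=G(d^2g)$, $\lambda_{2,g}=J(d^2g)$ (a second eigenvector and the smaller eigenvalue of $\nabla^2g$). Let $\mathfrak X^g_{x_0}:\mathbb R\to\mathbb R^2$ be the integral curve $\dot{\mathfrak X}=V_g(\mathfrak X)$, $\mathfrak X(0)=x_0$, and let $\Theta^g_{x_0}=\{t\in\mathbb R:\langle\nabla g,V_g\rangle(\mathfrak X^g_{x_0}(t))=0,\ \lambda_{2,g}(\mathfrak X^g_{x_0}(t))<0\}$. For $g=f$ the index $g$ is omitted; $\nabla V$ and $\nabla G$ are Jacobian matrices. **Assumptions.** * *Density.* $f\ge 0$ is a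 $C^4$ probability density on $\mathbb R^2$ whose partial derivatives of orders 1 to 4 are bounded. $\mathcal H\subset\mathbb R^2$ is compact, $f>0$ on an open $\epsilon_0$-neighbourhood of $\mathcal H$ for some $\epsilon_0>0$, and $\nabla^2f(x)$ has two distinct eigenvalues for every $x\in\mathcal H$. * *Filament.* $\mathcal L$ is compact, $a^*>0$, and $\mathcal G=\{\mathfrak X_{x}(t):x\in\mathcal L,\ |t|\le a^*\}\subset\mathcal H$. For each $x\in\mathcal G$ the minimiser $\theta_{x}$ of $|t|$ over $t\in\Theta_{x}$ exists and is unique, and $\mathcal L=\{\mathfrak X_{x}(\theta_{x}):x\in\mathcal G\}$. There is $\gamma>0$ with $\big\|\frac1{u-s}\int_s^uV(\mathfrak X_{x}(r))\,dr\big\|\ge\gamma$ for all $x\in\mathcal L$ and $-a^*\le s<u\le a^*$. Moreover $\langle\nabla\langle\nabla f,V\rangle,V\rangle\ne0$ on $\mathcal L$, and no $x\in\mathcal H$ satisfies $\lambda_2(x)=0=\langle\nabla f(x),V(x)\rangle$. * *Kernel.* $K$ is a four times differentiable probability density on $\mathbb R^2$ with $K(-z)=K(z)$, support the closed unit ball,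 bounded partial derivatives of orders 1 to 4, $\int K(z)zz^Tdz=\mu_2(K)I$, and $\int d^2K(z)\,d^2K(z)^Tdz$ finite. * *Bandwidth.* $h=h_n>0$, and as $n\to\infty$: $h_n\to0$, $nh_n^8/(\log n)^3\to\infty$, $nh_n^9\to\beta$ with $\beta\ge0$. **Estimators.** Let $X_1,X_2,\dots$ be i.i.d. with density $f$, $\hat f(x)=\frac1{nh^2}\sum_{i=1}^nK\big(\frac{x-X_i}h\big)$, and $\hat{\mathfrak X}_{x_0}=\mathfrak X^{\hat f}_{x_0}$. Let $\hat\theta_{x_0}$ be a (measurable choice of a) minimiser of $|t|$ over $t\in\Theta^{\hat f}_{x_0}$ whenever such a minimiser exists, $\hat\theta_{x_0}=0$ if $\Theta^{\hat f}_{x_0}=\emptyset$, and arbitrary otherwise. **Corollary.** Fix $x_0\in\mathcal G$, write $\theta=\theta_{x_0}$ and $x^*=\mathfrak X_{x_0}(\theta)$, and suppose that $\nabla f(x^*)=0$. Suppose also that $\lambda_2$ and $\langle\nabla f,V\rangle$ do not vanish simultaneously at any point $\mathfrak X_{x_0}(t)$ with $|t|\le|\theta|$ (this is automatic at the points that lie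 in $\mathcal H$). Put $\tilde a'=\nabla f^T\,\nabla V\,V+\lambda_2\|V\|^2$ and $$P_V=V(x^*)V(x^*)^T,\qquad \Gamma=\frac1{\tilde a'(x^*)}P_V\nabla^2f(x^*)-I,\qquad b=\tfrac12\mu_2(K)\begin{pmatrix}f^{(3,0)}+f^{(1,2)}\\ f^{(0,3)}+f^{(2,1)}\end{pmatrix}(x^*).$$ For $x=\mathfrak X_{x_0}(t)$ put $\tilde G(x)=\nabla G(d^2f(x))$, $v(x)=\big(\int K(z)z^T\nabla^2g(x)z\,dz\big)_{g=f^{(2,0)},f^{(1,1)},f^{(0,2)}}$ and $$Q(x)=\tilde G(x)\Big[\int_{\mathbb R}\int_{\mathbb R^2}d^2K(z)\,d^2K(\tau V(x)+z)^Tf(x)\,dz\,d\tau\Big]\tilde G(x)^T.$$ Then there are functions $m$ and $\Sigma$ of $t$ between $0$ and $\theta$ with values in $\mathbb R^2$ and $\mathbb R^{2\times2}$ such that, along $x=\mathfrak X_{x_0}(t)$, $$\dot m=\tfrac{\sqrt\beta}2\tilde G(x)v(x)+\nabla V(x)\,m,\quad m(0)=0;\qquad \dot\Sigma=\nabla V(x)\Sigma+\Sigma\,\nabla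 V(x)^T+\operatorname{sgn}(\theta)\,Q(x),\quad\Sigma(0)=0$$ (they are the mean and the covariance of the Gaussian process $\omega$ with $d\omega=\frac{\sqrt\beta}2\tilde Gv\,dt+\nabla V\omega\,dt+Q^{1/2}dW$, $\omega(0)=0$, where $W$ is a two-sided Brownian motion), the matrix $\Sigma(\theta)$ is positive semidefinite, and, in distribution as $n\to\infty$, $$\sqrt{nh^5}\,\big[\hat{\mathfrak X}_{x_0}(\hat\theta_{x_0})-\mathfrak X_{x_0}(\theta_{x_0})\big]\ \longrightarrow\ \mathscr N\Big(-\Gamma\,m(\theta)-\frac{\sqrt\beta}{\tilde a'(x^*)}\,P_V\,b,\ \ \Gamma\,\Sigma(\theta)\,\Gamma^T\Big).$$ -/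

import Mathlib

open MeasureTheory ProbabilityTheory Filter Set
open scoped Topology Matrix

namespace Filament

/-- The plane. -/
abbrev Plane : Type := EuclideanSpace ℝ (Fin 2)

/-- Three-dimensional Euclidean space, where `d² g` takes its values. -/
abbrev Space : Type := EuclideanSpace ℝ (Fin 3)

/-! ### Partial derivatives, gradient, Hessian -/

/-- The first order partial derivative in the `k`-th coordinate direction. -/
noncomputable def dir (k : Fin 2) (g : Plane → ℝ) : Plane → ℝ :=
  fun x => fderiv ℝ g x (EuclideanSpace.single k 1)

/-- The partial derivative `g^{(i,j)}`, of order `i` in `x₁` and of order `j` in `x₂`. -/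
noncomputable def pd (i j : ℕ) (g : Plane → ℝ) : Plane → ℝ :=
  (dir 0)^[i] ((dir 1)^[j] g)

/-- The gradient. -/
noncomputable def grad (g : Plane → ℝ) (x : Plane) : Plane :=
  !₂[pd 1 0 g x, pd 0 1 g x]

/-- The Hessian matrix. -/
noncomputable def hess (g : Plane → ℝ) (x : Plane) : Matrix (Fin 2) (Fin 2) ℝ :=
  !![pd 2 0 g x, pd 1 1 g x; pd 1 1 g x, pd 0 2 g x]

/-- The vector `d² g = (g^{(2,0)}, g^{(1,1)}, g^{(0,2)})`. -/
noncomputable def d2 (g : Plane → ℝ) (x : Plane) : Space :=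
  !₂[pd 2 0 g x, pd 1 1 g x, pd 0 2 g x]

/-- The Jacobian matrix of a vector field. -/
noncomputable def jac {p q : ℕ} (F : EuclideanSpace ℝ (Fin p) → EuclideanSpace ℝ (Fin q))
    (x : EuclideanSpace ℝ (Fin p)) : Matrix (Fin q) (Fin p) ℝ :=
  Matrix.of fun i j => fderiv ℝ F x (EuclideanSpace.single j 1) i

/-- A matrix acting on a Euclidean vector. -/
noncomputable def act {p q : ℕ} (M : Matrix (Fin q) (Fin p) ℝ) (v : EuclideanSpace ℝ (Fin p)) :
    EuclideanSpace ℝ (Fin q) :=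
  Matrix.toLpLin 2 2 M v

/-- `⟨v, w⟩_M = vᵀ M w`. -/
noncomputable def bil (M : Matrix (Fin 2) (Fin 2) ℝ) (v w : Plane) : ℝ :=
  inner ℝ v (act M w)

/-! ### Second eigenvectors of the Hessian and their integral curves

All notions below are functionals of a function `g` on the plane. They are applied both to the
density and to its kernel estimator. -/

/-- The map `G` that sends the entries of a symmetric matrix to a second eigenvector of it. -/
noncomputable def G (y : Space) : Plane :=
  !₂[2 * y 0 - 2 * y 2 + 2 * y 1 - 2 * √((y 2 - y 0) ^ 2 + 4 * y 1 ^ 2),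
     y 2 - y 0 + 4 * y 1 - √((y 2 - y 0) ^ 2 + 4 * y 1 ^ 2)]

/-- The smaller eigenvalue of the symmetric matrix with entries `u, v; v, w`. -/
noncomputable def J (y : Space) : ℝ :=
  (y 0 + y 2 - √((y 0 - y 2) ^ 2 + 4 * y 1 ^ 2)) / 2

/-- The second eigenvector `V = G(d² g)` of the Hessian. -/
noncomputable def V (g : Plane → ℝ) (x : Plane) : Plane := G (d2 g x)

/-- The second (smaller) eigenvalue `λ₂ = J(d² g)` of the Hessian. -/
noncomputable def lam2 (g : Plane → ℝ) (x : Plane) : ℝ := J (d2 g x)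

/-- The slope `⟨∇g, V⟩` in the direction of the second eigenvector. -/
noncomputable def dirSlope (g : Plane → ℝ) (x : Plane) : ℝ := inner ℝ (grad g x) (V g x)

/-- The integral curve of `V` that starts at `x₀`: the solution, on the whole real line, of
`γ' = V(γ)`, `γ(0) = x₀`. It exists and is unique when `V` is Lipschitz continuous, which is the
case when the third order partial derivatives of `g` are bounded. -/
noncomputable def curve (g : Plane → ℝ) (x₀ : Plane) : ℝ → Plane :=
  Classical.epsilon fun γ : ℝ → Plane =>
    γ 0 = x₀ ∧ ∀ t, HasDerivAt γ (V g (γ t)) t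

/-- The times at which the integral curve from `x₀` is at a filament point. -/
noncomputable def Theta (g : Plane → ℝ) (x₀ : Plane) : Set ℝ :=
  {t | dirSlope g (curve g x₀ t) = 0 ∧ lam2 g (curve g x₀ t) < 0}

/-- `t` is a minimiser of `|t|` over `Theta g x₀`. -/
def IsFirstTime (g : Plane → ℝ) (x₀ : Plane) (t : ℝ) : Prop :=
  t ∈ Theta g x₀ ∧ ∀ s ∈ Theta g x₀, |t| ≤ |s|

/-- The set `𝒢(ℒ, a)` of starting points: the points on integral curves through points of `ℒ`, at
times between `-a` and `a`. -/
def startSet (f : Plane → ℝ) (L : Set Plane) (a : ℝ) : Set Plane :=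
  {y | ∃ x ∈ L, ∃ t ∈ Icc (-a) a, curve f x t = y}

/-! ### Assumptions -/

/-- The assumptions on the density `f`, the compact set `H`, the filament `L` and the number
`a`. -/
structure DensityAssumptions (f : Plane → ℝ) (H L : Set Plane) (a : ℝ) : Prop where
  nonneg : ∀ x, 0 ≤ f x
  integrable : Integrable f
  integral_eq_one : ∫ x, f x = 1
  contDiff : ContDiff ℝ 4 f
  bounded : ∀ i j : ℕ, 1 ≤ i + j → i + j ≤ 4 → ∃ C, ∀ x, |pd i j f x| ≤ C
  isCompact_H : IsCompact H
  pos : ∃ ε > 0, ∀ x ∈ Metric.thickening ε H, 0 < f x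
  distinct : ∀ x ∈ H, ∃ l₁ l₂ : ℝ, l₁ ≠ l₂ ∧
    Module.End.HasEigenvalue (Matrix.toLin' (hess f x)) l₁ ∧
    Module.End.HasEigenvalue (Matrix.toLin' (hess f x)) l₂
  isCompact_L : IsCompact L
  a_pos : 0 < a
  startSet_subset : startSet f L a ⊆ H
  unique_time : ∀ x ∈ startSet f L a, ∃! t, IsFirstTime f x t
  L_eq : L = {y | ∃ x ∈ startSet f L a, ∃ t, IsFirstTime f x t ∧ curve f x t = y}
  mean_velocity : ∃ γ > 0, ∀ x ∈ L, ∀ s ∈ Icc (-a) a, ∀ u ∈ Icc (-a) a, s < u →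
    γ ≤ ‖(u - s)⁻¹ • ∫ r in s..u, V f (curve f x r)‖
  transversal : ∀ x ∈ L, inner ℝ (grad (dirSlope f) x) (V f x) ≠ 0
  nondegenerate : ∀ x ∈ H, ¬ (lam2 f x = 0 ∧ dirSlope f x = 0)

/-- The number `μ₂(K)`. -/
noncomputable def mu2 (K : Plane → ℝ) : ℝ := ∫ z, K z * z 0 ^ 2

/-- The assumptions on the kernel `K`. The first two fields say that `K` is four times
differentiable; the last one says that the matrix `∫ d²K (d²K)ᵀ` is finite. -/
structure KernelAssumptions (K : Plane → ℝ) : Prop where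
  contDiff : ContDiff ℝ 3 K
  differentiable : Differentiable ℝ (iteratedFDeriv ℝ 3 K)
  nonneg : ∀ z, 0 ≤ K z
  integrable : Integrable K
  integral_eq_one : ∫ z, K z = 1
  symmetric : ∀ z, K (-z) = K z
  support_eq : tsupport K = Metric.closedBall 0 1
  bounded : ∀ i j : ℕ, 1 ≤ i + j → i + j ≤ 4 → ∃ C, ∀ z, |pd i j K z| ≤ C
  second_moment : ∀ i j : Fin 2, ∫ z : Plane, K z * (z i * z j) = if i = j then mu2 K else 0
  roughness : ∀ i j : Fin 3, Integrable fun z => d2 K z i * d2 K z j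

/-- The assumptions on the bandwidths `h n`. -/
structure BandwidthAssumptions (h : ℕ → ℝ) (β : ℝ) : Prop where
  pos : ∀ n, 0 < h n
  tendsto_zero : Tendsto h atTop (𝓝 0)
  lower : Tendsto (fun n : ℕ => (n : ℝ) * h n ^ 8 / Real.log n ^ 3) atTop atTop
  nonneg : 0 ≤ β
  upper : Tendsto (fun n : ℕ => (n : ℝ) * h n ^ 9) atTop (𝓝 β)

/-! ### Estimators -/

/-- The kernel density estimator built from the first `n` points of the sequence `X`. -/
noncomputable def kde (K : Plane → ℝ) (h : ℝ) (n : ℕ) (X : ℕ → Plane) (x : Plane) : ℝ :=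
  ((n : ℝ) * h ^ 2)⁻¹ * ∑ i ∈ Finset.range n, K (h⁻¹ • (x - X i))

/-! ### The parameters of the limit law -/

/-- `ã'(x) = ⟨∇f, V⟩_{∇V} + λ₂ ‖V‖²`. -/
noncomputable def aPrime (f : Plane → ℝ) (x : Plane) : ℝ :=
  bil (jac (V f) x) (grad f x) (V f x) + lam2 f x * ‖V f x‖ ^ 2

/-- `P_V = V Vᵀ`. -/
noncomputable def PV (f : Plane → ℝ) (x : Plane) : Matrix (Fin 2) (Fin 2) ℝ :=
  Matrix.vecMulVec (V f x) (V f x)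

/-- `Γ = (ã')⁻¹ P_V ∇²f - I`. -/
noncomputable def Gam (f : Plane → ℝ) (x : Plane) : Matrix (Fin 2) (Fin 2) ℝ :=
  (aPrime f x)⁻¹ • (PV f x * hess f x) - 1

/-- `b = μ₂(K)/2 · (f^{(3,0)} + f^{(1,2)}, f^{(0,3)} + f^{(2,1)})`. -/
noncomputable def bias (f K : Plane → ℝ) (x : Plane) : Plane :=
  (mu2 K / 2) • !₂[pd 3 0 f x + pd 1 2 f x, pd 0 3 f x + pd 2 1 f x]

/-- `∫ K(z) zᵀ ∇²g(x) z dz`. -/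
noncomputable def kernelHess (K g : Plane → ℝ) (x : Plane) : ℝ :=
  ∫ z : Plane, K z * bil (hess g x) z z

/-- The vector `v(x)`, whose entries are `∫ K(z) zᵀ ∇²g(x) z dz` for `g = f^{(2,0)}`,
`f^{(1,1)}`, `f^{(0,2)}`. -/
noncomputable def vBias (f K : Plane → ℝ) (x : Plane) : Space :=
  !₂[kernelHess K (pd 2 0 f) x, kernelHess K (pd 1 1 f) x, kernelHess K (pd 0 2 f) x]

/-- The matrix `∇G(d² f(x))`. -/
noncomputable def Gtilde (f : Plane → ℝ) (x : Plane) : Matrix (Fin 2) (Fin 3) ℝ :=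
  jac G (d2 f x)

/-- The matrix `∫∫ d²K(z) d²K(τ V(x) + z)ᵀ f(x) dz dτ`. -/
noncomputable def innerCov (f K : Plane → ℝ) (x : Plane) : Matrix (Fin 3) (Fin 3) ℝ :=
  Matrix.of fun i j => ∫ τ : ℝ, ∫ z : Plane, d2 K z i * d2 K (τ • V f x + z) j * f x

/-- The squared diffusion coefficient of the Gaussian limit of the integral curve estimator. -/
noncomputable def diffusion (f K : Plane → ℝ) (x : Plane) : Matrix (Fin 2) (Fin 2) ℝ :=
  Gtilde f x * innerCov f K x * (Gtilde f x)ᵀ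

/-- `m` is, between the times `0` and `θ`, the mean function of the solution `ω` of
`dω = (√β/2) ∇G(d²f(X)) v(X) dt + ∇V(X) ω dt + (diffusion(X))^{1/2} dW`, `ω(0) = 0`, where `X` is
the integral curve from `x₀`. -/
def IsLimitMean (f K : Plane → ℝ) (β : ℝ) (x₀ : Plane) (θ : ℝ) (m : ℝ → Plane) : Prop :=
  m 0 = 0 ∧ ∀ t ∈ uIcc 0 θ,
    HasDerivWithinAt m
      ((√β / 2) • act (Gtilde f (curve f x₀ t)) (vBias f K (curve f x₀ t)) +
        act (jac (V f) (curve f x₀ t)) (m t))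
      (uIcc 0 θ) t

/-- `S` is, between the times `0` and `θ`, the covariance function `t ↦ Cov(ω(t))` of the process
`ω` in `IsLimitMean`. The Brownian motion `W` is two-sided, so the diffusion term enters with a
minus sign when time runs backwards from `0` to `θ < 0`. -/
def IsLimitCov (f K : Plane → ℝ) (x₀ : Plane) (θ : ℝ) (S : ℝ → Matrix (Fin 2) (Fin 2) ℝ) :
    Prop :=
  S 0 = 0 ∧ ∀ t ∈ uIcc 0 θ, ∀ i j : Fin 2,
    HasDerivWithinAt (fun s => S s i j)
      ((jac (V f) (curve f x₀ t) * S t + S t * (jac (V f) (curve f x₀ t))ᵀ +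
        Real.sign θ • diffusion f K (curve f x₀ t)) i j)
      (uIcc 0 θ) t

end Filament

open Filament

/-! Let z be the difference between the estimated and the true integral curve, and let δ be the
error of the estimated second derivatives along the true curve. Since V = G(d²f), subtracting the
two differential equations and expanding G gives, with time run from 0 to |θ| in the direction σ =
±1, an equation z' = σ(∇V z + ∇G δ) + O(‖δ‖²) + o(‖z‖) (`exists_remainder_bound`). Here G is
differentiable because V does not vanish on the path, so the two eigenvalues stay apart there.

Two rates decide what survives the scaling by √(nh⁵). Pointwise, ‖δ‖² has mean of order 1/(nh⁶) +
h⁴, and √(nh⁵) times this tends to zero, so the quadratic remainder disappears. Linear functionals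
of δ along the path are better behaved: the curve stays in a disc of radius h only for a time of
order h, because the mean velocity condition makes chords comparable with time increments.
Integration along the path therefore gains one power of h in the variance, which becomes of order
1/(nh⁵). Their bias is of order h², and √(nh⁵) h² = √(nh⁹) tends to √β.

At the end point x* the gradient vanishes. Along an integral curve the gradient has derivative λ₂V,
so the slope crosses zero at θ with derivative λ₂‖V‖², which is then the value of ã'. Writing Δ for
the error of the filament time, orthogonality of the estimated gradient and the estimated field
reads ⟨∇f̂(x*) + ∇²f z + Δ λ₂ V, V⟩ ≈ 0. Solving for Δ and inserting it in z + ΔV yields -Γz - P_V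
∇f̂(x*)/ã' (`exists_endpoint_bound`, `endpoint_expansion`). The noise of ∇f̂(x*) has variance of
order 1/(nh⁴), which is negligible, so this term contributes only its bias √β b.

For a fixed test vector p, the solution q of the adjoint equation with final value -Γᵀp turns -⟨p,
Γz(|θ|)⟩ into ∫⟨q, σ∇G δ⟩ up to negligible terms (`adjoint_bound`, `exists_linearization`). That
integral is a centred empirical mean of a single function of one observation. A central limit
theorem for bounded triangular arrays gives its characteristic function
(`tendsto_integral_cexp_emp`); the limiting variance comes from the substitution t = s + hτ in a
double integral along the path (`tendsto_second_moment`). The equations for m and Σ are dual to the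
same q, which identifies the limit (`exists_limit_mean_cov`).

All expansions are deterministic on the event that f̂ is close to f with its derivatives of orders
one to three on a large ball. The probability of this event tends to one by an exponential
inequality, a grid and nh⁸/(log n)³ → ∞ (`tendsto_measure_not_close`). There the estimated curve
also has a first filament time near θ (`exists_isFirstTime`). -/

namespace Filament

/-! ### Iterated partial derivatives along words -/

/-- The iterated partial derivative along a word of coordinate directions. -/
noncomputable def wd (w : List (Fin 2)) (g : Plane → ℝ) : Plane → ℝ := w.foldr dir g

@[simp] lemma wd_nil (g : Plane → ℝ) : wd [] g = g := rfl

@[simp] lemma wd_cons (k : Fin 2) (w : List (Fin 2)) (g : Plane → ℝ) :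
    wd (k :: w) g = dir k (wd w g) := rfl

lemma wd_append (v w : List (Fin 2)) (g : Plane → ℝ) : wd (v ++ w) g = wd v (wd w g) := by
  simp [wd, List.foldr_append]

lemma wd_replicate (k : Fin 2) (n : ℕ) (g : Plane → ℝ) :
    wd (List.replicate n k) g = (dir k)^[n] g := by
  induction n with
  | zero => rfl
  | succ n ih => rw [List.replicate_succ, wd_cons, ih, Function.iterate_succ_apply']

lemma pd_eq_wd (i j : ℕ) (g : Plane → ℝ) :
    pd i j g = wd (List.replicate i 0 ++ List.replicate j 1) g := by
  rw [wd_append, wd_replicate, wd_replicate, pd]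

/-- `g` has partial derivatives along all words of length `k`, and those along shorter words are
differentiable. -/
def DiffWords : ℕ → (Plane → ℝ) → Prop
  | 0, _ => True
  | k + 1, g => Differentiable ℝ g ∧ ∀ a, DiffWords k (dir a g)

lemma fderiv_eq_sum_dir (g : Plane → ℝ) (x v : Plane) :
    fderiv ℝ g x v = v 0 * dir 0 g x + v 1 * dir 1 g x := by
  have hv : v = v 0 • EuclideanSpace.single (0 : Fin 2) (1 : ℝ)
      + v 1 • EuclideanSpace.single (1 : Fin 2) (1 : ℝ) := by
    ext i; fin_cases i <;> simp
  conv_lhs => rw [hv]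
  simp [dir]

lemma fderiv_eq_dir_smul (g : Plane → ℝ) (x : Plane) :
    fderiv ℝ g x = dir 0 g x • (EuclideanSpace.proj (0 : Fin 2) : Plane →L[ℝ] ℝ)
      + dir 1 g x • (EuclideanSpace.proj (1 : Fin 2) : Plane →L[ℝ] ℝ) := by
  ext v
  rw [fderiv_eq_sum_dir]
  simp [mul_comm]

/-- Symmetry of second derivatives needs only that the first derivative is differentiable, and this
follows because `fderiv ℝ g` is a combination of the two partial derivatives with constant
functionals. Continuity of second derivatives is not needed, which matters for the fourth order
derivatives of the kernel. -/
lemma dir_comm {g : Plane → ℝ} (hg : DiffWords 2 g) (a b : Fin 2) :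
    dir a (dir b g) = dir b (dir a g) := by
  have h' : Differentiable ℝ (fderiv ℝ g) := by
    have : fderiv ℝ g = fun x => dir 0 g x • (EuclideanSpace.proj (0 : Fin 2) : Plane →L[ℝ] ℝ)
        + dir 1 g x • (EuclideanSpace.proj (1 : Fin 2) : Plane →L[ℝ] ℝ) := by
      funext x; exact fderiv_eq_dir_smul g x
    rw [this]
    exact ((hg.2 0).1.smul_const _).add ((hg.2 1).1.smul_const _)
  funext x
  have key := second_derivative_symmetric (f := g) (f' := fderiv ℝ g)
    (f'' := fderiv ℝ (fderiv ℝ g) x) (x := x) (fun y => (hg.1 y).hasFDerivAt)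
    (h' x).hasFDerivAt (EuclideanSpace.single a 1) (EuclideanSpace.single b 1)
  have e : ∀ a b : Fin 2, dir a (dir b g) x =
      fderiv ℝ (fderiv ℝ g) x (EuclideanSpace.single a 1) (EuclideanSpace.single b 1) := by
    intro a b
    have := ((h' x).hasFDerivAt.clm_apply
      (hasFDerivAt_const (EuclideanSpace.single b (1 : ℝ)) x)).fderiv
    unfold dir
    rw [this]; simp
  rw [e, e, key]

lemma DiffWords.mono {k l : ℕ} {g : Plane → ℝ} (hg : DiffWords l g) (h : k ≤ l) :
    DiffWords k g := by
  induction k generalizing l g with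
  | zero => trivial
  | succ k ih =>
    obtain ⟨l, rfl⟩ : ∃ m, l = m + 1 := ⟨l - 1, by omega⟩
    exact ⟨hg.1, fun a => ih (hg.2 a) (by omega)⟩

lemma DiffWords.wd {k : ℕ} {g : Plane → ℝ} (w : List (Fin 2)) (hg : DiffWords (k + w.length) g) :
    DiffWords k (wd w g) := by
  induction w generalizing k with
  | nil => exact hg
  | cons a w ih =>
    have : DiffWords (k + 1) (Filament.wd w g) :=
      ih (by simpa [add_assoc, add_comm 1] using hg)
    exact this.2 a

/-- Each transposition of neighbouring letters is an instance of `dir_comm` for the function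
differentiated along the letters to their right. -/
lemma wd_perm {v w : List (Fin 2)} (h : v.Perm w) {g : Plane → ℝ} (hg : DiffWords w.length g) :
    wd v g = wd w g := by
  induction h with
  | nil => rfl
  | cons a _ ih => rw [wd_cons, wd_cons, ih (hg.mono (by simp))]
  | swap a b l =>
    simp only [wd_cons]
    exact dir_comm (DiffWords.wd l (hg.mono (by simp; omega))) _ _
  | trans h₁ h₂ ih₁ ih₂ => rw [ih₁ (by rwa [h₂.length_eq]), ih₂ hg]

lemma perm_replicate (w : List (Fin 2)) :
    w.Perm (List.replicate (w.count 0) 0 ++ List.replicate (w.count 1) 1) := by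
  rw [List.perm_iff_count]
  intro a
  fin_cases a <;> simp [List.count_append, List.count_replicate]

lemma length_eq_count (w : List (Fin 2)) : w.count 0 + w.count 1 = w.length := by
  have := (perm_replicate w).length_eq
  simpa using this.symm

lemma wd_eq_pd {w : List (Fin 2)} {g : Plane → ℝ} (hg : DiffWords w.length g) :
    wd w g = pd (w.count 0) (w.count 1) g := by
  rw [pd_eq_wd]
  refine wd_perm (perm_replicate w) (hg.mono ?_)
  simp [length_eq_count]

lemma contDiff_dir {n : ℕ} {g : Plane → ℝ} (hg : ContDiff ℝ (n + 1 : ℕ) g) (a : Fin 2) :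
    ContDiff ℝ n (dir a g) := by
  have h := hg.fderiv_right (m := (n : WithTop ℕ∞)) (by norm_cast)
  exact h.clm_apply contDiff_const

lemma contDiff_wd {n : ℕ} {g : Plane → ℝ} (w : List (Fin 2))
    (hg : ContDiff ℝ (n + w.length : ℕ) g) : ContDiff ℝ n (wd w g) := by
  induction w generalizing n with
  | nil => simpa using hg
  | cons a w ih =>
    refine contDiff_dir (ih (n := n + 1) ?_) a
    convert hg using 2
    simp; ring

lemma ContDiff.diffWords {n : ℕ} {g : Plane → ℝ} (hg : ContDiff ℝ n g) : DiffWords n g := by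
  induction n generalizing g with
  | zero => trivial
  | succ n ih => exact ⟨hg.differentiable (by norm_cast), fun a => ih (contDiff_dir hg a)⟩

lemma diffWords_of_wd {k l : ℕ} {g : Plane → ℝ} (hg : DiffWords l g)
    (h : ∀ w : List (Fin 2), w.length = l → DiffWords k (wd w g)) : DiffWords (k + l) g := by
  induction l generalizing g with
  | zero => exact h [] rfl
  | succ l ih =>
    refine ⟨hg.1, fun a => ih (hg.2 a) fun w hw => ?_⟩
    have := h (w ++ [a]) (by simp [hw])
    rwa [wd_append] at this

lemma wd_eq_iteratedFDeriv {g : Plane → ℝ} (w : List (Fin 2)) {n : ℕ} (hn : w.length = n)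
    (hg : ContDiff ℝ n g) (x : Plane) :
    wd w g x = iteratedFDeriv ℝ n g x (fun i => EuclideanSpace.single (w.get (i.cast hn.symm)) 1) := by
  subst hn
  induction w generalizing x with
  | nil => simp
  | cons a w ih =>
    have hg' : ContDiff ℝ w.length g := hg.of_le (by norm_cast; simp)
    have h1 : wd w g = fun x => iteratedFDeriv ℝ w.length g x
        (fun i => EuclideanSpace.single (w.get i) 1) := by
      funext x; exact ih x hg'
    have hd : Differentiable ℝ (iteratedFDeriv ℝ w.length g) :=
      hg.differentiable_iteratedFDeriv (by norm_cast; simp)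
    change fderiv ℝ (wd w g) x _ = _
    rw [h1]
    change _ = iteratedFDeriv ℝ (w.length + 1) g x _
    rw [iteratedFDeriv_succ_apply_left]
    rw [((hd x).hasFDerivAt.continuousMultilinear_apply_const _).fderiv]
    rfl

/-- The kernel need not be C⁴. Derivatives along words of length three are values of the third
iterated derivative at fixed vectors, hence inherit its differentiability. -/
lemma diffWords_four {K : Plane → ℝ} (hK : ContDiff ℝ 3 K)
    (hd : Differentiable ℝ (iteratedFDeriv ℝ 3 K)) : DiffWords 4 K := by
  refine diffWords_of_wd (k := 1) (l := 3) (ContDiff.diffWords hK) fun w hw => ⟨?_, fun _ => trivial⟩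
  have : wd w K = fun x => iteratedFDeriv ℝ 3 K x
      (fun i => EuclideanSpace.single (w.get (i.cast hw.symm)) 1) := by
    funext x; exact wd_eq_iteratedFDeriv w hw hK x
  rw [this]
  exact fun x => ((hd x).hasFDerivAt.continuousMultilinear_apply_const _).differentiableAt

/-! ### Lipschitz bounds -/

lemma norm_fderiv_le_of_dir {g : Plane → ℝ} {x : Plane} {C : ℝ}
    (h : ∀ a, |dir a g x| ≤ C) : ‖fderiv ℝ g x‖ ≤ 2 * C := by
  have hC : 0 ≤ C := (abs_nonneg _).trans (h 0)
  refine ContinuousLinearMap.opNorm_le_bound _ (by positivity) fun v => ?_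
  rw [fderiv_eq_sum_dir, Real.norm_eq_abs]
  have h0 : |v 0| ≤ ‖v‖ := PiLp.norm_apply_le v 0
  have h1 : |v 1| ≤ ‖v‖ := PiLp.norm_apply_le v 1
  calc |v 0 * dir 0 g x + v 1 * dir 1 g x| ≤ |v 0 * dir 0 g x| + |v 1 * dir 1 g x| := abs_add_le _ _
    _ = |v 0| * |dir 0 g x| + |v 1| * |dir 1 g x| := by rw [abs_mul, abs_mul]
    _ ≤ ‖v‖ * C + ‖v‖ * C := by gcongr <;> apply h
    _ = 2 * C * ‖v‖ := by ring

lemma abs_sub_le_of_dir {g : Plane → ℝ} {s : Set Plane} {C : ℝ} (hs : Convex ℝ s)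
    (hg : Differentiable ℝ g) (h : ∀ x ∈ s, ∀ a, |dir a g x| ≤ C) {x y : Plane} (hx : x ∈ s)
    (hy : y ∈ s) : |g y - g x| ≤ 2 * C * ‖y - x‖ :=
  hs.norm_image_sub_le_of_norm_fderiv_le (fun z _ => hg z)
    (fun z hz => norm_fderiv_le_of_dir (h z hz)) hx hy

lemma dir_sub {g₁ g₂ : Plane → ℝ} (h₁ : Differentiable ℝ g₁) (h₂ : Differentiable ℝ g₂)
    (a : Fin 2) : dir a (fun x => g₁ x - g₂ x) = fun x => dir a g₁ x - dir a g₂ x := by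
  funext x
  simp [dir, fderiv_fun_sub (h₁ x) (h₂ x)]

/-! ### Derivatives of the kernel density estimator -/

lemma dir_comp_affine {g : Plane → ℝ} (hg : Differentiable ℝ g) (c : ℝ) (y : Plane) (a : Fin 2) :
    dir a (fun x => g (c • (x - y))) = fun x => c * dir a g (c • (x - y)) := by
  funext x
  have h : HasFDerivAt (fun x : Plane => c • (x - y)) (c • ContinuousLinearMap.id ℝ Plane) x :=
    ((hasFDerivAt_id x).sub_const y).const_smul c
  have := ((hg (c • (x - y))).hasFDerivAt.comp x h).fderiv
  unfold dir
  change fderiv ℝ (g ∘ fun x => c • (x - y)) x _ = _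
  rw [this]; simp

lemma differentiable_kde {K : Plane → ℝ} (hK : Differentiable ℝ K) (h : ℝ) (n : ℕ)
    (X : ℕ → Plane) : Differentiable ℝ (kde K h n X) := by
  unfold kde
  fun_prop

lemma dir_kde {K : Plane → ℝ} (hK : Differentiable ℝ K) (h : ℝ) (n : ℕ)
    (X : ℕ → Plane) (a : Fin 2) :
    dir a (kde K h n X) = fun x => h⁻¹ * kde (dir a K) h n X x := by
  funext x
  have h1 : ∀ i ∈ Finset.range n, DifferentiableAt ℝ (fun x => K (h⁻¹ • (x - X i))) x := by
    intro i _; fun_prop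
  have h2 : ∀ i, fderiv ℝ (fun x => K (h⁻¹ • (x - X i))) x (EuclideanSpace.single a 1)
      = h⁻¹ * dir a K (h⁻¹ • (x - X i)) := fun i => congrFun (dir_comp_affine hK h⁻¹ (X i) a) x
  unfold kde
  unfold dir
  rw [fderiv_const_mul (DifferentiableAt.fun_sum h1), fderiv_fun_sum h1]
  simp only [_root_.smul_apply, _root_.sum_apply, smul_eq_mul, h2]
  rw [← Finset.mul_sum]
  simp only [dir]
  ring

lemma dir_const_mul {g : Plane → ℝ} (hg : Differentiable ℝ g) (c : ℝ) (a : Fin 2) :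
    dir a (fun x => c * g x) = fun x => c * dir a g x := by
  funext x
  simp [dir, fderiv_const_mul (hg x)]

lemma wd_kde {K : Plane → ℝ} (h : ℝ) (n : ℕ) (X : ℕ → Plane) (w : List (Fin 2))
    (hK : DiffWords w.length K) :
    wd w (kde K h n X) = fun x => (h⁻¹) ^ w.length * kde (wd w K) h n X x := by
  induction w with
  | nil => simp
  | cons a w ih =>
    have hd : Differentiable ℝ (wd w K) := (DiffWords.wd (k := 1) w (hK.mono (by simp; omega))).1
    rw [wd_cons, ih (hK.mono (by simp)), dir_const_mul (differentiable_kde hd _ _ _), dir_kde hd]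
    funext x
    simp only [List.length_cons, wd_cons]
    ring

lemma grad_apply (g : Plane → ℝ) (x : Plane) (k : Fin 2) : grad g x k = wd [k] g x := by
  fin_cases k <;> simp [grad, pd]

/-- The word of a component of `d2`. -/
def d2word : Fin 3 → List (Fin 2) := ![[0, 0], [0, 1], [1, 1]]

lemma d2_apply (g : Plane → ℝ) (x : Plane) (k : Fin 3) : d2 g x k = wd (d2word k) g x := by
  fin_cases k <;> simp [d2, pd, d2word]

lemma length_d2word (k : Fin 3) : (d2word k).length = 2 := by fin_cases k <;> rfl


/-! ### Coordinates -/

lemma norm_le_sum_abs {n : ℕ} (v : EuclideanSpace ℝ (Fin n)) : ‖v‖ ≤ ∑ i, |v i| := by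
  rw [EuclideanSpace.norm_eq]
  refine Real.sqrt_le_iff.2 ⟨Finset.sum_nonneg fun i _ => abs_nonneg _, ?_⟩
  simp only [Real.norm_eq_abs]
  exact Finset.sum_sq_le_sq_sum_of_nonneg fun i _ => abs_nonneg _

lemma abs_apply_le_norm {n : ℕ} (v : EuclideanSpace ℝ (Fin n)) (i : Fin n) : |v i| ≤ ‖v‖ :=
  PiLp.norm_apply_le v i

lemma act_apply {p q : ℕ} (M : Matrix (Fin q) (Fin p) ℝ) (v : EuclideanSpace ℝ (Fin p))
    (i : Fin q) : act M v i = ∑ j, M i j * v j := by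
  simp [act, Matrix.toLpLin_apply, Matrix.mulVec, dotProduct]

lemma act_add {p q : ℕ} (M : Matrix (Fin q) (Fin p) ℝ) (v w : EuclideanSpace ℝ (Fin p)) :
    act M (v + w) = act M v + act M w := map_add _ _ _

lemma act_sub {p q : ℕ} (M : Matrix (Fin q) (Fin p) ℝ) (v w : EuclideanSpace ℝ (Fin p)) :
    act M (v - w) = act M v - act M w := map_sub _ _ _

lemma act_smul {p q : ℕ} (M : Matrix (Fin q) (Fin p) ℝ) (c : ℝ) (v : EuclideanSpace ℝ (Fin p)) :
    act M (c • v) = c • act M v := map_smul _ _ _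

lemma act_act {p q r : ℕ} (M : Matrix (Fin r) (Fin q) ℝ) (N : Matrix (Fin q) (Fin p) ℝ)
    (v : EuclideanSpace ℝ (Fin p)) : act M (act N v) = act (M * N) v := by
  ext i
  simp only [act_apply, Matrix.mul_apply, Finset.mul_sum, Finset.sum_mul, mul_assoc]
  exact Finset.sum_comm

lemma inner_act_transpose {p q : ℕ} (M : Matrix (Fin q) (Fin p) ℝ) (v : EuclideanSpace ℝ (Fin p))
    (w : EuclideanSpace ℝ (Fin q)) : inner ℝ w (act M v) = inner ℝ (act Mᵀ w) v := by
  simp only [PiLp.inner_apply, act_apply, RCLike.inner_apply, conj_trivial, Matrix.transpose_apply,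
    Finset.mul_sum, Finset.sum_mul]
  rw [Finset.sum_comm]
  exact Finset.sum_congr rfl fun i _ => Finset.sum_congr rfl fun j _ => by ring

lemma act_jac {p q : ℕ} (F : EuclideanSpace ℝ (Fin p) → EuclideanSpace ℝ (Fin q))
    (x v : EuclideanSpace ℝ (Fin p)) : act (jac F x) v = fderiv ℝ F x v := by
  have hv : v = ∑ j, v j • EuclideanSpace.single j (1 : ℝ) := by
    ext i; simp [Pi.single_apply]
  ext i
  rw [act_apply]
  conv_rhs => rw [hv]
  simp [jac, mul_comm]

lemma norm_act_le {p q : ℕ} (M : Matrix (Fin q) (Fin p) ℝ) (v : EuclideanSpace ℝ (Fin p)) :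
    ‖act M v‖ ≤ (∑ i, ∑ j, |M i j|) * ‖v‖ := by
  refine (norm_le_sum_abs _).trans ?_
  rw [Finset.sum_mul]
  refine Finset.sum_le_sum fun i _ => ?_
  rw [act_apply, Finset.sum_mul]
  refine (Finset.abs_sum_le_sum_abs _ _).trans (Finset.sum_le_sum fun j _ => ?_)
  rw [abs_mul]
  gcongr
  exact abs_apply_le_norm v j

/-! ### The second eigenvector map -/

/-- The discriminant vector of a symmetric matrix. -/
noncomputable def disc (y : Space) : Plane := !₂[y 2 - y 0, 2 * y 1]

lemma norm_disc (y : Space) : ‖disc y‖ = √((y 2 - y 0) ^ 2 + 4 * y 1 ^ 2) := by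
  rw [EuclideanSpace.norm_eq]
  simp [disc, Fin.sum_univ_two]
  ring_nf

lemma disc_add (y e : Space) : disc (y + e) = disc y + disc e := by
  ext i; fin_cases i <;> simp [disc] <;> ring

lemma disc_sub (y e : Space) : disc (y - e) = disc y - disc e := by
  ext i; fin_cases i <;> simp [disc] <;> ring

lemma norm_disc_le (y : Space) : ‖disc y‖ ≤ 4 * ‖y‖ := by
  refine (norm_le_sum_abs _).trans ?_
  have h0 := abs_apply_le_norm y 0
  have h1 := abs_apply_le_norm y 1
  have h2 := abs_apply_le_norm y 2
  have : |y 2 - y 0| ≤ |y 2| + |y 0| := abs_sub _ _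
  simp only [disc, Fin.sum_univ_two, Matrix.cons_val_zero, Matrix.cons_val_one, abs_mul]
  norm_num
  linarith

lemma continuous_disc : Continuous disc := by unfold disc; fun_prop

lemma abs_norm_disc_sub_le (y e : Space) : |‖disc y‖ - ‖disc e‖| ≤ 4 * ‖y - e‖ :=
  (abs_norm_sub_norm_le _ _).trans (by rw [← disc_sub]; exact norm_disc_le _)

lemma G_zero_apply (y : Space) : G y 0 = 2 * y 0 - 2 * y 2 + 2 * y 1 - 2 * ‖disc y‖ := by
  rw [norm_disc]; rfl

lemma G_one_apply (y : Space) : G y 1 = y 2 - y 0 + 4 * y 1 - ‖disc y‖ := by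
  rw [norm_disc]; rfl

lemma J_apply (y : Space) : J y = (y 0 + y 2 - ‖disc y‖) / 2 := by
  rw [norm_disc, J]; ring_nf

/-- `G` is a linear map minus multiples of the norm of the linear map `disc`. It is therefore
globally Lipschitz even across scalar matrices, where it is not differentiable; integral curves of
the estimator exist for all times without any eigenvalue gap. -/
lemma norm_G_sub_le (y e : Space) : ‖G y - G e‖ ≤ 24 * ‖y - e‖ := by
  refine (norm_le_sum_abs _).trans ?_
  have h0 : |y 0 - e 0| ≤ ‖y - e‖ := abs_apply_le_norm (y - e) 0
  have h1 : |y 1 - e 1| ≤ ‖y - e‖ := abs_apply_le_norm (y - e) 1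
  have h2 : |y 2 - e 2| ≤ ‖y - e‖ := abs_apply_le_norm (y - e) 2
  have h3 := abs_norm_disc_sub_le y e
  simp only [Fin.sum_univ_two, PiLp.sub_apply, G_zero_apply, G_one_apply]
  rw [abs_le] at h0 h1 h2 h3
  have A : |2 * y 0 - 2 * y 2 + 2 * y 1 - 2 * ‖disc y‖ -
      (2 * e 0 - 2 * e 2 + 2 * e 1 - 2 * ‖disc e‖)| ≤ 14 * ‖y - e‖ := by
    rw [abs_le]; constructor <;> linarith [h0.1, h0.2]
  have B : |y 2 - y 0 + 4 * y 1 - ‖disc y‖ - (e 2 - e 0 + 4 * e 1 - ‖disc e‖)|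
      ≤ 10 * ‖y - e‖ := by
    rw [abs_le]; constructor <;> linarith [h0.1, h0.2]
  linarith

lemma abs_J_sub_le (y e : Space) : |J y - J e| ≤ 3 * ‖y - e‖ := by
  have h0 : |y 0 - e 0| ≤ ‖y - e‖ := abs_apply_le_norm (y - e) 0
  have h2 : |y 2 - e 2| ≤ ‖y - e‖ := abs_apply_le_norm (y - e) 2
  have h3 := abs_norm_disc_sub_le y e
  rw [J_apply, J_apply]
  rw [abs_le] at h0 h2 h3 ⊢
  constructor <;> linarith [h0.1, h0.2]

lemma continuous_G : Continuous G :=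
  (LipschitzWith.of_dist_le_mul (K := 24) (fun y e => by
    simpa [dist_eq_norm] using norm_G_sub_le y e)).continuous

lemma continuous_J : Continuous J :=
  (LipschitzWith.of_dist_le_mul (K := 3) (fun y e => by
    simpa [dist_eq_norm, Real.dist_eq] using abs_J_sub_le y e)).continuous

/-- Used in contrapositive form: wherever V does not vanish the eigenvalues are distinct and `G` is
differentiable at the second derivatives. -/
lemma G_eq_zero {y : Space} (h : disc y = 0) : G y = 0 := by
  have h0 : y 2 - y 0 = 0 := by simpa [disc] using congrArg (fun v : Plane => v 0) h
  have h1 : y 1 = 0 := by simpa [disc] using congrArg (fun v : Plane => v 1) h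
  ext i
  fin_cases i
  · change G y 0 = 0
    rw [G_zero_apply, h, norm_zero, h1]; linarith
  · change G y 1 = 0
    rw [G_one_apply, h, norm_zero, h1]; linarith

lemma norm_G_le (y : Space) : ‖G y‖ ≤ 24 * ‖y‖ := by
  have h : G (0 : Space) = 0 := G_eq_zero (by ext i; fin_cases i <;> simp [disc])
  simpa [h] using norm_G_sub_le y 0

lemma sq_norm_disc (y : Space) : ‖disc y‖ ^ 2 = (y 2 - y 0) ^ 2 + 4 * y 1 ^ 2 := by
  rw [norm_disc, Real.sq_sqrt (by positivity)]

/-- `G` takes values in the eigenspace of the smaller eigenvalue. -/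
lemma eigen_zero (y : Space) : y 0 * G y 0 + y 1 * G y 1 = J y * G y 0 := by
  have := sq_norm_disc y
  rw [G_zero_apply, G_one_apply, J_apply]
  linear_combination -this

lemma eigen_one (y : Space) : y 1 * G y 0 + y 2 * G y 1 = J y * G y 1 := by
  have := sq_norm_disc y
  rw [G_zero_apply, G_one_apply, J_apply]
  linear_combination (-1 / 2) * this

lemma act_hess_V (g : Plane → ℝ) (x : Plane) : act (hess g x) (V g x) = lam2 g x • V g x := by
  have h0 := eigen_zero (d2 g x)
  have h1 := eigen_one (d2 g x)
  ext i
  rw [act_apply]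
  fin_cases i
  · simpa [hess, d2, Fin.sum_univ_two, V, lam2] using h0
  · simpa [hess, d2, Fin.sum_univ_two, V, lam2] using h1

/-- The derivative of `G` away from the scalar matrices. -/
noncomputable def dG (y e : Space) : Plane :=
  !₂[2 * e 0 - 2 * e 2 + 2 * e 1 - 2 * (inner ℝ (disc y) (disc e) / ‖disc y‖),
     e 2 - e 0 + 4 * e 1 - inner ℝ (disc y) (disc e) / ‖disc y‖]

/-- After multiplication by ‖a‖ the lower bound is the Cauchy–Schwarz inequality for a and a + e.
The upper bound follows from 2‖a‖‖a + e‖ ≤ ‖a‖² + ‖a + e‖². -/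
lemma abs_norm_add_sub_le {a e : Plane} (ha : a ≠ 0) :
    |‖a + e‖ - ‖a‖ - inner ℝ a e / ‖a‖| ≤ ‖e‖ ^ 2 / ‖a‖ := by
  have hp : 0 < ‖a‖ := norm_pos_iff.2 ha
  have hsq := norm_add_sq_real a e
  have hcs : inner ℝ a (a + e) ≤ ‖a‖ * ‖a + e‖ := real_inner_le_norm a (a + e)
  rw [inner_add_right, real_inner_self_eq_norm_sq] at hcs
  have e1 : ‖a + e‖ - ‖a‖ - inner ℝ a e / ‖a‖
      = (‖a‖ * ‖a + e‖ - ‖a‖ ^ 2 - inner ℝ a e) / ‖a‖ := by field_simp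
  rw [e1, abs_div, abs_norm]
  gcongr
  rw [abs_le]
  constructor
  · nlinarith [sq_nonneg ‖e‖]
  · nlinarith [sq_nonneg (‖a + e‖ - ‖a‖), sq_nonneg ‖e‖]

/-- Only the norm of `disc` is nonlinear, and it enters the two components with factors 2 and 1;
together with ‖disc e‖² ≤ 16‖e‖² this gives 48 = (2 + 1)·16. The bound is quadratic for every e,
large or small. -/
lemma norm_G_add_sub_le {y : Space} (hy : disc y ≠ 0) (e : Space) :
    ‖G (y + e) - G y - dG y e‖ ≤ 48 / ‖disc y‖ * ‖e‖ ^ 2 := by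
  have hp : 0 < ‖disc y‖ := norm_pos_iff.2 hy
  have h := abs_norm_add_sub_le (e := disc e) hy
  rw [← disc_add] at h
  have h' : ‖disc e‖ ^ 2 ≤ 16 * ‖e‖ ^ 2 := by
    have := norm_disc_le e
    nlinarith [norm_nonneg (disc e), norm_nonneg e]
  set q := ‖disc (y + e)‖ - ‖disc y‖ - inner ℝ (disc y) (disc e) / ‖disc y‖ with hq
  have hb : |q| ≤ 16 * ‖e‖ ^ 2 / ‖disc y‖ := h.trans (by gcongr)
  refine (norm_le_sum_abs _).trans ?_
  have A : (G (y + e) - G y - dG y e) 0 = -2 * q := by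
    simp only [PiLp.sub_apply, G_zero_apply, dG, hq, PiLp.add_apply]
    simp; ring
  have B : (G (y + e) - G y - dG y e) 1 = -q := by
    simp only [PiLp.sub_apply, G_one_apply, dG, hq, PiLp.add_apply]
    simp; ring
  rw [Fin.sum_univ_two, A, B, abs_mul, abs_neg, abs_neg]
  have : 48 / ‖disc y‖ * ‖e‖ ^ 2 = 3 * (16 * ‖e‖ ^ 2 / ‖disc y‖) := by ring
  rw [this]
  norm_num
  linarith

lemma disc_smul (c : ℝ) (y : Space) : disc (c • y) = c • disc y := by
  ext i; fin_cases i <;> simp [disc] <;> ring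

/-- `dG` as a continuous linear map. -/
noncomputable def dGL (y : Space) : Space →L[ℝ] Plane :=
  LinearMap.toContinuousLinearMap
    { toFun := dG y
      map_add' := fun a b => by
        ext i; fin_cases i <;> simp [dG, disc_add, inner_add_right] <;> ring
      map_smul' := fun c a => by
        ext i; fin_cases i <;> simp [dG, disc_smul, inner_smul_right] <;> ring }

@[simp] lemma dGL_apply (y e : Space) : dGL y e = dG y e := rfl

lemma hasFDerivAt_G {y : Space} (hy : disc y ≠ 0) : HasFDerivAt G (dGL y) y := by
  rw [hasFDerivAt_iff_isLittleO_nhds_zero]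
  have h1 : (fun e : Space => G (y + e) - G y - dGL y e) =O[𝓝 0] fun e => ‖e‖ ^ 2 :=
    Asymptotics.IsBigO.of_bound (48 / ‖disc y‖) (Eventually.of_forall fun e => by
      simpa using norm_G_add_sub_le hy e)
  refine h1.trans_isLittleO ?_
  exact Asymptotics.isLittleO_norm_pow_id (by norm_num)

lemma act_jac_G {y : Space} (hy : disc y ≠ 0) (e : Space) : act (jac G y) e = dG y e := by
  rw [act_jac, (hasFDerivAt_G hy).fderiv, dGL_apply]

lemma jac_G_apply {y : Space} (hy : disc y ≠ 0) (i : Fin 2) (j : Fin 3) :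
    jac G y i j = dG y (EuclideanSpace.single j 1) i := by
  simp [jac, (hasFDerivAt_G hy).fderiv]

lemma continuousOn_jac_G (i : Fin 2) (j : Fin 3) :
    ContinuousOn (fun y => jac G y i j) {y | disc y ≠ 0} := by
  refine ContinuousOn.congr (f := fun y => dG y (EuclideanSpace.single j 1) i) ?_
    fun y hy => jac_G_apply hy i j
  have h : ContinuousOn (fun y => inner ℝ (disc y) (disc (EuclideanSpace.single j 1)) / ‖disc y‖)
      {y | disc y ≠ 0} := by
    refine ContinuousOn.div ?_ continuous_disc.norm.continuousOn fun y hy => norm_ne_zero_iff.2 hy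
    exact (continuous_disc.inner continuous_const).continuousOn
  fin_cases i
  · simp only [dG]
    exact continuousOn_const.sub (continuousOn_const.mul h)
  · simp only [dG]
    exact continuousOn_const.sub h

/-! ### Derivatives of `d2`, `V` and `grad` -/

lemma hasFDerivAt_apply {n : ℕ} {F : Plane → EuclideanSpace ℝ (Fin n)}
    {F' : Plane →L[ℝ] EuclideanSpace ℝ (Fin n)} {x : Plane} (h : HasFDerivAt F F' x) (j : Fin n) :
    HasFDerivAt (fun y => F y j) ((EuclideanSpace.proj j).comp F') x :=
  (EuclideanSpace.proj (𝕜 := ℝ) j).hasFDerivAt.comp x h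

lemma differentiableAt_d2 {g : Plane → ℝ} (hg : DiffWords 3 g) (x : Plane) :
    DifferentiableAt ℝ (d2 g) x := by
  rw [differentiableAt_euclidean]
  intro j
  have : (fun y => d2 g y j) = wd (d2word j) g := by funext y; exact d2_apply g y j
  rw [this]
  exact (DiffWords.wd (k := 1) (d2word j) (by rw [length_d2word]; exact hg)).1 x

lemma fderiv_d2_apply {g : Plane → ℝ} (hg : DiffWords 3 g) (x v : Plane) (j : Fin 3) :
    fderiv ℝ (d2 g) x v j = fderiv ℝ (wd (d2word j) g) x v := by
  have h := (differentiableAt_d2 hg x).hasFDerivAt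
  have h2 := hasFDerivAt_apply h j
  have : (fun y => d2 g y j) = wd (d2word j) g := by funext y; exact d2_apply g y j
  rw [this] at h2
  rw [h2.fderiv]; rfl

lemma hasFDerivAt_V {g : Plane → ℝ} (hg : DiffWords 3 g) {x : Plane} (hx : disc (d2 g x) ≠ 0) :
    HasFDerivAt (V g) ((dGL (d2 g x)).comp (fderiv ℝ (d2 g) x)) x :=
  (hasFDerivAt_G hx).comp x (differentiableAt_d2 hg x).hasFDerivAt

lemma act_jac_V {g : Plane → ℝ} (hg : DiffWords 3 g) {x : Plane} (hx : disc (d2 g x) ≠ 0)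
    (v : Plane) : act (jac (V g) x) v = act (Gtilde g x) (fderiv ℝ (d2 g) x v) := by
  rw [act_jac, (hasFDerivAt_V hg hx).fderiv, Gtilde, act_jac_G hx]; rfl

lemma fderiv_grad_apply {g : Plane → ℝ} (hg : DiffWords 2 g) (x v : Plane) :
    HasFDerivAt (grad g) (fderiv ℝ (grad g) x) x ∧ fderiv ℝ (grad g) x v = act (hess g x) v := by
  have e : ∀ k : Fin 2, (fun y => grad g y k) = wd [k] g := fun k => by
    funext y; exact grad_apply g y k
  have hd : DifferentiableAt ℝ (grad g) x := by
    rw [differentiableAt_euclidean]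
    intro k
    rw [e]
    exact (hg.2 k).1 x
  refine ⟨hd.hasFDerivAt, ?_⟩
  ext k
  have h2 := hasFDerivAt_apply hd.hasFDerivAt k
  rw [e] at h2
  have h3 : fderiv ℝ (grad g) x v k = fderiv ℝ (wd [k] g) x v := by rw [h2.fderiv]; rfl
  rw [h3, fderiv_eq_sum_dir, act_apply, Fin.sum_univ_two]
  have hc := congrFun (dir_comm hg 1 0) x
  fin_cases k
  · simp [hess, pd, hc, mul_comm]
  · simp [hess, pd, mul_comm]


/-! ### Ordinary differential equations -/

section ODE

open scoped NNReal

variable {E : Type*} [NormedAddCommGroup E] [NormedSpace ℝ E]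

/-- Picard–Lindelöf on a ball whose radius is the bound of the field times the longest time, so that
the solution cannot leave it before the end of the interval. -/
lemma exists_solution_Icc [CompleteSpace E] {F : ℝ → E → E} {K L : ℝ≥0} {tmin tmax t₀ : ℝ}
    (ht₀ : t₀ ∈ Icc tmin tmax) (hK : ∀ t ∈ Icc tmin tmax, LipschitzWith K (F t))
    (hc : ∀ x, ContinuousOn (fun t => F t x) (Icc tmin tmax))
    (hL : ∀ t ∈ Icc tmin tmax, ∀ x, ‖F t x‖ ≤ L) (x₀ : E) :
    ∃ α : ℝ → E, α t₀ = x₀ ∧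
      ∀ t ∈ Icc tmin tmax, HasDerivWithinAt α (F t (α t)) (Icc tmin tmax) t := by
  have h0 : 0 ≤ max (tmax - t₀) (t₀ - tmin) := le_max_of_le_left (sub_nonneg.2 ht₀.2)
  have hP : IsPicardLindelof F (⟨t₀, ht₀⟩ : Icc tmin tmax) x₀
      (L * (max (tmax - t₀) (t₀ - tmin)).toNNReal) 0 L K :=
    { lipschitzOnWith := fun t ht => (hK t ht).lipschitzOnWith
      continuousOn := fun x _ => hc x
      norm_le := fun t ht x _ => hL t ht x
      mul_max_le := by
        rw [NNReal.coe_zero, sub_zero, NNReal.coe_mul, Real.coe_toNNReal _ h0] }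
  exact hP.exists_eq_forall_mem_Icc_hasDerivWithinAt₀

/-- Solutions on the intervals (-(N+1), N+1) agree on overlaps by uniqueness. At time t the solution
with N = ⌈|t|⌉ is used; near t it can be replaced by one with a fixed N, so the glued curve is
differentiable. -/
lemma exists_solution_univ [CompleteSpace E] {v : E → E} {K L : ℝ≥0}
    (hK : LipschitzWith K v) (hL : ∀ x, ‖v x‖ ≤ L) (x₀ : E) :
    ∃ γ : ℝ → E, γ 0 = x₀ ∧ ∀ t, HasDerivAt γ (v (γ t)) t := by
  have ex : ∀ N : ℕ, ∃ α : ℝ → E, α 0 = x₀ ∧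
      ∀ t ∈ Ioo (-((N : ℝ) + 1)) (N + 1), HasDerivAt α (v (α t)) t := by
    intro N
    have hN : (0 : ℝ) ≤ N := N.cast_nonneg
    obtain ⟨α, h0, h⟩ := exists_solution_Icc (F := fun _ => v) (tmin := -((N : ℝ) + 1))
      (tmax := N + 1) (t₀ := 0) ⟨by linarith, by linarith⟩ (fun _ _ => hK)
      (fun _ => continuousOn_const) (fun _ _ => hL) x₀
    exact ⟨α, h0, fun t ht => (h t (Ioo_subset_Icc_self ht)).hasDerivAt (Icc_mem_nhds ht.1 ht.2)⟩
  choose α h0 h using ex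
  have huniq : ∀ M N : ℕ, ∀ t : ℝ, |t| < M + 1 → |t| < N + 1 → α M t = α N t := by
    have key : ∀ M N : ℕ, M ≤ N → ∀ t : ℝ, |t| < M + 1 → α M t = α N t := by
      intro M N hMN t ht
      have hM : (0 : ℝ) ≤ M := M.cast_nonneg
      have hMN' : (M : ℝ) ≤ N := by exact_mod_cast hMN
      refine ODE_solution_unique_of_mem_Ioo (v := fun _ => v) (K := K) (s := fun _ => univ)
        (t₀ := 0) (a := -((M : ℝ) + 1)) (b := M + 1) (fun _ _ => hK.lipschitzOnWith)
        ⟨by linarith, by linarith⟩ (fun s hs => ⟨h M s hs, mem_univ _⟩)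
        (fun s hs => ⟨h N s ⟨by linarith [hs.1], by linarith [hs.2]⟩, mem_univ _⟩)
        (by rw [h0, h0]) (abs_lt.1 ht)
    intro M N t hM hN
    rcases le_total M N with hle | hle
    · exact key M N hle t hM
    · exact (key N M hle t hN).symm
  refine ⟨fun t => α ⌈|t|⌉₊ t, by simpa using h0 _, fun t => ?_⟩
  have hlt : ∀ s : ℝ, |s| < (⌈|s|⌉₊ : ℝ) + 1 := fun s =>
    (Nat.le_ceil _).trans_lt (lt_add_one _)
  have hd := h ⌈|t|⌉₊ t (abs_lt.1 (hlt t))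
  refine hd.congr_of_eventuallyEq ?_
  have : ∀ᶠ s in 𝓝 t, |s| < (⌈|t|⌉₊ : ℝ) + 1 :=
    continuous_abs.continuousAt.eventually_lt continuousAt_const (hlt t)
  filter_upwards [this] with s hs
  exact huniq _ _ s (hlt s) hs

/-- A Gronwall inequality with a variable forcing term, in which the differential inequality is
only needed as long as the solution is small. -/
lemma norm_le_of_norm_deriv_le {y y' : ℝ → E} {T C ρ : ℝ} {g : ℝ → ℝ} (hC : 0 ≤ C)
    (hy : ContinuousOn y (Icc 0 T)) (hy' : ∀ t ∈ Ico 0 T, HasDerivWithinAt y (y' t) (Ici t) t)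
    (h0 : y 0 = 0) (hg : Continuous g) (hg0 : ∀ t, 0 ≤ g t)
    (hb : ∀ t ∈ Ico 0 T, ‖y t‖ ≤ ρ → ‖y' t‖ ≤ C * ‖y t‖ + g t)
    (hsmall : Real.exp (C * T) * ∫ s in (0 : ℝ)..T, g s < ρ) {t : ℝ} (ht : t ∈ Icc 0 T) :
    ‖y t‖ ≤ Real.exp (C * t) * ∫ s in (0 : ℝ)..t, g s := by
  have hT : 0 ≤ T := ht.1.trans ht.2
  have hderiv : ∀ t, HasDerivAt (fun t => ∫ s in (0 : ℝ)..t, g s) (g t) t := fun t =>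
    intervalIntegral.integral_hasDerivAt_right (hg.intervalIntegrable _ _)
      (hg.stronglyMeasurableAtFilter _ _) hg.continuousAt
  have hmono : ∀ t ∈ Icc 0 T, ∫ s in (0 : ℝ)..t, g s ≤ ∫ s in (0 : ℝ)..T, g s := fun t ht =>
    intervalIntegral.integral_mono_interval le_rfl ht.1 ht.2
      (Eventually.of_forall hg0) (hg.intervalIntegrable _ _)
  have hnn : ∀ t, 0 ≤ t → 0 ≤ ∫ s in (0 : ℝ)..t, g s := fun t ht =>
    intervalIntegral.integral_nonneg ht fun s _ => hg0 s
  -- The comparison principle needs a strict inequality between derivatives on the boundary. The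
  -- forcing term is enlarged by ε, for which the strict inequality in `hsmall` leaves room, and ε
  -- tends to zero at the end.
  have key : ∀ ε > 0, Real.exp (C * T) * ((∫ s in (0 : ℝ)..T, g s) + ε * T) ≤ ρ →
      ∀ t ∈ Icc 0 T, ‖y t‖ ≤ Real.exp (C * t) * ((∫ s in (0 : ℝ)..t, g s) + ε * t) := by
    intro ε hε hρ
    refine image_norm_le_of_norm_deriv_right_lt_deriv_boundary
      (B' := fun t => Real.exp (C * t) * C * ((∫ s in (0 : ℝ)..t, g s) + ε * t)
        + Real.exp (C * t) * (g t + ε)) hy hy' (by simp [h0]) ?_ ?_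
    · intro t
      have h1 : HasDerivAt (fun t => Real.exp (C * t)) (Real.exp (C * t) * C) t := by
        simpa using ((hasDerivAt_id t).const_mul C).exp
      have h2 := (hderiv t).add ((hasDerivAt_id t).const_mul ε)
      simp only [mul_one] at h2
      exact h1.mul h2
    · intro t ht hyt
      have htI : t ∈ Icc 0 T := ⟨ht.1, ht.2.le⟩
      have hexp : (1 : ℝ) ≤ Real.exp (C * t) := Real.one_le_exp (mul_nonneg hC ht.1)
      have hle : ‖y t‖ ≤ ρ := by
        rw [hyt]
        refine le_trans ?_ hρ
        have := hnn t ht.1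
        have h3 := hmono t htI
        have h4 : C * t ≤ C * T := mul_le_mul_of_nonneg_left htI.2 hC
        have : 0 ≤ ε * t := mul_nonneg hε.le ht.1
        have : ε * t ≤ ε * T := mul_le_mul_of_nonneg_left htI.2 hε.le
        gcongr
      have h5 := hb t ht hle
      rw [hyt] at h5
      have h6 : g t < Real.exp (C * t) * (g t + ε) := by nlinarith [hg0 t]
      calc ‖y' t‖ ≤ _ := h5
        _ < _ := by linarith
  have hlim : Tendsto (fun ε : ℝ => Real.exp (C * t) * ((∫ s in (0 : ℝ)..t, g s) + ε * t))
      (𝓝[>] 0) (𝓝 (Real.exp (C * t) * ((∫ s in (0 : ℝ)..t, g s) + 0 * t))) :=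
    (Continuous.tendsto (by fun_prop) 0).mono_left nhdsWithin_le_nhds
  rw [zero_mul, add_zero] at hlim
  refine ge_of_tendsto hlim ?_
  have h7 : Tendsto (fun ε : ℝ => Real.exp (C * T) * ((∫ s in (0 : ℝ)..T, g s) + ε * T))
      (𝓝[>] 0) (𝓝 (Real.exp (C * T) * ((∫ s in (0 : ℝ)..T, g s) + 0 * T))) :=
    (Continuous.tendsto (by fun_prop) 0).mono_left nhdsWithin_le_nhds
  rw [zero_mul, add_zero] at h7
  filter_upwards [h7.eventually_le_const hsmall, self_mem_nhdsWithin] with ε h8 h9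
  exact key ε h9 h8 t ht

/-- Componentwise truncation. -/
noncomputable def clamp {ι : Type*} (R : ℝ) (x : ι → ℝ) : ι → ℝ := fun i => max (-R) (min R (x i))

lemma lipschitzWith_clamp {ι : Type*} [Fintype ι] (R : ℝ) :
    LipschitzWith 1 (clamp R : (ι → ℝ) → ι → ℝ) := by
  refine LipschitzWith.of_dist_le_mul fun x y => ?_
  rw [NNReal.coe_one, one_mul, dist_pi_le_iff dist_nonneg]
  intro i
  refine le_trans ?_ (dist_le_pi_dist x y i)
  have := ((LipschitzWith.id (α := ℝ)).const_min R).const_max (-R) |>.dist_le_mul (x i) (y i)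
  simpa [clamp] using this

lemma norm_clamp_le {ι : Type*} [Fintype ι] {R : ℝ} (hR : 0 ≤ R) (x : ι → ℝ) :
    ‖clamp R x‖ ≤ R := by
  rw [pi_norm_le_iff_of_nonneg hR]
  intro i
  rw [Real.norm_eq_abs, abs_le]
  exact ⟨le_max_left _ _, max_le (by linarith) (min_le_left _ _)⟩

lemma clamp_eq_self {ι : Type*} [Fintype ι] {R : ℝ} {x : ι → ℝ} (h : ‖x‖ ≤ R) :
    clamp R x = x := by
  funext i
  have := abs_le.1 ((norm_le_pi_norm x i).trans h)
  simp only [clamp]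
  rw [min_eq_right this.2, max_eq_right this.1]

lemma norm_clamp_le_norm {ι : Type*} [Fintype ι] {R : ℝ} (hR : 0 ≤ R) (x : ι → ℝ) :
    ‖clamp R x‖ ≤ ‖x‖ := by
  have h := (lipschitzWith_clamp R).dist_le_mul x 0
  have h0 : clamp R (0 : ι → ℝ) = 0 := clamp_eq_self (by simpa using hR)
  simpa [h0] using h

/-- A linear field is unbounded, so the argument of its linear part is truncated at the Gronwall
bound R. Truncation does not increase the norm, hence the truncated equation obeys the same a priori
bound R and its solution is never truncated. -/
lemma exists_linear_solution_pi {ι : Type*} [Fintype ι] {A : ℝ → (ι → ℝ) →L[ℝ] (ι → ℝ)}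
    {b : ℝ → ι → ℝ} (hA : Continuous A) (hb : Continuous b) (x₀ : ι → ℝ) {T : ℝ} (hT : 0 ≤ T) :
    ∃ x : ℝ → ι → ℝ, x 0 = x₀ ∧
      ∀ t ∈ Icc 0 T, HasDerivWithinAt x (A t (x t) + b t) (Icc 0 T) t := by
  obtain ⟨M, hM⟩ := isCompact_Icc.exists_bound_of_continuousOn (s := Icc 0 T) hA.continuousOn
  obtain ⟨N, hN⟩ := isCompact_Icc.exists_bound_of_continuousOn (s := Icc 0 T) hb.continuousOn
  have hM0 : 0 ≤ M := (norm_nonneg _).trans (hM 0 ⟨le_rfl, hT⟩)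
  have hN0 : 0 ≤ N := (norm_nonneg _).trans (hN 0 ⟨le_rfl, hT⟩)
  set R := gronwallBound ‖x₀‖ M N T with hR
  have hmono := gronwallBound_mono (norm_nonneg x₀) hN0 hM0
  have hR0 : 0 ≤ R := by
    have := hmono hT
    rw [gronwallBound_x0] at this
    exact (norm_nonneg _).trans this
  obtain ⟨α, h0, h⟩ := exists_solution_Icc (F := fun t x => A t (clamp R x) + b t)
    (K := ⟨M, hM0⟩) (L := ⟨M * R + N, by positivity⟩) (tmin := 0) (tmax := T) (t₀ := 0)
    ⟨le_rfl, hT⟩ (fun t ht => by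
      refine LipschitzWith.of_dist_le_mul fun x y => ?_
      rw [dist_add_right, dist_eq_norm, ← map_sub]
      refine ((A t).le_opNorm _).trans ?_
      have h1 := (lipschitzWith_clamp R).dist_le_mul x y
      rw [NNReal.coe_one, one_mul, dist_eq_norm] at h1
      exact mul_le_mul (hM t ht) h1 (norm_nonneg _) hM0)
    (fun x => by fun_prop)
    (fun t ht x => by
      refine (norm_add_le _ _).trans (add_le_add (((A t).le_opNorm _).trans ?_) (hN t ht))
      exact mul_le_mul (hM t ht) (norm_clamp_le hR0 _) (norm_nonneg _) hM0) x₀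
  have hbound : ∀ t ∈ Icc 0 T, ‖α t‖ ≤ R := by
    intro t ht
    have := norm_le_gronwallBound_of_norm_deriv_right_le (f := α)
      (f' := fun t => A t (clamp R (α t)) + b t) (δ := ‖x₀‖) (K := M) (ε := N) (a := 0) (b := T)
      (fun t ht => (h t ht).continuousWithinAt)
      (fun t ht => (h t ⟨ht.1, ht.2.le⟩).mono_of_mem_nhdsWithin (Icc_mem_nhdsGE_of_mem ht))
      (by rw [h0]) (fun t ht => by
        have ht' : t ∈ Icc 0 T := ⟨ht.1, ht.2.le⟩
        refine (norm_add_le _ _).trans (add_le_add (((A t).le_opNorm _).trans ?_) (hN t ht'))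
        exact mul_le_mul (hM t ht') (norm_clamp_le_norm hR0 _) (norm_nonneg _) hM0) t ht
    rw [sub_zero] at this
    exact this.trans (hmono ht.2)
  refine ⟨α, h0, fun t ht => ?_⟩
  have := h t ht
  rwa [clamp_eq_self (hbound t ht)] at this

lemma exists_linear_solution [FiniteDimensional ℝ E] {A : ℝ → E →L[ℝ] E}
    {b : ℝ → E} (hA : ∀ x, Continuous fun t => A t x) (hb : Continuous b) (x₀ : E) {T : ℝ}
    (hT : 0 ≤ T) : ∃ x : ℝ → E, x 0 = x₀ ∧
      ∀ t ∈ Icc 0 T, HasDerivWithinAt x (A t (x t) + b t) (Icc 0 T) t := by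
  let e := (Module.finBasis ℝ E).equivFunL
  obtain ⟨x, h0, h⟩ := exists_linear_solution_pi
    (A := fun t => (e : E →L[ℝ] _) ∘L (A t) ∘L (e.symm : _ →L[ℝ] E)) (b := fun t => e (b t))
    (continuous_clm_apply.2 fun y => e.continuous.comp (hA (e.symm y)))
    (e.continuous.comp hb) (e x₀) hT
  refine ⟨fun t => e.symm (x t), by simp [h0], fun t ht => ?_⟩
  have := (e.symm : _ →L[ℝ] E).hasFDerivAt.comp_hasDerivWithinAt t (h t ht)
  simpa using! this

end ODE

/-! ### Integral curves -/

/-- Functions whose partial derivatives of orders one to three are bounded. -/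
structure Tame (g : Plane → ℝ) : Prop where
  diff : DiffWords 3 g
  bdd : ∃ C, ∀ w : List (Fin 2), 1 ≤ w.length → w.length ≤ 3 → ∀ x, |wd w g x| ≤ C

lemma wd_lipschitz {g : Plane → ℝ} {C : ℝ} {w : List (Fin 2)} (hd : DiffWords (1 + w.length) g)
    (hC : ∀ a x, |wd (a :: w) g x| ≤ C) (x y : Plane) :
    |wd w g x - wd w g y| ≤ 2 * C * ‖x - y‖ :=
  abs_sub_le_of_dir convex_univ (DiffWords.wd (k := 1) w hd).1 (fun x _ a => hC a x)
    (mem_univ _) (mem_univ _)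

lemma norm_d2_sub_le {u v : Space} {C : ℝ} (h : ∀ j, |u j - v j| ≤ C) : ‖u - v‖ ≤ 3 * C := by
  refine (norm_le_sum_abs _).trans ?_
  rw [Fin.sum_univ_three]
  have h0 := h 0
  have h1 := h 1
  have h2 := h 2
  simp only [PiLp.sub_apply]
  linarith

lemma Tame.lipschitz_d2 {g : Plane → ℝ} (hg : Tame g) :
    ∃ C, 0 ≤ C ∧ ∀ x y, ‖d2 g x - d2 g y‖ ≤ C * ‖x - y‖ := by
  obtain ⟨C, hC⟩ := hg.bdd
  have hC0 : 0 ≤ C := (abs_nonneg _).trans (hC [0] (by simp) (by simp) 0)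
  refine ⟨6 * C, by positivity, fun x y => ?_⟩
  have : ‖d2 g x - d2 g y‖ ≤ 3 * (2 * C * ‖x - y‖) := by
    refine norm_d2_sub_le fun j => ?_
    rw [d2_apply, d2_apply]
    refine wd_lipschitz (by rw [length_d2word]; exact hg.diff) (fun a x => hC _ ?_ ?_ x) x y <;>
      simp [length_d2word]
  linarith

lemma Tame.lipschitz_V {g : Plane → ℝ} (hg : Tame g) :
    ∃ C, 0 ≤ C ∧ ∀ x y, ‖V g x - V g y‖ ≤ C * ‖x - y‖ := by
  obtain ⟨C, hC0, hC⟩ := hg.lipschitz_d2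
  refine ⟨24 * C, by positivity, fun x y => (norm_G_sub_le _ _).trans ?_⟩
  nlinarith [hC x y]

lemma Tame.bounded_V {g : Plane → ℝ} (hg : Tame g) : ∃ C, 0 ≤ C ∧ ∀ x, ‖V g x‖ ≤ C := by
  obtain ⟨C, hC⟩ := hg.bdd
  have hC0 : 0 ≤ C := (abs_nonneg _).trans (hC [0] (by simp) (by simp) 0)
  refine ⟨24 * (3 * C), by positivity, fun x => (norm_G_le _).trans ?_⟩
  gcongr
  have := norm_d2_sub_le (u := d2 g x) (v := 0) (C := C) fun j => by
    rw [d2_apply]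
    simpa using hC (d2word j) (by simp [length_d2word]) (by simp [length_d2word]) x
  simpa using this

lemma Tame.curve_spec {g : Plane → ℝ} (hg : Tame g) (x₀ : Plane) :
    curve g x₀ 0 = x₀ ∧ ∀ t, HasDerivAt (curve g x₀) (V g (curve g x₀ t)) t := by
  obtain ⟨C, hC0, hC⟩ := hg.lipschitz_V
  obtain ⟨B, hB0, hB⟩ := hg.bounded_V
  exact Classical.epsilon_spec (exists_solution_univ (v := V g) (K := ⟨C, hC0⟩) (L := ⟨B, hB0⟩)
    (LipschitzWith.of_dist_le_mul fun x y => by simpa [dist_eq_norm] using! hC x y) hB x₀)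

lemma Tame.eq_of_hasDerivAt {g : Plane → ℝ} (hg : Tame g) {γ₁ γ₂ : ℝ → Plane} {t₀ : ℝ}
    (h₁ : ∀ t, HasDerivAt γ₁ (V g (γ₁ t)) t) (h₂ : ∀ t, HasDerivAt γ₂ (V g (γ₂ t)) t)
    (h : γ₁ t₀ = γ₂ t₀) : γ₁ = γ₂ := by
  obtain ⟨C, hC0, hC⟩ := hg.lipschitz_V
  exact ODE_solution_unique_univ (v := fun _ => V g) (s := fun _ => univ) (K := ⟨C, hC0⟩)
    (fun _ => (LipschitzWith.of_dist_le_mul fun x y => by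
      simpa [dist_eq_norm] using! hC x y).lipschitzOnWith)
    (fun t => ⟨h₁ t, mem_univ _⟩) (fun t => ⟨h₂ t, mem_univ _⟩) h

lemma Tame.curve_add {g : Plane → ℝ} (hg : Tame g) (x₀ : Plane) (s t : ℝ) :
    curve g (curve g x₀ s) t = curve g x₀ (s + t) := by
  have h1 := hg.curve_spec x₀
  have h2 := hg.curve_spec (curve g x₀ s)
  refine congrFun (hg.eq_of_hasDerivAt (γ₂ := fun t => curve g x₀ (s + t)) (t₀ := 0) h2.2
    (fun t => ?_) (by simp [h2.1])) t
  exact (h1.2 (s + t)).comp_const_add s t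

/-- A zero of the field on the curve would make the constant curve a solution through that point,
and uniqueness would force the whole curve to be constant. -/
lemma Tame.V_curve_ne_zero {g : Plane → ℝ} (hg : Tame g) {x₀ : Plane} {s : ℝ}
    (h : V g (curve g x₀ s) ≠ 0) (t : ℝ) : V g (curve g x₀ t) ≠ 0 := by
  intro h0
  have h1 := hg.curve_spec x₀
  have := hg.eq_of_hasDerivAt (γ₂ := fun _ => curve g x₀ t) (t₀ := t) h1.2
    (fun u => by rw [h0]; exact hasDerivAt_const _ _) rfl
  exact h (by rw [this]; exact h0)

lemma Tame.continuous_curve {g : Plane → ℝ} (hg : Tame g) (x₀ : Plane) :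
    Continuous (curve g x₀) :=
  continuous_iff_continuousAt.2 fun t => ((hg.curve_spec x₀).2 t).continuousAt

lemma Tame.hasDerivAt_curve_mul {g : Plane → ℝ} (hg : Tame g) (x₀ : Plane) (σ t : ℝ) :
    HasDerivAt (fun s => curve g x₀ (σ * s)) (σ • V g (curve g x₀ (σ * t))) t := by
  have h1 := (hg.curve_spec x₀).2 (σ * t)
  have h2 : HasDerivAt (fun s => σ * s) σ t := by simpa using (hasDerivAt_id t).const_mul σ
  exact HasDerivAt.scomp t h1 h2

lemma Tame.continuous_d2 {g : Plane → ℝ} (hg : Tame g) : Continuous (d2 g) :=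
  continuous_iff_continuousAt.2 fun x => (differentiableAt_d2 hg.diff x).continuousAt

lemma Tame.continuous_V {g : Plane → ℝ} (hg : Tame g) : Continuous (V g) :=
  continuous_G.comp hg.continuous_d2

/-- Continuous dependence of integral curves on the function, as long as the two functions are
close on a neighbourhood of one of the curves. -/
lemma norm_curve_sub_le {f g : Plane → ℝ} (hf : Tame f) (hg : Tame g) {C : ℝ} (hC0 : 0 ≤ C)
    (hC : ∀ x y, ‖V f x - V f y‖ ≤ C * ‖x - y‖) {x₀ : Plane} {T ε ρ : ℝ} (hε : 0 ≤ ε)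
    (hclose : ∀ t, |t| ≤ T → ∀ x, ‖x - curve f x₀ t‖ ≤ ρ → ‖V g x - V f x‖ ≤ ε)
    (hsmall : Real.exp (C * T) * (T * ε) < ρ) {t : ℝ} (ht : |t| ≤ T) :
    ‖curve g x₀ t - curve f x₀ t‖ ≤ Real.exp (C * |t|) * (|t| * ε) := by
  -- Negative times are reduced to positive ones by running the curve with the field σV, where σ is
  -- a sign with σ|t| = t.
  obtain ⟨σ, hσ, hσt⟩ : ∃ σ : ℝ, |σ| = 1 ∧ σ * |t| = t := by
    rcases le_total 0 t with h | h
    · exact ⟨1, by simp, by simp [abs_of_nonneg h]⟩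
    · exact ⟨-1, by simp, by simp [abs_of_nonpos h]⟩
  have hd : ∀ s, HasDerivAt (fun s => curve g x₀ (σ * s) - curve f x₀ (σ * s))
      (σ • V g (curve g x₀ (σ * s)) - σ • V f (curve f x₀ (σ * s))) s := fun s =>
    (hg.hasDerivAt_curve_mul x₀ σ s).sub (hf.hasDerivAt_curve_mul x₀ σ s)
  have key := norm_le_of_norm_deriv_le (y := fun s => curve g x₀ (σ * s) - curve f x₀ (σ * s))
    (T := T) (C := C) (ρ := ρ) (g := fun _ => ε) hC0
    (fun s _ => (hd s).continuousAt.continuousWithinAt) (fun s _ => (hd s).hasDerivWithinAt)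
    (by simp [(hf.curve_spec x₀).1, (hg.curve_spec x₀).1]) continuous_const (fun _ => hε)
    (fun s hs hle => by
      have h1 : |σ * s| ≤ T := by
        rw [abs_mul, hσ, one_mul, abs_of_nonneg hs.1]; exact hs.2.le
      rw [← smul_sub, norm_smul, Real.norm_eq_abs, hσ, one_mul]
      have h2 := hclose (σ * s) h1 _ hle
      have h3 := hC (curve g x₀ (σ * s)) (curve f x₀ (σ * s))
      have := norm_add_le (V g (curve g x₀ (σ * s)) - V f (curve g x₀ (σ * s)))
        (V f (curve g x₀ (σ * s)) - V f (curve f x₀ (σ * s)))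
      rw [sub_add_sub_cancel] at this
      linarith)
    (by simpa using hsmall) (t := |t|) ⟨abs_nonneg t, ht⟩
  simpa [hσt] using key


/-! ### Continuous functions supported in the unit ball -/

/-- Continuous functions that vanish outside the closed unit ball. -/
structure BallFun (φ : Plane → ℝ) : Prop where
  cont : Continuous φ
  supp : ∀ z, 1 < ‖z‖ → φ z = 0

lemma BallFun.hasCompactSupport {φ : Plane → ℝ} (hφ : BallFun φ) : HasCompactSupport φ :=
  HasCompactSupport.intro (isCompact_closedBall 0 1) fun z hz => hφ.supp z (by
    simpa using hz)

lemma BallFun.integrable_mul {φ g : Plane → ℝ} (hφ : BallFun φ) (hg : Continuous g) :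
    Integrable fun z => φ z * g z :=
  (hφ.cont.mul hg).integrable_of_hasCompactSupport hφ.hasCompactSupport.mul_right

lemma BallFun.integrable {φ : Plane → ℝ} (hφ : BallFun φ) : Integrable φ :=
  hφ.cont.integrable_of_hasCompactSupport hφ.hasCompactSupport

lemma BallFun.bounded {φ : Plane → ℝ} (hφ : BallFun φ) : ∃ M, 0 ≤ M ∧ ∀ z, |φ z| ≤ M := by
  obtain ⟨M, hM⟩ := hφ.cont.bounded_above_of_compact_support hφ.hasCompactSupport
  exact ⟨M, (norm_nonneg _).trans (hM 0), hM⟩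

/-! ### Supports, differentiability and derivative bounds of the kernel and the density. -/

lemma dir_eq_zero_of_supp {g : Plane → ℝ} (hg : ∀ z, 1 < ‖z‖ → g z = 0) (a : Fin 2) (z : Plane)
    (hz : 1 < ‖z‖) : dir a g z = 0 := by
  have : g =ᶠ[𝓝 z] fun _ => 0 := by
    filter_upwards [continuous_norm.continuousAt.eventually (lt_mem_nhds hz)] with y hy
    exact hg y hy
  unfold dir
  rw [this.fderiv_eq]; simp

lemma wd_eq_zero_of_supp {g : Plane → ℝ} (hg : ∀ z, 1 < ‖z‖ → g z = 0) (w : List (Fin 2)) :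
    ∀ z, 1 < ‖z‖ → wd w g z = 0 := by
  induction w with
  | nil => exact hg
  | cons a w ih => exact dir_eq_zero_of_supp ih a

lemma KernelAssumptions.supp {K : Plane → ℝ} (hK : KernelAssumptions K) (z : Plane)
    (hz : 1 < ‖z‖) : K z = 0 := by
  by_contra h
  have := subset_tsupport K h
  rw [hK.support_eq] at this
  simp at this
  linarith

lemma KernelAssumptions.ballFun_wd {K : Plane → ℝ} (hK : KernelAssumptions K) (w : List (Fin 2))
    (hw : w.length ≤ 3) : BallFun (wd w K) where
  cont := (contDiff_wd (n := 0) w (hK.contDiff.of_le (by norm_cast; omega))).continuous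
  supp := wd_eq_zero_of_supp hK.supp w

lemma KernelAssumptions.diffWords {K : Plane → ℝ} (hK : KernelAssumptions K) : DiffWords 4 K :=
  diffWords_four hK.contDiff hK.differentiable

lemma exists_bound_wd {g : Plane → ℝ} (hd : DiffWords 4 g)
    (hb : ∀ i j : ℕ, 1 ≤ i + j → i + j ≤ 4 → ∃ C, ∀ x, |pd i j g x| ≤ C) :
    ∃ C, 0 ≤ C ∧ ∀ w : List (Fin 2), 1 ≤ w.length → w.length ≤ 4 → ∀ x, |wd w g x| ≤ C := by
  have : ∀ i j : ℕ, ∃ C, 1 ≤ i + j → i + j ≤ 4 → ∀ x, |pd i j g x| ≤ C := by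
    intro i j
    by_cases h : 1 ≤ i + j ∧ i + j ≤ 4
    · obtain ⟨C, hC⟩ := hb i j h.1 h.2
      exact ⟨C, fun _ _ => hC⟩
    · exact ⟨0, fun h1 h2 => absurd ⟨h1, h2⟩ h⟩
  choose C hC using this
  refine ⟨∑ i ∈ Finset.range 5, ∑ j ∈ Finset.range 5, |C i j|,
    Finset.sum_nonneg fun i _ => Finset.sum_nonneg fun j _ => abs_nonneg _, fun w h1 h4 x => ?_⟩
  rw [wd_eq_pd (hd.mono h4)]
  have hl := length_eq_count w
  have hi : w.count 0 ∈ Finset.range 5 := Finset.mem_range.2 (by omega)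
  have hj : w.count 1 ∈ Finset.range 5 := Finset.mem_range.2 (by omega)
  calc _ ≤ C (w.count 0) (w.count 1) := hC _ _ (by omega) (by omega) x
    _ ≤ |C (w.count 0) (w.count 1)| := le_abs_self _
    _ ≤ ∑ j ∈ Finset.range 5, |C (w.count 0) j| :=
      Finset.single_le_sum (f := fun j => |C (w.count 0) j|) (fun j _ => abs_nonneg _) hj
    _ ≤ _ := Finset.single_le_sum (f := fun i => ∑ j ∈ Finset.range 5, |C i j|)
      (fun i _ => Finset.sum_nonneg fun j _ => abs_nonneg _) hi

lemma exists_bound_wd_kernel {K : Plane → ℝ} (hK : KernelAssumptions K) :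
    ∃ C, 0 ≤ C ∧ ∀ w : List (Fin 2), 1 ≤ w.length → w.length ≤ 4 → ∀ x, |wd w K x| ≤ C :=
  exists_bound_wd hK.diffWords hK.bounded

lemma DensityAssumptions.diffWords {f : Plane → ℝ} {H L : Set Plane} {a : ℝ}
    (hf : DensityAssumptions f H L a) : DiffWords 4 f :=
  ContDiff.diffWords (n := 4) hf.contDiff

lemma exists_bound_wd_density {f : Plane → ℝ} {H L : Set Plane} {a : ℝ}
    (hf : DensityAssumptions f H L a) :
    ∃ C, 0 ≤ C ∧ ∀ w : List (Fin 2), 1 ≤ w.length → w.length ≤ 4 → ∀ x, |wd w f x| ≤ C :=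
  exists_bound_wd hf.diffWords hf.bounded

lemma DensityAssumptions.tame {f : Plane → ℝ} {H L : Set Plane} {a : ℝ}
    (hf : DensityAssumptions f H L a) : Tame f where
  diff := hf.diffWords.mono (by norm_num)
  bdd := by
    obtain ⟨C, _, hC⟩ := exists_bound_wd_density hf
    exact ⟨C, fun w h1 h3 => hC w h1 (by omega)⟩

/-- The derivative bounds depend on h and n and serve only to make the integral curves of the
estimator well defined. Quantitative control comes from closeness to the density. -/
lemma KernelAssumptions.tame_kde {K : Plane → ℝ} (hK : KernelAssumptions K) (h : ℝ) (n : ℕ)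
    (X : ℕ → Plane) : Tame (kde K h n X) := by
  have aux : ∀ k, ∀ g : Plane → ℝ, DiffWords k g → DiffWords k (kde g h n X) := by
    have mul : ∀ k, ∀ (c : ℝ) (g : Plane → ℝ), DiffWords k g → DiffWords k fun x => c * g x := by
      intro k
      induction k with
      | zero => exact fun _ _ _ => trivial
      | succ k ih =>
        intro c g hg
        refine ⟨hg.1.const_mul c, fun a => ?_⟩
        rw [dir_const_mul hg.1]
        exact ih c _ (hg.2 a)
    intro k
    induction k with
    | zero => exact fun _ _ => trivial
    | succ k ih =>
      intro g hg
      refine ⟨differentiable_kde hg.1 h n X, fun a => ?_⟩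
      rw [dir_kde hg.1]
      exact mul k _ _ (ih _ (hg.2 a))
  refine ⟨aux 3 K (hK.diffWords.mono (by norm_num)), ?_⟩
  obtain ⟨C, hC0, hC⟩ := exists_bound_wd_kernel hK
  have hle : ∀ k ≤ 3, |h⁻¹| ^ k ≤ (1 + |h⁻¹|) ^ 3 := fun k hk =>
    (pow_le_pow_left₀ (abs_nonneg _) (by linarith) k).trans
      (pow_le_pow_right₀ (by linarith [abs_nonneg h⁻¹]) hk)
  refine ⟨(1 + |h⁻¹|) ^ 3 * (|((n : ℝ) * h ^ 2)⁻¹| * (n * C)), fun w h1 h3 x => ?_⟩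
  rw [wd_kde h n X w (hK.diffWords.mono (by omega)), abs_mul, abs_pow]
  gcongr
  · exact hle _ h3
  · rw [kde, abs_mul]
    gcongr
    refine (Finset.abs_sum_le_sum_abs _ _).trans ?_
    refine (Finset.sum_le_sum fun i _ => hC w h1 (by omega) _).trans ?_
    simp

/-! ### Smoothing by a kernel -/

/-- `smooth φ g h x = ∫ φ(z) g(x - h z) dz`. -/
noncomputable def smooth (φ g : Plane → ℝ) (h : ℝ) (x : Plane) : ℝ :=
  ∫ z, φ z * g (x - h • z)

lemma integral_comp_scale (F g : Plane → ℝ) {h : ℝ} (hh : 0 < h) (x : Plane) :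
    ∫ y, F (h⁻¹ • (x - y)) * g y = h ^ 2 * ∫ z, F z * g (x - h • z) := by
  have h1 : ∫ y, F (h⁻¹ • (x - y)) * g y = ∫ y, F (h⁻¹ • y) * g (x - y) := by
    rw [← integral_sub_left_eq_self (fun y => F (h⁻¹ • y) * g (x - y)) volume x]
    simp
  have h2 := Measure.integral_comp_inv_smul (volume : Measure Plane)
    (fun z => F z * g (x - h • z)) h
  have h3 : ∀ y : Plane, h • h⁻¹ • y = y := fun y => by rw [smul_inv_smul₀ hh.ne']
  simp only [h3] at h2
  rw [h1, h2]
  simp [abs_of_pos (pow_pos hh 2)]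

/-- Integration by parts without boundary terms, since φ has compact support. The factor h is the
inner derivative of z ↦ x - hz. -/
lemma smooth_dir {φ g : Plane → ℝ} (hφ : ContDiff ℝ 1 φ) (hs : ∀ z, 1 < ‖z‖ → φ z = 0)
    (hg : ContDiff ℝ 1 g) (h : ℝ) (x : Plane) (a : Fin 2) :
    smooth (dir a φ) g h x = h * smooth φ (dir a g) h x := by
  have hφ' : BallFun φ := ⟨hφ.continuous, hs⟩
  have hd : BallFun (dir a φ) := ⟨(contDiff_dir (n := 0) (by simpa using hφ) a).continuous,
    dir_eq_zero_of_supp hs a⟩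
  have hgd : Differentiable ℝ g := hg.differentiable (by norm_num)
  have hgc : Continuous (dir a g) := (contDiff_dir (n := 0) (by simpa using hg) a).continuous
  have hder : ∀ z, fderiv ℝ (fun z => g (x - h • z)) z (EuclideanSpace.single a 1)
      = -(h * dir a g (x - h • z)) := by
    intro z
    have h1 : HasFDerivAt (fun z : Plane => x - h • z) (-(h • ContinuousLinearMap.id ℝ Plane)) z :=
      ((hasFDerivAt_id z).const_smul h).const_sub x
    have := ((hgd (x - h • z)).hasFDerivAt.comp z h1).fderiv
    change fderiv ℝ (g ∘ fun z => x - h • z) z _ = _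
    rw [this]; simp [dir]
  have hcomp : Continuous fun z : Plane => g (x - h • z) := hg.continuous.comp (by fun_prop)
  have hcomp' : Continuous fun z : Plane => dir a g (x - h • z) := hgc.comp (by fun_prop)
  have key := integral_mul_fderiv_eq_neg_fderiv_mul_of_integrable (μ := (volume : Measure Plane))
    (f := φ) (g := fun z => g (x - h • z)) (v := EuclideanSpace.single a 1)
    (hd.integrable_mul hcomp)
    (by simp only [hder]; exact hφ'.integrable_mul (hcomp'.const_mul h).neg)
    (hφ'.integrable_mul hcomp) (fun z _ => (hφ.differentiable (by norm_num)) z)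
    (fun z _ => (hgd.comp (by fun_prop : Differentiable ℝ fun z : Plane => x - h • z)) z)
  simp only [hder] at key
  unfold smooth
  have h4 : ∫ z, φ z * -(h * dir a g (x - h • z)) = -(h * ∫ z, φ z * dir a g (x - h • z)) := by
    rw [← integral_const_mul, ← integral_neg]
    congr 1; funext z; ring
  rw [h4] at key
  exact (neg_injective key).symm

lemma smooth_wd {K g : Plane → ℝ} (w : List (Fin 2)) (hK : ContDiff ℝ (w.length : ℕ) K)
    (hs : ∀ z, 1 < ‖z‖ → K z = 0) (hg : ContDiff ℝ (w.length : ℕ) g) (h : ℝ) (x : Plane) :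
    smooth (wd w K) g h x = h ^ w.length * smooth K (wd w g) h x := by
  induction w generalizing g with
  | nil => simp
  | cons a w ih =>
    have h1 : ContDiff ℝ (1 : ℕ) (wd w K) :=
      contDiff_wd w (hK.of_le (by norm_cast; simp; omega))
    have h2 : ContDiff ℝ (1 : ℕ) g := hg.of_le (by norm_cast; simp)
    rw [wd_cons, smooth_dir (by simpa using h1) (wd_eq_zero_of_supp hs w) (by simpa using h2),
      ih (hK.of_le (by norm_cast; simp)) (contDiff_dir hg a)]
    have h3 : wd w (dir a g) = wd (a :: w) g := by
      have : wd w (dir a g) = wd (w ++ [a]) g := by rw [wd_append]; rfl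
      rw [this]
      exact wd_perm (List.perm_append_singleton a w) (ContDiff.diffWords hg)
    rw [h3, List.length_cons]
    simp only [wd_cons]
    ring

/-- The first order bias bound. -/
lemma abs_smooth_sub_le {K g : Plane → ℝ} (hK : KernelAssumptions K) (hg : Continuous g) {C : ℝ}
    (hC : ∀ x y, |g x - g y| ≤ C * ‖x - y‖) {h : ℝ} (hh : 0 ≤ h) (x : Plane) :
    |smooth K g h x - g x| ≤ C * h := by
  have hb : BallFun K := hK.ballFun_wd [] (by simp)
  have hi : Integrable fun z => K z * g (x - h • z) := hb.integrable_mul (hg.comp (by fun_prop))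
  have h1 : smooth K g h x - g x = ∫ z, K z * (g (x - h • z) - g x) := by
    simp only [mul_sub]
    rw [integral_sub hi (hb.integrable.mul_const _), integral_mul_const, hK.integral_eq_one,
      one_mul, smooth]
  have h2 : ∫ z, K z * (C * h) = C * h := by
    rw [integral_mul_const, hK.integral_eq_one, one_mul]
  rw [h1, ← h2, ← Real.norm_eq_abs]
  refine norm_integral_le_of_norm_le (hb.integrable.mul_const _) (Eventually.of_forall fun z => ?_)
  rw [Real.norm_eq_abs, abs_mul, abs_of_nonneg (hK.nonneg z)]
  rcases lt_or_ge 1 ‖z‖ with hz | hz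
  · simp [hK.supp z hz]
  · refine mul_le_mul_of_nonneg_left ((hC _ _).trans ?_) (hK.nonneg z)
    have hC0 : 0 ≤ C := by
      have := (abs_nonneg _).trans (hC (EuclideanSpace.single 0 1) 0)
      simpa using this
    have : ‖x - h • z - x‖ = h * ‖z‖ := by
      rw [sub_sub_cancel_left, norm_neg, norm_smul, Real.norm_eq_abs, abs_of_nonneg hh]
    rw [this]
    have : h * ‖z‖ ≤ h := by nlinarith
    gcongr

/-! ### Second order bias -/

lemma hasDerivAt_line {g : Plane → ℝ} (hg : Differentiable ℝ g) (x z : Plane) (t : ℝ) :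
    HasDerivAt (fun t : ℝ => g (x + t • z)) (fderiv ℝ g (x + t • z) z) t := by
  have h1 : HasDerivAt (fun t : ℝ => x + t • z) z t := by
    simpa using ((hasDerivAt_id t).smul_const z).const_add x
  exact (hg (x + t • z)).hasFDerivAt.comp_hasDerivAt t h1

lemma hasDerivAt_line_neg {g : Plane → ℝ} (hg : Differentiable ℝ g) (x z : Plane) (t : ℝ) :
    HasDerivAt (fun t : ℝ => g (x - t • z)) (-(fderiv ℝ g (x - t • z) z)) t := by
  have h := hasDerivAt_line hg x (-z) t
  simpa [sub_eq_add_neg] using! h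

lemma hasDerivAt_fderiv_line {g : Plane → ℝ} (hg : DiffWords 2 g) (x z : Plane) :
    HasDerivAt (fun t : ℝ => fderiv ℝ g (x + t • z) z) (bil (hess g x) z z) 0 := by
  have h : ∀ a, HasDerivAt (fun t : ℝ => dir a g (x + t • z)) (fderiv ℝ (dir a g) x z) 0 := by
    intro a
    simpa using hasDerivAt_line (hg.2 a).1 x z 0
  have h2 := ((h 0).const_mul (z 0)).add ((h 1).const_mul (z 1))
  have e : (fun t : ℝ => fderiv ℝ g (x + t • z) z) =
      (fun t : ℝ => z 0 * dir 0 g (x + t • z)) + fun t : ℝ => z 1 * dir 1 g (x + t • z) := by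
    funext t; exact fderiv_eq_sum_dir g _ z
  rw [e]
  refine h2.congr_deriv ?_
  rw [fderiv_eq_sum_dir, fderiv_eq_sum_dir]
  have hc := congrFun (dir_comm hg 1 0) x
  simp [bil, PiLp.inner_apply, act_apply, Fin.sum_univ_two, hess, pd, hc]
  ring

/-- One application of l'Hôpital's rule leaves a symmetric difference quotient of the directional
derivative at 0. Hence second derivatives need to exist but not to be continuous. -/
lemma secondDiff_tendsto {g : Plane → ℝ} (hg : DiffWords 2 g) (x z : Plane) :
    Tendsto (fun t : ℝ => (g (x - t • z) + g (x + t • z) - 2 * g x) / t ^ 2) (𝓝[>] 0)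
      (𝓝 (bil (hess g x) z z)) := by
  have hd : Differentiable ℝ g := hg.1
  refine HasDerivAt.lhopital_zero_nhdsGT
    (f' := fun t => -(fderiv ℝ g (x - t • z) z) + fderiv ℝ g (x + t • z) z)
    (g' := fun t => 2 * t)
    (Eventually.of_forall fun t =>
      ((hasDerivAt_line_neg hd x z t).add (hasDerivAt_line hd x z t)).sub_const _)
    (Eventually.of_forall fun t => by simpa using hasDerivAt_pow 2 t) ?_ ?_ ?_ ?_
  · filter_upwards [self_mem_nhdsWithin] with t ht
    have : (0 : ℝ) < t := ht
    positivity
  · have : Continuous fun t : ℝ => g (x - t • z) + g (x + t • z) - 2 * g x := by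
      have := hd.continuous
      fun_prop
    have := this.tendsto 0
    simp only [zero_smul, sub_zero, add_zero] at this
    rw [show g x + g x - 2 * g x = 0 by ring] at this
    exact this.mono_left nhdsWithin_le_nhds
  · have : Continuous fun t : ℝ => t ^ 2 := by fun_prop
    have := this.tendsto 0
    rw [zero_pow (by norm_num)] at this
    exact this.mono_left nhdsWithin_le_nhds
  · have h1 := hasDerivAt_fderiv_line hg x z
    have h2 : HasDerivAt (fun t : ℝ => fderiv ℝ g (x - t • z) z) (-bil (hess g x) z z) 0 := by
      have h3 : HasDerivAt (fun t : ℝ => -t) (-1) 0 := hasDerivAt_neg' 0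
      have h4 := HasDerivAt.comp (0 : ℝ) (h₂ := fun t : ℝ => fderiv ℝ g (x + t • z) z)
        (by simpa using h1) h3
      simpa [Function.comp_def, sub_eq_add_neg] using! h4
    have h5 := (h1.sub h2).tendsto_slope_zero_right
    have h6 := h5.const_mul (1 / 2)
    rw [show (1 / 2 : ℝ) * (bil (hess g x) z z - -bil (hess g x) z z)
      = bil (hess g x) z z by ring] at h6
    refine h6.congr' ?_
    filter_upwards [self_mem_nhdsWithin] with t ht
    have : (0 : ℝ) < t := ht
    simp
    field_simp
    ring

lemma abs_secondDiff_le {g : Plane → ℝ} (hg : DiffWords 2 g) {C : ℝ}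
    (hC : ∀ a b x, |dir a (dir b g) x| ≤ C) (x z : Plane) {t : ℝ} (ht : 0 ≤ t) :
    |g (x - t • z) + g (x + t • z) - 2 * g x| ≤ 8 * C * ‖z‖ ^ 2 * t ^ 2 := by
  have hd : Differentiable ℝ g := hg.1
  have hC0 : 0 ≤ C := (abs_nonneg _).trans (hC 0 0 0)
  have hlip : ∀ a (u v : Plane), |dir a g u - dir a g v| ≤ 2 * C * ‖u - v‖ := fun a u v =>
    abs_sub_le_of_dir convex_univ (hg.2 a).1 (fun y _ b => hC b a y) (mem_univ _) (mem_univ _)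
  have hder : ∀ s ∈ Ico 0 t, ‖-(fderiv ℝ g (x - s • z) z) + fderiv ℝ g (x + s • z) z‖
      ≤ 8 * C * ‖z‖ ^ 2 * t := by
    intro s hs
    rw [fderiv_eq_sum_dir, fderiv_eq_sum_dir, Real.norm_eq_abs]
    have e : ‖x + s • z - (x - s • z)‖ = 2 * s * ‖z‖ := by
      rw [add_sub_sub_cancel, ← two_smul ℝ, norm_smul, norm_smul, Real.norm_eq_abs,
        Real.norm_eq_abs, abs_of_nonneg hs.1]
      norm_num; ring
    have h0 := hlip 0 (x + s • z) (x - s • z)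
    have h1 := hlip 1 (x + s • z) (x - s • z)
    rw [e] at h0 h1
    have z0 := abs_apply_le_norm z 0
    have z1 := abs_apply_le_norm z 1
    calc _ = |z 0 * (dir 0 g (x + s • z) - dir 0 g (x - s • z))
          + z 1 * (dir 1 g (x + s • z) - dir 1 g (x - s • z))| := by congr 1; ring
      _ ≤ |z 0| * |dir 0 g (x + s • z) - dir 0 g (x - s • z)|
          + |z 1| * |dir 1 g (x + s • z) - dir 1 g (x - s • z)| := by
        rw [← abs_mul, ← abs_mul]; exact abs_add_le _ _
      _ ≤ ‖z‖ * (2 * C * (2 * s * ‖z‖)) + ‖z‖ * (2 * C * (2 * s * ‖z‖)) := by gcongr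
      _ = 8 * C * ‖z‖ ^ 2 * s := by ring
      _ ≤ _ := by
        have := hs.2.le
        gcongr
  have key := norm_image_sub_le_of_norm_deriv_le_segment'
    (f := fun s : ℝ => g (x - s • z) + g (x + s • z)) (a := 0) (b := t)
    (fun s _ => ((hasDerivAt_line_neg hd x z s).add (hasDerivAt_line hd x z s)).hasDerivWithinAt)
    hder t ⟨ht, le_rfl⟩
  simp only [zero_smul, sub_zero, add_zero, Real.norm_eq_abs] at key
  calc _ = |g (x - t • z) + g (x + t • z) - (g x + g x)| := by congr 1; ring
    _ ≤ _ := key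
    _ = _ := by ring

/-- The symmetry of the kernel allows averaging over z and -z. The first order term of the Taylor
expansion cancels, and the bias becomes of order h². -/
lemma smooth_sub_eq {K g : Plane → ℝ} (hK : KernelAssumptions K) (hg : Continuous g) (h : ℝ)
    (x : Plane) : smooth K g h x - g x =
      2⁻¹ * ∫ z, K z * (g (x - h • z) + g (x + h • z) - 2 * g x) := by
  have hb : BallFun K := hK.ballFun_wd [] (by simp)
  have hi : Integrable fun z => K z * g (x - h • z) := hb.integrable_mul (hg.comp (by fun_prop))
  have hi' : Integrable fun z => K z * g (x + h • z) := hb.integrable_mul (hg.comp (by fun_prop))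
  have e : ∫ z, K z * g (x + h • z) = ∫ z, K z * g (x - h • z) := by
    rw [← integral_neg_eq_self]
    congr 1; funext z
    rw [hK.symmetric, smul_neg, sub_eq_add_neg]
  have e2 : ∫ z, K z * (g (x - h • z) + g (x + h • z) - 2 * g x) =
      (∫ z, K z * g (x - h • z)) + (∫ z, K z * g (x + h • z)) - ∫ z, K z * (2 * g x) := by
    have h1 : Integrable fun z => K z * g (x - h • z) + K z * g (x + h • z) := hi.add hi'
    simp only [mul_sub, mul_add]
    rw [integral_sub h1 (hb.integrable.mul_const _), integral_add hi hi']
  rw [e2, integral_mul_const, hK.integral_eq_one, e, smooth]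
  ring

lemma abs_smooth_sub_le_sq {K g : Plane → ℝ} (hK : KernelAssumptions K) (hg : DiffWords 2 g)
    {C : ℝ} (hC : ∀ a b x, |dir a (dir b g) x| ≤ C) {h : ℝ} (hh : 0 ≤ h) (x : Plane) :
    |smooth K g h x - g x| ≤ 4 * C * h ^ 2 := by
  have hC0 : 0 ≤ C := (abs_nonneg _).trans (hC 0 0 0)
  have hb : BallFun K := hK.ballFun_wd [] (by simp)
  rw [smooth_sub_eq hK hg.1.continuous, abs_mul]
  have h2 : ∫ z, K z * (8 * C * h ^ 2) = 8 * C * h ^ 2 := by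
    rw [integral_mul_const, hK.integral_eq_one, one_mul]
  have : |∫ z, K z * (g (x - h • z) + g (x + h • z) - 2 * g x)| ≤ 8 * C * h ^ 2 := by
    rw [← h2, ← Real.norm_eq_abs]
    refine norm_integral_le_of_norm_le (hb.integrable.mul_const _)
      (Eventually.of_forall fun z => ?_)
    rw [Real.norm_eq_abs, abs_mul, abs_of_nonneg (hK.nonneg z)]
    rcases lt_or_ge 1 ‖z‖ with hz | hz
    · simp [hK.supp z hz]
    · refine mul_le_mul_of_nonneg_left ((abs_secondDiff_le hg hC x z hh).trans ?_) (hK.nonneg z)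
      have : ‖z‖ ^ 2 ≤ 1 := pow_le_one₀ (norm_nonneg _) hz
      have h3 : 8 * C * ‖z‖ ^ 2 ≤ 8 * C * 1 := by gcongr
      have h4 : 0 ≤ h ^ 2 := by positivity
      nlinarith
  rw [abs_of_pos (by norm_num : (0 : ℝ) < 2⁻¹)]
  linarith

/-- Dominated convergence for the second differences, with the uniform bound of `abs_secondDiff_le`
on the unit disc as dominating function. It supplies the bias both of the gradient at the end point
and of the second derivatives along the path. -/
lemma smooth_bias_tendsto {K g : Plane → ℝ} (hK : KernelAssumptions K) (hg : DiffWords 2 g)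
    {C : ℝ} (hC : ∀ a b x, |dir a (dir b g) x| ≤ C) (x : Plane) :
    Tendsto (fun h : ℝ => (smooth K g h x - g x) / h ^ 2) (𝓝[>] 0)
      (𝓝 (2⁻¹ * kernelHess K g x)) := by
  have hC0 : 0 ≤ C := (abs_nonneg _).trans (hC 0 0 0)
  have hb : BallFun K := hK.ballFun_wd [] (by simp)
  have hgc := hg.1.continuous
  have e : ∀ h : ℝ, (smooth K g h x - g x) / h ^ 2 =
      2⁻¹ * ∫ z, K z * ((g (x - h • z) + g (x + h • z) - 2 * g x) / h ^ 2) := by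
    intro h
    rw [smooth_sub_eq hK hgc, mul_div_assoc, ← integral_div]
    simp only [mul_div_assoc]
  simp only [e]
  refine Tendsto.const_mul _ ?_
  unfold kernelHess
  refine tendsto_integral_filter_of_dominated_convergence (fun z => K z * (8 * C))
    ?_ ?_ (hb.integrable.mul_const _) ?_
  · refine Eventually.of_forall fun h => ?_
    have : Continuous fun z => K z * ((g (x - h • z) + g (x + h • z) - 2 * g x) / h ^ 2) := by
      have := hb.cont
      fun_prop
    exact this.aestronglyMeasurable
  · filter_upwards [self_mem_nhdsWithin] with h hh
    have hh : 0 < h := hh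
    refine Eventually.of_forall fun z => ?_
    rw [Real.norm_eq_abs, abs_mul, abs_of_nonneg (hK.nonneg z)]
    rcases lt_or_ge 1 ‖z‖ with hz | hz
    · simp [hK.supp z hz]
    · refine mul_le_mul_of_nonneg_left ?_ (hK.nonneg z)
      rw [abs_div, abs_of_pos (pow_pos hh 2), div_le_iff₀ (pow_pos hh 2)]
      refine (abs_secondDiff_le hg hC x z hh.le).trans ?_
      have : ‖z‖ ^ 2 ≤ 1 := pow_le_one₀ (norm_nonneg _) hz
      have h3 : 8 * C * ‖z‖ ^ 2 ≤ 8 * C * 1 := by gcongr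
      have h4 : 0 ≤ h ^ 2 := by positivity
      nlinarith
  · exact Eventually.of_forall fun z => (secondDiff_tendsto hg x z).const_mul _


/-! ### Samples and empirical means -/

/-- An independent sample with continuous density `f`. -/
structure IIDSample {Ω : Type*} [MeasurableSpace Ω] (f : Plane → ℝ) (P : Measure Ω)
    (X : ℕ → Ω → Plane) : Prop where
  nonneg : ∀ x, 0 ≤ f x
  cont : Continuous f
  integrable : Integrable f
  integral_eq_one : ∫ x, f x = 1
  meas : ∀ i, Measurable (X i)
  indep : iIndepFun X P
  law : ∀ i, HasLaw (X i) (volume.withDensity fun x => ENNReal.ofReal (f x)) P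

/-- The empirical mean of `ψ` over the first `n` points. -/
noncomputable def emp (ψ : Plane → ℝ) (n : ℕ) (x : ℕ → Plane) : ℝ :=
  (n : ℝ)⁻¹ * ∑ i ∈ Finset.range n, ψ (x i)

section

variable {Ω : Type*} [MeasurableSpace Ω] {f : Plane → ℝ} {P : Measure Ω} [IsProbabilityMeasure P]
  {X : ℕ → Ω → Plane}

lemma IIDSample.integral_comp {E : Type*} [NormedAddCommGroup E] [NormedSpace ℝ E]
    (hX : IIDSample f P X) {ψ : Plane → E} (hψ : StronglyMeasurable ψ)
    (i : ℕ) : ∫ ω, ψ (X i ω) ∂P = ∫ y, f y • ψ y := by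
  have h1 := (hX.law i).integral_comp (f := ψ) hψ.aestronglyMeasurable
  have h2 : ∫ ω, ψ (X i ω) ∂P = P[ψ ∘ X i] := rfl
  rw [h2, h1, integral_withDensity_eq_integral_toReal_smul
    (hX.cont.measurable.ennreal_ofReal) (Eventually.of_forall fun x => ENNReal.ofReal_lt_top)]
  congr 1; funext y
  rw [ENNReal.toReal_ofReal (hX.nonneg y)]

lemma IIDSample.integral_comp_real (hX : IIDSample f P X) {ψ : Plane → ℝ} (hψ : Measurable ψ)
    (i : ℕ) : ∫ ω, ψ (X i ω) ∂P = ∫ y, ψ y * f y := by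
  rw [hX.integral_comp hψ.stronglyMeasurable]
  simp only [smul_eq_mul, mul_comm]

lemma IIDSample.integrable_comp (hX : IIDSample f P X) {ψ : Plane → ℝ} (hψ : Measurable ψ)
    {M : ℝ} (hM : ∀ y, |ψ y| ≤ M) (i : ℕ) : Integrable (fun ω => ψ (X i ω)) P :=
  Integrable.of_bound (hψ.comp (hX.meas i)).aestronglyMeasurable M
    (Eventually.of_forall fun _ => hM _)

lemma IIDSample.memLp_comp (hX : IIDSample f P X) {ψ : Plane → ℝ} (hψ : Measurable ψ)
    {M : ℝ} (hM : ∀ y, |ψ y| ≤ M) (i : ℕ) : MemLp (fun ω => ψ (X i ω)) 2 P :=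
  MemLp.of_bound (hψ.comp (hX.meas i)).aestronglyMeasurable M
    (Eventually.of_forall fun _ => hM _)

/-- The mean square deviation from c splits into variance and squared bias. Independence divides the
variance of one summand by n, and that variance is at most the raw second moment. -/
lemma IIDSample.integral_emp_sub_sq_le (hX : IIDSample f P X) {ψ : Plane → ℝ} (hψ : Measurable ψ)
    {M : ℝ} (hM : ∀ y, |ψ y| ≤ M) {n : ℕ} (hn : n ≠ 0) (c : ℝ) :
    ∫ ω, (emp ψ n (fun i => X i ω) - c) ^ 2 ∂P ≤
      (n : ℝ)⁻¹ * (∫ y, ψ y ^ 2 * f y) + ((∫ y, ψ y * f y) - c) ^ 2 := by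
  have hn0 : (n : ℝ) ≠ 0 := by exact_mod_cast hn
  set S : Ω → ℝ := fun ω => emp ψ n (fun i => X i ω) with hS
  have hSsum : S = (n : ℝ)⁻¹ • ∑ i ∈ Finset.range n, fun ω => ψ (X i ω) := by
    funext ω; simp [hS, emp, Finset.sum_apply]
  have hL : MemLp S 2 P := by
    rw [hSsum]
    exact (memLp_finsetSum' _ fun i _ => hX.memLp_comp hψ hM i).const_smul _
  have hmean : ∫ ω, S ω ∂P = ∫ y, ψ y * f y := by
    simp only [hS, emp]
    rw [integral_const_mul, integral_finsetSum _ fun i _ => hX.integrable_comp hψ hM i]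
    simp only [hX.integral_comp_real hψ, Finset.sum_const, Finset.card_range, nsmul_eq_mul]
    field_simp
  have hvar : Var[S; P] ≤ (n : ℝ)⁻¹ * ∫ y, ψ y ^ 2 * f y := by
    rw [hSsum, variance_smul, IndepFun.variance_sum (fun i _ => hX.memLp_comp hψ hM i)]
    · have : ∀ i ∈ Finset.range n, Var[fun ω => ψ (X i ω); P] ≤ ∫ y, ψ y ^ 2 * f y := by
        intro i _
        refine (variance_le_expectation_sq (hψ.comp (hX.meas i)).aestronglyMeasurable).trans ?_
        exact (hX.integral_comp_real (ψ := fun y => ψ y ^ 2) (hψ.pow_const 2) i).le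
      have h2 := Finset.sum_le_sum this
      rw [Finset.sum_const, Finset.card_range, nsmul_eq_mul] at h2
      calc _ ≤ ((n : ℝ)⁻¹) ^ 2 * (n * ∫ y, ψ y ^ 2 * f y) := by gcongr
        _ = _ := by field_simp
    · intro i _ j _ hij
      exact (hX.indep.indepFun hij).comp hψ hψ
  have h3 : ∫ ω, (S ω - c) ^ 2 ∂P = Var[S; P] + ((∫ y, ψ y * f y) - c) ^ 2 := by
    rw [variance_eq_sub hL, hmean]
    have hi : Integrable S P := hL.integrable one_le_two
    have hsq : Integrable (fun ω => S ω ^ 2) P := hL.integrable_sq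
    have e : ∀ ω, (S ω - c) ^ 2 = S ω ^ 2 - 2 * c * S ω + c ^ 2 := fun ω => by ring
    simp only [e]
    have i1 : Integrable (fun ω => S ω ^ 2 - 2 * c * S ω) P := hsq.sub (hi.const_mul _)
    rw [integral_add i1 (integrable_const _), integral_sub hsq (hi.const_mul _),
      integral_const_mul, hmean]
    simp
    ring
  rw [h3]
  linarith

/-- A one-sided exponential inequality for empirical means. -/
lemma IIDSample.measure_emp_gt_le (hX : IIDSample f P X) {ψ : Plane → ℝ} (hψ : Measurable ψ)
    {M v l : ℝ} (hM : ∀ y, |ψ y| ≤ M) (hv : ∫ y, ψ y ^ 2 * f y ≤ v) (hl : 0 ≤ l)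
    (hlM : 2 * l * M ≤ 1) {n : ℕ} (hn : n ≠ 0) (ε : ℝ) :
    P.real {ω | ε ≤ emp ψ n (fun i => X i ω) - ∫ y, ψ y * f y} ≤
      Real.exp (-(n * l * ε) + n * l ^ 2 * v) := by
  have hn0 : (0 : ℝ) < n := by exact_mod_cast Nat.pos_of_ne_zero hn
  set μ := ∫ y, ψ y * f y with hμ
  have hμM : |μ| ≤ M := by
    rw [hμ, ← hX.integral_comp_real hψ 0, ← Real.norm_eq_abs]
    refine (norm_integral_le_of_norm_le_const (C := M) (Eventually.of_forall fun _ => hM _)).trans ?_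
    simp
  let Y : ℕ → Ω → ℝ := fun i ω => ψ (X i ω) - μ
  have hYm : ∀ i, Measurable (Y i) := fun i => (hψ.comp (hX.meas i)).sub_const _
  have hYb : ∀ i ω, |l * Y i ω| ≤ 1 := by
    intro i ω
    rw [abs_mul, abs_of_nonneg hl]
    have : |Y i ω| ≤ 2 * M := by
      have := abs_sub (ψ (X i ω)) μ
      have h1 := hM (X i ω)
      simp only [Y]; linarith
    nlinarith
  have hYi : iIndepFun Y P := hX.indep.comp (fun _ y => ψ y - μ) fun _ => hψ.sub_const _
  have hmgf : ∀ i, mgf (Y i) P l ≤ Real.exp (l ^ 2 * v) := by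
    intro i
    have hYint : Integrable (Y i) P := (hX.integrable_comp hψ hM i).sub (integrable_const _)
    have hsq : Integrable (fun ω => (Y i ω) ^ 2) P :=
      ((hX.memLp_comp hψ hM i).sub (memLp_const μ)).integrable_sq
    -- The condition 2lM ≤ 1 keeps the exponent in [-1, 1], where exp x ≤ 1 + x + x². The linear
    -- term has mean zero.
    have hle : ∀ ω, Real.exp (l * Y i ω) ≤ 1 + l * Y i ω + l ^ 2 * (Y i ω) ^ 2 := by
      intro ω
      have := (abs_le.1 (Real.abs_exp_sub_one_sub_id_le (hYb i ω))).2
      nlinarith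
    have hexp : Integrable (fun ω => Real.exp (l * Y i ω)) P := by
      refine Integrable.of_bound (((hYm i).const_mul l).exp).aestronglyMeasurable (Real.exp 1)
        (Eventually.of_forall fun ω => ?_)
      rw [Real.norm_eq_abs, abs_of_pos (Real.exp_pos _)]
      exact Real.exp_le_exp.2 ((le_abs_self _).trans (hYb i ω))
    have h0 : ∫ ω, Y i ω ∂P = 0 := by
      simp only [Y]
      rw [integral_sub (hX.integrable_comp hψ hM i) (integrable_const _),
        hX.integral_comp_real hψ]
      simp [hμ]
    have h2 : ∫ ω, (Y i ω) ^ 2 ∂P ≤ v := by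
      have hpi : Integrable (fun ω => ψ (X i ω)) P := hX.integrable_comp hψ hM i
      have hpsq : Integrable (fun ω => ψ (X i ω) ^ 2) P := (hX.memLp_comp hψ hM i).integrable_sq
      have e : ∀ ω, (Y i ω) ^ 2 = ψ (X i ω) ^ 2 - 2 * μ * ψ (X i ω) + μ ^ 2 := fun ω => by
        simp only [Y]; ring
      simp only [e]
      have i1 : Integrable (fun ω => ψ (X i ω) ^ 2 - 2 * μ * ψ (X i ω)) P :=
        hpsq.sub (hpi.const_mul _)
      rw [integral_add i1 (integrable_const _), integral_sub hpsq (hpi.const_mul _),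
        integral_const_mul, hX.integral_comp_real hψ,
        hX.integral_comp_real (ψ := fun y => ψ y ^ 2) (hψ.pow_const 2), ← hμ]
      simp
      nlinarith [sq_nonneg μ]
    calc mgf (Y i) P l = ∫ ω, Real.exp (l * Y i ω) ∂P := rfl
      _ ≤ ∫ ω, (1 + l * Y i ω + l ^ 2 * (Y i ω) ^ 2) ∂P :=
        integral_mono hexp (((integrable_const _).add (hYint.const_mul _)).add (hsq.const_mul _)) hle
      _ = 1 + l ^ 2 * ∫ ω, (Y i ω) ^ 2 ∂P := by
        have i1 : Integrable (fun ω => 1 + l * Y i ω) P :=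
          (integrable_const _).add (hYint.const_mul _)
        rw [integral_add i1 (hsq.const_mul _),
          integral_add (integrable_const _) (hYint.const_mul _), integral_const_mul,
          integral_const_mul, h0]
        simp
      _ ≤ 1 + l ^ 2 * v := by gcongr
      _ ≤ _ := by linarith [Real.add_one_le_exp (l ^ 2 * v)]
  have hsum : ∀ ω, (∑ i ∈ Finset.range n, Y i) ω =
      n * (emp ψ n (fun i => X i ω) - μ) := by
    intro ω
    simp only [Finset.sum_apply, Y, Finset.sum_sub_distrib, Finset.sum_const, Finset.card_range,
      nsmul_eq_mul, emp]
    field_simp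
  have hset : {ω | ε ≤ emp ψ n (fun i => X i ω) - μ} =
      {ω | n * ε ≤ (∑ i ∈ Finset.range n, Y i) ω} := by
    ext ω
    simp only [mem_ofPred_eq, hsum]
    exact (mul_le_mul_iff_right₀ hn0).symm
  have hint : Integrable (fun ω => Real.exp (l * (∑ i ∈ Finset.range n, Y i) ω)) P := by
    refine Integrable.of_bound (C := Real.exp n) ?_ (Eventually.of_forall fun ω => ?_)
    · simp only [Finset.sum_apply]
      exact ((Finset.measurable_sum _ fun i _ => hYm i).const_mul l).exp.aestronglyMeasurable
    · rw [Real.norm_eq_abs, abs_of_pos (Real.exp_pos _)]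
      refine Real.exp_le_exp.2 ?_
      rw [Finset.sum_apply, Finset.mul_sum]
      refine (Finset.sum_le_sum fun i _ => (le_abs_self _).trans (hYb i ω)).trans ?_
      simp
  rw [hset]
  refine (measure_ge_le_exp_mul_mgf _ hl hint).trans ?_
  rw [hYi.mgf_sum hYm, Real.exp_add]
  have : ∏ i ∈ Finset.range n, mgf (Y i) P l ≤ ∏ _i ∈ Finset.range n, Real.exp (l ^ 2 * v) :=
    Finset.prod_le_prod (fun i _ => mgf_nonneg) fun i _ => hmgf i
  rw [Finset.prod_const, Finset.card_range, ← Real.exp_nat_mul] at this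
  calc _ ≤ Real.exp (-l * (n * ε)) * Real.exp (n * (l ^ 2 * v)) := by gcongr
    _ = _ := by ring_nf

lemma IIDSample.measure_abs_emp_gt_le (hX : IIDSample f P X) {ψ : Plane → ℝ} (hψ : Measurable ψ)
    {M v l : ℝ} (hM : ∀ y, |ψ y| ≤ M) (hv : ∫ y, ψ y ^ 2 * f y ≤ v) (hl : 0 ≤ l)
    (hlM : 2 * l * M ≤ 1) {n : ℕ} (hn : n ≠ 0) (ε : ℝ) :
    P {ω | ε < |emp ψ n (fun i => X i ω) - ∫ y, ψ y * f y|} ≤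
      ENNReal.ofReal (2 * Real.exp (-(n * l * ε) + n * l ^ 2 * v)) := by
  have h1 := hX.measure_emp_gt_le hψ hM hv hl hlM hn ε
  have h2 := hX.measure_emp_gt_le (ψ := fun y => -ψ y) hψ.neg (M := M) (v := v)
    (fun y => by rw [abs_neg]; exact hM y) (by simpa using hv) hl hlM hn ε
  have h3 := add_le_add h1 h2
  rw [two_mul]
  refine le_trans ?_ (ENNReal.ofReal_le_ofReal h3)
  rw [ENNReal.ofReal_add measureReal_nonneg measureReal_nonneg, ofReal_measureReal,
    ofReal_measureReal]
  refine (measure_mono fun ω hω => ?_).trans (measure_union_le _ _)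
  rcases lt_abs.1 (show ε < _ from hω) with h | h
  · exact Or.inl h.le
  · refine Or.inr ?_
    simp only [mem_ofPred_eq, emp, Finset.sum_neg_distrib, neg_mul, integral_neg, mul_neg] at h ⊢
    linarith

end


/-! ### Bandwidths -/

lemma BandwidthAssumptions.tendsto_nhdsGT {h : ℕ → ℝ} {β : ℝ} (hh : BandwidthAssumptions h β) :
    Tendsto h atTop (𝓝[>] 0) :=
  tendsto_nhdsWithin_iff.2 ⟨hh.tendsto_zero, Eventually.of_forall hh.pos⟩

lemma BandwidthAssumptions.eventually_le_one {h : ℕ → ℝ} {β : ℝ} (hh : BandwidthAssumptions h β) :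
    ∀ᶠ n in atTop, h n ≤ 1 :=
  hh.tendsto_zero.eventually_le_const (by norm_num)

lemma BandwidthAssumptions.eventually_log {h : ℕ → ℝ} {β : ℝ} (hh : BandwidthAssumptions h β)
    (C : ℝ) : ∀ᶠ n : ℕ in atTop, C * Real.log n ≤ n * h n ^ 8 ∧ 1 ≤ Real.log n := by
  have hlog : ∀ᶠ n : ℕ in atTop, 1 ≤ Real.log n :=
    (Real.tendsto_log_atTop.comp tendsto_natCast_atTop_atTop).eventually_ge_atTop 1
  filter_upwards [hlog, hh.lower.eventually_ge_atTop (max C 0)] with n h1 h2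
  refine ⟨?_, h1⟩
  have h3 : 0 < Real.log n ^ 3 := by positivity
  rw [le_div_iff₀ h3] at h2
  have h4 : Real.log n ≤ Real.log n ^ 3 := le_self_pow₀ h1 (by norm_num)
  calc C * Real.log n ≤ max C 0 * Real.log n := by gcongr; exact le_max_left _ _
    _ ≤ max C 0 * Real.log n ^ 3 := by gcongr
    _ ≤ _ := h2

lemma BandwidthAssumptions.tendsto_mul_pow_eight {h : ℕ → ℝ} {β : ℝ}
    (hh : BandwidthAssumptions h β) : Tendsto (fun n : ℕ => (n : ℝ) * h n ^ 8) atTop atTop := by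
  refine tendsto_atTop_mono' _ ?_ (Real.tendsto_log_atTop.comp tendsto_natCast_atTop_atTop)
  filter_upwards [hh.eventually_log 1] with n hn
  simpa using hn.1

/-- The power 12 comes from the number of points of a planar grid of mesh proportional to h⁶.
Eventually the exponential is at most n⁻³, while h⁻¹² ≤ (h⁻⁸)² ≤ n². -/
lemma BandwidthAssumptions.tendsto_exp {h : ℕ → ℝ} {β : ℝ} (hh : BandwidthAssumptions h β)
    {c : ℝ} (hc : 0 < c) :
    Tendsto (fun n : ℕ => ((h n)⁻¹) ^ 12 * Real.exp (-(c * (n * h n ^ 8)))) atTop (𝓝 0) := by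
  refine squeeze_zero' (Eventually.of_forall fun n => ?_) ?_ tendsto_inv_atTop_nhds_zero_nat
  · have := hh.pos n
    positivity
  filter_upwards [hh.eventually_log (3 / c), hh.eventually_log 1, hh.eventually_le_one,
    eventually_gt_atTop 0] with n h1 h2 h3 hn
  have hn0 : (0 : ℝ) < n := by exact_mod_cast hn
  have hp := hh.pos n
  have e1 : Real.exp (-(c * (n * h n ^ 8))) ≤ ((n : ℝ) ^ 3)⁻¹ := by
    have : 3 * Real.log n ≤ c * (n * h n ^ 8) := by
      have := mul_le_mul_of_nonneg_left h1.1 hc.le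
      calc 3 * Real.log n = c * (3 / c * Real.log n) := by field_simp
        _ ≤ _ := this
    calc Real.exp (-(c * (n * h n ^ 8))) ≤ Real.exp (-(3 * Real.log n)) :=
          Real.exp_le_exp.2 (neg_le_neg this)
      _ = _ := by
        rw [Real.exp_neg, show 3 * Real.log n = Real.log ((n : ℝ) ^ 3) by
          rw [Real.log_pow]; norm_num, Real.exp_log (by positivity)]
  have e2 : ((h n)⁻¹) ^ 12 ≤ (n : ℝ) ^ 2 := by
    have hi : 1 ≤ (h n)⁻¹ := (one_le_inv₀ hp).2 h3
    have h8 : ((h n)⁻¹) ^ 8 ≤ n := by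
      rw [inv_pow, inv_le_iff_one_le_mul₀ (by positivity)]
      linarith [h2.1, h2.2]
    calc ((h n)⁻¹) ^ 12 ≤ ((h n)⁻¹) ^ 16 := pow_le_pow_right₀ hi (by norm_num)
      _ = (((h n)⁻¹) ^ 8) ^ 2 := by ring
      _ ≤ _ := by gcongr
  calc _ ≤ (n : ℝ) ^ 2 * ((n : ℝ) ^ 3)⁻¹ := by gcongr
    _ = (n : ℝ)⁻¹ := by field_simp

/-! ### Moments of the kernel -/

/-- The summands of the (scaled) kernel density estimator. -/
noncomputable def term (φ : Plane → ℝ) (k : ℕ) (h : ℝ) (x z : Plane) : ℝ :=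
  (h⁻¹) ^ (k + 2) * φ (h⁻¹ • (x - z))

lemma mul_kde_eq_emp (φ : Plane → ℝ) (k : ℕ) (h : ℝ) (n : ℕ) (x : ℕ → Plane) (y : Plane) :
    (h⁻¹) ^ k * kde φ h n x y = emp (term φ k h y) n x := by
  simp only [kde, emp, term, ← Finset.mul_sum, mul_inv]
  ring

lemma BallFun.exists_abs_smooth_le {φ f : Plane → ℝ} (hφ : BallFun φ) (hf : Continuous f) (R : ℝ) :
    ∃ C, 0 ≤ C ∧ ∀ h, 0 ≤ h → h ≤ 1 → ∀ x ∈ Metric.closedBall (0 : Plane) R,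
      |smooth φ f h x| ≤ C := by
  obtain ⟨F, hF⟩ := (isCompact_closedBall (0 : Plane) (R + 1)).exists_bound_of_continuousOn
    hf.continuousOn
  have hI : 0 ≤ ∫ z, |φ z| := integral_nonneg fun z => abs_nonneg _
  refine ⟨(∫ z, |φ z|) * |F|, by positivity, fun h h0 h1 x hx => ?_⟩
  rw [← integral_mul_const, ← Real.norm_eq_abs]
  refine norm_integral_le_of_norm_le (hφ.integrable.abs.mul_const _)
    (Eventually.of_forall fun z => ?_)
  rw [Real.norm_eq_abs, abs_mul]
  rcases lt_or_ge 1 ‖z‖ with hz | hz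
  · simp [hφ.supp z hz]
  · refine mul_le_mul_of_nonneg_left ?_ (abs_nonneg _)
    refine (hF _ ?_).trans (le_abs_self _)
    rw [mem_closedBall_zero_iff] at hx ⊢
    refine (norm_sub_le _ _).trans ?_
    rw [norm_smul, Real.norm_eq_abs, abs_of_nonneg h0]
    nlinarith [norm_nonneg z]

lemma BallFun.sq {φ : Plane → ℝ} (hφ : BallFun φ) : BallFun fun z => φ z ^ 2 :=
  ⟨hφ.cont.pow 2, fun z hz => by simp [hφ.supp z hz]⟩

lemma integral_term (φ f : Plane → ℝ) (k : ℕ) {h : ℝ} (hh : 0 < h) (x : Plane) :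
    ∫ y, term φ k h x y * f y = (h⁻¹) ^ k * smooth φ f h x := by
  have := integral_comp_scale φ f hh x
  simp only [term, mul_assoc]
  rw [integral_const_mul, this, smooth]
  have e : (h⁻¹) ^ 2 * h ^ 2 = 1 := by field_simp
  linear_combination ((h⁻¹) ^ k * ∫ z, φ z * f (x - h • z)) * e

lemma integral_term_sq (φ f : Plane → ℝ) (k : ℕ) {h : ℝ} (hh : 0 < h) (x : Plane) :
    ∫ y, term φ k h x y ^ 2 * f y = (h⁻¹) ^ (2 * k + 2) * smooth (fun z => φ z ^ 2) f h x := by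
  have := integral_comp_scale (fun z => φ z ^ 2) f hh x
  simp only [term, mul_pow, mul_assoc]
  rw [integral_const_mul, this, smooth, ← pow_mul]
  have e : (h⁻¹) ^ 2 * h ^ 2 = 1 := by field_simp
  linear_combination ((h⁻¹) ^ (2 * k + 2) * ∫ z, φ z ^ 2 * f (x - h • z)) * e

lemma BallFun.abs_term_le {φ : Plane → ℝ} {M : ℝ} (hM : ∀ z, |φ z| ≤ M) (k : ℕ) {h : ℝ}
    (hh : 0 < h) (x y : Plane) : |term φ k h x y| ≤ (h⁻¹) ^ (k + 2) * M := by
  rw [term, abs_mul, abs_of_pos (by positivity)]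
  gcongr
  exact hM _

lemma BallFun.continuous_term {φ : Plane → ℝ} (hφ : BallFun φ) (k : ℕ) (h : ℝ) (x : Plane) :
    Continuous (term φ k h x) := by
  have := hφ.cont
  unfold term
  fun_prop

lemma abs_term_sub_le {φ : Plane → ℝ} {C : ℝ} (hC : ∀ z w, |φ z - φ w| ≤ C * ‖z - w‖) (k : ℕ)
    {h : ℝ} (hh : 0 < h) (x x' y : Plane) :
    |term φ k h x y - term φ k h x' y| ≤ C * (h⁻¹) ^ (k + 3) * ‖x - x'‖ := by
  rw [term, term, ← mul_sub, abs_mul, abs_of_pos (by positivity : 0 < (h⁻¹) ^ (k + 2))]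
  have h1 := hC (h⁻¹ • (x - y)) (h⁻¹ • (x' - y))
  rw [← smul_sub, sub_sub_sub_cancel_right, norm_smul, Real.norm_eq_abs,
    abs_of_pos (inv_pos.2 hh)] at h1
  calc _ ≤ (h⁻¹) ^ (k + 2) * (C * (h⁻¹ * ‖x - x'‖)) := by gcongr
    _ = _ := by ring

/-! ### Uniform concentration -/

lemma exists_grid_point {R ρ : ℝ} (hρ : 0 < ρ) (hρ1 : 2 * ρ ≤ 1) {x : Plane}
    (hx : x ∈ Metric.closedBall (0 : Plane) R) :
    ∃ i ∈ Finset.Icc (-((⌈R / ρ⌉₊ + 1 : ℕ) : ℤ)) ((⌈R / ρ⌉₊ + 1 : ℕ) : ℤ),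
    ∃ j ∈ Finset.Icc (-((⌈R / ρ⌉₊ + 1 : ℕ) : ℤ)) ((⌈R / ρ⌉₊ + 1 : ℕ) : ℤ),
      ‖x - !₂[ρ * i, ρ * j]‖ ≤ 2 * ρ ∧ !₂[ρ * i, ρ * j] ∈ Metric.closedBall (0 : Plane) (R + 1) := by
  rw [mem_closedBall_zero_iff] at hx
  have key : ∀ k : Fin 2, ⌊x k / ρ⌋ ∈
      Finset.Icc (-((⌈R / ρ⌉₊ + 1 : ℕ) : ℤ)) ((⌈R / ρ⌉₊ + 1 : ℕ) : ℤ) ∧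
      |x k - ρ * ⌊x k / ρ⌋| ≤ ρ := by
    intro k
    have h1 := abs_le.1 ((abs_apply_le_norm x k).trans hx)
    have h2 : x k / ρ ≤ R / ρ := by gcongr; exact h1.2
    have h3 : -(R / ρ) ≤ x k / ρ := by rw [← neg_div]; gcongr; exact h1.1
    have h4 := Nat.le_ceil (R / ρ)
    have h5 := Int.floor_le (x k / ρ)
    have h6 := Int.lt_floor_add_one (x k / ρ)
    refine ⟨Finset.mem_Icc.2 ⟨?_, ?_⟩, ?_⟩
    · have : (-((⌈R / ρ⌉₊ + 1 : ℕ) : ℝ)) ≤ (⌊x k / ρ⌋ : ℝ) := by push_cast; linarith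
      exact_mod_cast this
    · have : (⌊x k / ρ⌋ : ℝ) ≤ ((⌈R / ρ⌉₊ + 1 : ℕ) : ℝ) := by push_cast; linarith
      exact_mod_cast this
    · rw [le_div_iff₀ hρ] at h5
      rw [div_lt_iff₀ hρ] at h6
      rw [abs_le]; constructor <;> nlinarith
  have hdist : ‖x - !₂[ρ * ⌊x 0 / ρ⌋, ρ * ⌊x 1 / ρ⌋]‖ ≤ 2 * ρ := by
    refine (norm_le_sum_abs _).trans ?_
    rw [Fin.sum_univ_two]
    have h0 := (key 0).2
    have h1 := (key 1).2
    simp only [PiLp.sub_apply, Matrix.cons_val_zero, Matrix.cons_val_one]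
    linarith
  refine ⟨⌊x 0 / ρ⌋, (key 0).1, ⌊x 1 / ρ⌋, (key 1).1, hdist, ?_⟩
  rw [mem_closedBall_zero_iff]
  have := norm_sub_norm_le !₂[ρ * (⌊x 0 / ρ⌋ : ℝ), ρ * ⌊x 1 / ρ⌋] x
  rw [norm_sub_rev] at this
  linarith

section

variable {Ω : Type*} [MeasurableSpace Ω] {f : Plane → ℝ} {P : Measure Ω} [IsProbabilityMeasure P]
  {X : ℕ → Ω → Plane}

/-- Uniform concentration of kernel estimators on balls. -/
theorem IIDSample.tendsto_measure_kde_sub_smooth (hX : IIDSample f P X) {φ : Plane → ℝ}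
    (hφ : BallFun φ) {C : ℝ} (hC : ∀ z w, |φ z - φ w| ≤ C * ‖z - w‖) {h : ℕ → ℝ} {β : ℝ}
    (hh : BandwidthAssumptions h β) {k : ℕ} (hk : k ≤ 3) {R : ℝ} (hR : 0 ≤ R) {ε : ℝ}
    (hε : 0 < ε) :
    Tendsto (fun n => P {ω | ∃ x ∈ Metric.closedBall (0 : Plane) R,
      ε < |((h n)⁻¹) ^ k * kde φ (h n) n (fun i => X i ω) x
        - ((h n)⁻¹) ^ k * smooth φ f (h n) x|}) atTop (𝓝 0) := by
  obtain ⟨M, hM0, hM⟩ := hφ.bounded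
  obtain ⟨v, hv0, hv⟩ := hφ.sq.exists_abs_smooth_le hX.cont (R + 1)
  have hC0 : 0 ≤ C := by
    have := (abs_nonneg _).trans (hC (EuclideanSpace.single 0 1) 0)
    simpa using this
  -- the constants of the exponential inequality and of the grid
  obtain ⟨c, hc0, hcM, hcv⟩ : ∃ c > 0, 2 * c * M ≤ 1 ∧ c * v ≤ ε / 4 := by
    refine ⟨min (1 / (2 * M + 1)) (ε / (4 * v + 4)), by positivity, ?_, ?_⟩
    · have h1 : min (1 / (2 * M + 1)) (ε / (4 * v + 4)) ≤ 1 / (2 * M + 1) := min_le_left _ _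
      calc _ ≤ 2 * (1 / (2 * M + 1)) * M := by gcongr
        _ ≤ 1 := by rw [mul_one_div, div_mul_eq_mul_div, div_le_one (by positivity)]; linarith
    · have h1 : min (1 / (2 * M + 1)) (ε / (4 * v + 4)) ≤ ε / (4 * v + 4) := min_le_right _ _
      calc _ ≤ ε / (4 * v + 4) * v := by gcongr
        _ ≤ ε / 4 := by
          rw [div_mul_eq_mul_div, div_le_div_iff₀ (by positivity) (by positivity)]
          nlinarith
  obtain ⟨q, hq0, hq1, hqC⟩ : ∃ q > 0, 2 * q ≤ 1 ∧ 4 * C * q ≤ ε / 2 := by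
    refine ⟨min (1 / 2) (ε / (8 * C + 8)), by positivity, ?_, ?_⟩
    · have := min_le_left (1 / 2) (ε / (8 * C + 8)); linarith
    · have h1 : min (1 / 2) (ε / (8 * C + 8)) ≤ ε / (8 * C + 8) := min_le_right _ _
      calc _ ≤ 4 * C * (ε / (8 * C + 8)) := by gcongr
        _ ≤ ε / 2 := by
          rw [mul_div_assoc', div_le_div_iff₀ (by positivity) (by positivity)]
          nlinarith
  have hlim := (hh.tendsto_exp (c := c * ε / 4) (by positivity)).const_mul
    (2 * ((2 * R + 5) / q) ^ 2)
  rw [mul_zero] at hlim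
  have hlim' := ENNReal.tendsto_ofReal hlim
  rw [ENNReal.ofReal_zero] at hlim'
  refine tendsto_of_tendsto_of_tendsto_of_le_of_le' tendsto_const_nhds hlim'
    (Eventually.of_forall fun _ => zero_le) ?_
  filter_upwards [hh.eventually_le_one, eventually_gt_atTop 0] with n hn1 hn
  have hp := hh.pos n
  have hi1 : 1 ≤ (h n)⁻¹ := (one_le_inv₀ hp).2 hn1
  -- The mesh compensates the Lipschitz constant of the summands in the location, which is at most C
  -- h⁻⁶ because k + 3 ≤ 6. The choice of q makes the change of the deviation between a point and
  -- its grid point at most ε/2.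
  set ρ := q * (h n) ^ 6 with hρ
  have hρ0 : 0 < ρ := by positivity
  have hh6 : (h n) ^ 6 ≤ 1 := pow_le_one₀ hp.le hn1
  have hρ1 : 2 * ρ ≤ 1 := by nlinarith
  set N := ⌈R / ρ⌉₊ + 1 with hN
  let D : Plane → Ω → ℝ := fun x ω => emp (term φ k (h n) x) n (fun i => X i ω)
    - ∫ y, term φ k (h n) x y * f y
  have hD : ∀ x ω, ((h n)⁻¹) ^ k * kde φ (h n) n (fun i => X i ω) x
      - ((h n)⁻¹) ^ k * smooth φ f (h n) x = D x ω := fun x ω => by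
    simp only [D]; rw [mul_kde_eq_emp, integral_term φ f k hp]
  simp only [hD]
  -- the deviation is Lipschitz in the location
  have hDlip : ∀ x x' ω, |D x ω - D x' ω| ≤ 2 * (C * ((h n)⁻¹) ^ 6 * ‖x - x'‖) := by
    intro x x' ω
    have hpow : ((h n)⁻¹) ^ (k + 3) ≤ ((h n)⁻¹) ^ 6 := pow_le_pow_right₀ hi1 (by omega)
    have hb : ∀ y, |term φ k (h n) x y - term φ k (h n) x' y| ≤ C * ((h n)⁻¹) ^ 6 * ‖x - x'‖ :=
      fun y => (abs_term_sub_le hC k hp x x' y).trans (by gcongr)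
    have e1 : |emp (term φ k (h n) x) n (fun i => X i ω) - emp (term φ k (h n) x') n
        (fun i => X i ω)| ≤ C * ((h n)⁻¹) ^ 6 * ‖x - x'‖ := by
      rw [emp, emp, ← mul_sub, ← Finset.sum_sub_distrib, abs_mul,
        abs_of_nonneg (by positivity : (0 : ℝ) ≤ (n : ℝ)⁻¹)]
      have := (Finset.abs_sum_le_sum_abs (fun i => term φ k (h n) x (X i ω)
        - term φ k (h n) x' (X i ω)) (Finset.range n)).trans
        (Finset.sum_le_sum fun i _ => hb (X i ω))
      refine (mul_le_mul_of_nonneg_left this (by positivity)).trans (le_of_eq ?_)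
      have hn0 : (n : ℝ) ≠ 0 := by exact_mod_cast hn.ne'
      rw [Finset.sum_const, Finset.card_range, nsmul_eq_mul]
      field_simp
    have e2 : |(∫ y, term φ k (h n) x y * f y) - ∫ y, term φ k (h n) x' y * f y|
        ≤ C * ((h n)⁻¹) ^ 6 * ‖x - x'‖ := by
      have hint : ∀ x, Integrable fun y => term φ k (h n) x y * f y := fun x =>
        hX.integrable.bdd_mul (hφ.continuous_term k (h n) x).aestronglyMeasurable
          (Eventually.of_forall fun y => BallFun.abs_term_le hM k hp x y)
      rw [← integral_sub (hint x) (hint x'), ← Real.norm_eq_abs]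
      have h3 : ∫ y, C * ((h n)⁻¹) ^ 6 * ‖x - x'‖ * f y = C * ((h n)⁻¹) ^ 6 * ‖x - x'‖ := by
        rw [integral_const_mul, hX.integral_eq_one, mul_one]
      refine (norm_integral_le_of_norm_le (hX.integrable.const_mul (C * ((h n)⁻¹) ^ 6 * ‖x - x'‖))
        (Eventually.of_forall fun y => ?_)).trans h3.le
      rw [← sub_mul, Real.norm_eq_abs, abs_mul, abs_of_nonneg (hX.nonneg y)]
      exact mul_le_mul_of_nonneg_right (hb y) (hX.nonneg y)
    calc |D x ω - D x' ω| = |(emp (term φ k (h n) x) n (fun i => X i ω) - emp (term φ k (h n) x') n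
        (fun i => X i ω)) - ((∫ y, term φ k (h n) x y * f y)
          - ∫ y, term φ k (h n) x' y * f y)| := by simp only [D]; congr 1; ring
      _ ≤ _ := abs_sub _ _
      _ ≤ _ := by linarith
  -- the exponential inequality at one point
  have hpt : ∀ p ∈ Metric.closedBall (0 : Plane) (R + 1), P {ω | ε / 2 < |D p ω|} ≤
      ENNReal.ofReal (2 * Real.exp (-(c * ε / 4 * (n * h n ^ 8)))) := by
    intro p hp'
    have h28 : ((h n)⁻¹) ^ (2 * k + 2) ≤ ((h n)⁻¹) ^ 8 := pow_le_pow_right₀ hi1 (by omega)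
    have hvar : ∫ y, term φ k (h n) p y ^ 2 * f y ≤ ((h n)⁻¹) ^ 8 * v := by
      rw [integral_term_sq φ f k hp]
      have := (le_abs_self _).trans (hv (h n) hp.le hn1 p hp')
      calc _ ≤ ((h n)⁻¹) ^ (2 * k + 2) * v := by gcongr
        _ ≤ _ := by gcongr
    -- The exponential inequality is used with l = c h⁸. Since k ≤ 3, both the sup bound and the
    -- second moment of the summands are at most constants times h⁻⁸. The exponent is then at most
    -- -c(ε/2)nh⁸ + c(cv)nh⁸, and cv ≤ ε/4.
    have hlM : 2 * (c * h n ^ 8) * (((h n)⁻¹) ^ (k + 2) * M) ≤ 1 := by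
      have h5 : ((h n)⁻¹) ^ (k + 2) ≤ ((h n)⁻¹) ^ 8 := pow_le_pow_right₀ hi1 (by omega)
      calc _ ≤ 2 * (c * h n ^ 8) * (((h n)⁻¹) ^ 8 * M) := by gcongr
        _ = 2 * c * M := by field_simp
        _ ≤ 1 := hcM
    refine (hX.measure_abs_emp_gt_le (hφ.continuous_term k (h n) p).measurable
      (BallFun.abs_term_le hM k hp p) hvar (l := c * h n ^ 8) (by positivity) hlM hn.ne'
      (ε / 2)).trans (ENNReal.ofReal_le_ofReal ?_)
    refine mul_le_mul_of_nonneg_left (Real.exp_le_exp.2 ?_) (by norm_num)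
    have e : (n : ℝ) * (c * h n ^ 8) ^ 2 * (((h n)⁻¹) ^ 8 * v) = n * h n ^ 8 * c * (c * v) := by
      field_simp
    rw [e]
    have : (n : ℝ) * h n ^ 8 * c * (c * v) ≤ n * h n ^ 8 * c * (ε / 4) := by gcongr
    linarith
  -- union bound over the grid
  let I : Finset (ℤ × ℤ) := (Finset.Icc (-(N : ℤ)) N ×ˢ Finset.Icc (-(N : ℤ)) N)
  let pt : ℤ × ℤ → Plane := fun ij => !₂[ρ * (ij.1 : ℝ), ρ * ij.2]
  let A : ℤ × ℤ → Set Ω := fun ij =>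
    {ω | pt ij ∈ Metric.closedBall (0 : Plane) (R + 1) ∧ ε / 2 < |D (pt ij) ω|}
  have hsub : {ω | ∃ x ∈ Metric.closedBall (0 : Plane) R, ε < |D x ω|} ⊆ ⋃ ij ∈ I, A ij := by
    rintro ω ⟨x, hx, hxε⟩
    obtain ⟨i, hi, j, hj, hij, hb⟩ := exists_grid_point hρ0 hρ1 hx
    refine mem_iUnion₂.2 ⟨(i, j), Finset.mem_product.2 ⟨hi, hj⟩, hb, ?_⟩
    have h1 := hDlip x (pt (i, j)) ω
    have h2 : 2 * (C * ((h n)⁻¹) ^ 6 * ‖x - pt (i, j)‖) ≤ ε / 2 := by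
      calc _ ≤ 2 * (C * ((h n)⁻¹) ^ 6 * (2 * ρ)) := by gcongr
        _ = 4 * C * q := by rw [hρ]; field_simp; ring
        _ ≤ _ := hqC
    have h3 := abs_sub_abs_le_abs_sub (D x ω) (D (pt (i, j)) ω)
    linarith
  have hA : ∀ ij, P (A ij) ≤ ENNReal.ofReal (2 * Real.exp (-(c * ε / 4 * (n * h n ^ 8)))) := by
    intro ij
    by_cases hb : pt ij ∈ Metric.closedBall (0 : Plane) (R + 1)
    · exact (measure_mono fun ω hω => hω.2).trans (hpt _ hb)
    · have : A ij = ∅ := by ext ω; simp only [A, hb, false_and]; rfl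
      rw [this]; simp
  refine (measure_mono hsub).trans ((measure_biUnion_finset_le I A).trans ?_)
  refine (Finset.sum_le_sum fun ij _ => hA ij).trans ?_
  rw [Finset.sum_const, nsmul_eq_mul, ← ENNReal.ofReal_natCast,
    ← ENNReal.ofReal_mul (by positivity)]
  refine ENNReal.ofReal_le_ofReal ?_
  have hcard : (I.card : ℝ) ≤ ((2 * R + 5) / q) ^ 2 * ((h n)⁻¹) ^ 12 := by
    have h1 : I.card = (2 * N + 1) * (2 * N + 1) := by
      simp only [I, Finset.card_product, Int.card_Icc]
      have : ((N : ℤ) + 1 - -(N : ℤ)).toNat = 2 * N + 1 := by omega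
      rw [this]
    have h2 : (N : ℝ) ≤ R / ρ + 2 := by
      have := (Nat.ceil_lt_add_one (show 0 ≤ R / ρ by positivity)).le
      rw [hN]; push_cast; linarith
    have h3 : (2 * N + 1 : ℝ) ≤ (2 * R + 5) / ρ := by
      have h4 : 5 ≤ 5 / ρ := by
        rw [le_div_iff₀ hρ0]; linarith
      rw [add_div, mul_div_assoc]
      linarith
    rw [h1]
    push_cast
    calc (2 * N + 1 : ℝ) * (2 * N + 1) ≤ ((2 * R + 5) / ρ) * ((2 * R + 5) / ρ) := by gcongr
      _ = _ := by rw [hρ]; field_simp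
  calc _ ≤ ((2 * R + 5) / q) ^ 2 * ((h n)⁻¹) ^ 12
        * (2 * Real.exp (-(c * ε / 4 * (n * h n ^ 8)))) := by gcongr
    _ = _ := by ring

end


/-! ### Consistency of the derivatives of the kernel density estimator -/

/-- `g` is `ε`-close to `f` on the ball of radius `R`, with its derivatives of orders one to
three. -/
def Close (f g : Plane → ℝ) (R ε : ℝ) : Prop :=
  ∀ x ∈ Metric.closedBall (0 : Plane) R, ∀ w : List (Fin 2), 1 ≤ w.length → w.length ≤ 3 →
    |wd w g x - wd w f x| ≤ ε

lemma wd_kde_bias {f K : Plane → ℝ} {H L : Set Plane} {a : ℝ} (hf : DensityAssumptions f H L a)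
    (hK : KernelAssumptions K) {w : List (Fin 2)} (hw : w.length ≤ 3) {h : ℝ} (hh : 0 < h)
    (x : Plane) : (h⁻¹) ^ w.length * smooth (wd w K) f h x = smooth K (wd w f) h x := by
  have h1 := smooth_wd w (hK.contDiff.of_le (by norm_cast)) hK.supp
    (hf.contDiff.of_le (by norm_cast; omega)) h x
  rw [h1, ← mul_assoc, ← mul_pow, inv_mul_cancel₀ hh.ne', one_pow, one_mul]

lemma DensityAssumptions.iidSample {f : Plane → ℝ} {H L : Set Plane} {a : ℝ} {Ω : Type*}
    [MeasurableSpace Ω] {P : Measure Ω} {X : ℕ → Ω → Plane} (hf : DensityAssumptions f H L a)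
    (hm : ∀ i, Measurable (X i)) (hindep : iIndepFun X P)
    (hlaw : ∀ i, HasLaw (X i) (volume.withDensity fun x => ENNReal.ofReal (f x)) P) :
    IIDSample f P X :=
  ⟨hf.nonneg, hf.contDiff.continuous, hf.integrable, hf.integral_eq_one, hm, hindep, hlaw⟩

lemma wd_lipschitz_of_bound {g : Plane → ℝ} (hd : DiffWords 4 g) {C : ℝ}
    (hC : ∀ w : List (Fin 2), 1 ≤ w.length → w.length ≤ 4 → ∀ x, |wd w g x| ≤ C)
    {w : List (Fin 2)} (hw : w.length ≤ 3) (x y : Plane) :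
    |wd w g x - wd w g y| ≤ 2 * C * ‖x - y‖ :=
  wd_lipschitz (hd.mono (by omega)) (fun a x => hC (a :: w) (by simp) (by simp; omega) x) x y

section

variable {Ω : Type*} [MeasurableSpace Ω] {f K : Plane → ℝ} {P : Measure Ω}
  [IsProbabilityMeasure P] {X : ℕ → Ω → Plane} {H L : Set Plane} {a : ℝ} {h : ℕ → ℝ} {β : ℝ}

/-- There are finitely many words of length at most three. For each, the stochastic part is handled
by uniform concentration with ε/2. The bias is at most 2 Cf h, because the bounded derivatives of
the next order make each of these derivatives Lipschitz. -/
theorem IIDSample.tendsto_measure_not_close (hX : IIDSample f P X)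
    (hf : DensityAssumptions f H L a) (hK : KernelAssumptions K) (hh : BandwidthAssumptions h β)
    {R : ℝ} (hR : 0 ≤ R) {ε : ℝ} (hε : 0 < ε) :
    Tendsto (fun n => P {ω | ¬ Close f (kde K (h n) n fun i => X i ω) R ε}) atTop (𝓝 0) := by
  obtain ⟨Cf, hCf0, hCf⟩ := exists_bound_wd_density hf
  obtain ⟨CK, hCK0, hCK⟩ := exists_bound_wd_kernel hK
  let S : Finset (List (Fin 2)) := (List.finite_length_le (Fin 2) 3).toFinset
  have hS : ∀ w ∈ S, w.length ≤ 3 := fun w hw => by simpa [S] using hw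
  have hlim := tendsto_finsetSum S fun w hw =>
    hX.tendsto_measure_kde_sub_smooth (hK.ballFun_wd w (hS w hw))
      (wd_lipschitz_of_bound hK.diffWords hCK (hS w hw)) hh (hS w hw) hR (half_pos hε)
  rw [Finset.sum_const_zero] at hlim
  refine tendsto_of_tendsto_of_tendsto_of_le_of_le' tendsto_const_nhds hlim
    (Eventually.of_forall fun _ => zero_le) ?_
  have hb : Tendsto (fun n => 2 * Cf * h n) atTop (𝓝 0) := by
    simpa using hh.tendsto_zero.const_mul (2 * Cf)
  filter_upwards [hb.eventually_le_const (half_pos hε)] with n hn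
  refine (measure_mono ?_).trans (measure_biUnion_finset_le S _)
  intro ω hω
  simp only [Close, mem_ofPred_eq, not_forall, not_le] at hω
  obtain ⟨x, hx, w, h1, h3, hlt⟩ := hω
  refine mem_iUnion₂.2 ⟨w, by simpa [S] using h3, x, hx, ?_⟩
  rw [wd_kde (h n) n _ w (hK.diffWords.mono (by omega))] at hlt
  rw [wd_kde_bias hf hK h3 (hh.pos n)]
  have h4 := abs_smooth_sub_le hK (DiffWords.wd (k := 1) w (hf.diffWords.mono (by omega))).1.continuous
    (wd_lipschitz_of_bound hf.diffWords hCf h3) (hh.pos n).le x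
  have h5 := abs_sub_le ((h n)⁻¹ ^ w.length * kde (wd w K) (h n) n (fun i => X i ω) x)
    (smooth K (wd w f) (h n) x) (wd w f x)
  linarith

/-- The mean square error of a derivative of the kernel density estimator. -/
theorem IIDSample.exists_integral_wd_kde_sub_sq_le (hX : IIDSample f P X)
    (hf : DensityAssumptions f H L a) (hK : KernelAssumptions K) (R : ℝ) {w : List (Fin 2)}
    (hw : w.length ≤ 2) :
    ∃ C, 0 ≤ C ∧ ∀ h, 0 < h → h ≤ 1 → ∀ n : ℕ, n ≠ 0 → ∀ x ∈ Metric.closedBall (0 : Plane) R,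
      ∫ ω, (wd w (kde K h n fun i => X i ω) x - wd w f x) ^ 2 ∂P ≤
        C * ((n : ℝ)⁻¹ * (h⁻¹) ^ (2 * w.length + 2) + h ^ 4) := by
  obtain ⟨Cf, hCf0, hCf⟩ := exists_bound_wd_density hf
  have hφ := hK.ballFun_wd w (by omega)
  obtain ⟨M, hM0, hM⟩ := hφ.bounded
  obtain ⟨v, hv0, hv⟩ := hφ.sq.exists_abs_smooth_le hX.cont R
  refine ⟨v + (4 * Cf) ^ 2, by positivity, fun h hh h1 n hn x hx => ?_⟩
  have e : ∀ ω, wd w (kde K h n fun i => X i ω) x = emp (term (wd w K) w.length h x) n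
      (fun i => X i ω) := fun ω => by
    rw [congrFun (wd_kde h n _ w (hK.diffWords.mono (by omega))) x, mul_kde_eq_emp]
  simp only [e]
  refine (hX.integral_emp_sub_sq_le (hφ.continuous_term _ h x).measurable
    (BallFun.abs_term_le hM _ hh x) hn _).trans ?_
  rw [integral_term_sq _ _ _ hh, integral_term _ _ _ hh, wd_kde_bias hf hK (by omega) hh]
  have h2 := abs_smooth_sub_le_sq hK (DiffWords.wd (k := 2) w (hf.diffWords.mono (by omega)))
    (fun a b x => hCf (a :: b :: w) (by simp) (by simp; omega) x) hh.le x
  have h3 := (le_abs_self _).trans (hv h hh.le h1 x hx)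
  have h4 : (smooth K (wd w f) h x - wd w f x) ^ 2 ≤ (4 * Cf * h ^ 2) ^ 2 :=
    sq_le_sq' (by linarith [(abs_le.1 h2).1]) (abs_le.1 h2).2
  have h5 : 0 ≤ (n : ℝ)⁻¹ * (h⁻¹) ^ (2 * w.length + 2) := by positivity
  have h6 : 0 ≤ h ^ 4 := by positivity
  calc _ ≤ (n : ℝ)⁻¹ * ((h⁻¹) ^ (2 * w.length + 2) * v) + (4 * Cf * h ^ 2) ^ 2 := by gcongr
    _ = v * ((n : ℝ)⁻¹ * (h⁻¹) ^ (2 * w.length + 2)) + (4 * Cf) ^ 2 * h ^ 4 := by ring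
    _ ≤ _ := by nlinarith [mul_nonneg hv0 h6, mul_nonneg (sq_nonneg (4 * Cf)) h5]

/-- At one point, the gradient of the kernel density estimator has, at the scale of the integral
curve estimator, only a bias. -/
theorem IIDSample.tendsto_integral_grad_sq (hX : IIDSample f P X)
    (hf : DensityAssumptions f H L a) (hK : KernelAssumptions K) (hh : BandwidthAssumptions h β)
    (x : Plane) (k : Fin 2) :
    Tendsto (fun n : ℕ => ∫ ω, (√((n : ℝ) * h n ^ 5) * (wd [k] (kde K (h n) n fun i => X i ω) x
      - wd [k] f x) - √β * (2⁻¹ * kernelHess K (wd [k] f) x)) ^ 2 ∂P) atTop (𝓝 0) := by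
  obtain ⟨Cf, hCf0, hCf⟩ := exists_bound_wd_density hf
  have hφ := hK.ballFun_wd [k] (by simp)
  obtain ⟨M, hM0, hM⟩ := hφ.bounded
  obtain ⟨v, hv0, hv⟩ := hφ.sq.exists_abs_smooth_le hX.cont ‖x‖
  set b := 2⁻¹ * kernelHess K (wd [k] f) x with hb
  have hbias : Tendsto (fun n : ℕ => √((n : ℝ) * h n ^ 5) * (smooth K (wd [k] f) (h n) x
      - wd [k] f x)) atTop (𝓝 (√β * b)) := by
    have h1 := (smooth_bias_tendsto hK (DiffWords.wd (k := 2) [k] (hf.diffWords.mono (by simp)))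
      (fun a b x => hCf (a :: b :: [k]) (by simp) (by simp) x) x).comp hh.tendsto_nhdsGT
    have h2 := (Real.continuous_sqrt.tendsto β).comp hh.upper
    refine (h2.mul h1).congr fun n => ?_
    have hp := hh.pos n
    simp only [Function.comp]
    have : (n : ℝ) * h n ^ 9 = n * h n ^ 5 * (h n ^ 2) ^ 2 := by ring
    rw [this, Real.sqrt_mul (by positivity), Real.sqrt_sq (by positivity)]
    field_simp
  -- The variance of a first derivative is of order 1/(nh⁴); multiplied by nh⁵ it is of order h.
  -- This is why the noise of the gradient does not appear in the limit.
  have hvar : Tendsto (fun n : ℕ => h n * v) atTop (𝓝 0) := by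
    simpa using hh.tendsto_zero.mul_const v
  have hlim := hvar.add ((hbias.sub_const (√β * b)).pow 2)
  rw [sub_self, zero_pow two_ne_zero, add_zero] at hlim
  refine tendsto_of_tendsto_of_tendsto_of_le_of_le' tendsto_const_nhds hlim
    (Eventually.of_forall fun _ => integral_nonneg fun _ => sq_nonneg _) ?_
  filter_upwards [hh.eventually_le_one, eventually_gt_atTop 0] with n hn1 hn
  have hp := hh.pos n
  have hn0 : (0 : ℝ) < n := by exact_mod_cast hn
  set r := √((n : ℝ) * h n ^ 5) with hr
  have hr0 : 0 < r := Real.sqrt_pos.2 (by positivity)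
  have hr2 : r ^ 2 = n * h n ^ 5 := Real.sq_sqrt (by positivity)
  have e : ∀ ω, (r * (wd [k] (kde K (h n) n fun i => X i ω) x - wd [k] f x) - √β * b) ^ 2 =
      r ^ 2 * (emp (term (wd [k] K) 1 (h n) x) n (fun i => X i ω)
        - (wd [k] f x + r⁻¹ * (√β * b))) ^ 2 := by
    intro ω
    rw [congrFun (wd_kde (h n) n _ [k] (hK.diffWords.mono (by simp))) x, ← mul_kde_eq_emp]
    simp only [List.length_singleton]
    field_simp
    ring
  simp only [e]
  rw [integral_const_mul]
  have h1 := hX.integral_emp_sub_sq_le (hφ.continuous_term 1 (h n) x).measurable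
    (BallFun.abs_term_le hM _ hp x) hn.ne' (wd [k] f x + r⁻¹ * (√β * b))
  rw [integral_term_sq _ _ _ hp, integral_term _ _ _ hp] at h1
  have h2 := wd_kde_bias hf hK (w := [k]) (by simp) hp x
  rw [List.length_singleton] at h2
  rw [h2] at h1
  have h3 := (le_abs_self _).trans (hv (h n) hp.le hn1 x (by simp))
  calc _ ≤ r ^ 2 * ((n : ℝ)⁻¹ * (((h n)⁻¹) ^ (2 * 1 + 2) * v)
        + (smooth K (wd [k] f) (h n) x - (wd [k] f x + r⁻¹ * (√β * b))) ^ 2) := by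
        refine mul_le_mul_of_nonneg_left (h1.trans ?_) (by positivity)
        gcongr
    _ = r ^ 2 * ((n : ℝ)⁻¹ * (((h n)⁻¹) ^ (2 * 1 + 2) * v))
        + (r * (smooth K (wd [k] f) (h n) x - wd [k] f x) - √β * b) ^ 2 := by
        field_simp
        ring
    _ = _ := by
        have : (n : ℝ) * h n ^ 5 * ((n : ℝ)⁻¹ * (((h n)⁻¹) ^ (2 * 1 + 2) * v)) = h n * v := by
          norm_num
          field_simp
        rw [hr2, this]

end

lemma kernelHess_eq {K : Plane → ℝ} (hK : KernelAssumptions K) (g : Plane → ℝ) (x : Plane) :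
    kernelHess K g x = mu2 K * (pd 2 0 g x + pd 0 2 g x) := by
  have hb : BallFun K := hK.ballFun_wd [] (by simp)
  have hi : ∀ i j : Fin 2, Integrable fun z : Plane => K z * (z i * z j) := fun i j =>
    hb.integrable_mul (by fun_prop)
  have e : ∀ z : Plane, K z * bil (hess g x) z z = pd 2 0 g x * (K z * (z 0 * z 0))
      + (2 * pd 1 1 g x) * (K z * (z 0 * z 1)) + pd 0 2 g x * (K z * (z 1 * z 1)) := by
    intro z
    simp [bil, PiLp.inner_apply, act_apply, Fin.sum_univ_two, hess]
    ring
  unfold kernelHess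
  simp only [e]
  have i1 : Integrable fun z : Plane => pd 2 0 g x * (K z * (z 0 * z 0))
      + (2 * pd 1 1 g x) * (K z * (z 0 * z 1)) := ((hi 0 0).const_mul _).add ((hi 0 1).const_mul _)
  rw [integral_add i1 ((hi 1 1).const_mul _), integral_add ((hi 0 0).const_mul _)
    ((hi 0 1).const_mul _), integral_const_mul, integral_const_mul, integral_const_mul,
    hK.second_moment, hK.second_moment, hK.second_moment]
  simp
  ring

lemma bias_apply {f K : Plane → ℝ} (hK : KernelAssumptions K) (hf : DiffWords 3 f) (x : Plane)
    (k : Fin 2) : bias f K x k = 2⁻¹ * kernelHess K (wd [k] f) x := by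
  rw [kernelHess_eq hK]
  have h1 : ∀ i j : ℕ, pd i j (wd [k] f) = wd (List.replicate i 0 ++ List.replicate j 1 ++ [k]) f := by
    intro i j
    rw [pd_eq_wd, ← wd_append]
  fin_cases k
  · have e : pd 0 2 (wd [0] f) = pd 1 2 f := by
      rw [pd_eq_wd 1 2]
      refine (h1 0 2).trans (wd_perm ?_ hf)
      decide
    change mu2 K / 2 * (pd 3 0 f x + pd 1 2 f x) = 2⁻¹ * (mu2 K * (pd 2 0 (wd [0] f) x + pd 0 2 (wd [0] f) x))
    rw [e]
    have : pd 2 0 (wd [0] f) = pd 3 0 f := rfl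
    rw [this]; ring
  · change mu2 K / 2 * (pd 0 3 f x + pd 2 1 f x) = 2⁻¹ * (mu2 K * (pd 2 0 (wd [1] f) x + pd 0 2 (wd [1] f) x))
    have h2 : pd 2 0 (wd [1] f) = pd 2 1 f := rfl
    have h3 : pd 0 2 (wd [1] f) = pd 0 3 f := rfl
    rw [h2, h3]; ring


/-! ### A central limit theorem for empirical means -/

lemma norm_cexp_sub_le {x : ℝ} (hx : |x| ≤ 1) :
    ‖Complex.exp (x * Complex.I) - (1 + x * Complex.I - (x : ℂ) ^ 2 / 2)‖ ≤ |x| ^ 3 := by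
  have h := Complex.exp_bound (x := x * Complex.I) (by simpa using hx) (n := 3) (by norm_num)
  simp only [Finset.sum_range_succ, Finset.sum_range_zero, Complex.norm_mul, Complex.norm_I,
    mul_one, Complex.norm_real, Real.norm_eq_abs] at h
  have e : (x * Complex.I : ℂ) ^ 2 = -(x : ℂ) ^ 2 := by
    rw [mul_pow, Complex.I_sq]; ring
  rw [e] at h
  norm_num [Nat.factorial] at h
  have h3 : 0 ≤ |x| ^ 3 := by positivity
  refine le_trans (le_of_eq ?_) (h.trans ?_)
  · congr 1; ring
  · linarith

section

variable {Ω : Type*} [MeasurableSpace Ω] {f : Plane → ℝ} {P : Measure Ω} [IsProbabilityMeasure P]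
  {X : ℕ → Ω → Plane}

lemma IIDSample.integral_cexp_sum (hX : IIDSample f P X) {ψ : Plane → ℝ} (hψ : Measurable ψ)
    (n : ℕ) : ∫ ω, Complex.exp ((∑ i ∈ Finset.range n, ψ (X i ω) : ℝ) * Complex.I) ∂P =
      (∫ ω, Complex.exp (ψ (X 0 ω) * Complex.I) ∂P) ^ n := by
  have hm : ∀ i, Measurable fun ω => ψ (X i ω) := fun i => hψ.comp (hX.meas i)
  have hi : iIndepFun (fun i ω => ψ (X i ω)) P := hX.indep.comp (fun _ => ψ) fun _ => hψ
  have hc : ∀ Y : Ω → ℝ, Measurable Y →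
      ∫ ω, Complex.exp (Y ω * Complex.I) ∂P = charFun (P.map Y) 1 := by
    intro Y hY
    rw [charFun_apply_real, integral_map hY.aemeasurable (by fun_prop)]
    simp
  rw [hc _ (hm 0), hc _ (Finset.measurable_sum _ fun i _ => hm i)]
  rw [iIndepFun.charFun_map_fun_finsetSum_eq_prod (X := fun i ω => ψ (X i ω))
    (fun i _ => (hm i).aemeasurable) (hi.restrict _)]
  rw [Finset.prod_apply, Finset.prod_congr rfl (g := fun _ => charFun (P.map fun ω => ψ (X 0 ω)) 1)]
  · simp
  intro i _
  rw [← hc _ (hm i), ← hc _ (hm 0),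
    hX.integral_comp (ψ := fun y => Complex.exp (ψ y * Complex.I))
      (by fun_prop : Measurable _).stronglyMeasurable,
    hX.integral_comp (ψ := fun y => Complex.exp (ψ y * Complex.I))
      (by fun_prop : Measurable _).stronglyMeasurable]

/-- The centred summands ξ = (r/n)(ψ - μ) are uniformly bounded by a null sequence, which replaces
Lindeberg's condition. By `h3` the squared mean is negligible, so n Var(ξ) tends to s and the n-th
power of the characteristic function of ξ tends to exp(-s/2). The remaining factor comes from the
deterministic shift r(μ - c). -/
theorem IIDSample.tendsto_integral_cexp_emp (hX : IIDSample f P X) {ψ : ℕ → Plane → ℝ}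
    (hψ : ∀ n, Measurable (ψ n)) {M r c : ℕ → ℝ} (hM : ∀ n y, |ψ n y| ≤ M n) (hr : ∀ n, 0 ≤ r n)
    {s m : ℝ} (h1 : Tendsto (fun n : ℕ => r n / n * M n) atTop (𝓝 0))
    (h2 : Tendsto (fun n : ℕ => r n ^ 2 / n * ∫ y, ψ n y ^ 2 * f y) atTop (𝓝 s))
    (h3 : Tendsto (fun n : ℕ => r n ^ 2 / n * (∫ y, ψ n y * f y) ^ 2) atTop (𝓝 0))
    (h4 : Tendsto (fun n : ℕ => r n * ((∫ y, ψ n y * f y) - c n)) atTop (𝓝 m)) :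
    Tendsto (fun n : ℕ => ∫ ω, Complex.exp
        ((r n * (emp (ψ n) n (fun i => X i ω) - c n) : ℝ) * Complex.I) ∂P) atTop
      (𝓝 (Complex.exp (m * Complex.I - s / 2))) := by
  set μ : ℕ → ℝ := fun n => ∫ y, ψ n y * f y with hμ
  have hμM : ∀ n, |μ n| ≤ M n := fun n => by
    change |∫ y, ψ n y * f y| ≤ M n
    rw [← hX.integral_comp_real (hψ n) 0, ← Real.norm_eq_abs]
    refine (norm_integral_le_of_norm_le_const (C := M n)
      (Eventually.of_forall fun _ => hM n _)).trans ?_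
    simp
  let ξ : ℕ → Plane → ℝ := fun n y => r n / n * (ψ n y - μ n)
  have hξm : ∀ n, Measurable (ξ n) := fun n => ((hψ n).sub_const _).const_mul _
  have hrn : ∀ n : ℕ, 0 ≤ r n / n := fun n => div_nonneg (hr n) n.cast_nonneg
  have hξb : ∀ n y, |ξ n y| ≤ 2 * (r n / n * M n) := by
    intro n y
    have h5 := abs_sub (ψ n y) (μ n)
    rw [abs_mul, abs_of_nonneg (hrn n)]
    have : |ψ n y - μ n| ≤ 2 * M n := by linarith [hM n y, hμM n]
    calc _ ≤ r n / n * (2 * M n) := mul_le_mul_of_nonneg_left this (hrn n)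
      _ = _ := by ring
  have hpi : ∀ n, Integrable (fun ω => ψ n (X 0 ω)) P := fun n =>
    hX.integrable_comp (hψ n) (hM n) 0
  have hξi : ∀ n, Integrable (fun ω => ξ n (X 0 ω)) P := fun n =>
    hX.integrable_comp (hξm n) (hξb n) 0
  have hξi2 : ∀ n, Integrable (fun ω => ξ n (X 0 ω) ^ 2) P := fun n =>
    (hX.memLp_comp (hξm n) (hξb n) 0).integrable_sq
  have hξ0 : ∀ n, ∫ ω, ξ n (X 0 ω) ∂P = 0 := by
    intro n
    simp only [ξ]
    rw [integral_const_mul, integral_sub (hpi n) (integrable_const _),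
      hX.integral_comp_real (hψ n)]
    simp [hμ]
  set v : ℕ → ℝ := fun n => ∫ ω, ξ n (X 0 ω) ^ 2 ∂P with hv
  have hv0 : ∀ n, 0 ≤ v n := fun n => integral_nonneg fun _ => sq_nonneg _
  have hvlim : Tendsto (fun n : ℕ => (n : ℝ) * v n) atTop (𝓝 s) := by
    have := h2.sub h3
    rw [sub_zero] at this
    refine this.congr' ?_
    filter_upwards [eventually_gt_atTop 0] with n hn
    have hn0 : (n : ℝ) ≠ 0 := by exact_mod_cast hn.ne'
    have e : v n = (r n / n) ^ 2 * ((∫ y, ψ n y ^ 2 * f y) - μ n ^ 2) := by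
      have hp2 : Integrable (fun ω => ψ n (X 0 ω) ^ 2) P :=
        (hX.memLp_comp (hψ n) (hM n) 0).integrable_sq
      have e1 : ∀ ω, ξ n (X 0 ω) ^ 2 = (r n / n) ^ 2 *
          (ψ n (X 0 ω) ^ 2 - 2 * μ n * ψ n (X 0 ω) + μ n ^ 2) := fun ω => by
        simp only [ξ]; ring
      have i1 : Integrable (fun ω => ψ n (X 0 ω) ^ 2 - 2 * μ n * ψ n (X 0 ω)) P :=
        hp2.sub ((hpi n).const_mul _)
      simp only [hv, e1]
      rw [integral_const_mul, integral_add i1 (integrable_const _),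
        integral_sub hp2 ((hpi n).const_mul _), integral_const_mul,
        hX.integral_comp_real (hψ n),
        hX.integral_comp_real (ψ := fun y => ψ n y ^ 2) ((hψ n).pow_const 2)]
      simp only [integral_const, smul_eq_mul, probReal_univ, one_mul]
      change _ * (_ - 2 * μ n * μ n + _) = _
      ring
    rw [e]
    field_simp
    rfl
  set g : ℕ → ℂ := fun n => (∫ ω, Complex.exp (ξ n (X 0 ω) * Complex.I) ∂P) - 1 with hg
  -- The Taylor remainder |ξ|³ is bounded by sup|ξ| times ξ²; integration leaves sup|ξ| times the
  -- variance.
  have hbound : ∀ᶠ n : ℕ in atTop, ‖g n + (v n : ℂ) / 2‖ ≤ 2 * (r n / n * M n) * v n := by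
    have : ∀ᶠ n : ℕ in atTop, 2 * (r n / n * M n) ≤ 1 := by
      have := h1.const_mul 2
      rw [mul_zero] at this
      exact this.eventually_le_const (by norm_num)
    filter_upwards [this] with n hn
    have hei : Integrable (fun ω => Complex.exp (ξ n (X 0 ω) * Complex.I)) P := by
      have hmm : Measurable fun ω => ξ n (X 0 ω) := (hξm n).comp (hX.meas 0)
      generalize ξ n = ζ at hmm ⊢
      refine Integrable.of_bound (C := 1) ?_ (Eventually.of_forall fun ω => ?_)
      · have : Measurable fun ω => Complex.exp (ζ (X 0 ω) * Complex.I) := by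
          exact (Complex.measurable_ofReal.comp hmm).mul_const Complex.I |>.cexp
        exact this.aestronglyMeasurable
      · rw [Complex.norm_exp_ofReal_mul_I]
    have i1 : Integrable (fun ω => (ξ n (X 0 ω) : ℂ) * Complex.I) P := (hξi n).ofReal.mul_const _
    have i2 : Integrable (fun ω => ((ξ n (X 0 ω) : ℂ)) ^ 2 / 2) P := by
      have := ((hξi2 n).ofReal (𝕜 := ℂ)).div_const 2
      simpa using this
    have i3 : Integrable (fun ω => (1 : ℂ) + (ξ n (X 0 ω) : ℂ) * Complex.I) P :=
      (integrable_const _).add i1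
    have e : g n + (v n : ℂ) / 2 = ∫ ω, (Complex.exp (ξ n (X 0 ω) * Complex.I)
        - (1 + ξ n (X 0 ω) * Complex.I - (ξ n (X 0 ω) : ℂ) ^ 2 / 2)) ∂P := by
      have i5 : Integrable (fun ω => (1 : ℂ) + (ξ n (X 0 ω) : ℂ) * Complex.I
          - (ξ n (X 0 ω) : ℂ) ^ 2 / 2) P := i3.sub i2
      rw [integral_sub hei i5, integral_sub i3 i2, integral_add (integrable_const _) i1,
        integral_mul_const, integral_complex_ofReal, hξ0, integral_div]
      have : ∫ ω, (ξ n (X 0 ω) : ℂ) ^ 2 ∂P = (v n : ℂ) := by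
        rw [hv, ← integral_complex_ofReal]; simp
      rw [this]
      simp only [hg, integral_const, probReal_univ, one_smul]
      push_cast
      ring
    rw [e]
    have i4 := (hξi2 n).const_mul (2 * (r n / n * M n))
    refine (norm_integral_le_of_norm_le i4 (Eventually.of_forall fun ω => ?_)).trans
      (by rw [integral_const_mul])
    refine (norm_cexp_sub_le ((hξb n _).trans hn)).trans ?_
    rw [pow_succ, sq_abs, mul_comm]
    exact mul_le_mul_of_nonneg_right (hξb n _) (sq_nonneg _)
  have hglim : Tendsto (fun n : ℕ => (n : ℂ) * g n) atTop (𝓝 (-(s : ℂ) / 2)) := by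
    have hA : Tendsto (fun n : ℕ => (n : ℂ) * (g n + (v n : ℂ) / 2)) atTop (𝓝 0) := by
      have h5 := (h1.const_mul 2).mul hvlim
      rw [mul_zero, zero_mul] at h5
      refine squeeze_zero_norm' ?_ h5
      filter_upwards [hbound] with n hn
      rw [norm_mul, Complex.norm_natCast]
      calc _ ≤ (n : ℝ) * (2 * (r n / n * M n) * v n) := by gcongr
        _ = _ := by ring
    have hB : Tendsto (fun n : ℕ => (((n : ℝ) * v n : ℝ) : ℂ)) atTop (𝓝 (s : ℂ)) :=
      (Complex.continuous_ofReal.tendsto s).comp hvlim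
    have := hA.sub (hB.div_const 2)
    rw [zero_sub, ← neg_div] at this
    refine this.congr fun n => ?_
    push_cast
    ring
  have hpow := Complex.tendsto_one_add_pow_exp_of_tendsto hglim
  have hm : Tendsto (fun n : ℕ => Complex.exp ((r n * (μ n - c n) : ℝ) * Complex.I)) atTop
      (𝓝 (Complex.exp (m * Complex.I))) := by
    have : Continuous fun x : ℝ => Complex.exp (x * Complex.I) := by fun_prop
    exact (this.tendsto m).comp h4
  have hfin := hm.mul hpow
  rw [← Complex.exp_add] at hfin
  have e0 : (m : ℂ) * Complex.I - s / 2 = m * Complex.I + -(s : ℂ) / 2 := by ring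
  rw [e0]
  refine hfin.congr' ?_
  filter_upwards [eventually_gt_atTop 0] with n hn
  have hn0 : (n : ℝ) ≠ 0 := by exact_mod_cast hn.ne'
  have e1 : (1 + g n) ^ n =
      ∫ ω, Complex.exp ((∑ i ∈ Finset.range n, ξ n (X i ω) : ℝ) * Complex.I) ∂P := by
    rw [hX.integral_cexp_sum (hξm n)]
    congr 1
    simp [hg]
  rw [e1, ← integral_const_mul]
  congr 1; funext ω
  rw [← Complex.exp_add]
  congr 1
  rw [← add_mul]
  congr 1
  rw [← Complex.ofReal_add]
  congr 1
  simp only [emp, ξ, ← Finset.mul_sum, Finset.sum_sub_distrib, Finset.sum_const,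
    Finset.card_range, nsmul_eq_mul]
  field_simp
  ring

/-- Characteristic functions do not see a perturbation that vanishes in probability. -/
lemma tendsto_integral_cexp_of_close {A B : ℕ → Ω → ℝ} (hA : ∀ n, AEMeasurable (A n) P)
    (hB : ∀ n, AEMeasurable (B n) P)
    (hAB : ∀ κ > 0, ∀ δ > 0, ∀ᶠ n in atTop, P.real {ω | κ < |A n ω - B n ω|} ≤ δ) {l : ℂ}
    (h : Tendsto (fun n => ∫ ω, Complex.exp (B n ω * Complex.I) ∂P) atTop (𝓝 l)) :
    Tendsto (fun n => ∫ ω, Complex.exp (A n ω * Complex.I) ∂P) atTop (𝓝 l) := by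
  have hi : ∀ Y : Ω → ℝ, AEMeasurable Y P →
      Integrable (fun ω => Complex.exp (Y ω * Complex.I)) P := by
    intro Y hY
    refine Integrable.of_bound (C := 1) ?_ (Eventually.of_forall fun ω => ?_)
    · have : AEMeasurable (fun ω => Complex.exp (Y ω * Complex.I)) P := by fun_prop
      exact this.aestronglyMeasurable
    · rw [Complex.norm_exp_ofReal_mul_I]
  have hdiff : Tendsto (fun n => (∫ ω, Complex.exp (A n ω * Complex.I) ∂P) -
      ∫ ω, Complex.exp (B n ω * Complex.I) ∂P) atTop (𝓝 0) := by
    rw [Metric.tendsto_nhds]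
    intro ε hε
    -- The integrands differ by at most ε/3 where the variables are close and by at most 2 on a set
    -- of measure at most ε/6, in total by at most 2ε/3.
    filter_upwards [hAB (ε / 3) (by positivity) (ε / 6) (by positivity)] with n hn
    rw [dist_zero_right, ← integral_sub (hi _ (hA n)) (hi _ (hB n))]
    set S := {ω | ε / 3 < |A n ω - B n ω|} with hS
    have hSm : NullMeasurableSet S P :=
      nullMeasurableSet_lt aemeasurable_const (by
        have := ((hA n).sub (hB n)).norm
        simpa [Real.norm_eq_abs] using this)
    have hind : Integrable (S.indicator fun _ => (2 : ℝ)) P :=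
      (integrable_const 2).indicator₀ hSm
    have hle : ∀ ω, ‖Complex.exp (A n ω * Complex.I) - Complex.exp (B n ω * Complex.I)‖ ≤
        ε / 3 + S.indicator (fun _ => (2 : ℝ)) ω := by
      intro ω
      by_cases hω : ω ∈ S
      · rw [indicator_of_mem hω]
        refine (norm_sub_le _ _).trans ?_
        rw [Complex.norm_exp_ofReal_mul_I, Complex.norm_exp_ofReal_mul_I]
        linarith
      · rw [indicator_of_notMem hω, add_zero]
        have h1 : |A n ω - B n ω| ≤ ε / 3 := not_lt.1 hω
        refine le_trans ?_ h1
        have h2 := Real.norm_exp_I_mul_ofReal_sub_one_le (x := A n ω - B n ω)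
        have h3 : Complex.exp (A n ω * Complex.I) - Complex.exp (B n ω * Complex.I) =
            Complex.exp (B n ω * Complex.I) *
              (Complex.exp (Complex.I * (A n ω - B n ω : ℝ)) - 1) := by
          rw [mul_sub, ← Complex.exp_add, mul_one]
          congr 2
          push_cast; ring
        rw [h3, norm_mul, Complex.norm_exp_ofReal_mul_I, one_mul]
        exact h2
    refine (norm_integral_le_of_norm_le ((integrable_const (ε / 3)).add hind)
      (Eventually.of_forall hle)).trans_lt ?_
    simp only [Pi.add_apply]
    rw [integral_add (integrable_const _) hind, integral_indicator₀ hSm]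
    simp
    linarith
  simpa using hdiff.add h

end


/-! ### Kernel averages along a curve -/

/-- A curve `c` with continuous velocity `c'` whose chords on `[0, T]` are uniformly comparable
with the time increments. -/
structure PathData (c c' : ℝ → Plane) (T γ : ℝ) : Prop where
  nonneg : 0 ≤ T
  deriv : ∀ s, HasDerivAt c (c' s) s
  cont' : Continuous c'
  pos : 0 < γ
  sep : ∀ s ∈ Icc 0 T, ∀ t ∈ Icc 0 T, γ * |s - t| ≤ ‖c s - c t‖

/-- A bounded continuous family of functions supported in the unit disc. -/
structure PathKernel (φ : ℝ → Plane → ℝ) (M : ℝ) : Prop where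
  cont : Continuous (Function.uncurry φ)
  supp : ∀ s z, 1 < ‖z‖ → φ s z = 0
  bound : ∀ s z, |φ s z| ≤ M

/-- The average `∫₀ᵁ h⁻⁴ φ_s ((c(s) - y) / h) ds`. -/
noncomputable def pathTerm (φ : ℝ → Plane → ℝ) (c : ℝ → Plane) (U h : ℝ) (y : Plane) : ℝ :=
  ∫ s in Ioc 0 U, (h⁻¹) ^ 4 * φ s (h⁻¹ • (c s - y))

section

variable {c c' : ℝ → Plane} {T γ : ℝ} {φ : ℝ → Plane → ℝ} {M : ℝ}

lemma PathData.continuous (hc : PathData c c' T γ) : Continuous c :=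
  continuous_iff_continuousAt.2 fun s => (hc.deriv s).continuousAt

lemma PathKernel.nonneg (hφ : PathKernel φ M) : 0 ≤ M := (abs_nonneg _).trans (hφ.bound 0 0)

lemma PathKernel.continuous_comp (hφ : PathKernel φ M) {Y : Type*} [TopologicalSpace Y]
    {a : Y → ℝ} {b : Y → Plane} (ha : Continuous a) (hb : Continuous b) :
    Continuous fun y => φ (a y) (b y) :=
  hφ.cont.comp (ha.prodMk hb)

/-- The time that the curve spends in a disc of radius `h` is of order `h`. -/
lemma PathData.setIntegral_le (hc : PathData c c' T γ) (hφ : PathKernel φ M) {U h : ℝ}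
    (hU : U ≤ T) (hh : 0 < h) (y : Plane) :
    ∫ s in Ioc 0 U, |φ s (h⁻¹ • (c s - y))| ≤ M * (4 * h / γ) := by
  have hM := hφ.nonneg
  have hγ := hc.pos
  by_cases hex : ∃ s₀ ∈ Ioc 0 U, ‖c s₀ - y‖ ≤ h
  · obtain ⟨s₀, hs₀, h0⟩ := hex
    -- Two points of the curve in the disc are at most 2h apart, so their times differ by at most
    -- 2h/γ. All relevant times thus lie in an interval of length 4h/γ around one of them.
    have hle : ∀ s ∈ Ioc 0 U, |φ s (h⁻¹ • (c s - y))| ≤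
        (Icc (s₀ - 2 * h / γ) (s₀ + 2 * h / γ)).indicator (fun _ => M) s := by
      intro s hs
      by_cases h1 : ‖c s - y‖ ≤ h
      · have h2 := hc.sep s ⟨hs.1.le, hs.2.trans hU⟩ s₀ ⟨hs₀.1.le, hs₀.2.trans hU⟩
        have h3 : ‖c s - c s₀‖ ≤ 2 * h := by
          have : c s - c s₀ = (c s - y) - (c s₀ - y) := by abel
          rw [this]
          exact (norm_sub_le _ _).trans (by linarith)
        have h4 : |s - s₀| ≤ 2 * h / γ := by
          rw [le_div_iff₀ hγ]; linarith
        rw [abs_le] at h4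
        rw [indicator_of_mem (mem_Icc.2 ⟨by linarith, by linarith⟩)]
        exact hφ.bound _ _
      · rw [hφ.supp, abs_zero]
        · exact indicator_nonneg (fun _ _ => hM) _
        · rw [norm_smul, norm_inv, Real.norm_eq_abs, abs_of_pos hh, inv_mul_eq_div, lt_div_iff₀ hh]
          linarith
    have hi : Integrable ((Icc (s₀ - 2 * h / γ) (s₀ + 2 * h / γ)).indicator fun _ => M) :=
      (integrableOn_const (by simp)).integrable_indicator measurableSet_Icc
    calc _ ≤ ∫ s in Ioc 0 U, (Icc (s₀ - 2 * h / γ) (s₀ + 2 * h / γ)).indicator (fun _ => M) s :=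
          setIntegral_mono_on (Continuous.integrableOn_Ioc (by
            have := hc.continuous
            exact (hφ.continuous_comp continuous_id (by fun_prop)).abs)) hi.integrableOn
            measurableSet_Ioc hle
      _ ≤ ∫ s, (Icc (s₀ - 2 * h / γ) (s₀ + 2 * h / γ)).indicator (fun _ => M) s :=
          setIntegral_le_integral hi (Eventually.of_forall fun s => indicator_nonneg (fun _ _ => hM) _)
      _ = _ := by
          rw [integral_indicator measurableSet_Icc, setIntegral_const, smul_eq_mul,
            Real.volume_real_Icc_of_le (by
              have : 0 ≤ 2 * h / γ := by positivity
              linarith)]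
          ring
  · push Not at hex
    have : ∀ s ∈ Ioc 0 U, |φ s (h⁻¹ • (c s - y))| = 0 := by
      intro s hs
      rw [hφ.supp, abs_zero]
      rw [norm_smul, norm_inv, Real.norm_eq_abs, abs_of_pos hh, inv_mul_eq_div, lt_div_iff₀ hh]
      linarith [hex s hs]
    rw [setIntegral_congr_fun measurableSet_Ioc this]
    simp
    positivity

/-- The occupation time of order h turns h⁻⁴ into h⁻³. This is the gain of one power of h that
produces the rate √(nh⁵). -/
lemma PathData.abs_pathTerm_le (hc : PathData c c' T γ) (hφ : PathKernel φ M) {U h : ℝ}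
    (hU : U ≤ T) (hh : 0 < h) (y : Plane) : |pathTerm φ c U h y| ≤ 4 * M / γ * (h⁻¹) ^ 3 := by
  have h1 := hc.setIntegral_le hφ hU hh y
  rw [pathTerm, integral_const_mul, abs_mul, abs_of_pos (by positivity)]
  calc _ ≤ (h⁻¹) ^ 4 * (M * (4 * h / γ)) := by
        gcongr
        exact (abs_integral_le_integral_abs).trans h1
    _ = _ := by field_simp

lemma PathKernel.continuous_setIntegral (hφ : PathKernel φ M) {Y : Type*} [TopologicalSpace Y]
    [FirstCountableTopology Y] {b : Y → ℝ → Plane} (hb : Continuous (Function.uncurry b)) (U : ℝ) :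
    Continuous fun y => ∫ s in Ioc 0 U, φ s (b y s) := by
  refine continuous_of_dominated (bound := fun _ => M) (fun y => ?_) (fun y => ?_) ?_ ?_
  · have : Continuous fun s => φ s (b y s) :=
      hφ.continuous_comp continuous_id (hb.comp (by fun_prop : Continuous fun s => (y, s)))
    exact this.aestronglyMeasurable
  · exact Eventually.of_forall fun s => hφ.bound _ _
  · exact integrable_const _
  · exact Eventually.of_forall fun s =>
      hφ.continuous_comp continuous_const (hb.comp (by fun_prop : Continuous fun y => (y, s)))

lemma PathData.continuous_pathTerm (hc : PathData c c' T γ) (hφ : PathKernel φ M) (U h : ℝ) :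
    Continuous (pathTerm φ c U h) := by
  have := hc.continuous
  unfold pathTerm
  simp only [integral_const_mul]
  exact (hφ.continuous_setIntegral (b := fun y s => h⁻¹ • (c s - y))
    (by unfold Function.uncurry; fun_prop) U).const_mul _

/-- Interchange of the integration along the curve with the integration over the plane. -/
lemma PathData.integral_pathTerm_mul (hc : PathData c c' T γ) (hφ : PathKernel φ M) {g : Plane → ℝ}
    (hg : Continuous g) (U : ℝ) {h : ℝ} (hh : 0 < h) :
    ∫ y, pathTerm φ c U h y * g y =
      ∫ s in Ioc 0 U, (h⁻¹) ^ 2 * ∫ z, φ s z * g (c s - h • z) := by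
  have hcc := hc.continuous
  have hcont : Continuous fun p : Plane × ℝ => φ p.2 (h⁻¹ • (c p.2 - p.1)) * g p.1 :=
    (hφ.continuous_comp continuous_snd (by fun_prop)).mul (hg.comp continuous_fst)
  obtain ⟨R, hR⟩ := (isCompact_Icc (a := (0 : ℝ)) (b := U)).exists_bound_of_continuousOn
    hcc.continuousOn
  obtain ⟨B, hB⟩ := (isCompact_closedBall (0 : Plane) (R + h)).exists_bound_of_continuousOn
    hg.continuousOn
  have hint : Integrable (fun p : Plane × ℝ => φ p.2 (h⁻¹ • (c p.2 - p.1)) * g p.1)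
      ((volume : Measure Plane).prod (volume.restrict (Ioc 0 U))) := by
    have hi : Integrable ((Metric.closedBall (0 : Plane) (R + h)).indicator fun _ => M * |B|) :=
      (integrableOn_const (by
        exact (isCompact_closedBall (0 : Plane) (R + h)).measure_lt_top.ne)).integrable_indicator
        Metric.isClosed_closedBall.measurableSet
    refine (hi.comp_fst (volume.restrict (Ioc (0 : ℝ) U))).mono' hcont.aestronglyMeasurable ?_
    have hae : ∀ᵐ p ∂((volume : Measure Plane).prod (volume.restrict (Ioc (0 : ℝ) U))),
        p.2 ∈ Ioc 0 U :=
      Measure.quasiMeasurePreserving_snd.ae (ae_restrict_mem measurableSet_Ioc)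
    filter_upwards [hae] with p hp
    by_cases h1 : ‖c p.2 - p.1‖ ≤ h
    · have h2 : p.1 ∈ Metric.closedBall (0 : Plane) (R + h) := by
        rw [mem_closedBall_zero_iff]
        have : p.1 = c p.2 - (c p.2 - p.1) := by abel
        rw [this]
        exact (norm_sub_le _ _).trans (add_le_add (hR _ ⟨hp.1.le, hp.2⟩) h1)
      rw [indicator_of_mem h2, norm_mul]
      exact mul_le_mul (hφ.bound _ _) ((hB _ h2).trans (le_abs_self _)) (norm_nonneg _) hφ.nonneg
    · rw [hφ.supp, zero_mul, norm_zero]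
      · exact indicator_nonneg (fun _ _ => mul_nonneg hφ.nonneg (abs_nonneg _)) _
      · rw [norm_smul, norm_inv, Real.norm_eq_abs, abs_of_pos hh, inv_mul_eq_div, lt_div_iff₀ hh]
        linarith
  have e : ∀ y, pathTerm φ c U h y * g y =
      (h⁻¹) ^ 4 * ∫ s in Ioc 0 U, φ s (h⁻¹ • (c s - y)) * g y := by
    intro y
    rw [pathTerm, integral_const_mul, integral_mul_const, mul_assoc]
  simp only [e]
  rw [integral_const_mul, integral_integral_swap hint, ← integral_const_mul]
  congr 1; funext s
  have h1 := integral_comp_scale (φ s) g hh (c s)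
  rw [h1]
  field_simp

/-- The inner integral in the second moment of `pathTerm`. -/
noncomputable def pathCorr (φ : ℝ → Plane → ℝ) (c : ℝ → Plane) (U h s : ℝ) (z : Plane) : ℝ :=
  h⁻¹ * ∫ t in Ioc 0 U, φ t (z + h⁻¹ • (c t - c s))

lemma pathCorr_eq (U : ℝ) {h : ℝ} (hh : 0 < h) (s : ℝ) (z : Plane) :
    h ^ 3 * pathTerm φ c U h (c s - h • z) = pathCorr φ c U h s z := by
  have e : ∀ t, h⁻¹ • (c t - (c s - h • z)) = z + h⁻¹ • (c t - c s) := by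
    intro t
    rw [sub_sub_eq_add_sub, add_comm (c t), add_sub_assoc, smul_add, inv_smul_smul₀ hh.ne']
  rw [pathTerm, pathCorr, integral_const_mul]
  simp only [e]
  field_simp

lemma PathData.abs_pathCorr_le (hc : PathData c c' T γ) (hφ : PathKernel φ M) {U h : ℝ}
    (hU : U ≤ T) (hh : 0 < h) (s : ℝ) (z : Plane) : |pathCorr φ c U h s z| ≤ 4 * M / γ := by
  rw [← pathCorr_eq U hh, abs_mul, abs_of_pos (by positivity)]
  calc _ ≤ h ^ 3 * (4 * M / γ * (h⁻¹) ^ 3) := by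
        gcongr
        exact hc.abs_pathTerm_le hφ hU hh _
    _ = _ := by field_simp

/-- One factor of the square is opened by the interchange of integrals, which gives h⁻². The other
is evaluated at c(s) - hz and equals h⁻³ times `pathCorr`, so the powers of h cancel. -/
lemma PathData.second_moment_eq (hc : PathData c c' T γ) (hφ : PathKernel φ M) {g : Plane → ℝ}
    (hg : Continuous g) (U : ℝ) {h : ℝ} (hh : 0 < h) :
    h ^ 5 * ∫ y, pathTerm φ c U h y ^ 2 * g y =
      ∫ s in Ioc 0 U, ∫ z, φ s z * (pathCorr φ c U h s z * g (c s - h • z)) := by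
  have h1 := hc.integral_pathTerm_mul (g := fun y => pathTerm φ c U h y * g y) hφ
    ((hc.continuous_pathTerm hφ U h).mul hg) U hh
  have e : ∀ y, pathTerm φ c U h y ^ 2 * g y = pathTerm φ c U h y * (pathTerm φ c U h y * g y) :=
    fun y => by ring
  simp only [e]
  rw [h1, ← integral_const_mul]
  congr 1; funext s
  rw [← mul_assoc, ← integral_const_mul]
  congr 1; funext z
  rw [← pathCorr_eq U hh]
  field_simp

/-- Under t = s + hτ the scaled chord (c(s + hτ) - c(s))/h tends to τ c'(s). The lower bound on
chords makes the integrand vanish for |τ| > (1 + ‖z‖)/γ, which gives domination. As s is an interior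
time, every fixed τ is eventually admissible and the integral extends over the whole line. -/
lemma PathData.pathCorr_tendsto (hc : PathData c c' T γ) (hφ : PathKernel φ M) {s : ℝ}
    (hs : s ∈ Ioo 0 T) (z : Plane) :
    Tendsto (fun h => pathCorr φ c T h s z) (𝓝[>] 0) (𝓝 (∫ τ : ℝ, φ s (τ • c' s + z))) := by
  have hcc := hc.continuous
  have hγ := hc.pos
  set F : ℝ → ℝ → ℝ := fun h => (Ioc 0 T).indicator fun t => φ t (z + h⁻¹ • (c t - c s)) with hF
  have e : ∀ h : ℝ, 0 < h → pathCorr φ c T h s z = ∫ τ : ℝ, F h (s + h * τ) := by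
    intro h hh
    rw [Measure.integral_comp_mul_left (fun t => F h (s + t)) h, integral_add_left_eq_self,
      hF, integral_indicator measurableSet_Ioc, abs_of_pos (inv_pos.2 hh)]
    rfl
  refine Tendsto.congr' (f₁ := fun h => ∫ τ : ℝ, F h (s + h * τ)) ?_ ?_
  · filter_upwards [self_mem_nhdsWithin] with h hh using (e h hh).symm
  refine tendsto_integral_filter_of_dominated_convergence
    (bound := (Icc (-((1 + ‖z‖) / γ)) ((1 + ‖z‖) / γ)).indicator fun _ => M) ?_ ?_ ?_ ?_
  · refine Eventually.of_forall fun h => ?_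
    have hm : Measurable (F h) := by
      refine Measurable.indicator ?_ measurableSet_Ioc
      exact (hφ.continuous_comp continuous_id (by fun_prop)).measurable
    exact (hm.comp (by fun_prop)).aestronglyMeasurable
  · filter_upwards [self_mem_nhdsWithin] with h (hh : 0 < h)
    refine Eventually.of_forall fun τ => ?_
    by_cases h1 : s + h * τ ∈ Ioc 0 T
    · simp only [hF, indicator_of_mem h1]
      by_cases h2 : τ ∈ Icc (-((1 + ‖z‖) / γ)) ((1 + ‖z‖) / γ)
      · rw [indicator_of_mem h2]
        exact hφ.bound _ _
      · rw [indicator_of_notMem h2, hφ.supp, norm_zero]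
        have h3 : (1 + ‖z‖) / γ < |τ| := by
          by_contra hcon
          exact h2 (abs_le.1 (not_lt.1 hcon))
        have h4 := hc.sep _ ⟨h1.1.le, h1.2⟩ s ⟨hs.1.le, hs.2.le⟩
        rw [add_sub_cancel_left, abs_mul, abs_of_pos hh] at h4
        rw [div_lt_iff₀ hγ] at h3
        have h5 : |τ| * γ ≤ ‖h⁻¹ • (c (s + h * τ) - c s)‖ := by
          rw [norm_smul, norm_inv, Real.norm_eq_abs, abs_of_pos hh, inv_mul_eq_div, le_div_iff₀ hh]
          linarith
        have h6 := norm_sub_le (z + h⁻¹ • (c (s + h * τ) - c s)) z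
        rw [add_sub_cancel_left] at h6
        linarith
    · simp only [hF, indicator_of_notMem h1, norm_zero]
      exact indicator_nonneg (fun _ _ => hφ.nonneg) _
  · exact (integrableOn_const (by simp)).integrable_indicator measurableSet_Icc
  · refine Eventually.of_forall fun τ => ?_
    have hlin : Tendsto (fun h : ℝ => s + h * τ) (𝓝[>] 0) (𝓝 s) := by
      have : Continuous fun h : ℝ => s + h * τ := by fun_prop
      simpa using (this.tendsto 0).mono_left nhdsWithin_le_nhds
    have hslope : Tendsto (fun h : ℝ => h⁻¹ • (c (s + h * τ) - c s)) (𝓝[>] 0) (𝓝 (τ • c' s)) := by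
      have h1 : HasDerivAt (fun h : ℝ => c (s + h * τ)) (τ • c' s) 0 := by
        have h2 : HasDerivAt (fun h : ℝ => s + h * τ) τ 0 := by
          simpa using ((hasDerivAt_id (0 : ℝ)).mul_const τ).const_add s
        have h3 : HasDerivAt c (c' s) (s + 0 * τ) := by simpa using hc.deriv s
        exact h3.scomp 0 h2
      have h4 := h1.tendsto_slope_zero_right
      simpa using h4
    have hlim : Tendsto (fun h : ℝ => φ (s + h * τ) (z + h⁻¹ • (c (s + h * τ) - c s))) (𝓝[>] 0)
        (𝓝 (φ s (τ • c' s + z))) := by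
      have h1 := (hφ.cont.tendsto (s, z + τ • c' s)).comp
        (hlin.prodMk_nhds (hslope.const_add z))
      rw [add_comm]
      exact h1
    refine hlim.congr' ?_
    filter_upwards [hlin.eventually (Ioo_mem_nhds hs.1 hs.2)] with h hmem
    simp only [hF]
    rw [indicator_of_mem (Ioo_subset_Ioc_self hmem)]

lemma PathData.exists_abs_comp_le (hc : PathData c c' T γ) {g : Plane → ℝ} (hg : Continuous g) :
    ∃ B, 0 ≤ B ∧ ∀ s ∈ Ioc 0 T, ∀ z : Plane, ‖z‖ ≤ 1 → ∀ h : ℝ, 0 < h → h ≤ 1 → |g (c s - h • z)| ≤ B := by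
  obtain ⟨R, hR⟩ := (isCompact_Icc (a := (0 : ℝ)) (b := T)).exists_bound_of_continuousOn
    hc.continuous.continuousOn
  obtain ⟨B, hB⟩ := (isCompact_closedBall (0 : Plane) (R + 1)).exists_bound_of_continuousOn
    hg.continuousOn
  refine ⟨|B|, abs_nonneg _, fun s hs z hz h h0 h1 => (hB _ ?_).trans (le_abs_self _)⟩
  rw [mem_closedBall_zero_iff]
  refine (norm_sub_le _ _).trans (add_le_add (hR s ⟨hs.1.le, hs.2⟩) ?_)
  rw [norm_smul, Real.norm_eq_abs, abs_of_pos h0]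
  nlinarith [norm_nonneg z]

/-- The dominating function for the inner integral of the second moment. -/
lemma PathData.norm_integrand_le (hc : PathData c c' T γ) (hφ : PathKernel φ M) {g : Plane → ℝ}
    {B : ℝ} (hB0 : 0 ≤ B) {U h s : ℝ} (hU : U ≤ T) (hh : 0 < h)
    (hB : ∀ z : Plane, ‖z‖ ≤ 1 → |g (c s - h • z)| ≤ B) (z : Plane) :
    ‖φ s z * (pathCorr φ c U h s z * g (c s - h • z))‖ ≤
      (Metric.closedBall (0 : Plane) 1).indicator (fun _ => M * (4 * M / γ * B)) z := by
  have hM := hφ.nonneg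
  have hγ := hc.pos
  by_cases hz : ‖z‖ ≤ 1
  · rw [indicator_of_mem (by simpa using hz), norm_mul, norm_mul]
    have := hc.abs_pathCorr_le hφ hU hh s z
    exact mul_le_mul (hφ.bound _ _) (mul_le_mul this (hB z hz) (norm_nonneg _) (by positivity))
      (by positivity) hM
  · rw [hφ.supp s z (not_le.1 hz), zero_mul, norm_zero]
    exact indicator_nonneg (fun _ _ => by positivity) _

lemma integrable_indicator_closedBall (C : ℝ) :
    Integrable ((Metric.closedBall (0 : Plane) 1).indicator fun _ => C) :=
  (integrableOn_const (isCompact_closedBall (0 : Plane) 1).measure_lt_top.ne).integrable_indicator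
    Metric.isClosed_closedBall.measurableSet

lemma PathData.exists_second_moment_le (hc : PathData c c' T γ) (hφ : PathKernel φ M)
    {g : Plane → ℝ} (hg : Continuous g) :
    ∃ C, 0 ≤ C ∧ ∀ U ∈ Icc 0 T, ∀ h, 0 < h → h ≤ 1 →
      ∫ y, pathTerm φ c U h y ^ 2 * g y ≤ C * (h⁻¹) ^ 5 := by
  obtain ⟨B, hB0, hB⟩ := hc.exists_abs_comp_le hg
  have hM := hφ.nonneg
  have hγ := hc.pos
  set D := ∫ z, (Metric.closedBall (0 : Plane) 1).indicator (fun _ => M * (4 * M / γ * B)) z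
  have hD : 0 ≤ D := integral_nonneg fun z => indicator_nonneg (fun _ _ => by positivity) _
  refine ⟨D * T, mul_nonneg hD hc.nonneg, fun U hU h h0 h1 => ?_⟩
  have h2 := hc.second_moment_eq hφ hg U h0
  have h3 : ‖∫ s in Ioc 0 U, ∫ z, φ s z * (pathCorr φ c U h s z * g (c s - h • z))‖ ≤
      D * volume.real (Ioc 0 U) := by
    refine norm_setIntegral_le_of_norm_le_const (by simp) fun s hs => ?_
    exact norm_integral_le_of_norm_le (integrable_indicator_closedBall _)
      (Eventually.of_forall fun z => hc.norm_integrand_le hφ hB0 hU.2 h0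
        (fun z hz => hB s ⟨hs.1, hs.2.trans hU.2⟩ z hz h h0 h1) z)
  rw [← h2, Real.volume_real_Ioc_of_le hU.1, sub_zero] at h3
  have h4 := (le_abs_self _).trans h3
  have h5 : D * U ≤ D * T := mul_le_mul_of_nonneg_left hU.2 hD
  rw [inv_pow, ← div_eq_mul_inv, le_div_iff₀ (by positivity)]
  linarith

/-- Dominated convergence in z and then in s, starting from `second_moment_eq`. In the limit the
second time variable has been replaced by the variable τ along the tangent line at c(s). -/
theorem PathData.tendsto_second_moment (hc : PathData c c' T γ) (hφ : PathKernel φ M)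
    {g : Plane → ℝ} (hg : Continuous g) :
    Tendsto (fun h => h ^ 5 * ∫ y, pathTerm φ c T h y ^ 2 * g y) (𝓝[>] 0)
      (𝓝 (∫ s in Ioc 0 T, ∫ z, φ s z * ((∫ τ : ℝ, φ s (τ • c' s + z)) * g (c s)))) := by
  obtain ⟨B, hB0, hB⟩ := hc.exists_abs_comp_le hg
  have hM := hφ.nonneg
  have hγ := hc.pos
  have hcc := hc.continuous
  have hev : ∀ᶠ h : ℝ in 𝓝[>] 0, 0 < h ∧ h ≤ 1 :=
    (eventually_mem_nhdsWithin).and (eventually_nhdsWithin_of_eventually_nhds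
      (eventually_le_nhds one_pos))
  have hcorr : ∀ h, Continuous fun p : ℝ × Plane => pathCorr φ c T h p.1 p.2 := by
    intro h
    unfold pathCorr
    exact (hφ.continuous_setIntegral (b := fun (p : ℝ × Plane) t => p.2 + h⁻¹ • (c t - c p.1))
      (by unfold Function.uncurry; fun_prop) T).const_mul _
  have hint : ∀ h, Continuous fun p : ℝ × Plane =>
      φ p.1 p.2 * (pathCorr φ c T h p.1 p.2 * g (c p.1 - h • p.2)) := fun h =>
    (hφ.continuous_comp continuous_fst continuous_snd).mul ((hcorr h).mul (hg.comp (by fun_prop)))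
  refine Tendsto.congr' (f₁ := fun h => ∫ s in Ioc 0 T, ∫ z, φ s z *
    (pathCorr φ c T h s z * g (c s - h • z))) ?_ ?_
  · filter_upwards [hev] with h hh using (hc.second_moment_eq hφ hg T hh.1).symm
  refine tendsto_integral_filter_of_dominated_convergence (bound := fun _ =>
    ∫ z, (Metric.closedBall (0 : Plane) 1).indicator (fun _ => M * (4 * M / γ * B)) z) ?_ ?_
    (integrable_const _) ?_
  · refine Eventually.of_forall fun h => ?_
    exact (hint h).stronglyMeasurable.integral_prod_right'.aestronglyMeasurable
  · filter_upwards [hev] with h hh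
    filter_upwards [ae_restrict_mem measurableSet_Ioc] with s hs
    exact norm_integral_le_of_norm_le (integrable_indicator_closedBall _)
      (Eventually.of_forall fun z => hc.norm_integrand_le hφ hB0 le_rfl hh.1
        (fun z hz => hB s hs z hz h hh.1 hh.2) z)
  -- The limit of the inner integral is available only at interior times; the end time T is a null
  -- set.
  · have hne : ∀ᵐ s ∂(volume.restrict (Ioc 0 T)), s ≠ T :=
      ae_restrict_of_ae (Measure.ae_ne volume T)
    filter_upwards [ae_restrict_mem measurableSet_Ioc, hne] with s hs hsT
    refine tendsto_integral_filter_of_dominated_convergence (bound :=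
      (Metric.closedBall (0 : Plane) 1).indicator (fun _ => M * (4 * M / γ * B))) ?_ ?_
      (integrable_indicator_closedBall _) ?_
    · exact Eventually.of_forall fun h =>
        ((hint h).comp (by fun_prop : Continuous fun z : Plane => (s, z))).aestronglyMeasurable
    · filter_upwards [hev] with h hh
      exact Eventually.of_forall fun z => hc.norm_integrand_le hφ hB0 le_rfl hh.1
        (fun z hz => hB s hs z hz h hh.1 hh.2) z
    · refine Eventually.of_forall fun z => ?_
      refine Tendsto.const_mul _ ((hc.pathCorr_tendsto hφ
        ⟨hs.1, lt_of_le_of_ne hs.2 hsT⟩ z).mul ?_)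
      have : Continuous fun h : ℝ => g (c s - h • z) := hg.comp (by fun_prop)
      simpa using (this.tendsto 0).mono_left nhdsWithin_le_nhds


end


/-! ### Weighted second derivatives of the estimator along a curve -/

/-- The kernel `z ↦ ⟨a(s), d²K(z)⟩`. -/
noncomputable def coefKernel (a : ℝ → Space) (K : Plane → ℝ) (s : ℝ) (z : Plane) : ℝ :=
  inner ℝ (a s) (d2 K z)

lemma coefKernel_eq_sum (a : ℝ → Space) (K : Plane → ℝ) (s : ℝ) (z : Plane) :
    coefKernel a K s z = ∑ j, a s j * wd (d2word j) K z := by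
  simp [coefKernel, PiLp.inner_apply, d2_apply, mul_comm]

lemma inner_d2_eq_sum (u : Space) (g : Plane → ℝ) (x : Plane) :
    inner ℝ u (d2 g x) = ∑ j, u j * wd (d2word j) g x := by
  simp [PiLp.inner_apply, d2_apply, mul_comm]

lemma length_d2word_le (j : Fin 3) : (d2word j).length ≤ 2 := (length_d2word j).le

lemma exists_pathKernel {K : Plane → ℝ} (hK : KernelAssumptions K) {a : ℝ → Space}
    (ha : Continuous a) {A : ℝ} (hA : ∀ s, ‖a s‖ ≤ A) : ∃ M, PathKernel (coefKernel a K) M := by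
  obtain ⟨C, hC0, hC⟩ := exists_bound_wd_kernel hK
  have hA0 : 0 ≤ A := (norm_nonneg _).trans (hA 0)
  refine ⟨∑ _j : Fin 3, A * C, ?_, ?_, ?_⟩
  · have : Function.uncurry (coefKernel a K) =
        fun p => ∑ j, a p.1 j * wd (d2word j) K p.2 := by
      funext p; exact coefKernel_eq_sum _ _ _ _
    rw [this]
    refine continuous_finsetSum _ fun j _ => ?_
    have := (hK.ballFun_wd (d2word j) ((length_d2word_le j).trans (by norm_num))).cont
    fun_prop
  · intro s z hz
    rw [coefKernel_eq_sum]
    refine Finset.sum_eq_zero fun j _ => ?_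
    rw [wd_eq_zero_of_supp hK.supp _ z hz, mul_zero]
  · intro s z
    rw [coefKernel_eq_sum]
    refine (Finset.abs_sum_le_sum_abs _ _).trans (Finset.sum_le_sum fun j _ => ?_)
    rw [abs_mul]
    exact mul_le_mul ((abs_apply_le_norm _ _).trans (hA s))
      (hC _ (by rw [length_d2word]; norm_num) (by rw [length_d2word]; norm_num) z) (abs_nonneg _) hA0

lemma inner_d2_kde {K : Plane → ℝ} (hK : KernelAssumptions K) (a : ℝ → Space) (s : ℝ) (h : ℝ)
    (n : ℕ) (X : ℕ → Plane) (x : Plane) :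
    inner ℝ (a s) (d2 (kde K h n X) x) =
      emp (fun y => (h⁻¹) ^ 4 * coefKernel a K s (h⁻¹ • (x - y))) n X := by
  have e : ∀ j, wd (d2word j) (kde K h n X) x = emp (term (wd (d2word j) K) 2 h x) n X := by
    intro j
    rw [congrFun (wd_kde h n X (d2word j)
      (hK.diffWords.mono (by rw [length_d2word]; norm_num))) x, mul_kde_eq_emp, length_d2word]
  rw [inner_d2_eq_sum]
  simp only [e, emp, term, coefKernel_eq_sum, Finset.mul_sum]
  rw [Finset.sum_comm]
  refine Finset.sum_congr rfl fun i _ => Finset.sum_congr rfl fun j _ => ?_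
  ring

section

variable {c c' : ℝ → Plane} {T γ : ℝ} {f K : Plane → ℝ} {H L : Set Plane} {l : ℝ}
  {a : ℝ → Space} {A : ℝ}

lemma Tame.continuous_inner_d2 {g : Plane → ℝ} (hg : Tame g) (hc : PathData c c' T γ)
    (ha : Continuous a) : Continuous fun s => inner ℝ (a s) (d2 g (c s)) :=
  ha.inner (hg.continuous_d2.comp hc.continuous)

/-- Linearity of the estimator in the sample makes a weighted path integral of its second
derivatives the empirical mean of one function, so the results for independent identically
distributed summands apply. -/
lemma PathData.setIntegral_inner_d2_kde (hc : PathData c c' T γ) (hK : KernelAssumptions K)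
    (ha : Continuous a) (hA : ∀ s, ‖a s‖ ≤ A) (U h : ℝ) (n : ℕ) (X : ℕ → Plane) :
    ∫ s in Ioc 0 U, inner ℝ (a s) (d2 (kde K h n X) (c s)) =
      emp (pathTerm (coefKernel a K) c U h) n X := by
  obtain ⟨M, hφ⟩ := exists_pathKernel hK ha hA
  have hcc := hc.continuous
  simp only [inner_d2_kde hK, emp, pathTerm]
  rw [integral_const_mul, integral_finsetSum]
  intro i _
  exact ((hφ.continuous_comp continuous_id (by fun_prop)).const_mul _).integrableOn_Ioc

lemma PathData.integral_pathTerm_density (hc : PathData c c' T γ) (hf : DensityAssumptions f H L l)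
    (hK : KernelAssumptions K) (ha : Continuous a) (hA : ∀ s, ‖a s‖ ≤ A) (U : ℝ) {h : ℝ}
    (hh : 0 < h) : ∫ y, pathTerm (coefKernel a K) c U h y * f y =
      ∫ s in Ioc 0 U, ∑ j, a s j * smooth K (wd (d2word j) f) h (c s) := by
  obtain ⟨M, hφ⟩ := exists_pathKernel hK ha hA
  rw [hc.integral_pathTerm_mul hφ hf.contDiff.continuous U hh]
  congr 1; funext s
  have e : ∀ z, coefKernel a K s z * f (c s - h • z) =
      ∑ j, a s j * (wd (d2word j) K z * f (c s - h • z)) := fun z => by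
    rw [coefKernel_eq_sum, Finset.sum_mul]
    simp only [mul_assoc]
  simp only [e]
  have hlen : ∀ j, (d2word j).length ≤ 3 := fun j => by rw [length_d2word]; norm_num
  rw [integral_finsetSum, Finset.mul_sum]
  · refine Finset.sum_congr rfl fun j _ => ?_
    rw [integral_const_mul, ← wd_kde_bias hf hK (hlen j) hh, length_d2word]
    simp only [smooth]
    ring
  · intro j _
    exact ((hK.ballFun_wd _ (hlen j)).integrable_mul
      (hf.contDiff.continuous.comp (by fun_prop))).const_mul _

lemma continuous_smooth (hK : KernelAssumptions K) {g : Plane → ℝ} (hg : Continuous g)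
    (h : ℝ) {C : ℝ} (hC : ∀ x y, |g x - g y| ≤ C * ‖x - y‖) :
    Continuous (smooth K g h) := by
  have hb : BallFun K := hK.ballFun_wd [] (by simp)
  have hC0 : 0 ≤ C ∨ C < 0 := le_or_gt 0 C
  have hi : ∀ x, Integrable fun z => K z * g (x - h • z) := fun x =>
    hb.integrable_mul (hg.comp (by fun_prop))
  refine (LipschitzWith.of_dist_le_mul (K := Real.toNNReal |C|) fun x y => ?_).continuous
  rw [Real.coe_toNNReal _ (abs_nonneg C), dist_eq_norm, dist_eq_norm]
  unfold smooth
  rw [← integral_sub (hi x) (hi y)]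
  have h1 : Integrable fun z => K z * (|C| * ‖x - y‖) := hb.integrable.mul_const _
  refine (norm_integral_le_of_norm_le h1 (Eventually.of_forall fun z => ?_)).trans ?_
  · rw [← mul_sub, norm_mul, Real.norm_eq_abs, Real.norm_eq_abs, abs_of_nonneg (hK.nonneg z)]
    refine mul_le_mul_of_nonneg_left ((hC _ _).trans ?_) (hK.nonneg z)
    rw [sub_sub_sub_cancel_right]
    exact mul_le_mul_of_nonneg_right (le_abs_self C) (norm_nonneg _)
  · rw [integral_mul_const, hK.integral_eq_one, one_mul]

/-- The pointwise bias of the weighted second derivatives. -/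
noncomputable def pathBias (f K : Plane → ℝ) (a : ℝ → Space) (c : ℝ → Plane) (h s : ℝ) : ℝ :=
  ∑ j, a s j * (smooth K (wd (d2word j) f) h (c s) - wd (d2word j) f (c s))

lemma PathData.continuous_pathBias (hc : PathData c c' T γ) (hf : DensityAssumptions f H L l)
    (hK : KernelAssumptions K) (ha : Continuous a) (h : ℝ) :
    Continuous (pathBias f K a c h) := by
  obtain ⟨C, hC0, hC⟩ := exists_bound_wd_density hf
  have hcc := hc.continuous
  refine continuous_finsetSum _ fun j _ => ?_
  have hlen : (d2word j).length ≤ 3 := by rw [length_d2word]; norm_num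
  have h1 := (DiffWords.wd (k := 1) (d2word j) (hf.diffWords.mono
    (by rw [length_d2word]; norm_num))).1.continuous
  have h2 := continuous_smooth hK h1 h (wd_lipschitz_of_bound hf.diffWords hC hlen)
  fun_prop

lemma abs_pathBias_le (hf : DensityAssumptions f H L l)
    (hK : KernelAssumptions K) (hA : ∀ s, ‖a s‖ ≤ A) {C : ℝ}
    (hC : ∀ w : List (Fin 2), 1 ≤ w.length → w.length ≤ 4 → ∀ x, |wd w f x| ≤ C) {h : ℝ}
    (hh : 0 ≤ h) (s : ℝ) : |pathBias f K a c h s| ≤ 12 * A * C * h ^ 2 := by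
  have hA0 : 0 ≤ A := (norm_nonneg _).trans (hA 0)
  refine (Finset.abs_sum_le_sum_abs _ _).trans ?_
  have : ∀ j ∈ Finset.univ, |a s j * (smooth K (wd (d2word j) f) h (c s)
      - wd (d2word j) f (c s))| ≤ A * (4 * C * h ^ 2) := by
    intro j _
    rw [abs_mul]
    refine mul_le_mul ((abs_apply_le_norm _ _).trans (hA s)) ?_ (abs_nonneg _) hA0
    exact abs_smooth_sub_le_sq hK (DiffWords.wd (k := 2) (d2word j) (hf.diffWords.mono
      (by rw [length_d2word])))
      (fun u v x => hC (u :: v :: d2word j) (by simp) (by simp [length_d2word]) x) hh (c s)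
  refine (Finset.sum_le_sum this).trans ?_
  simp
  linarith

lemma PathData.integral_pathTerm_sub (hc : PathData c c' T γ) (hf : DensityAssumptions f H L l)
    (hK : KernelAssumptions K) (ha : Continuous a) (hA : ∀ s, ‖a s‖ ≤ A) (U : ℝ) {h : ℝ}
    (hh : 0 < h) : (∫ y, pathTerm (coefKernel a K) c U h y * f y)
      - ∫ s in Ioc 0 U, inner ℝ (a s) (d2 f (c s)) = ∫ s in Ioc 0 U, pathBias f K a c h s := by
  rw [hc.integral_pathTerm_density hf hK ha hA U hh]
  have h1 := (hf.tame.continuous_inner_d2 hc ha).integrableOn_Ioc (μ := volume) (a := 0) (b := U)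
  have h2 := (hc.continuous_pathBias hf hK ha h).integrableOn_Ioc (μ := volume) (a := 0) (b := U)
  have e : ∀ s, ∑ j, a s j * smooth K (wd (d2word j) f) h (c s) =
      pathBias f K a c h s + inner ℝ (a s) (d2 f (c s)) := by
    intro s
    rw [inner_d2_eq_sum, pathBias, ← Finset.sum_add_distrib]
    exact Finset.sum_congr rfl fun j _ => by ring
  simp only [e]
  rw [integral_add h2 h1, add_sub_cancel_right]

lemma vBias_apply (f K : Plane → ℝ) (x : Plane) (j : Fin 3) :
    vBias f K x j = kernelHess K (wd (d2word j) f) x := by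
  fin_cases j
  · rfl
  · rfl
  · rfl

lemma PathData.tendsto_pathBias (hc : PathData c c' T γ) (hf : DensityAssumptions f H L l)
    (hK : KernelAssumptions K) (ha : Continuous a) (hA : ∀ s, ‖a s‖ ≤ A) :
    Tendsto (fun h : ℝ => (∫ s in Ioc 0 T, pathBias f K a c h s) / h ^ 2) (𝓝[>] 0)
      (𝓝 (∫ s in Ioc 0 T, inner ℝ (a s) ((2⁻¹ : ℝ) • vBias f K (c s)))) := by
  obtain ⟨C, hC0, hC⟩ := exists_bound_wd_density hf
  simp only [← integral_div]
  refine tendsto_integral_filter_of_dominated_convergence (bound := fun _ => 12 * A * C) ?_ ?_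
    (integrable_const _) ?_
  · exact Eventually.of_forall fun h =>
      ((hc.continuous_pathBias hf hK ha h).div_const _).aestronglyMeasurable
  · filter_upwards [self_mem_nhdsWithin] with h (hh : 0 < h)
    refine Eventually.of_forall fun s => ?_
    rw [norm_div, Real.norm_eq_abs, Real.norm_eq_abs, abs_of_pos (by positivity : 0 < h ^ 2),
      div_le_iff₀ (by positivity)]
    exact abs_pathBias_le hf hK hA hC hh.le s
  · refine Eventually.of_forall fun s => ?_
    have e : inner ℝ (a s) ((2⁻¹ : ℝ) • vBias f K (c s)) =
        ∑ j, a s j * (2⁻¹ * kernelHess K (wd (d2word j) f) (c s)) := by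
      simp only [PiLp.inner_apply, PiLp.smul_apply, vBias_apply, smul_eq_mul]
      refine Finset.sum_congr rfl fun j _ => ?_
      simp [mul_comm]
    rw [e]
    simp only [pathBias, Finset.sum_div, mul_div_assoc]
    refine tendsto_finsetSum _ fun j _ => Tendsto.const_mul _ ?_
    exact smooth_bias_tendsto hK (DiffWords.wd (k := 2) (d2word j) (hf.diffWords.mono
      (by rw [length_d2word])))
      (fun u v x => hC (u :: v :: d2word j) (by simp) (by simp [length_d2word]) x) (c s)

/-- The covariance that `d² \hat f` accumulates along the curve. -/
noncomputable def pathVar (f K : Plane → ℝ) (a : ℝ → Space) (c c' : ℝ → Plane) (T : ℝ) : ℝ :=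
  ∫ s in Ioc 0 T, ∫ z, coefKernel a K s z *
    ((∫ τ : ℝ, coefKernel a K s (τ • c' s + z)) * f (c s))

variable {Ω : Type*} [MeasurableSpace Ω] {P : Measure Ω} [IsProbabilityMeasure P]
  {X : ℕ → Ω → Plane} {h : ℕ → ℝ} {β : ℝ}

/-- The central limit theorem for empirical means with r = √(nh⁵), applied to `pathTerm`. Its second
moment scales like h⁻⁵, its mean stays bounded, and the bias of order h² is multiplied by √(nh⁵),
whence √β. -/
theorem IIDSample.tendsto_integral_cexp_path (hX : IIDSample f P X)
    (hf : DensityAssumptions f H L l) (hK : KernelAssumptions K) (hh : BandwidthAssumptions h β)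
    (hc : PathData c c' T γ) (ha : Continuous a) (hA : ∀ s, ‖a s‖ ≤ A) :
    Tendsto (fun n : ℕ => ∫ ω, Complex.exp ((√((n : ℝ) * h n ^ 5) *
        ((∫ s in Ioc 0 T, inner ℝ (a s) (d2 (kde K (h n) n fun i => X i ω) (c s)))
          - ∫ s in Ioc 0 T, inner ℝ (a s) (d2 f (c s))) : ℝ) * Complex.I) ∂P) atTop
      (𝓝 (Complex.exp ((√β * ∫ s in Ioc 0 T, inner ℝ (a s) ((2⁻¹ : ℝ) • vBias f K (c s)) : ℝ)
        * Complex.I - (pathVar f K a c c' T : ℝ) / 2))) := by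
  obtain ⟨M, hφ⟩ := exists_pathKernel hK ha hA
  simp only [hc.setIntegral_inner_d2_kde hK ha hA]
  have hr2 : ∀ n : ℕ, √((n : ℝ) * h n ^ 5) ^ 2 = n * h n ^ 5 := fun n => by
    have := hh.pos n
    exact Real.sq_sqrt (by positivity)
  have hbias := (hc.tendsto_pathBias hf hK ha hA).comp hh.tendsto_nhdsGT
  refine hX.tendsto_integral_cexp_emp (M := fun n => 4 * M / γ * (h n)⁻¹ ^ 3)
    (fun n => (hc.continuous_pathTerm hφ T (h n)).measurable)
    (fun n y => hc.abs_pathTerm_le hφ le_rfl (hh.pos n) y) (fun n => Real.sqrt_nonneg _) ?_ ?_ ?_ ?_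
  -- Up to constants the bound on a single summand is √(nh⁵)/n · h⁻³ = (nh)^(-1/2), written here
  -- through nh⁸, which tends to infinity.
  · have h1 : Tendsto (fun n : ℕ => 4 * M / γ * (h n ^ 3 * (√((n : ℝ) * h n ^ 8))⁻¹ * √(h n))) atTop
        (𝓝 (4 * M / γ * (0 ^ 3 * 0 * √0))) := by
      refine Tendsto.const_mul _ (((hh.tendsto_zero.pow 3).mul (tendsto_inv_atTop_zero.comp
        (Real.tendsto_sqrt_atTop.comp hh.tendsto_mul_pow_eight))).mul ?_)
      exact (Real.continuous_sqrt.tendsto 0).comp hh.tendsto_zero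
    simp only [Real.sqrt_zero, mul_zero] at h1
    refine h1.congr' ?_
    filter_upwards [eventually_gt_atTop 0] with n hn
    have hn0 : (0 : ℝ) < n := by exact_mod_cast hn
    have hp := hh.pos n
    have e1 : √((n : ℝ) * h n ^ 8) = √n * h n ^ 4 := by
      rw [show (n : ℝ) * h n ^ 8 = n * (h n ^ 4) ^ 2 by ring, Real.sqrt_mul hn0.le,
        Real.sqrt_sq (by positivity)]
    have e2 : √((n : ℝ) * h n ^ 5) = √n * (h n ^ 2 * √(h n)) := by
      rw [show (n : ℝ) * h n ^ 5 = n * ((h n ^ 2) ^ 2 * h n) by ring, Real.sqrt_mul hn0.le,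
        Real.sqrt_mul (by positivity), Real.sqrt_sq (by positivity)]
    have e3 : (n : ℝ) = √n * √n := (Real.mul_self_sqrt hn0.le).symm
    have e4 : 0 < √(n : ℝ) := Real.sqrt_pos.2 hn0
    rw [e1, e2]
    nth_rewrite 3 [e3]
    field_simp
  · refine ((hc.tendsto_second_moment hφ hf.contDiff.continuous).comp hh.tendsto_nhdsGT).congr' ?_
    filter_upwards [eventually_gt_atTop 0] with n hn
    have hn0 : (n : ℝ) ≠ 0 := by exact_mod_cast hn.ne'
    rw [hr2]
    simp only [Function.comp]
    field_simp
  · have h1 : Tendsto (fun n : ℕ => h n ^ 5 * (h n ^ 2 * ((∫ s in Ioc 0 T, pathBias f K a c (h n) s)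
        / h n ^ 2) + ∫ s in Ioc 0 T, inner ℝ (a s) (d2 f (c s))) ^ 2) atTop (𝓝 _) :=
      (hh.tendsto_zero.pow 5).mul ((((hh.tendsto_zero.pow 2).mul hbias).add_const _).pow 2)
    rw [zero_pow (by norm_num), zero_mul] at h1
    refine h1.congr' ?_
    filter_upwards [eventually_gt_atTop 0] with n hn
    have hn0 : (n : ℝ) ≠ 0 := by exact_mod_cast hn.ne'
    have hp := (hh.pos n).ne'
    rw [hr2, ← hc.integral_pathTerm_sub hf hK ha hA T (hh.pos n)]
    field_simp
    ring
  · have h2 := (Real.continuous_sqrt.tendsto β).comp hh.upper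
    refine (h2.mul hbias).congr fun n => ?_
    have hp := hh.pos n
    rw [hc.integral_pathTerm_sub hf hK ha hA T hp]
    simp only [Function.comp]
    have : (n : ℝ) * h n ^ 9 = n * h n ^ 5 * (h n ^ 2) ^ 2 := by ring
    rw [this, Real.sqrt_mul (by positivity), Real.sqrt_sq (by positivity)]
    field_simp

theorem IIDSample.exists_integral_path_sq_le (hX : IIDSample f P X)
    (hf : DensityAssumptions f H L l) (hK : KernelAssumptions K)
    (hc : PathData c c' T γ) (ha : Continuous a) (hA : ∀ s, ‖a s‖ ≤ A) :
    ∃ C, 0 ≤ C ∧ ∀ h, 0 < h → h ≤ 1 → ∀ n : ℕ, n ≠ 0 → ∀ U ∈ Icc 0 T,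
      ∫ ω, ((∫ s in Ioc 0 U, inner ℝ (a s) (d2 (kde K h n fun i => X i ω) (c s)))
          - ∫ s in Ioc 0 U, inner ℝ (a s) (d2 f (c s))) ^ 2 ∂P ≤
        C * ((n : ℝ)⁻¹ * (h⁻¹) ^ 5 + h ^ 4) := by
  obtain ⟨M, hφ⟩ := exists_pathKernel hK ha hA
  obtain ⟨C, hC0, hC⟩ := exists_bound_wd_density hf
  obtain ⟨v, hv0, hv⟩ := hc.exists_second_moment_le hφ hf.contDiff.continuous
  have hA0 : 0 ≤ A := (norm_nonneg _).trans (hA 0)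
  have hT := hc.nonneg
  refine ⟨v + (12 * A * C * T) ^ 2, by positivity, fun h hh h1 n hn U hU => ?_⟩
  simp only [hc.setIntegral_inner_d2_kde hK ha hA]
  refine (hX.integral_emp_sub_sq_le (hc.continuous_pathTerm hφ U h).measurable
    (fun y => hc.abs_pathTerm_le hφ hU.2 hh y) hn _).trans ?_
  rw [hc.integral_pathTerm_sub hf hK ha hA U hh]
  have h2 : |∫ s in Ioc 0 U, pathBias f K a c h s| ≤ 12 * A * C * h ^ 2 * U := by
    have := norm_setIntegral_le_of_norm_le_const (μ := volume) (s := Ioc 0 U) (by simp)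
      (f := pathBias f K a c h) fun s _ => abs_pathBias_le (c := c) hf hK hA hC hh.le s
    rwa [Real.volume_real_Ioc_of_le hU.1, sub_zero] at this
  have h3 : |∫ s in Ioc 0 U, pathBias f K a c h s| ≤ 12 * A * C * T * h ^ 2 := by
    refine h2.trans ?_
    have : 12 * A * C * h ^ 2 * U ≤ 12 * A * C * h ^ 2 * T := by gcongr; exact hU.2
    linarith
  have h4 : (∫ s in Ioc 0 U, pathBias f K a c h s) ^ 2 ≤ (12 * A * C * T * h ^ 2) ^ 2 :=
    sq_le_sq' (by linarith [(abs_le.1 h3).1]) (abs_le.1 h3).2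
  have h5 := hv U hU h hh h1
  have h6 : 0 ≤ (n : ℝ)⁻¹ * (h⁻¹) ^ 5 := by positivity
  have h7 : 0 ≤ h ^ 4 := by positivity
  calc _ ≤ (n : ℝ)⁻¹ * (v * (h⁻¹) ^ 5) + (12 * A * C * T * h ^ 2) ^ 2 := by gcongr
    _ = v * ((n : ℝ)⁻¹ * (h⁻¹) ^ 5) + (12 * A * C * T) ^ 2 * h ^ 4 := by ring
    _ ≤ _ := by nlinarith [mul_nonneg hv0 h7, mul_nonneg (sq_nonneg (12 * A * C * T)) h6]

end


/-! ### Correlations of functions with support in the disc -/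

/-- The cross-correlation of two functions. -/
noncomputable def crossCorr (φ ψ : Plane → ℝ) (u : Plane) : ℝ := ∫ z, φ z * ψ (u + z)

/-- The integral of a function over the line through the origin in the direction `v`. -/
noncomputable def lineInt (g : Plane → ℝ) (v : Plane) : ℝ := ∫ τ : ℝ, g (τ • v)

section

variable {φ ψ : Plane → ℝ}

lemma crossCorr_neg (φ ψ : Plane → ℝ) (u : Plane) : crossCorr φ ψ (-u) = crossCorr ψ φ u := by
  unfold crossCorr
  rw [← integral_add_left_eq_self (fun z => φ z * ψ (-u + z)) u]
  simp [mul_comm]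

/-- A translation exchanges the two functions at the price of u ↦ -u, and integration over a line
through the origin does not see this reflection. The symmetry of the limiting covariance rests on
it. -/
lemma lineInt_crossCorr_comm (φ ψ : Plane → ℝ) (v : Plane) :
    lineInt (crossCorr φ ψ) v = lineInt (crossCorr ψ φ) v := by
  unfold lineInt
  rw [← integral_neg_eq_self]
  simp only [neg_smul, crossCorr_neg]

lemma lineInt_neg (g : Plane → ℝ) (v : Plane) : lineInt g (-v) = lineInt g v := by
  unfold lineInt
  rw [← integral_neg_eq_self]
  simp

lemma BallFun.crossCorr_eq_zero (hφ : BallFun φ) (hψ : BallFun ψ) {u : Plane} (hu : 2 < ‖u‖) :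
    crossCorr φ ψ u = 0 := by
  unfold crossCorr
  rw [integral_eq_zero_of_ae]
  refine Eventually.of_forall fun z => ?_
  by_cases hz : 1 < ‖z‖
  · simp [hφ.supp z hz]
  · have : 1 < ‖u + z‖ := by
      have := norm_sub_le (u + z) z
      rw [add_sub_cancel_right] at this
      linarith [not_lt.1 hz]
    simp [hψ.supp _ this]

lemma BallFun.exists_abs_crossCorr_le (hφ : BallFun φ) (hψ : BallFun ψ) :
    ∃ C, 0 ≤ C ∧ ∀ u, |crossCorr φ ψ u| ≤ C := by
  obtain ⟨M, hM0, hM⟩ := hψ.bounded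
  refine ⟨∫ z, |φ z| * M, integral_nonneg fun z => mul_nonneg (abs_nonneg _) hM0, fun u => ?_⟩
  rw [crossCorr, ← Real.norm_eq_abs]
  refine norm_integral_le_of_norm_le (hφ.integrable.abs.mul_const _)
    (Eventually.of_forall fun z => ?_)
  rw [norm_mul]
  exact mul_le_mul_of_nonneg_left (hM _) (norm_nonneg _)

lemma BallFun.continuous_crossCorr (hφ : BallFun φ) (hψ : BallFun ψ) :
    Continuous (crossCorr φ ψ) := by
  obtain ⟨M, hM0, hM⟩ := hψ.bounded
  have hc := hψ.cont
  have hc' := hφ.cont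
  refine continuous_of_dominated (bound := fun z => |φ z| * M) (fun u => ?_) (fun u => ?_)
    (hφ.integrable.abs.mul_const _) ?_
  · exact (by fun_prop : Continuous fun z => φ z * ψ (u + z)).aestronglyMeasurable
  · refine Eventually.of_forall fun z => ?_
    rw [norm_mul]
    exact mul_le_mul_of_nonneg_left (hM _) (norm_nonneg _)
  · exact Eventually.of_forall fun z => by fun_prop

lemma integrable_comp_smul {g : Plane → ℝ} (hg : Continuous g) (hs : ∀ u, 2 < ‖u‖ → g u = 0)
    {v : Plane} (hv : v ≠ 0) : Integrable fun τ : ℝ => g (τ • v) := by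
  refine Continuous.integrable_of_hasCompactSupport (by fun_prop)
    (HasCompactSupport.intro (isCompact_Icc (a := -(2 / ‖v‖)) (b := 2 / ‖v‖)) fun τ hτ => hs _ ?_)
  rw [norm_smul, Real.norm_eq_abs, ← div_lt_iff₀ (norm_pos_iff.2 hv)]
  by_contra h
  exact hτ (abs_le.1 (not_lt.1 h))

/-- For w near v one has ‖w‖ > ‖v‖/2, so g(τw) vanishes for |τ| > 4/‖v‖ and a fixed bounded interval
dominates. Hence the condition v ≠ 0. -/
lemma continuousAt_lineInt {g : Plane → ℝ} (hg : Continuous g) (hs : ∀ u, 2 < ‖u‖ → g u = 0)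
    {C : ℝ} (hC : ∀ u, |g u| ≤ C) {v : Plane} (hv : v ≠ 0) :
    ContinuousAt (lineInt g) v := by
  have hv0 : 0 < ‖v‖ := norm_pos_iff.2 hv
  refine continuousAt_of_dominated
    (bound := (Icc (-(4 / ‖v‖)) (4 / ‖v‖)).indicator fun _ => C) ?_ ?_
    ((integrableOn_const (by simp)).integrable_indicator measurableSet_Icc) ?_
  · exact Eventually.of_forall fun w =>
      (by fun_prop : Continuous fun τ : ℝ => g (τ • w)).aestronglyMeasurable
  · have : ∀ᶠ w in 𝓝 v, ‖v‖ / 2 < ‖w‖ :=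
      continuous_norm.continuousAt.eventually (lt_mem_nhds (by linarith))
    filter_upwards [this] with w hw
    refine Eventually.of_forall fun τ => ?_
    by_cases hτ : τ ∈ Icc (-(4 / ‖v‖)) (4 / ‖v‖)
    · rw [indicator_of_mem hτ]
      exact hC _
    · rw [indicator_of_notMem hτ, hs, norm_zero]
      have h1 : 4 / ‖v‖ < |τ| := by
        by_contra h
        exact hτ (abs_le.1 (not_lt.1 h))
      rw [div_lt_iff₀ hv0] at h1
      rw [norm_smul, Real.norm_eq_abs]
      have h2 : 0 < |τ| := by
        by_contra h
        have := abs_nonneg τ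
        have h3 : |τ| = 0 := le_antisymm (not_lt.1 h) this
        rw [h3] at h1; linarith
      nlinarith
  · exact Eventually.of_forall fun τ => by fun_prop

/-- Fubini's theorem applies because v ≠ 0: the supports of both factors confine z to the unit disc
and τ to |τ| ≤ 2/‖v‖. -/
lemma BallFun.integral_mul_integral_line (hφ : BallFun φ) (hψ : BallFun ψ) {v : Plane}
    (hv : v ≠ 0) : ∫ z, φ z * ∫ τ : ℝ, ψ (τ • v + z) = lineInt (crossCorr φ ψ) v := by
  have hc := hψ.cont
  have hc' := hφ.cont
  have hv0 : 0 < ‖v‖ := norm_pos_iff.2 hv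
  have hint : Integrable (Function.uncurry fun (z : Plane) (τ : ℝ) => φ z * ψ (τ • v + z))
      ((volume : Measure Plane).prod volume) := by
    refine Continuous.integrable_of_hasCompactSupport (by unfold Function.uncurry; fun_prop)
      (HasCompactSupport.intro ((isCompact_closedBall (0 : Plane) 1).prod
        (isCompact_Icc (a := -(2 / ‖v‖)) (b := 2 / ‖v‖))) fun p hp => ?_)
    obtain ⟨z, τ⟩ := p
    simp only [Function.uncurry]
    by_cases hz : 1 < ‖z‖
    · rw [hφ.supp z hz, zero_mul]
    · rw [hψ.supp, mul_zero]
      have h1 : 2 / ‖v‖ < |τ| := by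
        by_contra h
        exact hp ⟨by simpa using not_lt.1 hz, abs_le.1 (not_lt.1 h)⟩
      rw [div_lt_iff₀ hv0] at h1
      have h2 := norm_sub_le (τ • v + z) z
      rw [add_sub_cancel_right, norm_smul, Real.norm_eq_abs] at h2
      linarith [not_lt.1 hz]
  simp only [← integral_const_mul]
  rw [integral_integral_swap hint]
  rfl

lemma BallFun.crossCorr_sum {ι : Type*} (s : Finset ι) {φ : ι → Plane → ℝ}
    (hφ : ∀ i, BallFun (φ i)) (a : ι → ℝ) (u : Plane) :
    crossCorr (fun z => ∑ i ∈ s, a i * φ i z) (fun z => ∑ i ∈ s, a i * φ i z) u =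
      ∑ i ∈ s, ∑ j ∈ s, a i * a j * crossCorr (φ i) (φ j) u := by
  unfold crossCorr
  have hi : ∀ i j, Integrable fun z => φ i z * φ j (u + z) := fun i j =>
    (hφ i).integrable_mul ((hφ j).cont.comp (by fun_prop))
  simp only [Finset.sum_mul_sum]
  rw [integral_finsetSum]
  · refine Finset.sum_congr rfl fun i _ => ?_
    rw [integral_finsetSum]
    · refine Finset.sum_congr rfl fun j _ => ?_
      rw [← integral_const_mul]
      congr 1; funext z; ring
    · intro j _
      exact ((hi i j).const_mul (a i * a j)).congr (Eventually.of_forall fun z => by ring)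
  · intro i _
    refine integrable_finsetSum _ fun j _ => ?_
    exact ((hi i j).const_mul (a i * a j)).congr (Eventually.of_forall fun z => by ring)

end

lemma innerCov_apply (f K : Plane → ℝ) (x : Plane) (i j : Fin 3) :
    innerCov f K x i j =
      f x * lineInt (crossCorr (wd (d2word i) K) (wd (d2word j) K)) (V f x) := by
  simp only [innerCov, Matrix.of_apply, d2_apply, integral_mul_const, lineInt, crossCorr]
  rw [mul_comm]

lemma innerCov_symm (f K : Plane → ℝ) (x : Plane) : (innerCov f K x)ᵀ = innerCov f K x := by
  ext i j
  rw [Matrix.transpose_apply, innerCov_apply, innerCov_apply, lineInt_crossCorr_comm]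

lemma KernelAssumptions.ballFun_d2word {K : Plane → ℝ} (hK : KernelAssumptions K) (j : Fin 3) :
    BallFun (wd (d2word j) K) := hK.ballFun_wd _ (by rw [length_d2word]; norm_num)

lemma continuousAt_innerCov {f K : Plane → ℝ} (hf : Tame f) (hK : KernelAssumptions K)
    {x : Plane} (hx : V f x ≠ 0) (i j : Fin 3) : ContinuousAt (fun x => innerCov f K x i j) x := by
  simp only [innerCov_apply]
  obtain ⟨C, hC0, hC⟩ := (hK.ballFun_d2word i).exists_abs_crossCorr_le (hK.ballFun_d2word j)
  refine (hf.diff.1.continuous.continuousAt).mul (ContinuousAt.comp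
    (g := lineInt (crossCorr (wd (d2word i) K) (wd (d2word j) K))) (f := V f) ?_
    hf.continuous_V.continuousAt)
  exact continuousAt_lineInt ((hK.ballFun_d2word i).continuous_crossCorr (hK.ballFun_d2word j))
    (fun u hu => (hK.ballFun_d2word i).crossCorr_eq_zero (hK.ballFun_d2word j) hu) hC hx

/-- The accumulated covariance as an integral of a quadratic form. -/
lemma pathVar_eq {f K : Plane → ℝ} (hK : KernelAssumptions K) (a : ℝ → Space)
    {c c' : ℝ → Plane} {T σ : ℝ} (hσ : σ = 1 ∨ σ = -1) (hc' : ∀ s, c' s = σ • V f (c s))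
    (hV : ∀ s, V f (c s) ≠ 0) :
    pathVar f K a c c' T = ∫ s in Ioc 0 T, inner ℝ (a s) (act (innerCov f K (c s)) (a s)) := by
  unfold pathVar
  congr 1; funext s
  have hB := hK.ballFun_d2word
  have hφ : coefKernel a K s = fun z => ∑ j, a s j * wd (d2word j) K z :=
    funext fun z => coefKernel_eq_sum _ _ _ _
  have hball : BallFun (coefKernel a K s) := by
    rw [hφ]
    refine ⟨continuous_finsetSum _ fun j _ => (hB j).cont.const_mul _, fun z hz => ?_⟩
    exact Finset.sum_eq_zero fun j _ => by rw [(hB j).supp z hz, mul_zero]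
  have hne : c' s ≠ 0 := by
    rw [hc']
    rcases hσ with rfl | rfl <;> simpa using hV s
  have h1 := hball.integral_mul_integral_line hball hne
  simp only [← mul_assoc]
  rw [integral_mul_const, h1]
  have h2 : lineInt (crossCorr (coefKernel a K s) (coefKernel a K s)) (c' s) =
      lineInt (crossCorr (coefKernel a K s) (coefKernel a K s)) (V f (c s)) := by
    rw [hc']
    rcases hσ with rfl | rfl
    · rw [one_smul]
    · rw [neg_one_smul, lineInt_neg]
  rw [h2, hφ]
  have h3 : lineInt (crossCorr (fun z => ∑ j, a s j * wd (d2word j) K z)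
      (fun z => ∑ j, a s j * wd (d2word j) K z)) (V f (c s)) =
      ∑ i, ∑ j, a s i * a s j *
        lineInt (crossCorr (wd (d2word i) K) (wd (d2word j) K)) (V f (c s)) := by
    have hi : ∀ i j, Integrable fun τ : ℝ =>
        crossCorr (wd (d2word i) K) (wd (d2word j) K) (τ • V f (c s)) := fun i j =>
      integrable_comp_smul ((hB i).continuous_crossCorr (hB j))
        (fun u hu => (hB i).crossCorr_eq_zero (hB j) hu) (hV s)
    unfold lineInt
    simp only [BallFun.crossCorr_sum _ hB]
    rw [integral_finsetSum]
    · refine Finset.sum_congr rfl fun i _ => ?_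
      rw [integral_finsetSum]
      · exact Finset.sum_congr rfl fun j _ => integral_const_mul _ _
      · exact fun j _ => (hi i j).const_mul _
    · exact fun i _ => integrable_finsetSum _ fun j _ => (hi i j).const_mul _
  rw [h3]
  simp only [PiLp.inner_apply, act_apply, innerCov_apply, Finset.sum_mul]
  refine Finset.sum_congr rfl fun i _ => ?_
  rw [RCLike.inner_apply, Finset.sum_mul]
  refine Finset.sum_congr rfl fun j _ => ?_
  simp
  ring

/-- Positivity is not visible in the quadratic form itself, but the form is a limit of scaled second
moments. The positive semidefiniteness of Σ(θ) comes from here. -/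
lemma PathData.pathVar_nonneg {f K : Plane → ℝ} {H L : Set Plane} {l : ℝ}
    {c c' : ℝ → Plane} {T γ : ℝ} {a : ℝ → Space} {A : ℝ} (hc : PathData c c' T γ)
    (hf : DensityAssumptions f H L l) (hK : KernelAssumptions K) (ha : Continuous a)
    (hA : ∀ s, ‖a s‖ ≤ A) : 0 ≤ pathVar f K a c c' T := by
  obtain ⟨M, hφ⟩ := exists_pathKernel hK ha hA
  refine ge_of_tendsto (hc.tendsto_second_moment hφ hf.contDiff.continuous) ?_
  filter_upwards [self_mem_nhdsWithin] with h (hh : 0 < h)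
  exact mul_nonneg (by positivity) (integral_nonneg fun y => mul_nonneg (sq_nonneg _) (hf.nonneg y))


/-! ### Integral curves of functions that are close to the density -/

section

variable {f g : Plane → ℝ} {H L : Set Plane} {a : ℝ}

lemma Close.mono {R ε ε' : ℝ} (h : Close f g R ε) (hε : ε ≤ ε') : Close f g R ε' :=
  fun x hx w h1 h3 => (h x hx w h1 h3).trans hε

lemma Close.norm_grad_sub_le {R ε : ℝ} (h : Close f g R ε) {x : Plane} (hx : ‖x‖ ≤ R) :
    ‖grad g x - grad f x‖ ≤ 2 * ε := by
  refine (norm_le_sum_abs _).trans ?_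
  have h0 := h x (by simpa using hx) [0] (by simp) (by simp)
  have h1 := h x (by simpa using hx) [1] (by simp) (by simp)
  rw [Fin.sum_univ_two, PiLp.sub_apply, PiLp.sub_apply, grad_apply, grad_apply, grad_apply,
    grad_apply]
  linarith

lemma Close.norm_d2_sub_le {R ε : ℝ} (h : Close f g R ε) {x : Plane} (hx : ‖x‖ ≤ R) :
    ‖d2 g x - d2 f x‖ ≤ 3 * ε := by
  refine Filament.norm_d2_sub_le fun j => ?_
  rw [d2_apply, d2_apply]
  exact h x (by simpa using hx) _ (by simp [length_d2word]) (by simp [length_d2word])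

/-- On a ball, `d² g - d² f` is Lipschitz continuous with a small constant. -/
lemma Close.norm_d2_sub_sub_le {R ε : ℝ} (h : Close f g R ε) (hf : Tame f) (hg : Tame g)
    {x y : Plane} (hx : ‖x‖ ≤ R) (hy : ‖y‖ ≤ R) :
    ‖(d2 g y - d2 f y) - (d2 g x - d2 f x)‖ ≤ 6 * ε * ‖y - x‖ := by
  have : ‖(d2 g y - d2 f y) - (d2 g x - d2 f x)‖ ≤ 3 * (2 * ε * ‖y - x‖) := by
    refine Filament.norm_d2_sub_le fun j => ?_
    have hfd := (DiffWords.wd (k := 1) (d2word j) (by rw [length_d2word]; exact hf.diff)).1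
    have hgd := (DiffWords.wd (k := 1) (d2word j) (by rw [length_d2word]; exact hg.diff)).1
    have := abs_sub_le_of_dir (g := fun x => wd (d2word j) g x - wd (d2word j) f x) (C := ε)
      (convex_closedBall (0 : Plane) R) (hgd.sub hfd) (fun x hx b => ?_)
      (by simpa using hx) (by simpa using hy)
    · simpa [d2_apply] using this
    · rw [dir_sub hgd hfd]
      exact h x hx (b :: d2word j) (by simp) (by simp [length_d2word])
  linarith

lemma Tame.lipschitz_grad (hf : Tame f) :
    ∃ C, 0 ≤ C ∧ ∀ x y, ‖grad f x - grad f y‖ ≤ C * ‖x - y‖ := by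
  obtain ⟨C, hC⟩ := hf.bdd
  have hC0 : 0 ≤ C := (abs_nonneg _).trans (hC [0] (by simp) (by simp) 0)
  refine ⟨4 * C, by positivity, fun x y => (norm_le_sum_abs _).trans ?_⟩
  have : ∀ k : Fin 2, |wd [k] f x - wd [k] f y| ≤ 2 * C * ‖x - y‖ := fun k =>
    wd_lipschitz (hf.diff.mono (by simp)) (fun b x => hC (b :: [k]) (by simp) (by simp) x) x y
  rw [Fin.sum_univ_two, PiLp.sub_apply, PiLp.sub_apply, grad_apply, grad_apply, grad_apply,
    grad_apply]
  linarith [this 0, this 1]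

lemma Tame.exists_norm_grad_le (hf : Tame f) : ∃ C, 0 ≤ C ∧ ∀ x, ‖grad f x‖ ≤ C := by
  obtain ⟨C, hC⟩ := hf.bdd
  have hC0 : 0 ≤ C := (abs_nonneg _).trans (hC [0] (by simp) (by simp) 0)
  refine ⟨2 * C, by positivity, fun x => (norm_le_sum_abs _).trans ?_⟩
  rw [Fin.sum_univ_two, grad_apply, grad_apply]
  linarith [hC [0] (by simp) (by simp) x, hC [1] (by simp) (by simp) x]

/-- A first order Taylor expansion with a uniform quadratic remainder. -/
lemma abs_taylor_le {F : Plane → ℝ} (hF : DiffWords 2 F) {C : ℝ}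
    (hC : ∀ a b x, |dir a (dir b F) x| ≤ C) (x v : Plane) :
    |F (x + v) - F x - fderiv ℝ F x v| ≤ 4 * C * ‖v‖ ^ 2 := by
  have hC0 : 0 ≤ C := (abs_nonneg _).trans (hC 0 0 0)
  have hlin : Differentiable ℝ fun y => fderiv ℝ F x y := (fderiv ℝ F x).differentiable
  have h := abs_sub_le_of_dir (g := fun y => F y - fderiv ℝ F x y) (C := 2 * C * ‖v‖)
    (convex_closedBall x ‖v‖) (hF.1.sub hlin) (fun y hy b => ?_)
    (Metric.mem_closedBall_self (norm_nonneg v)) (y := x + v) (by simp)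
  · rw [add_sub_cancel_left, map_add] at h
    calc _ = |F (x + v) - (fderiv ℝ F x x + fderiv ℝ F x v) - (F x - fderiv ℝ F x x)| := by
          congr 1; ring
      _ ≤ _ := h
      _ = _ := by ring
  · rw [dir_sub hF.1 hlin]
    have e : dir b (fun y => fderiv ℝ F x y) y = dir b F x := by
      unfold dir
      rw [ContinuousLinearMap.fderiv]
    change |dir b F y - dir b (fun y => fderiv ℝ F x y) y| ≤ _
    rw [e]
    have := abs_sub_le_of_dir convex_univ (hF.2 b).1 (fun z _ a => hC a b z) (mem_univ x) (mem_univ y)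
    refine this.trans ?_
    gcongr
    simpa [dist_eq_norm] using hy

lemma DensityAssumptions.exists_norm_d2_taylor_le (hf : DensityAssumptions f H L a) :
    ∃ C, 0 ≤ C ∧ ∀ x v, ‖d2 f (x + v) - d2 f x - fderiv ℝ (d2 f) x v‖ ≤ C * ‖v‖ ^ 2 := by
  obtain ⟨C, hC0, hC⟩ := exists_bound_wd_density hf
  refine ⟨12 * C, by positivity, fun x v => ?_⟩
  have : ‖(d2 f (x + v) - d2 f x) - fderiv ℝ (d2 f) x v‖ ≤ 3 * (4 * C * ‖v‖ ^ 2) := by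
    refine norm_d2_sub_le fun j => ?_
    rw [PiLp.sub_apply, d2_apply, d2_apply, fderiv_d2_apply hf.tame.diff]
    exact abs_taylor_le (DiffWords.wd (k := 2) (d2word j) (hf.diffWords.mono
      (by rw [length_d2word])))
      (fun u v x => hC (u :: v :: d2word j) (by simp) (by simp [length_d2word]) x) x v
  linarith

lemma DensityAssumptions.exists_norm_grad_taylor_le (hf : DensityAssumptions f H L a) :
    ∃ C, 0 ≤ C ∧ ∀ x v, ‖grad f (x + v) - grad f x - act (hess f x) v‖ ≤ C * ‖v‖ ^ 2 := by
  obtain ⟨C, hC0, hC⟩ := exists_bound_wd_density hf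
  refine ⟨8 * C, by positivity, fun x v => (norm_le_sum_abs _).trans ?_⟩
  have hd := fderiv_grad_apply (hf.diffWords.mono (by norm_num)) x v
  have key : ∀ k : Fin 2, |(grad f (x + v) - grad f x - act (hess f x) v) k| ≤ 4 * C * ‖v‖ ^ 2 := by
    intro k
    have h1 := hasFDerivAt_apply hd.1 k
    have e : (fun y => grad f y k) = wd [k] f := by funext y; exact grad_apply f y k
    rw [e] at h1
    have h2 : fderiv ℝ (wd [k] f) x v = act (hess f x) v k := by
      rw [h1.fderiv, ← hd.2]; rfl
    rw [PiLp.sub_apply, PiLp.sub_apply, grad_apply, grad_apply, ← h2]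
    exact abs_taylor_le (DiffWords.wd (k := 2) [k] (hf.diffWords.mono (by simp)))
      (fun u v x => hC (u :: v :: [k]) (by simp) (by simp) x) x v
  rw [Fin.sum_univ_two]
  linarith [key 0, key 1]

/-- On a ball, `∇g - ∇f` is Lipschitz continuous with a small constant. -/
lemma Close.norm_grad_sub_sub_le {R ε : ℝ} (h : Close f g R ε) (hf : Tame f) (hg : Tame g)
    {x y : Plane} (hx : ‖x‖ ≤ R) (hy : ‖y‖ ≤ R) :
    ‖(grad g y - grad f y) - (grad g x - grad f x)‖ ≤ 4 * ε * ‖y - x‖ := by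
  refine (norm_le_sum_abs _).trans ?_
  have key : ∀ k : Fin 2, |((grad g y - grad f y) - (grad g x - grad f x)) k| ≤
      2 * ε * ‖y - x‖ := by
    intro k
    have hfd := (DiffWords.wd (k := 1) [k] (hf.diff.mono (by simp))).1
    have hgd := (DiffWords.wd (k := 1) [k] (hg.diff.mono (by simp))).1
    have := abs_sub_le_of_dir (g := fun x => wd [k] g x - wd [k] f x) (C := ε)
      (convex_closedBall (0 : Plane) R) (hgd.sub hfd) (fun x hx b => ?_)
      (by simpa using hx) (by simpa using hy)
    · simpa [grad_apply] using this
    · rw [dir_sub hgd hfd]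
      exact h x hx (b :: [k]) (by simp) (by simp)
  rw [Fin.sum_univ_two]
  linarith [key 0, key 1]

lemma abs_inner_sub_inner_le {u v w y : Plane} {e A B : ℝ} (h1 : ‖u - w‖ ≤ e) (h2 : ‖v - y‖ ≤ e)
    (he : e ≤ 1) (hA : ‖w‖ ≤ A) (hB : ‖y‖ ≤ B) :
    |inner ℝ u v - inner ℝ w y| ≤ e * (1 + A + B) := by
  have he0 : 0 ≤ e := (norm_nonneg _).trans h1
  have h : inner ℝ u v - inner ℝ w y =
      inner ℝ (u - w) (v - y) + inner ℝ (u - w) y + inner ℝ w (v - y) := by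
    simp only [inner_sub_left, inner_sub_right]; ring
  rw [h]
  have k1 := abs_real_inner_le_norm (u - w) (v - y)
  have k2 := abs_real_inner_le_norm (u - w) y
  have k3 := abs_real_inner_le_norm w (v - y)
  have m1 : ‖u - w‖ * ‖v - y‖ ≤ e * 1 := mul_le_mul h1 (h2.trans he) (norm_nonneg _) he0
  have m2 : ‖u - w‖ * ‖y‖ ≤ e * B := mul_le_mul h1 hB (norm_nonneg _) he0
  have m3 : ‖w‖ * ‖v - y‖ ≤ A * e := mul_le_mul hA h2 (norm_nonneg _) ((norm_nonneg _).trans hA)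
  have := abs_add_three (inner ℝ (u - w) (v - y)) (inner ℝ (u - w) y) (inner ℝ w (v - y))
  linarith

/-- The integral curves of `f` and `g` from `x₀` are `η`-close up to the time `T`, together with
the fields along them. -/
structure Near (f g : Plane → ℝ) (x₀ : Plane) (T η : ℝ) : Prop where
  curve : ∀ t, |t| ≤ T → ‖curve g x₀ t - curve f x₀ t‖ ≤ η
  grad : ∀ t, |t| ≤ T → ‖grad g (Filament.curve g x₀ t) - grad f (Filament.curve f x₀ t)‖ ≤ η
  field : ∀ t, |t| ≤ T → ‖V g (Filament.curve g x₀ t) - V f (Filament.curve f x₀ t)‖ ≤ η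
  eigen : ∀ t, |t| ≤ T → |lam2 g (Filament.curve g x₀ t) - lam2 f (Filament.curve f x₀ t)| ≤ η
  slope : ∀ t, |t| ≤ T →
    |dirSlope g (Filament.curve g x₀ t) - dirSlope f (Filament.curve f x₀ t)| ≤ η

/-- Gronwall's inequality keeps the curves within D ε of each other; the factor 72 = 24·3 in D
combines the Lipschitz constant of `G` with the closeness of the second derivatives. The ball of
radius R contains the 1-neighbourhood of the true curve, so closeness on that ball may be used along
the estimated curve as well. Lipschitz bounds transfer the estimate to the gradient, the field, the
eigenvalue and the slope. -/
theorem Tame.exists_near (hf : Tame f) {x₀ : Plane} {T R : ℝ} (hT : 0 ≤ T)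
    (hR : ∀ t, |t| ≤ T → ‖Filament.curve f x₀ t‖ + 1 ≤ R) {η : ℝ} (hη : 0 < η) :
    ∃ ε > 0, ε ≤ η ∧ ∀ g, Tame g → Close f g R ε → Near f g x₀ T η := by
  obtain ⟨CV, hCV0, hCV⟩ := hf.lipschitz_V
  obtain ⟨CD, hCD0, hCD⟩ := hf.lipschitz_d2
  obtain ⟨CG, hCG0, hCG⟩ := hf.lipschitz_grad
  obtain ⟨BV, hBV0, hBV⟩ := hf.bounded_V
  obtain ⟨BG, hBG0, hBG⟩ := hf.exists_norm_grad_le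
  -- the distance of the curves is at most `D * ε`
  set D := Real.exp (CV * T) * (T * 72) with hD
  have hD0 : 0 ≤ D := by positivity
  set N := (D + 1) + (2 + CG * D) + 24 * (3 + CD * D) with hN
  have hN1 : 1 ≤ N := by nlinarith [mul_nonneg hCG0 hD0, mul_nonneg hCD0 hD0]
  set Q := N * (1 + BV + BG + 1) + 1 with hQ
  have hQN : N ≤ Q := by nlinarith
  have hQ1 : 1 ≤ Q := hN1.trans hQN
  have hQ0 : 0 < Q := by linarith
  refine ⟨min 1 η / (2 * Q), by positivity, ?_, fun g hg hc => ?_⟩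
  · rw [div_le_iff₀ (by positivity)]
    have : min 1 η ≤ η := min_le_right _ _
    nlinarith
  set ε := min 1 η / (2 * Q) with hε
  have hε0 : 0 < ε := by positivity
  have hQε : Q * ε ≤ min 1 η / 2 := by
    rw [hε]; apply le_of_eq; field_simp
  have h1 : Q * ε ≤ 1 / 2 := hQε.trans (by linarith [min_le_left 1 η])
  have h2 : Q * ε ≤ η := hQε.trans (by linarith [min_le_right 1 η, lt_min one_pos hη])
  have hNε : N * ε ≤ Q * ε := mul_le_mul_of_nonneg_right hQN hε0.le
  have hVclose : ∀ x, ‖x‖ ≤ R → ‖V g x - V f x‖ ≤ 72 * ε := fun x hx => by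
    refine (norm_G_sub_le _ _).trans ?_
    linarith [hc.norm_d2_sub_le hx]
  have hball : ∀ t, |t| ≤ T → ∀ x, ‖x - Filament.curve f x₀ t‖ ≤ 1 → ‖x‖ ≤ R := by
    intro t ht x hx
    have : x = (x - Filament.curve f x₀ t) + Filament.curve f x₀ t := by abel
    rw [this]
    exact (norm_add_le _ _).trans (by linarith [hR t ht])
  have hDN : D ≤ N := by nlinarith [mul_nonneg hCG0 hD0, mul_nonneg hCD0 hD0]
  have hDε : D * ε ≤ N * ε := mul_le_mul_of_nonneg_right hDN hε0.le
  have hcurve : ∀ t, |t| ≤ T → ‖Filament.curve g x₀ t - Filament.curve f x₀ t‖ ≤ D * ε := by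
    intro t ht
    refine (norm_curve_sub_le hf hg hCV0 hCV (T := T) (ε := 72 * ε) (ρ := 1) (by positivity)
      (fun t ht x hx => hVclose x (hball t ht x hx)) ?_ ht).trans ?_
    · calc Real.exp (CV * T) * (T * (72 * ε)) = D * ε := by rw [hD]; ring
        _ < 1 := by linarith
    · calc _ ≤ Real.exp (CV * T) * (T * (72 * ε)) := by gcongr
        _ = D * ε := by rw [hD]; ring
  have hcR : ∀ t, |t| ≤ T → ‖Filament.curve g x₀ t‖ ≤ R := fun t ht =>
    hball t ht _ ((hcurve t ht).trans (by linarith))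
  have hgrad : ∀ t, |t| ≤ T →
      ‖Filament.grad g (Filament.curve g x₀ t) - Filament.grad f (Filament.curve f x₀ t)‖ ≤ N * ε := by
    intro t ht
    have e1 := hc.norm_grad_sub_le (hcR t ht)
    have e2 := hCG (Filament.curve g x₀ t) (Filament.curve f x₀ t)
    have e3 := mul_le_mul_of_nonneg_left (hcurve t ht) hCG0
    have e4 := norm_sub_le_norm_sub_add_norm_sub (Filament.grad g (Filament.curve g x₀ t))
      (Filament.grad f (Filament.curve g x₀ t)) (Filament.grad f (Filament.curve f x₀ t))
    have e5 : (2 + CG * D) * ε ≤ N * ε := by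
      refine mul_le_mul_of_nonneg_right ?_ hε0.le
      nlinarith [mul_nonneg hCD0 hD0]
    linarith
  have hd2 : ∀ t, |t| ≤ T →
      ‖d2 g (Filament.curve g x₀ t) - d2 f (Filament.curve f x₀ t)‖ ≤ (3 + CD * D) * ε := by
    intro t ht
    have e1 := hc.norm_d2_sub_le (hcR t ht)
    have e2 := hCD (Filament.curve g x₀ t) (Filament.curve f x₀ t)
    have e3 := mul_le_mul_of_nonneg_left (hcurve t ht) hCD0
    have e4 := norm_sub_le_norm_sub_add_norm_sub (d2 g (Filament.curve g x₀ t))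
      (d2 f (Filament.curve g x₀ t)) (d2 f (Filament.curve f x₀ t))
    linarith
  have h24 : 24 * ((3 + CD * D) * ε) ≤ N * ε := by
    rw [← mul_assoc]
    refine mul_le_mul_of_nonneg_right ?_ hε0.le
    nlinarith [mul_nonneg hCG0 hD0]
  have hfield : ∀ t, |t| ≤ T →
      ‖V g (Filament.curve g x₀ t) - V f (Filament.curve f x₀ t)‖ ≤ N * ε := fun t ht =>
    (norm_G_sub_le _ _).trans (by linarith [hd2 t ht])
  refine ⟨fun t ht => ?_, fun t ht => ?_, fun t ht => ?_, fun t ht => ?_, fun t ht => ?_⟩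
  · linarith [hcurve t ht]
  · linarith [hgrad t ht]
  · linarith [hfield t ht]
  · refine (abs_J_sub_le _ _).trans ?_
    have := hd2 t ht
    have h0 := (norm_nonneg _).trans this
    linarith
  · have e1 := hgrad t ht
    have e2 := hfield t ht
    have hQe : N * ε * (1 + BG + BV) ≤ Q * ε := by
      have e3 : Q * ε = N * ε * (1 + BG + BV) + N * ε + ε := by rw [hQ]; ring
      have e4 : 0 ≤ N * ε := by positivity
      linarith
    exact (abs_inner_sub_inner_le e1 e2 (by linarith) (hBG _) (hBV _)).trans (hQe.trans h2)

end


/-! ### The end point of the estimated curve -/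

lemma Near.mono {f g : Plane → ℝ} {x₀ : Plane} {T η η' : ℝ} (h : Near f g x₀ T η) (hη : η ≤ η') :
    Near f g x₀ T η' :=
  ⟨fun t ht => (h.1 t ht).trans hη, fun t ht => (h.2 t ht).trans hη, fun t ht => (h.3 t ht).trans hη,
    fun t ht => (h.4 t ht).trans hη, fun t ht => (h.5 t ht).trans hη⟩

lemma Tame.continuous_lam2 {g : Plane → ℝ} (hg : Tame g) : Continuous (lam2 g) :=
  continuous_J.comp hg.continuous_d2

lemma Tame.continuous_grad {g : Plane → ℝ} (hg : Tame g) : Continuous (grad g) :=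
  continuous_iff_continuousAt.2 fun x =>
    (fderiv_grad_apply (hg.diff.mono (by norm_num)) x 0).1.continuousAt

lemma Tame.continuous_dirSlope {g : Plane → ℝ} (hg : Tame g) : Continuous (dirSlope g) :=
  hg.continuous_grad.inner hg.continuous_V

/-- Along an integral curve the gradient moves in the direction of the field. -/
lemma Tame.hasDerivAt_grad_curve {g : Plane → ℝ} (hg : Tame g) (x₀ : Plane) (t : ℝ) :
    HasDerivAt (fun t => grad g (curve g x₀ t))
      (lam2 g (curve g x₀ t) • V g (curve g x₀ t)) t := by
  have h := fderiv_grad_apply (hg.diff.mono (by norm_num)) (curve g x₀ t) (V g (curve g x₀ t))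
  have h2 := h.1.comp_hasDerivAt t ((hg.curve_spec x₀).2 t)
  rw [h.2, act_hess_V] at h2
  exact h2

lemma norm_sub_sub_smul_le {y y' : ℝ → Plane} (hy : ∀ t, HasDerivAt y (y' t) t) {v : Plane}
    {θ δ η : ℝ} (h : ∀ t, |t - θ| ≤ δ → ‖y' t - v‖ ≤ η) {t : ℝ} (ht : |t - θ| ≤ δ) :
    ‖y t - y θ - (t - θ) • v‖ ≤ η * |t - θ| := by
  have hδ : 0 ≤ δ := (abs_nonneg _).trans ht
  have h1 := (convex_closedBall θ δ).norm_image_sub_le_of_norm_hasDerivWithin_le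
    (f := fun t => y t - t • v) (f' := fun t => y' t - v) (C := η)
    (fun s _ => ((hy s).sub (by simpa using (hasDerivAt_id s).smul_const v)).hasDerivWithinAt)
    (fun s hs => h s (by simpa [Real.dist_eq] using hs)) (Metric.mem_closedBall_self hδ)
    (y := t) (by simpa [Real.dist_eq] using ht)
  rw [Real.norm_eq_abs] at h1
  refine le_trans (le_of_eq ?_) h1
  congr 1
  rw [sub_smul]; abel

set_option maxHeartbeats 1000000 in
/-- The linear algebra behind the expansion of the end point. -/
lemma exists_endpoint_bound {v : Plane} (hv : v ≠ 0) {l : ℝ} (hl : l < 0)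
    (M : Matrix (Fin 2) (Fin 2) ℝ) :
    ∃ C, 0 ≤ C ∧ ∃ η₀ > 0, ∀ η, 0 ≤ η → η ≤ η₀ → ∀ (Δ : ℝ) (N n z w e e' e'' : Plane),
      ‖w - v‖ ≤ η → ‖e‖ ≤ η * |Δ| → ‖e'‖ ≤ η * |Δ| → ‖e''‖ ≤ η * ‖z‖ →
      N = n + act M z + e'' → inner ℝ (N + Δ • l • v + e) w = 0 →
      ‖(Δ • v + e') + (l * ‖v‖ ^ 2)⁻¹ • (inner ℝ v (act M z + n) • v)‖ ≤
        C * η * (‖z‖ + ‖n‖) := by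
  set b := ‖v‖ with hb
  have hb0 : 0 < b := norm_pos_iff.2 hv
  set κ := -l * b ^ 2 with hκ
  have hκ0 : 0 < κ := mul_pos (neg_pos.2 hl) (by positivity)
  set C' := -l * b + b + 1 with hC'
  have hlb : 0 < -l * b := mul_pos (neg_pos.2 hl) hb0
  have hC'0 : 0 < C' := by positivity
  set D := 2 / κ * (b + 1) with hD
  have hD0 : 0 < D := by positivity
  set S := ∑ i, ∑ j, |M i j| with hS
  have hS0 : 0 ≤ S := Finset.sum_nonneg fun i _ => Finset.sum_nonneg fun j _ => abs_nonneg _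
  set E := D + b / κ * (1 + C' * D) with hE
  have hE0 : 0 < E := by positivity
  refine ⟨E * (S + 1) + b ^ 2 / κ, by positivity, min 1 (κ / (2 * C')), by positivity, ?_⟩
  intro η h0 h1 Δ N n z w e e' e'' hw he he' he'' hN horth
  have hη1 : η ≤ 1 := h1.trans (min_le_left _ _)
  have hηκ : η * C' ≤ κ / 2 := by
    have := h1.trans (min_le_right _ _)
    rw [le_div_iff₀ (by positivity)] at this
    linarith
  have hwn : ‖w‖ ≤ b + 1 := by
    have := norm_sub_norm_le w v
    linarith
  -- A is the value of the orthogonality relation after replacing w by v and dropping e. It would be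
  -- zero in the exact linear problem, and here it measures how well Δ = -⟨N, v⟩/(l b²) holds.
  set A := inner ℝ N v + Δ * (l * b ^ 2) with hA
  have hAeq : A = -(inner ℝ N (w - v)) - Δ * l * inner ℝ v (w - v) - inner ℝ e w := by
    rw [inner_add_left, inner_add_left, real_inner_smul_left, real_inner_smul_left] at horth
    simp only [inner_sub_right, real_inner_self_eq_norm_sq]
    rw [hA, hb]
    linarith
  have hAle : |A| ≤ η * ‖N‖ + η * C' * |Δ| := by
    have k1 : |inner ℝ N (w - v)| ≤ ‖N‖ * η :=
      (abs_real_inner_le_norm _ _).trans (mul_le_mul_of_nonneg_left hw (norm_nonneg _))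
    have k2 : |Δ * l * inner ℝ v (w - v)| ≤ |Δ| * (-l) * (b * η) := by
      rw [abs_mul, abs_mul, abs_of_neg hl]
      refine mul_le_mul_of_nonneg_left ?_ (mul_nonneg (abs_nonneg _) (neg_pos.2 hl).le)
      exact (abs_real_inner_le_norm _ _).trans (mul_le_mul_of_nonneg_left hw (norm_nonneg _))
    have k3 : |inner ℝ e w| ≤ η * |Δ| * (b + 1) :=
      (abs_real_inner_le_norm _ _).trans (mul_le_mul he hwn (norm_nonneg _) (by positivity))
    have k4 := abs_sub (-(inner ℝ N (w - v)) - Δ * l * inner ℝ v (w - v)) (inner ℝ e w)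
    have k5 := abs_sub (-(inner ℝ N (w - v))) (Δ * l * inner ℝ v (w - v))
    rw [abs_neg] at k5
    rw [hAeq, hC']
    linarith
  have hNv : |inner ℝ N v| ≤ ‖N‖ * b := abs_real_inner_le_norm _ _
  -- The bound on A still contains |Δ|, with the factor ηC' ≤ κ/2. This part is absorbed in the
  -- left-hand side κ|Δ|.
  have hΔ : |Δ| ≤ D * ‖N‖ := by
    have k1 : |Δ| * κ ≤ |A| + |inner ℝ N v| := by
      have : |Δ| * κ = |A - inner ℝ N v| := by
        rw [hA, add_sub_cancel_left, abs_mul, abs_mul, abs_of_neg hl, abs_of_nonneg (sq_nonneg b)]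
      rw [this]
      exact abs_sub _ _
    have k2 : η * C' * |Δ| ≤ κ / 2 * |Δ| := mul_le_mul_of_nonneg_right hηκ (abs_nonneg _)
    have k3 : η * ‖N‖ ≤ 1 * ‖N‖ := mul_le_mul_of_nonneg_right hη1 (norm_nonneg _)
    have k4 : |Δ| * κ ≤ 2 * (b + 1) * ‖N‖ := by linarith
    rw [hD, div_mul_eq_mul_div, div_mul_eq_mul_div, le_div_iff₀ hκ0]
    linarith
  have hA2 : |A| ≤ η * (1 + C' * D) * ‖N‖ := by
    have : η * C' * |Δ| ≤ η * C' * (D * ‖N‖) := mul_le_mul_of_nonneg_left hΔ (by positivity)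
    linarith
  have hNn : ‖N‖ ≤ ‖n‖ + (S + 1) * ‖z‖ := by
    rw [hN]
    have k1 := norm_add₃_le (a := n) (b := act M z) (c := e'')
    have k2 := norm_act_le M z
    have k3 : η * ‖z‖ ≤ 1 * ‖z‖ := mul_le_mul_of_nonneg_right hη1 (norm_nonneg _)
    linarith
  have hMz : act M z + n = N - e'' := by rw [hN]; abel
  have hl2 : l * b ^ 2 ≠ 0 := mul_ne_zero hl.ne (by positivity)
  have hfin : (Δ • v + e') + (l * b ^ 2)⁻¹ • (inner ℝ v (act M z + n) • v) =
      e' + ((l * b ^ 2)⁻¹ * A) • v - ((l * b ^ 2)⁻¹ * inner ℝ v e'') • v := by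
    rw [hMz, inner_sub_right, real_inner_comm N v, hA, smul_smul, mul_add]
    have : (l * b ^ 2)⁻¹ * (Δ * (l * b ^ 2)) = Δ := by
      rw [mul_comm Δ, inv_mul_cancel_left₀ hl2]
    rw [this, mul_sub, sub_smul, add_smul]
    abel
  have hinv : |(l * b ^ 2)⁻¹| = κ⁻¹ := by
    rw [abs_inv, abs_mul, abs_of_neg hl, abs_of_nonneg (sq_nonneg b)]
  have t1 : ‖((l * b ^ 2)⁻¹ * A) • v‖ ≤ κ⁻¹ * (η * (1 + C' * D) * ‖N‖) * b := by
    rw [norm_smul, Real.norm_eq_abs, abs_mul, hinv]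
    gcongr
  have t2 : ‖((l * b ^ 2)⁻¹ * inner ℝ v e'') • v‖ ≤ κ⁻¹ * (b * (η * ‖z‖)) * b := by
    rw [norm_smul, Real.norm_eq_abs, abs_mul, hinv]
    have : |inner ℝ v e''| ≤ b * (η * ‖z‖) :=
      (abs_real_inner_le_norm _ _).trans (mul_le_mul_of_nonneg_left he'' (norm_nonneg _))
    gcongr
  have t3 : ‖e'‖ ≤ η * (D * ‖N‖) := he'.trans (mul_le_mul_of_nonneg_left hΔ h0)
  rw [hfin]
  have t4 := norm_sub_le (e' + ((l * b ^ 2)⁻¹ * A) • v) (((l * b ^ 2)⁻¹ * inner ℝ v e'') • v)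
  have t5 := norm_add_le e' (((l * b ^ 2)⁻¹ * A) • v)
  have t6 : η * (D * ‖N‖) + κ⁻¹ * (η * (1 + C' * D) * ‖N‖) * b = η * E * ‖N‖ := by
    rw [hE]; field_simp
  have t7 : η * E * ‖N‖ ≤ η * E * (‖n‖ + (S + 1) * ‖z‖) :=
    mul_le_mul_of_nonneg_left hNn (by positivity)
  have t8 : κ⁻¹ * (b * (η * ‖z‖)) * b = b ^ 2 / κ * η * ‖z‖ := by field_simp
  have t9 : η * E * ‖n‖ ≤ η * (E * (S + 1) + b ^ 2 / κ) * ‖n‖ := by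
    have : E ≤ E * (S + 1) + b ^ 2 / κ :=
      le_add_of_le_of_nonneg (le_mul_of_one_le_right hE0.le (le_add_of_nonneg_left hS0))
        (by positivity)
    gcongr
  calc _ ≤ η * E * ‖N‖ + κ⁻¹ * (b * (η * ‖z‖)) * b := by linarith
    _ ≤ η * E * (‖n‖ + (S + 1) * ‖z‖) + b ^ 2 / κ * η * ‖z‖ := by linarith
    _ = η * E * ‖n‖ + η * (E * (S + 1) + b ^ 2 / κ) * ‖z‖ := by ring
    _ ≤ _ := by linarith

section

variable {f : Plane → ℝ} {x₀ : Plane} {θ : ℝ}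

/-- Closeness at times near `θ`. -/
lemma Tame.exists_near_time (hf : Tame f) (x₀ : Plane) (θ : ℝ) {η : ℝ} (hη : 0 < η) :
    ∃ δ > 0, δ ≤ 1 ∧ ∃ η₁ > 0, ∀ g T, |θ| + 1 ≤ T → Near f g x₀ T η₁ → ∀ t, |t - θ| ≤ δ →
      ‖V g (curve g x₀ t) - V f (curve f x₀ θ)‖ ≤ η ∧
      |lam2 g (curve g x₀ t) - lam2 f (curve f x₀ θ)| ≤ η ∧
      ‖lam2 g (curve g x₀ t) • V g (curve g x₀ t)
        - lam2 f (curve f x₀ θ) • V f (curve f x₀ θ)‖ ≤ η := by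
  set v := V f (curve f x₀ θ) with hv
  set l := lam2 f (curve f x₀ θ) with hl
  set κ := min 1 (η / (1 + ‖v‖ + |l|)) / 2 with hκ
  have hκ0 : 0 < κ := by positivity
  have hVc : ContinuousAt (fun t => V f (curve f x₀ t)) θ :=
    (hf.continuous_V.comp (hf.continuous_curve x₀)).continuousAt
  have hlc : ContinuousAt (fun t => lam2 f (curve f x₀ t)) θ :=
    (hf.continuous_lam2.comp (hf.continuous_curve x₀)).continuousAt
  obtain ⟨δ₁, hδ₁, h1⟩ := Metric.continuousAt_iff.1 hVc κ hκ0
  obtain ⟨δ₂, hδ₂, h2⟩ := Metric.continuousAt_iff.1 hlc κ hκ0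
  refine ⟨min 1 (min δ₁ δ₂ / 2), by positivity, min_le_left _ _, κ, hκ0, ?_⟩
  intro g T hT hn t ht
  have ht1 : |t - θ| ≤ 1 := ht.trans (min_le_left _ _)
  have ht2 : |t - θ| < min δ₁ δ₂ := by
    have h3 : 0 < min δ₁ δ₂ := lt_min hδ₁ hδ₂
    have := ht.trans (min_le_right _ _)
    linarith
  have htT : |t| ≤ T := by
    have := abs_add_le (t - θ) θ
    rw [sub_add_cancel] at this
    linarith
  have k1 := h1 (x := t) (by rw [Real.dist_eq]; exact ht2.trans_le (min_le_left _ _))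
  have k2 := h2 (x := t) (by rw [Real.dist_eq]; exact ht2.trans_le (min_le_right _ _))
  rw [dist_eq_norm] at k1
  rw [Real.dist_eq] at k2
  have k3 := hn.field t htT
  have k4 := hn.eigen t htT
  have h2κ : 2 * κ ≤ 1 := by rw [hκ]; linarith [min_le_left 1 (η / (1 + ‖v‖ + |l|))]
  have h2κ' : 2 * κ * (1 + ‖v‖ + |l|) ≤ η := by
    have : 2 * κ ≤ η / (1 + ‖v‖ + |l|) := by
      rw [hκ]; linarith [min_le_right 1 (η / (1 + ‖v‖ + |l|))]
    rwa [le_div_iff₀ (by positivity)] at this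
  have a1 : ‖V g (curve g x₀ t) - v‖ ≤ 2 * κ := by
    have := norm_sub_le_norm_sub_add_norm_sub (V g (curve g x₀ t)) (V f (curve f x₀ t)) v
    linarith
  have a2 : |lam2 g (curve g x₀ t) - l| ≤ 2 * κ := by
    have := abs_sub_le (lam2 g (curve g x₀ t)) (lam2 f (curve f x₀ t)) l
    linarith
  have h2κη : 2 * κ ≤ η := by
    have : 2 * κ * 1 ≤ 2 * κ * (1 + ‖v‖ + |l|) := by
      gcongr
      linarith [norm_nonneg v, abs_nonneg l]
    linarith
  refine ⟨a1.trans h2κη, a2.trans h2κη, ?_⟩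
  set V' := V g (curve g x₀ t)
  set l' := lam2 g (curve g x₀ t)
  have e : l' • V' - l • v = (l' - l) • (V' - v) + (l' - l) • v + l • (V' - v) := by
    module
  rw [e]
  refine (norm_add₃_le).trans ?_
  rw [norm_smul, norm_smul, norm_smul, Real.norm_eq_abs, Real.norm_eq_abs]
  have m1 : |l' - l| * ‖V' - v‖ ≤ 2 * κ * 1 :=
    mul_le_mul a2 (a1.trans h2κ) (norm_nonneg _) (by positivity)
  have m2 : |l' - l| * ‖v‖ ≤ 2 * κ * ‖v‖ := mul_le_mul_of_nonneg_right a2 (norm_nonneg _)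
  have m3 : |l| * ‖V' - v‖ ≤ |l| * (2 * κ) := mul_le_mul_of_nonneg_left a1 (abs_nonneg _)
  linarith

/-- Away from `θ` the density has no filament point up to a time slightly larger than `|θ|`. -/
lemma Tame.exists_off_bound (hf : Tame f)
    (hoff : ∀ t, |t| ≤ |θ| → t ≠ θ →
      ¬ (dirSlope f (curve f x₀ t) = 0 ∧ lam2 f (curve f x₀ t) ≤ 0)) {δ : ℝ} (hδ : 0 < δ) :
    ∃ δ' > 0, δ' ≤ δ / 2 ∧ ∃ m > 0, ∀ t, |t| ≤ |θ| + δ' → δ ≤ |t - θ| →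
      m ≤ max |dirSlope f (curve f x₀ t)| (lam2 f (curve f x₀ t)) := by
  -- F(t) > 0 says exactly that the slope is nonzero or the eigenvalue is positive. A positive lower
  -- bound on F excludes filament points of nearby functions too.
  set F : ℝ → ℝ := fun t => max |dirSlope f (curve f x₀ t)| (lam2 f (curve f x₀ t)) with hF
  have hcc := hf.continuous_curve x₀
  have hFc : Continuous F :=
    ((hf.continuous_dirSlope.comp hcc).abs).max (hf.continuous_lam2.comp hcc)
  set S : Set ℝ := Icc (-|θ|) |θ| ∩ {t | δ / 2 ≤ |t - θ|} with hS
  have hScomp : IsCompact S := isCompact_Icc.inter_right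
    (isClosed_le continuous_const (by fun_prop))
  have hSU : S ⊆ {t | 0 < F t} := by
    rintro t ⟨ht, htδ⟩
    have hne : t ≠ θ := by
      rintro rfl
      simp only [mem_ofPred_eq, sub_self, abs_zero] at htδ
      linarith
    have := hoff t (abs_le.2 ht) hne
    by_contra hcon
    simp only [hF, mem_ofPred_eq, lt_max_iff, abs_pos, not_or, not_not, not_lt] at hcon
    exact this hcon
  obtain ⟨ρ, hρ, hρU⟩ := hScomp.exists_thickening_subset_open (isOpen_lt continuous_const hFc) hSU
  set δ' := min (ρ / 2) (δ / 2) with hδ'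
  have hδ'0 : 0 < δ' := by positivity
  set S' : Set ℝ := Icc (-(|θ| + δ')) (|θ| + δ') ∩ {t | δ ≤ |t - θ|} with hS'
  have hS'comp : IsCompact S' := isCompact_Icc.inter_right
    (isClosed_le continuous_const (by fun_prop))
  have hpos : ∀ t ∈ S', 0 < F t := by
    rintro t ⟨ht, htδ⟩
    refine hρU (Metric.mem_thickening_iff.2 ?_)
    have hθ0 := abs_nonneg θ
    -- The projection of t onto [-|θ|, |θ|] moves t by at most δ' ≤ δ/2, so it keeps distance at
    -- least δ/2 from θ and belongs to the compact set where F is known to be positive.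
    set p := max (-|θ|) (min |θ| t) with hp
    have hpt : |t - p| ≤ δ' := by
      rw [abs_le]
      rcases le_total |θ| t with h1 | h1
      · rw [hp, min_eq_left h1, max_eq_right (by linarith)]
        constructor <;> linarith [ht.2]
      · rw [hp, min_eq_right h1]
        rcases le_total (-|θ|) t with h2 | h2
        · rw [max_eq_right h2]; constructor <;> linarith
        · rw [max_eq_left h2]; constructor <;> linarith [ht.1]
    refine ⟨p, ⟨⟨le_max_left _ _, max_le (by linarith) (min_le_left _ _)⟩, ?_⟩, ?_⟩
    · have h1 := abs_sub_le t p θ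
      have h2 : δ' ≤ δ / 2 := min_le_right _ _
      simp only [mem_ofPred_eq] at htδ ⊢
      linarith
    · rw [Real.dist_eq]
      have : δ' ≤ ρ / 2 := min_le_left _ _
      linarith
  refine ⟨δ', hδ'0, min_le_right _ _, ?_⟩
  rcases S'.eq_empty_or_nonempty with he | hne
  · refine ⟨1, one_pos, fun t h1 h2 => ?_⟩
    have : t ∈ S' := ⟨abs_le.1 h1, h2⟩
    rw [he] at this
    exact absurd this (notMem_empty t)
  · obtain ⟨t₀, ht₀, hmin⟩ := hS'comp.exists_isMinOn hne hFc.continuousOn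
    exact ⟨F t₀, hpos t₀ ht₀, fun t h1 h2 => hmin ⟨abs_le.1 h1, h2⟩⟩

end


lemma act_sub_left {p q : ℕ} (M N : Matrix (Fin q) (Fin p) ℝ) (v : EuclideanSpace ℝ (Fin p)) :
    act (M - N) v = act M v - act N v := by
  ext i; simp [act_apply, sub_mul, Finset.sum_sub_distrib]

lemma act_smul_left {p q : ℕ} (c : ℝ) (M : Matrix (Fin q) (Fin p) ℝ)
    (v : EuclideanSpace ℝ (Fin p)) : act (c • M) v = c • act M v := by
  ext i; simp [act_apply, Finset.mul_sum, mul_assoc]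

lemma act_one {p : ℕ} (v : EuclideanSpace ℝ (Fin p)) : act 1 v = v := by
  ext i; simp [act_apply, Matrix.one_apply]

/-! ### The first filament time of a function close to the density. -/

section

variable {f : Plane → ℝ} {x₀ : Plane} {θ : ℝ}

/-- If the gradient vanishes at `θ`, the slope has a nondegenerate zero there. -/
lemma Tame.exists_slope_sign (hf : Tame f) (hV : V f (curve f x₀ θ) ≠ 0)
    (hgrad : grad f (curve f x₀ θ) = 0) (hlam : lam2 f (curve f x₀ θ) < 0) :
    ∃ δ₁ > 0, ∀ d, 0 < d → d ≤ δ₁ → dirSlope f (curve f x₀ (θ + d)) < 0 ∧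
      0 < dirSlope f (curve f x₀ (θ - d)) := by
  set φ : ℝ → ℝ := fun t => dirSlope f (curve f x₀ t) with hφ
  have h1 := hf.hasDerivAt_grad_curve x₀ θ
  have hVc : Continuous fun t => V f (curve f x₀ t) :=
    hf.continuous_V.comp (hf.continuous_curve x₀)
  set l := lam2 f (curve f x₀ θ)
  set v := V f (curve f x₀ θ)
  have hneg : l * ‖v‖ ^ 2 < 0 := mul_neg_of_neg_of_pos hlam (by
    have := norm_pos_iff.2 hV
    positivity)
  have hslope : Tendsto (fun t => inner ℝ (slope (fun t => grad f (curve f x₀ t)) θ t)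
      (V f (curve f x₀ t))) (𝓝[≠] θ) (𝓝 (l * ‖v‖ ^ 2)) := by
    have := Filter.Tendsto.inner (𝕜 := ℝ) (hasDerivAt_iff_tendsto_slope.1 h1)
      ((hVc.tendsto θ).mono_left (nhdsWithin_le_nhds (s := {θ}ᶜ)))
    rwa [real_inner_smul_left, real_inner_self_eq_norm_sq] at this
  have hev := hslope.eventually (gt_mem_nhds hneg)
  rw [eventually_nhdsWithin_iff, Metric.eventually_nhds_iff] at hev
  obtain ⟨ε, hε, h⟩ := hev
  have key : ∀ t, |t - θ| < ε → t ≠ θ → (t - θ)⁻¹ * φ t < 0 := by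
    intro t ht hne
    have := h (y := t) (by rwa [Real.dist_eq]) hne
    simp only [slope_def_module, hgrad, sub_zero, real_inner_smul_left] at this
    exact this
  refine ⟨ε / 2, by positivity, fun d hd hdε => ⟨?_, ?_⟩⟩
  · have := key (θ + d) (by rw [add_sub_cancel_left, abs_of_pos hd]; linarith) (by linarith)
    rw [add_sub_cancel_left] at this
    exact neg_of_mul_neg_right this (inv_pos.2 hd).le
  · have := key (θ - d) (by rw [sub_sub_cancel_left, abs_neg, abs_of_pos hd]; linarith)
      (by linarith)
    rw [sub_sub_cancel_left, inv_neg, neg_mul, neg_lt_zero] at this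
    exact (pos_iff_pos_of_mul_pos this).1 (inv_pos.2 hd)

/-- Existence and consistency of the first filament time of a function close to `f`. -/
theorem Tame.exists_isFirstTime (hf : Tame f) (hV : V f (curve f x₀ θ) ≠ 0)
    (hgrad : grad f (curve f x₀ θ) = 0) (hlam : lam2 f (curve f x₀ θ) < 0)
    (hoff : ∀ t, |t| ≤ |θ| → t ≠ θ →
      ¬ (dirSlope f (curve f x₀ t) = 0 ∧ lam2 f (curve f x₀ t) ≤ 0)) {δ : ℝ} (hδ : 0 < δ) :
    ∃ η > 0, ∀ g T, Tame g → |θ| + 1 ≤ T → Near f g x₀ T η →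
      (∃ t, IsFirstTime g x₀ t) ∧ ∀ t, IsFirstTime g x₀ t → |t - θ| ≤ δ := by
  obtain ⟨δ₁, hδ₁, hsign⟩ := hf.exists_slope_sign hV hgrad hlam
  obtain ⟨δ₂, hδ₂, hδ₂1, η₂, hη₂, hloc⟩ := hf.exists_near_time x₀ θ
    (η := -lam2 f (curve f x₀ θ) / 2) (by linarith)
  set δ₃ := min δ (min δ₁ δ₂) with hδ₃
  have hδ₃0 : 0 < δ₃ := by positivity
  have hδ₃δ : δ₃ ≤ δ := min_le_left _ _
  have hδ₃1 : δ₃ ≤ δ₁ := (min_le_right _ _).trans (min_le_left _ _)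
  have hδ₃2 : δ₃ ≤ δ₂ := (min_le_right _ _).trans (min_le_right _ _)
  obtain ⟨δ', hδ', hδ'δ, m, hm, hout⟩ := hf.exists_off_bound hoff hδ₃0
  obtain ⟨hs1, hs2⟩ := hsign δ' hδ' (by linarith)
  set η := min η₂ (min (m / 2) (min (-dirSlope f (curve f x₀ (θ + δ')) / 2)
    (dirSlope f (curve f x₀ (θ - δ')) / 2))) with hη
  have hη0 : 0 < η := by
    refine lt_min hη₂ (lt_min (by positivity) (lt_min (by linarith) (by linarith)))
  have q1 : η ≤ η₂ := min_le_left _ _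
  have q2 : η ≤ m / 2 := (min_le_right _ _).trans (min_le_left _ _)
  have q3 : η ≤ -dirSlope f (curve f x₀ (θ + δ')) / 2 :=
    (min_le_right _ _).trans ((min_le_right _ _).trans (min_le_left _ _))
  have q4 : η ≤ dirSlope f (curve f x₀ (θ - δ')) / 2 :=
    (min_le_right _ _).trans ((min_le_right _ _).trans (min_le_right _ _))
  refine ⟨η, hη0, fun g T hg hT hn => ?_⟩
  have hT' : ∀ t, |t - θ| ≤ 1 → |t| ≤ T := fun t ht => by
    have := abs_add_le (t - θ) θ
    rw [sub_add_cancel] at this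
    linarith
  have hc : Continuous fun t => dirSlope g (curve g x₀ t) :=
    hg.continuous_dirSlope.comp (hg.continuous_curve x₀)
  have hlneg : ∀ t, |t - θ| ≤ δ₃ → lam2 g (curve g x₀ t) < 0 := by
    intro t ht
    have := (abs_le.1 (hloc g T hT (hn.mono q1) t (ht.trans hδ₃2)).2.1).2
    linarith
  have hp : dirSlope g (curve g x₀ (θ + δ')) < 0 := by
    have := (abs_le.1 (hn.slope (θ + δ') (hT' _ (by
      rw [add_sub_cancel_left, abs_of_pos hδ']; linarith)))).2
    linarith
  have hq : 0 < dirSlope g (curve g x₀ (θ - δ')) := by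
    have := (abs_le.1 (hn.slope (θ - δ') (hT' _ (by
      rw [sub_sub_cancel_left, abs_neg, abs_of_pos hδ']; linarith)))).1
    linarith
  -- The slope of f is positive at θ - δ' and negative at θ + δ', and η is at most half of both
  -- absolute values. The slope of g therefore changes sign as well, and its zero t₁ is a filament
  -- time because the eigenvalue is negative near θ.
  obtain ⟨t₁, ht₁, h0⟩ := intermediate_value_Icc' (by linarith : θ - δ' ≤ θ + δ') hc.continuousOn
    ⟨hp.le, hq.le⟩
  have ht₁δ : |t₁ - θ| ≤ δ' := abs_le.2 ⟨by linarith [ht₁.1], by linarith [ht₁.2]⟩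
  have ht₁Θ : t₁ ∈ Theta g x₀ := ⟨h0, hlneg t₁ (by linarith)⟩
  have ht₁abs : |t₁| ≤ |θ| + δ' := by
    have := abs_add_le (t₁ - θ) θ
    rw [sub_add_cancel] at this
    linarith
  -- At a filament time of g the slope of f is at most m/2 in absolute value and its eigenvalue is
  -- below m/2. This contradicts the lower bound m away from θ, which reaches up to |t| ≤ |θ| + δ'
  -- so that all competitors of t₁ are covered.
  have hnear : ∀ t ∈ Theta g x₀, |t| ≤ |θ| + δ' → |t - θ| ≤ δ₃ := by
    intro t ht hle
    by_contra hcon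
    have htT : |t| ≤ T := by linarith
    have k1 := hout t hle (not_le.1 hcon).le
    have k2 := abs_le.1 (hn.slope t htT)
    have k3 := abs_le.1 (hn.eigen t htT)
    have k4 := ht.1
    have k5 := ht.2
    rw [k4] at k2
    have : max |dirSlope f (curve f x₀ t)| (lam2 f (curve f x₀ t)) < m := by
      refine max_lt (abs_lt.2 ⟨?_, ?_⟩) ?_ <;> linarith [k2.1, k2.2, k3.1]
    linarith
  constructor
  -- The condition that the eigenvalue be negative is open, so Θ is not closed in general. Within δ₃
  -- of θ it holds automatically; there Θ is the zero set of the slope, which is compact, and |t|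
  -- attains its minimum.
  · set S : Set ℝ := Icc (θ - δ₃) (θ + δ₃) ∩ {t | dirSlope g (curve g x₀ t) = 0} with hS
    have hScomp : IsCompact S := isCompact_Icc.inter_right (isClosed_eq hc continuous_const)
    have hmem : ∀ t ∈ Theta g x₀, |t| ≤ |θ| + δ' → t ∈ S := by
      intro t ht hle
      have := abs_le.1 (hnear t ht hle)
      exact ⟨⟨by linarith [this.1], by linarith [this.2]⟩, ht.1⟩
    have ht₁S := hmem t₁ ht₁Θ ht₁abs
    obtain ⟨t₂, ht₂, hmin⟩ := hScomp.exists_isMinOn ⟨t₁, ht₁S⟩ continuous_abs.continuousOn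
    refine ⟨t₂, ⟨ht₂.2, hlneg t₂ (abs_le.2 ⟨by linarith [ht₂.1.1], by linarith [ht₂.1.2]⟩)⟩, ?_⟩
    intro s hs
    by_cases hle : |s| ≤ |θ| + δ'
    · exact hmin (hmem s hs hle)
    · have : |t₂| ≤ |t₁| := hmin ht₁S
      linarith
  · intro t ht
    exact (hnear t ht.1 ((ht.2 t₁ ht₁Θ).trans ht₁abs)).trans hδ₃δ

end

/-! ### Expansion of the estimated filament point around the true one. -/

section

variable {f : Plane → ℝ} {H L : Set Plane} {a : ℝ} {x₀ : Plane} {θ : ℝ}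

/-- Expansion of the estimated filament point. -/
theorem DensityAssumptions.endpoint_expansion (hf : DensityAssumptions f H L a)
    (hV : V f (curve f x₀ θ) ≠ 0) (hgrad : grad f (curve f x₀ θ) = 0)
    (hlam : lam2 f (curve f x₀ θ) < 0)
    (hoff : ∀ t, |t| ≤ |θ| → t ≠ θ →
      ¬ (dirSlope f (curve f x₀ t) = 0 ∧ lam2 f (curve f x₀ t) ≤ 0)) {R : ℝ}
    (hR : ∀ t, |t| ≤ |θ| + 1 → ‖curve f x₀ t‖ + 1 ≤ R) {η : ℝ} (hη : 0 < η) :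
    ∃ ε > 0, ∀ g, Tame g → Close f g R ε → (∃ t, IsFirstTime g x₀ t) ∧
      ∀ t, IsFirstTime g x₀ t →
        ‖(curve g x₀ t - curve f x₀ θ)
          + act (Gam f (curve f x₀ θ)) (curve g x₀ θ - curve f x₀ θ)
          + (aPrime f (curve f x₀ θ))⁻¹ • act (PV f (curve f x₀ θ)) (grad g (curve f x₀ θ))‖ ≤
        η * (‖curve g x₀ θ - curve f x₀ θ‖ + ‖grad g (curve f x₀ θ)‖) := by
  have htame := hf.tame
  set xs := curve f x₀ θ with hxs
  set v := V f xs with hv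
  set l := lam2 f xs with hl
  obtain ⟨C, hC0, η₀, hη₀, hend⟩ := exists_endpoint_bound hV hlam (hess f xs)
  obtain ⟨CT, hCT0, hCT⟩ := hf.exists_norm_grad_taylor_le
  set κ := min η₀ (η / (C + 1)) with hκ
  have hκ0 : 0 < κ := by positivity
  have hCκ : C * κ ≤ η := by
    have h1 : κ ≤ η / (C + 1) := min_le_right _ _
    rw [le_div_iff₀ (by positivity)] at h1
    linarith
  obtain ⟨δ, hδ, hδ1, η₁, hη₁, hloc⟩ := htame.exists_near_time x₀ θ hκ0
  obtain ⟨η₂, hη₂, hfirst⟩ := htame.exists_isFirstTime hV hgrad hlam hoff hδ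
  set η₃ := min (min η₁ η₂) (min 1 (κ / (2 * (CT + 1)))) with hη₃
  have hη₃0 : 0 < η₃ := by positivity
  obtain ⟨ε, hε, hεη, hnear⟩ := htame.exists_near (x₀ := x₀) (T := |θ| + 1) (R := R) (by positivity)
    hR hη₃0
  -- The difference of the gradients has Lipschitz constant 4·κ/8 = κ/2; the Taylor remainder of the
  -- gradient of f contributes the other κ/2 to the bound on e''.
  refine ⟨min ε (κ / 8), by positivity, fun g hg hc => ?_⟩
  have hn := hnear g hg (hc.mono (min_le_left _ _))
  have hc8 : Close f g R (κ / 8) := hc.mono (min_le_right _ _)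
  have hn1 : Near f g x₀ (|θ| + 1) η₁ := hn.mono ((min_le_left _ _).trans (min_le_left _ _))
  have hn2 : Near f g x₀ (|θ| + 1) η₂ := hn.mono ((min_le_left _ _).trans (min_le_right _ _))
  obtain ⟨hex, hall⟩ := hfirst g _ hg le_rfl hn2
  refine ⟨hex, fun t ht => ?_⟩
  have htδ := hall t ht
  have hlocg := hloc g _ le_rfl hn1
  set z := curve g x₀ θ - xs with hz
  have hθ1 : |θ| ≤ |θ| + 1 := by linarith
  have hzle : ‖z‖ ≤ η₃ := hn.curve θ hθ1
  have hzT : CT * ‖z‖ ≤ κ / 2 := by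
    have h1 : ‖z‖ ≤ κ / (2 * (CT + 1)) :=
      hzle.trans ((min_le_right _ _).trans (min_le_right _ _))
    rw [le_div_iff₀ (by positivity)] at h1
    nlinarith [norm_nonneg z]
  have hz1 : ‖z‖ ≤ 1 := hzle.trans ((min_le_right _ _).trans (min_le_left _ _))
  have hxsR : ‖xs‖ + 1 ≤ R := hR θ hθ1
  have hxz : xs + z = curve g x₀ θ := by rw [hz]; abel
  have hxzR : ‖curve g x₀ θ‖ ≤ R := by
    rw [← hxz]
    exact (norm_add_le _ _).trans (by linarith)
  set N := grad g (curve g x₀ θ) with hN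
  set n := grad g xs with hn'
  -- remainder terms
  have hE1 : ‖grad g (curve g x₀ t) - N - (t - θ) • (l • v)‖ ≤ κ * |t - θ| :=
    norm_sub_sub_smul_le (hg.hasDerivAt_grad_curve x₀) (fun s hs => (hlocg s hs).2.2) htδ
  have hE2 : ‖curve g x₀ t - curve g x₀ θ - (t - θ) • v‖ ≤ κ * |t - θ| :=
    norm_sub_sub_smul_le (hg.curve_spec x₀).2 (fun s hs => (hlocg s hs).1) htδ
  have hE3 : ‖N - n - act (hess f xs) z‖ ≤ κ * ‖z‖ := by
    have k1 := hCT xs z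
    rw [hxz] at k1
    have k2 := hc8.norm_grad_sub_sub_le htame hg (x := xs) (y := curve g x₀ θ) (by linarith) hxzR
    have e : N - n - act (hess f xs) z = ((N - grad f (curve g x₀ θ)) - (n - grad f xs))
        + (grad f (curve g x₀ θ) - grad f xs - act (hess f xs) z) := by abel
    rw [e]
    refine (norm_add_le _ _).trans ?_
    have k3 : CT * ‖z‖ ^ 2 ≤ κ / 2 * ‖z‖ := by
      rw [pow_two, ← mul_assoc]
      exact mul_le_mul_of_nonneg_right hzT (norm_nonneg _)
    have k4 : 4 * (κ / 8) * ‖curve g x₀ θ - xs‖ = κ / 2 * ‖z‖ := by rw [← hz]; ring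
    linarith
  have horth : inner ℝ (N + (t - θ) • l • v + (grad g (curve g x₀ t) - N - (t - θ) • (l • v)))
      (V g (curve g x₀ t)) = 0 := by
    have : N + (t - θ) • l • v + (grad g (curve g x₀ t) - N - (t - θ) • (l • v)) =
        grad g (curve g x₀ t) := by abel
    rw [this]
    exact ht.1.1
  have hfin := hend κ hκ0.le (min_le_left _ _) (t - θ) N n z (V g (curve g x₀ t)) _ _ _
    (hlocg t htδ).1 hE1 hE2 hE3 (by abel) horth
  -- The first summand of ã' contains the gradient of f, which vanishes at the end point.
  have ha : aPrime f xs = l * ‖v‖ ^ 2 := by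
    rw [aPrime, bil, hgrad, inner_zero_left, zero_add]
  have hPV : ∀ u, act (PV f xs) u = inner ℝ v u • v := by
    intro u
    ext i
    simp only [act_apply, PV, Matrix.vecMulVec_apply, PiLp.smul_apply, smul_eq_mul,
      PiLp.inner_apply, RCLike.inner_apply, conj_trivial, Finset.sum_mul]
    exact Finset.sum_congr rfl fun j _ => by ring
  have hG : act (Gam f xs) z = (l * ‖v‖ ^ 2)⁻¹ • (inner ℝ v (act (hess f xs) z) • v) - z := by
    rw [← hPV, act_act, ← ha]
    rw [Gam, act_sub_left, act_smul_left, act_one]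
  have hcalc : (curve g x₀ t - xs) + act (Gam f xs) z + (aPrime f xs)⁻¹ • act (PV f xs) n =
      ((t - θ) • v + (curve g x₀ t - curve g x₀ θ - (t - θ) • v))
        + (l * ‖v‖ ^ 2)⁻¹ • (inner ℝ v (act (hess f xs) z + n) • v) := by
    rw [hG, hPV, ha, inner_add_right, add_smul, smul_add, ← hxz]
    abel
  rw [hcalc]
  exact hfin.trans (mul_le_mul_of_nonneg_right hCκ (by positivity))

end


/-! ### Linearization along the curve -/

lemma norm_act_Gtilde_le (f : Plane → ℝ) (x : Plane) (e : Space) :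
    ‖act (Gtilde f x) e‖ ≤ 24 * ‖e‖ := by
  rw [Gtilde, act_jac]
  have hL : LipschitzWith 24 G := LipschitzWith.of_dist_le_mul fun y e => by
    simpa [dist_eq_norm] using norm_G_sub_le y e
  have := norm_fderiv_le_of_lipschitz ℝ hL (x₀ := d2 f x)
  refine (ContinuousLinearMap.le_opNorm _ _).trans ?_
  gcongr
  simpa using this

lemma disc_ne_zero {f : Plane → ℝ} {x : Plane} (h : V f x ≠ 0) : disc (d2 f x) ≠ 0 :=
  fun h0 => h (G_eq_zero h0)

lemma Tame.continuousAt_Gtilde {f : Plane → ℝ} (hf : Tame f) {x : Plane} (h : V f x ≠ 0)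
    (i : Fin 2) (j : Fin 3) : ContinuousAt (fun x => Gtilde f x i j) x := by
  have h1 : IsOpen {y : Space | disc y ≠ 0} := isOpen_ne_fun continuous_disc continuous_const
  exact ContinuousAt.comp (g := fun y => jac G y i j) (f := d2 f)
    ((continuousOn_jac_G i j).continuousAt (h1.mem_nhds (disc_ne_zero h)))
    hf.continuous_d2.continuousAt

/-- V remains nonzero near x, so there the chain rule writes the entries through `Gtilde` and third
derivatives of f, all of which are continuous. -/
lemma DensityAssumptions.continuousAt_jac_V {f : Plane → ℝ} {H L : Set Plane} {a : ℝ}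
    (hf : DensityAssumptions f H L a) {x : Plane} (h : V f x ≠ 0) (i j : Fin 2) :
    ContinuousAt (fun x => jac (V f) x i j) x := by
  have hev : ∀ᶠ y in 𝓝 x, V f y ≠ 0 :=
    hf.tame.continuous_V.continuousAt.eventually_ne h
  have hc : ContinuousAt (fun x => ∑ k, Gtilde f x i k * dir j (wd (d2word k) f) x) x := by
    refine tendsto_finsetSum _ fun k _ => ?_
    refine (hf.tame.continuousAt_Gtilde h i k).mul ?_
    exact (DiffWords.wd (k := 1) (j :: d2word k) (hf.diffWords.mono
      (by simp [length_d2word]))).1.continuous.continuousAt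
  refine hc.congr ?_
  filter_upwards [hev] with y hy
  have h1 := act_jac_V hf.tame.diff (disc_ne_zero hy) (EuclideanSpace.single j 1)
  have h2 : act (jac (V f) y) (EuclideanSpace.single j 1) i = jac (V f) y i j := by
    simp [act_apply]
  rw [← h2, h1, act_apply]
  refine Finset.sum_congr rfl fun k _ => ?_
  rw [fderiv_d2_apply hf.tame.diff]
  rfl

lemma continuous_act_of_entries {p q : ℕ} {A : ℝ → Matrix (Fin q) (Fin p) ℝ}
    (hA : ∀ i j, Continuous fun s => A s i j) {v : ℝ → EuclideanSpace ℝ (Fin p)}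
    (hv : Continuous v) : Continuous fun s => act (A s) (v s) := by
  have : (fun s => act (A s) (v s)) = fun s => WithLp.toLp 2 fun i => ∑ j, A s i j * v s j := by
    funext s; ext i; simp [act_apply]
  rw [this]
  refine (PiLp.continuous_toLp 2 _).comp (continuous_pi fun i => continuous_finsetSum _ fun j _ => ?_)
  have := hA i j
  fun_prop

lemma exists_norm_act_le {p q : ℕ} {A : ℝ → Matrix (Fin q) (Fin p) ℝ}
    (hA : ∀ i j, Continuous fun s => A s i j) (T : ℝ) :
    ∃ C, 0 ≤ C ∧ ∀ s ∈ Icc 0 T, ∀ v, ‖act (A s) v‖ ≤ C * ‖v‖ := by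
  have hc : Continuous fun s => ∑ i, ∑ j, |A s i j| :=
    continuous_finsetSum _ fun i _ => continuous_finsetSum _ fun j _ => (hA i j).abs
  obtain ⟨C, hC⟩ := (isCompact_Icc (a := (0 : ℝ)) (b := T)).exists_bound_of_continuousOn
    hc.continuousOn
  refine ⟨|C|, abs_nonneg _, fun s hs v => (norm_act_le _ _).trans ?_⟩
  gcongr
  exact (le_abs_self _).trans ((hC s hs).trans (le_abs_self _))

lemma hasDerivWithinAt_Ici {E : Type*} [NormedAddCommGroup E] [NormedSpace ℝ E] {y : ℝ → E} {y' : E}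
    {T t : ℝ} (ht : t ∈ Ico 0 T) (h : HasDerivWithinAt y y' (Icc 0 T) t) :
    HasDerivWithinAt y y' (Ici t) t :=
  h.mono_of_mem_nhdsWithin (Icc_mem_nhdsGE_of_mem ht)

/-- Perturbation bound for a linear equation. -/
lemma linear_ode_bound {A : ℝ → Matrix (Fin 2) (Fin 2) ℝ} {z z' b : ℝ → Plane} {D : ℝ → ℝ}
    {T C η : ℝ} (hC : 0 ≤ C) (hA : ∀ s ∈ Icc 0 T, ∀ v, ‖act (A s) v‖ ≤ C * ‖v‖)
    (hb : Continuous b) (hD : Continuous D) (hD0 : ∀ s, 0 ≤ D s) (hη : η ≤ 1)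
    (hz : ∀ s, HasDerivAt z (z' s) s) (hz0 : z 0 = 0)
    (hr : ∀ s ∈ Icc 0 T, ‖z' s - (act (A s) (z s) + b s)‖ ≤ D s + η * ‖z s‖) {t : ℝ}
    (ht : t ∈ Icc 0 T) :
    ‖z t‖ ≤ ‖∫ s in (0 : ℝ)..t, b s‖ + Real.exp ((C + 1) * T) *
      ∫ s in (0 : ℝ)..T, ((C + 1) * ‖∫ r in (0 : ℝ)..s, b r‖ + D s) := by
  -- The primitive of the forcing term is subtracted before Gronwall's inequality is applied. The
  -- bound then involves ‖∫b‖ and not ∫‖b‖; in the application b is too large pointwise, and only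
  -- its primitive has the rate (nh⁵)^(-1/2).
  set w : ℝ → Plane := fun t => ∫ s in (0 : ℝ)..t, b s with hw
  have hw' : ∀ t, HasDerivAt w (b t) t := fun t =>
    intervalIntegral.integral_hasDerivAt_right (hb.intervalIntegrable _ _)
      hb.stronglyMeasurable.stronglyMeasurableAtFilter hb.continuousAt
  have hwc : Continuous w := continuous_iff_continuousAt.2 fun t => (hw' t).continuousAt
  set φ : ℝ → ℝ := fun s => (C + 1) * ‖w s‖ + D s with hφ
  have hφc : Continuous φ := by fun_prop
  have hφ0 : ∀ s, 0 ≤ φ s := fun s => by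
    have := hD0 s
    positivity
  have hy : ∀ s, HasDerivAt (fun s => z s - w s) (z' s - b s) s := fun s => (hz s).sub (hw' s)
  have hbd : ∀ s ∈ Ico 0 T, ‖z' s - b s‖ ≤ (C + 1) * ‖z s - w s‖ + φ s := by
    intro s hs
    have hs' := Ico_subset_Icc_self hs
    have e : z' s - b s = act (A s) (z s) + (z' s - (act (A s) (z s) + b s)) := by abel
    have h1 := norm_add_le (act (A s) (z s)) (z' s - (act (A s) (z s) + b s))
    have h2 := hA s hs' (z s)
    have h3 := hr s hs'
    have h4 : η * ‖z s‖ ≤ 1 * ‖z s‖ := mul_le_mul_of_nonneg_right hη (norm_nonneg _)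
    have h5 : ‖z s‖ ≤ ‖z s - w s‖ + ‖w s‖ := by
      simpa using norm_add_le (z s - w s) (w s)
    have h6 : (C + 1) * ‖z s‖ ≤ (C + 1) * (‖z s - w s‖ + ‖w s‖) := by gcongr
    rw [e, hφ]
    simp only
    linarith
  have h := norm_le_of_norm_deriv_le (y := fun s => z s - w s) (C := C + 1) (g := φ)
    (ρ := Real.exp ((C + 1) * T) * (∫ s in (0 : ℝ)..T, φ s) + 1) (by positivity)
    (fun s _ => (hy s).continuousAt.continuousWithinAt) (fun s _ => (hy s).hasDerivWithinAt)
    (by simp [hz0, hw]) hφc hφ0 (fun s hs _ => hbd s hs) (by linarith) ht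
  have h1 : ‖z t‖ ≤ ‖w t‖ + ‖z t - w t‖ := by
    simpa using norm_add_le (w t) (z t - w t)
  have h2 : ∫ s in (0 : ℝ)..t, φ s ≤ ∫ s in (0 : ℝ)..T, φ s :=
    intervalIntegral.integral_mono_interval le_rfl ht.1 ht.2 (Eventually.of_forall hφ0)
      (hφc.intervalIntegrable _ _)
  have h3 : 0 ≤ ∫ s in (0 : ℝ)..t, φ s :=
    intervalIntegral.integral_nonneg ht.1 fun s _ => hφ0 s
  have h4 : Real.exp ((C + 1) * t) ≤ Real.exp ((C + 1) * T) := by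
    gcongr
    exact ht.2
  have h5 : Real.exp ((C + 1) * t) * (∫ s in (0 : ℝ)..t, φ s) ≤
      Real.exp ((C + 1) * T) * ∫ s in (0 : ℝ)..T, φ s := by gcongr
  linarith

/-- Duality between a linear equation and its adjoint. -/
lemma adjoint_bound {A : ℝ → Matrix (Fin 2) (Fin 2) ℝ} {z z' b q : ℝ → Plane} {D : ℝ → ℝ}
    {T Q : ℝ} (hT : 0 ≤ T) (hb : Continuous b) (hD : Continuous D)
    (hz : ∀ s, HasDerivAt z (z' s) s) (hz0 : z 0 = 0)
    (hr : ∀ s ∈ Icc 0 T, ‖z' s - (act (A s) (z s) + b s)‖ ≤ D s) (hq : Continuous q)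
    (hq' : ∀ s ∈ Icc 0 T, HasDerivWithinAt q (-(act (A s)ᵀ (q s))) (Icc 0 T) s)
    (hQ : ∀ s ∈ Icc 0 T, ‖q s‖ ≤ Q) :
    |inner ℝ (q T) (z T) - ∫ s in (0 : ℝ)..T, inner ℝ (q s) (b s)| ≤
      Q * ∫ s in (0 : ℝ)..T, D s := by
  have hqb : Continuous fun s => (inner ℝ (q s) (b s) : ℝ) := hq.inner hb
  have hI : ∀ {φ : ℝ → ℝ}, Continuous φ → ∀ t, HasDerivAt (fun t => ∫ s in (0 : ℝ)..t, φ s) (φ t) t :=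
    fun hφ t => intervalIntegral.integral_hasDerivAt_right (hφ.intervalIntegrable _ _)
      hφ.stronglyMeasurable.stronglyMeasurableAtFilter hφ.continuousAt
  have hzc : Continuous z := continuous_iff_continuousAt.2 fun t => (hz t).continuousAt
  have hIc : Continuous fun t => ∫ s in (0 : ℝ)..t, inner ℝ (q s) (b s) :=
    continuous_iff_continuousAt.2 fun t => (hI hqb t).continuousAt
  have hIDc : Continuous fun t => ∫ s in (0 : ℝ)..t, D s :=
    continuous_iff_continuousAt.2 fun t => (hI hD t).continuousAt
  have h := image_norm_le_of_norm_deriv_right_le_deriv_boundary' (a := 0) (b := T)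
    (f := fun t => inner ℝ (q t) (z t) - ∫ s in (0 : ℝ)..t, inner ℝ (q s) (b s))
    (f' := fun t => inner ℝ (q t) (z' t - (act (A t) (z t) + b t)))
    (B := fun t => Q * ∫ s in (0 : ℝ)..t, D s) (B' := fun t => Q * D t)
    ((hq.inner hzc).sub hIc).continuousOn (fun t ht => ?_) (by simp [hz0])
    (hIDc.const_mul Q).continuousOn (fun t _ => ((hI hD t).const_mul Q).hasDerivWithinAt)
    (fun t ht => ?_) (x := T) ⟨hT, le_rfl⟩
  · simpa using h
  · have h1 := (hasDerivWithinAt_Ici ht (hq' t (Ico_subset_Icc_self ht))).inner ℝ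
      (hz t).hasDerivWithinAt (s := Ici t)
    have h2 := h1.sub (hI hqb t).hasDerivWithinAt
    convert! h2 using 1
    rw [inner_neg_left, inner_sub_right, inner_add_right, inner_act_transpose]
    ring
  · have h1 := hr t (Ico_subset_Icc_self ht)
    have h2 := hQ t (Ico_subset_Icc_self ht)
    exact (norm_inner_le_norm _ _).trans
      (mul_le_mul h2 h1 (norm_nonneg _) ((norm_nonneg _).trans h2))

/-- Reversing time turns the final value problem into an initial value problem with the transposed
matrices A(T - t)ᵀ. Clamping the time to [0, T] makes the solution continuous on the whole line. -/
lemma exists_adjoint {A : ℝ → Matrix (Fin 2) (Fin 2) ℝ} (hA : ∀ i j, Continuous fun s => A s i j)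
    {T : ℝ} (hT : 0 ≤ T) (p : Plane) : ∃ q : ℝ → Plane, Continuous q ∧ q T = p ∧
      ∀ s ∈ Icc 0 T, HasDerivWithinAt q (-(act (A s)ᵀ (q s))) (Icc 0 T) s := by
  obtain ⟨x, h0, hx⟩ := exists_linear_solution
    (A := fun t => LinearMap.toContinuousLinearMap (Matrix.toLpLin 2 2 (A (T - t))ᵀ))
    (b := fun _ => (0 : Plane))
    (fun v => continuous_act_of_entries (A := fun t => (A (T - t))ᵀ)
      (fun i j => (hA j i).comp (by fun_prop : Continuous fun t => T - t)) continuous_const)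
    continuous_const p hT
  have hx' : ∀ t ∈ Icc 0 T, HasDerivWithinAt x (act (A (T - t))ᵀ (x t)) (Icc 0 T) t := by
    intro t ht
    have := hx t ht
    rw [add_zero] at this
    exact this
  set π : ℝ → ℝ := fun s => max 0 (min T (T - s)) with hπ
  have hπm : ∀ s, π s ∈ Icc 0 T := fun s => ⟨le_max_left _ _, max_le hT (min_le_left _ _)⟩
  have hπe : ∀ s ∈ Icc 0 T, π s = T - s := by
    intro s hs
    simp only [hπ]
    rw [min_eq_right (by linarith [hs.1]), max_eq_right (by linarith [hs.2])]
  have hxc : ContinuousOn x (Icc 0 T) := fun t ht => (hx' t ht).continuousWithinAt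
  refine ⟨fun s => x (π s), hxc.comp_continuous (by fun_prop) hπm, ?_, fun s hs => ?_⟩
  · simp only
    rw [hπe T ⟨hT, le_rfl⟩, sub_self, h0]
  · have hs' : T - s ∈ Icc 0 T := ⟨by linarith [hs.2], by linarith [hs.1]⟩
    have h1 := hx' (T - s) hs'
    have h2 : HasDerivWithinAt (fun s => T - s) (-1) (Icc 0 T) s := by
      simpa using ((hasDerivAt_id s).const_sub T).hasDerivWithinAt
    have h3 := h1.scomp s h2 (fun r hr => ⟨by linarith [hr.2], by linarith [hr.1]⟩)
    rw [sub_sub_cancel, neg_one_smul] at h3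
    have h4 : HasDerivWithinAt (fun s => x (π s)) (-(act (A s)ᵀ (x (T - s)))) (Icc 0 T) s :=
      h3.congr (fun r hr => by simp only [hπe r hr, Function.comp]) (by
        simp only [hπe s hs, Function.comp])
    simpa only [hπe s hs] using h4


/-! ### The path from the starting point to the filament, and linearization along it. -/

section

variable {f K : Plane → ℝ} {H L : Set Plane} {a : ℝ} {x₀ : Plane} {θ : ℝ}

lemma DensityAssumptions.curve_mem_L (hf : DensityAssumptions f H L a)
    (hx₀ : x₀ ∈ startSet f L a) (hθ : IsFirstTime f x₀ θ) : curve f x₀ θ ∈ L := by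
  rw [hf.L_eq]
  exact ⟨x₀, hx₀, θ, hθ, rfl⟩

/-- A starting point is reached from a point of the filament in some time t with |t| ≤ a. Going back
in time -t leads to a filament point, so -t competes with θ. -/
lemma DensityAssumptions.abs_time_le (hf : DensityAssumptions f H L a)
    (hx₀ : x₀ ∈ startSet f L a) (hθ : IsFirstTime f x₀ θ) : |θ| ≤ a := by
  obtain ⟨x, hx, t, ht, rfl⟩ := hx₀
  have h1 : curve f (curve f x t) (-t) = x := by
    rw [hf.tame.curve_add, add_neg_cancel, (hf.tame.curve_spec x).1]
  have h2 : -t ∈ Theta f (curve f x t) := by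
    rw [hf.L_eq] at hx
    obtain ⟨y, -, s, hs, rfl⟩ := hx
    change dirSlope f (curve f _ (-t)) = 0 ∧ lam2 f (curve f _ (-t)) < 0
    rw [h1]
    exact hs.1
  have h3 := hθ.2 _ h2
  rw [abs_neg] at h3
  exact h3.trans (abs_le.2 ht)

lemma DensityAssumptions.integral_V_curve (hf : DensityAssumptions f H L a) (x : Plane) (s u : ℝ) :
    ∫ r in s..u, V f (curve f x r) = curve f x u - curve f x s :=
  intervalIntegral.integral_eq_sub_of_hasDerivAt (fun t _ => (hf.tame.curve_spec x).2 t)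
    ((hf.tame.continuous_V.comp (hf.tame.continuous_curve x)).intervalIntegrable _ _)

/-- A zero of V would make the curve stationary and its mean velocity over [-a, a] zero. -/
lemma DensityAssumptions.V_ne_zero_on_L (hf : DensityAssumptions f H L a) {x : Plane} (hx : x ∈ L) :
    V f x ≠ 0 := by
  intro h0
  obtain ⟨γ, hγ, h⟩ := hf.mean_velocity
  have ha := hf.a_pos
  have h1 : V f (curve f x 0) = 0 := by rw [(hf.tame.curve_spec x).1, h0]
  have h2 : ∀ t, V f (curve f x t) = 0 := fun t => by
    by_contra hne
    exact hf.tame.V_curve_ne_zero hne 0 h1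
  have h3 := h x hx (-a) ⟨le_rfl, by linarith⟩ a ⟨by linarith, le_rfl⟩ (by linarith)
  simp only [h2, intervalIntegral.integral_zero, smul_zero, norm_zero] at h3
  linarith

lemma DensityAssumptions.V_curve_ne_zero (hf : DensityAssumptions f H L a)
    (hx₀ : x₀ ∈ startSet f L a) (hθ : IsFirstTime f x₀ θ) (t : ℝ) : V f (curve f x₀ t) ≠ 0 :=
  hf.tame.V_curve_ne_zero (hf.V_ne_zero_on_L (hf.curve_mem_L hx₀ hθ)) t

/-- The path from the starting point to the filament. -/
lemma DensityAssumptions.exists_pathData (hf : DensityAssumptions f H L a)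
    (hx₀ : x₀ ∈ startSet f L a) (hθ : IsFirstTime f x₀ θ) {σ : ℝ} (hσ : σ = 1 ∨ σ = -1)
    (hσθ : σ * |θ| = θ) :
    ∃ γ, PathData (fun s => curve f x₀ (σ * s)) (fun s => σ • V f (curve f x₀ (σ * s))) |θ| γ := by
  obtain ⟨γ, hγ, h⟩ := hf.mean_velocity
  refine ⟨γ, abs_nonneg _, fun s => hf.tame.hasDerivAt_curve_mul x₀ σ s, ?_, hγ, ?_⟩
  · exact (hf.tame.continuous_V.comp ((hf.tame.continuous_curve x₀).comp
      (by fun_prop : Continuous fun s : ℝ => σ * s))).const_smul σ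
  have hxL := hf.curve_mem_L hx₀ hθ
  have hle := hf.abs_time_le hx₀ hθ
  -- The lower bound on mean velocities is assumed only for curves that start on the filament, so
  -- time is measured from the end point; the shifted times lie in [-a, a] because |θ| ≤ a.
  set x := curve f x₀ θ with hx
  have hcx : ∀ s, curve f x₀ (σ * s) = curve f x (σ * s - θ) := by
    intro s
    rw [hx, hf.tame.curve_add]
    congr 1; ring
  have hmem : ∀ s ∈ Icc 0 |θ|, σ * s - θ ∈ Icc (-a) a := by
    intro s hs
    have e : σ * s - θ = σ * (s - |θ|) := by rw [mul_sub, hσθ]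
    rw [e]
    rcases hσ with rfl | rfl <;> constructor <;> linarith [hs.1, hs.2]
  have key : ∀ s ∈ Icc (-a) a, ∀ u ∈ Icc (-a) a, s < u →
      γ * (u - s) ≤ ‖curve f x u - curve f x s‖ := by
    intro s hs u hu hsu
    have h1 := h x hxL s hs u hu hsu
    rw [hf.integral_V_curve, norm_smul, norm_inv, Real.norm_eq_abs, abs_of_pos (sub_pos.2 hsu),
      inv_mul_eq_div, le_div_iff₀ (sub_pos.2 hsu)] at h1
    exact h1
  intro s hs t ht
  simp only [hcx]
  have e : |s - t| = |(σ * s - θ) - (σ * t - θ)| := by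
    rw [sub_sub_sub_cancel_right, ← mul_sub, abs_mul]
    rcases hσ with rfl | rfl <;> simp
  rw [e]
  have hs' := hmem s hs
  have ht' := hmem t ht
  rcases lt_trichotomy (σ * s - θ) (σ * t - θ) with h1 | h1 | h1
  · rw [abs_of_neg (by linarith), norm_sub_rev]
    have := key _ hs' _ ht' h1
    linarith
  · rw [h1]; simp
  · rw [abs_of_pos (by linarith)]
    exact key _ ht' _ hs' h1

/-- If the eigenvalue is negative at such a time, t is a second minimiser of |t|, which uniqueness
forbids. If it is zero, `hpath` is violated. The time -θ is covered too. -/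
lemma DensityAssumptions.no_filament_before (hf : DensityAssumptions f H L a)
    (hx₀ : x₀ ∈ startSet f L a) (hθ : IsFirstTime f x₀ θ)
    (hpath : ∀ t : ℝ, |t| ≤ |θ| →
      ¬ (lam2 f (curve f x₀ t) = 0 ∧ dirSlope f (curve f x₀ t) = 0)) (t : ℝ) (ht : |t| ≤ |θ|)
    (hne : t ≠ θ) : ¬ (dirSlope f (curve f x₀ t) = 0 ∧ lam2 f (curve f x₀ t) ≤ 0) := by
  rintro ⟨h1, h2⟩
  rcases h2.lt_or_eq with h3 | h3
  · have hΘ : t ∈ Theta f x₀ := ⟨h1, h3⟩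
    have ht' : IsFirstTime f x₀ t := ⟨hΘ, fun s hs => ht.trans (hθ.2 s hs)⟩
    exact hne ((hf.unique_time x₀ hx₀).unique ht' hθ)
  · exact hpath t ht ⟨h3, h1⟩

/-- The linearization of the equation of the integral curves. -/
theorem DensityAssumptions.exists_remainder_bound (hf : DensityAssumptions f H L a)
    (hV : ∀ t, V f (curve f x₀ t) ≠ 0) {σ : ℝ} (hσ : σ = 1 ∨ σ = -1) {T R : ℝ} (hT : 0 ≤ T)
    (hR : ∀ t, |t| ≤ T → ‖curve f x₀ t‖ + 1 ≤ R) :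
    ∃ C, 0 ≤ C ∧ ∀ η, 0 < η → ∃ ε > 0, ∀ g, Tame g → Close f g R ε → ∀ s ∈ Icc 0 T,
      ‖(σ • V g (curve g x₀ (σ * s)) - σ • V f (curve f x₀ (σ * s)))
        - (act (σ • jac (V f) (curve f x₀ (σ * s))) (curve g x₀ (σ * s) - curve f x₀ (σ * s))
          + act (σ • Gtilde f (curve f x₀ (σ * s)))
            (d2 g (curve f x₀ (σ * s)) - d2 f (curve f x₀ (σ * s))))‖ ≤
        C * ‖d2 g (curve f x₀ (σ * s)) - d2 f (curve f x₀ (σ * s))‖ ^ 2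
          + η * ‖curve g x₀ (σ * s) - curve f x₀ (σ * s)‖ := by
  have htame := hf.tame
  have hσ1 : |σ| = 1 := by rcases hσ with rfl | rfl <;> simp
  obtain ⟨CT, hCT0, hCT⟩ := hf.exists_norm_d2_taylor_le
  obtain ⟨CD, hCD0, hCD⟩ := htame.lipschitz_d2
  -- Since V is nonzero on the compact path, the eigenvalue gap is bounded below there, and the
  -- quadratic remainder of `G` has a uniform constant.
  obtain ⟨d0, hd0, hd⟩ : ∃ d0 > 0, ∀ t, |t| ≤ T → d0 ≤ ‖disc (d2 f (curve f x₀ t))‖ := by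
    have hc : Continuous fun t => ‖disc (d2 f (curve f x₀ t))‖ :=
      (continuous_disc.comp (htame.continuous_d2.comp (htame.continuous_curve x₀))).norm
    obtain ⟨t₀, -, hmin⟩ := (isCompact_Icc (a := -T) (b := T)).exists_isMinOn
      ⟨0, by constructor <;> linarith⟩ hc.continuousOn
    exact ⟨_, norm_pos_iff.2 (disc_ne_zero (hV t₀)), fun t ht => hmin (abs_le.1 ht)⟩
  set q := 48 / d0 with hq
  have hq0 : 0 < q := by positivity
  set Q := 2 * q * (6 + CD) ^ 2 + 24 * CT with hQ
  have hQ0 : 0 ≤ Q := by positivity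
  refine ⟨2 * q, by positivity, fun η hη => ?_⟩
  obtain ⟨ε, hε, -, hnear⟩ := htame.exists_near (x₀ := x₀) hT hR
    (η := min 1 (η / (2 * (Q + 1)))) (by positivity)
  -- The factor 24 of `Gtilde` times the Lipschitz constant 6ε' of the error of the second
  -- derivatives gives 144ε' ≤ η/2. The other half of η absorbs the terms quadratic in z.
  refine ⟨min ε (min 1 (η / 288)), by positivity, fun g hg hc s hs => ?_⟩
  have hn := hnear g hg (hc.mono (min_le_left _ _))
  set ε' := min ε (min 1 (η / 288)) with hε'
  have hε'0 : 0 < ε' := by positivity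
  have hε'1 : ε' ≤ 1 := (min_le_right _ _).trans (min_le_left _ _)
  have hε'η : ε' ≤ η / 288 := (min_le_right _ _).trans (min_le_right _ _)
  have hst : |σ * s| ≤ T := by rw [abs_mul, hσ1, one_mul, abs_of_nonneg hs.1]; exact hs.2
  have hz1 := hn.curve _ hst
  have hRx := hR _ hst
  have hdx := hd _ hst
  set x := curve f x₀ (σ * s) with hx
  set x' := curve g x₀ (σ * s) with hx'
  set z := x' - x with hz
  set δ := d2 g x - d2 f x with hδ
  have hVx : V f x ≠ 0 := hV _
  have hxz : x + z = x' := by rw [hz]; abel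
  have hz' : ‖z‖ ≤ 1 := hz1.trans (min_le_left _ _)
  have hzQ : Q * ‖z‖ ≤ η / 2 := by
    have h1 : ‖z‖ ≤ η / (2 * (Q + 1)) := hz1.trans (min_le_right _ _)
    rw [le_div_iff₀ (by positivity)] at h1
    nlinarith [norm_nonneg z]
  have hx'R : ‖x'‖ ≤ R := by
    rw [← hxz]
    exact (norm_add_le _ _).trans (by linarith)
  -- The increment of the second derivatives between the two curves is e = δ + D(d²f)z + ρ. Here ρ
  -- collects the variation of the error from x to x' and the Taylor remainder of d²f; both are
  -- small multiples of ‖z‖.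
  set ρ := ((d2 g x' - d2 f x') - (d2 g x - d2 f x)) + (d2 f x' - d2 f x - fderiv ℝ (d2 f) x z)
    with hρ
  set e := d2 g x' - d2 f x with he
  have heq : e = δ + fderiv ℝ (d2 f) x z + ρ := by rw [he, hδ, hρ]; abel
  have k1 : ‖(d2 g x' - d2 f x') - (d2 g x - d2 f x)‖ ≤ 6 * ε' * ‖z‖ :=
    hc.norm_d2_sub_sub_le htame hg (by linarith) hx'R
  have k2 : ‖d2 f x' - d2 f x - fderiv ℝ (d2 f) x z‖ ≤ CT * ‖z‖ ^ 2 := by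
    have := hCT x z
    rwa [hxz] at this
  have hρle : ‖ρ‖ ≤ 6 * ε' * ‖z‖ + CT * ‖z‖ ^ 2 := (norm_add_le _ _).trans (by linarith)
  have hele : ‖e‖ ≤ ‖δ‖ + (6 + CD) * ‖z‖ := by
    have e1 : e = δ + ((d2 g x' - d2 f x') - (d2 g x - d2 f x)) + (d2 f x' - d2 f x) := by
      rw [he, hδ]; abel
    rw [e1]
    have h1 := norm_add₃_le (a := δ) (b := (d2 g x' - d2 f x') - (d2 g x - d2 f x))
      (c := d2 f x' - d2 f x)
    have h2 := hCD x' x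
    have h3 : 6 * ε' * ‖z‖ ≤ 6 * 1 * ‖z‖ := by gcongr
    rw [← hz] at h2
    linarith
  have hmain : (σ • V g x' - σ • V f x) - (act (σ • jac (V f) x) z + act (σ • Gtilde f x) δ) =
      σ • ((G (d2 f x + e) - G (d2 f x) - dG (d2 f x) e) + act (Gtilde f x) ρ) := by
    have h1 : d2 f x + e = d2 g x' := by rw [he]; abel
    have h2 : dG (d2 f x) e = act (Gtilde f x) δ + act (jac (V f) x) z + act (Gtilde f x) ρ := by
      rw [act_jac_V htame.diff (disc_ne_zero hVx), ← act_add, ← act_add, ← heq, Gtilde,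
        act_jac_G (disc_ne_zero hVx)]
    rw [h1, h2, act_smul_left, act_smul_left]
    change (σ • G (d2 g x') - σ • G (d2 f x)) - _ = _
    module
  rw [hmain, norm_smul, Real.norm_eq_abs, hσ1, one_mul]
  have t1 := norm_G_add_sub_le (disc_ne_zero hVx) e
  have t2 : 48 / ‖disc (d2 f x)‖ * ‖e‖ ^ 2 ≤ q * ‖e‖ ^ 2 := by
    rw [hq]; gcongr
  have t3 := norm_act_Gtilde_le f x ρ
  have t4 : ‖e‖ ^ 2 ≤ 2 * ‖δ‖ ^ 2 + 2 * (6 + CD) ^ 2 * ‖z‖ ^ 2 := by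
    have : ‖e‖ ^ 2 ≤ (‖δ‖ + (6 + CD) * ‖z‖) ^ 2 := pow_le_pow_left₀ (norm_nonneg _) hele 2
    nlinarith [sq_nonneg (‖δ‖ - (6 + CD) * ‖z‖)]
  have t5 : q * ‖e‖ ^ 2 ≤ q * (2 * ‖δ‖ ^ 2 + 2 * (6 + CD) ^ 2 * ‖z‖ ^ 2) := by gcongr
  have t6 : Q * ‖z‖ * ‖z‖ ≤ η / 2 * ‖z‖ := mul_le_mul_of_nonneg_right hzQ (norm_nonneg _)
  have t7 : 144 * ε' * ‖z‖ ≤ η / 2 * ‖z‖ :=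
    mul_le_mul_of_nonneg_right (by linarith) (norm_nonneg _)
  have t8 := norm_add_le (G (d2 f x + e) - G (d2 f x) - dG (d2 f x) e) (act (Gtilde f x) ρ)
  have t9 : Q * ‖z‖ * ‖z‖ = q * (2 * (6 + CD) ^ 2 * ‖z‖ ^ 2) + 24 * (CT * ‖z‖ ^ 2) := by
    rw [hQ]; ring
  have t10 : q * (2 * ‖δ‖ ^ 2 + 2 * (6 + CD) ^ 2 * ‖z‖ ^ 2) =
    2 * q * ‖δ‖ ^ 2 + q * (2 * (6 + CD) ^ 2 * ‖z‖ ^ 2) := by ring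
  linarith

/-- The estimated filament point is, up to small terms, a linear functional of the errors of the
second derivatives along the path and of the gradient at the filament point. -/
theorem DensityAssumptions.exists_linearization (hf : DensityAssumptions f H L a)
    (hx₀ : x₀ ∈ startSet f L a) (hθ : IsFirstTime f x₀ θ)
    (hpath : ∀ t : ℝ, |t| ≤ |θ| →
      ¬ (lam2 f (curve f x₀ t) = 0 ∧ dirSlope f (curve f x₀ t) = 0))
    (hflat : grad f (curve f x₀ θ) = 0) {σ : ℝ} (hσ : σ = 1 ∨ σ = -1) (hσθ : σ * |θ| = θ) {R : ℝ}
    (hR : ∀ t, |t| ≤ |θ| + 1 → ‖curve f x₀ t‖ + 1 ≤ R) (p : Plane) {q : ℝ → Plane}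
    (hq : Continuous q) (hqT : q |θ| = -(act (Gam f (curve f x₀ θ))ᵀ p))
    (hq' : ∀ s ∈ Icc 0 |θ|, HasDerivWithinAt q
      (-(act (σ • jac (V f) (curve f x₀ (σ * s)))ᵀ (q s))) (Icc 0 |θ|) s) :
    ∃ C, 0 ≤ C ∧ ∀ η, 0 < η → ∃ ε > 0, ∀ g, Tame g → Close f g R ε → (∃ t, IsFirstTime g x₀ t) ∧
      ∀ t, IsFirstTime g x₀ t → ∀ δ : ℝ → Space,
        (∀ s, δ s = d2 g (curve f x₀ (σ * s)) - d2 f (curve f x₀ (σ * s))) →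
        ∀ W : ℝ → Plane, (∀ t, W t =
          ∫ s in (0 : ℝ)..t, act (σ • Gtilde f (curve f x₀ (σ * s))) (δ s)) →
        |inner ℝ p (curve g x₀ t - curve f x₀ θ)
          - ((∫ s in (0 : ℝ)..|θ|, inner ℝ (q s) (act (σ • Gtilde f (curve f x₀ (σ * s))) (δ s)))
            - (aPrime f (curve f x₀ θ))⁻¹ *
              inner ℝ p (act (PV f (curve f x₀ θ)) (grad g (curve f x₀ θ))))| ≤
        C * (∫ s in (0 : ℝ)..|θ|, ‖δ s‖ ^ 2)
          + η * (‖W |θ|‖ + (∫ s in (0 : ℝ)..|θ|, ‖W s‖) + ‖grad g (curve f x₀ θ)‖) := by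
  have htame := hf.tame
  have hV := hf.V_curve_ne_zero hx₀ hθ
  have hcc : Continuous fun s => curve f x₀ (σ * s) :=
    (htame.continuous_curve x₀).comp (by fun_prop)
  set A : ℝ → Matrix (Fin 2) (Fin 2) ℝ := fun s => σ • jac (V f) (curve f x₀ (σ * s)) with hA
  set B : ℝ → Matrix (Fin 2) (Fin 3) ℝ := fun s => σ • Gtilde f (curve f x₀ (σ * s)) with hB
  have hAc : ∀ i j, Continuous fun s => A s i j := fun i j =>
    (continuous_iff_continuousAt.2 fun s => ContinuousAt.comp (g := fun x => jac (V f) x i j)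
      (f := fun s => curve f x₀ (σ * s)) (hf.continuousAt_jac_V (hV _) i j)
      hcc.continuousAt).const_smul σ
  have hBc : ∀ i j, Continuous fun s => B s i j := fun i j =>
    (continuous_iff_continuousAt.2 fun s => ContinuousAt.comp (g := fun x => Gtilde f x i j)
      (f := fun s => curve f x₀ (σ * s)) (htame.continuousAt_Gtilde (hV _) i j)
      hcc.continuousAt).const_smul σ
  obtain ⟨CA, hCA0, hCA⟩ := exists_norm_act_le hAc |θ|
  obtain ⟨C₁, hC₁0, hrem⟩ := hf.exists_remainder_bound hV hσ (abs_nonneg θ)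
    (fun t ht => hR t (by linarith))
  obtain ⟨Q, hQ'⟩ := (isCompact_Icc (a := (0 : ℝ)) (b := |θ|)).exists_bound_of_continuousOn
    hq.continuousOn
  have hθ0 := abs_nonneg θ
  have hQ0 : 0 ≤ Q := (norm_nonneg _).trans (hQ' 0 ⟨le_rfl, hθ0⟩)
  set T := |θ| with hT
  set E := Real.exp ((CA + 1) * T) with hE
  have hE0 : 0 < E := Real.exp_pos _
  set K1 := E * (CA + 1) with hK1
  set K2 := E * C₁ with hK2
  have hK10 : 0 ≤ K1 := by positivity
  have hK20 : 0 ≤ K2 := by positivity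
  refine ⟨‖p‖ * K2 + Q * C₁ + Q * (T * K2), by positivity, fun η hη => ?_⟩
  set M := ‖p‖ * (1 + K1) + Q * (1 + T * K1) with hM
  have hM0 : 0 ≤ M := by positivity
  set η' := min 1 (η / (M + 1)) with hη'
  have hη'0 : 0 < η' := by positivity
  have hη'1 : η' ≤ 1 := min_le_left _ _
  have hη'M : η' * M ≤ η := by
    have h1 : η' ≤ η / (M + 1) := min_le_right _ _
    rw [le_div_iff₀ (by positivity)] at h1
    linarith
  obtain ⟨ε₁, hε₁, hend⟩ := hf.endpoint_expansion (hV θ) hflat hθ.1.2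
    (hf.no_filament_before hx₀ hθ hpath) hR hη'0
  obtain ⟨ε₂, hε₂, hrem⟩ := hrem η' hη'0
  refine ⟨min ε₁ ε₂, by positivity, fun g hg hc => ?_⟩
  obtain ⟨hex, hall⟩ := hend g hg (hc.mono (min_le_left _ _))
  refine ⟨hex, fun t ht δ hδ W hW => ?_⟩
  have hlin := hall t ht
  have hr := hrem g hg (hc.mono (min_le_right _ _))
  have hδc : Continuous δ := by
    have : δ = fun s => d2 g (curve f x₀ (σ * s)) - d2 f (curve f x₀ (σ * s)) := funext hδ
    rw [this]
    exact (hg.continuous_d2.comp hcc).sub (htame.continuous_d2.comp hcc)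
  have hbc : Continuous fun s => act (B s) (δ s) := continuous_act_of_entries hBc hδc
  set z : ℝ → Plane := fun s => curve g x₀ (σ * s) - curve f x₀ (σ * s) with hz
  have hzd : ∀ s, HasDerivAt z (σ • V g (curve g x₀ (σ * s)) - σ • V f (curve f x₀ (σ * s))) s :=
    fun s => (hg.hasDerivAt_curve_mul x₀ σ s).sub (htame.hasDerivAt_curve_mul x₀ σ s)
  have hzc : Continuous z := continuous_iff_continuousAt.2 fun s => (hzd s).continuousAt
  have hz0 : z 0 = 0 := by
    simp [hz, (hg.curve_spec x₀).1, (htame.curve_spec x₀).1]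
  have hr' : ∀ s ∈ Icc 0 T, ‖(σ • V g (curve g x₀ (σ * s)) - σ • V f (curve f x₀ (σ * s)))
      - (act (A s) (z s) + act (B s) (δ s))‖ ≤ C₁ * ‖δ s‖ ^ 2 + η' * ‖z s‖ := by
    intro s hs
    have := hr s hs
    rw [← hδ s] at this
    exact this
  have hWc : Continuous W := by
    have : W = fun t => ∫ s in (0 : ℝ)..t, act (B s) (δ s) := funext hW
    rw [this]
    exact intervalIntegral.continuous_primitive (fun _ _ => hbc.intervalIntegrable _ _) 0
  have hbd := fun {t : ℝ} (ht : t ∈ Icc 0 T) => linear_ode_bound (D := fun s => C₁ * ‖δ s‖ ^ 2)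
    hCA0 hCA hbc (by fun_prop) (fun s => by positivity) hη'1 hzd hz0 hr' ht
  have hW' : ∀ t, ∫ s in (0 : ℝ)..t, act (B s) (δ s) = W t := fun t => (hW t).symm
  simp only [hW'] at hbd
  set S := ∫ s in (0 : ℝ)..T, ‖δ s‖ ^ 2 with hS
  set I := ∫ s in (0 : ℝ)..T, ‖W s‖ with hI
  have hS0 : 0 ≤ S := intervalIntegral.integral_nonneg hθ0 fun s _ => by positivity
  have hI0 : 0 ≤ I := intervalIntegral.integral_nonneg hθ0 fun s _ => norm_nonneg _
  have hsplit : ∫ s in (0 : ℝ)..T, ((CA + 1) * ‖W s‖ + C₁ * ‖δ s‖ ^ 2) = (CA + 1) * I + C₁ * S := by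
    rw [intervalIntegral.integral_add
      ((by fun_prop : Continuous fun s => (CA + 1) * ‖W s‖).intervalIntegrable _ _)
      ((by fun_prop : Continuous fun s => C₁ * ‖δ s‖ ^ 2).intervalIntegrable _ _),
      intervalIntegral.integral_const_mul, intervalIntegral.integral_const_mul]
  rw [hsplit] at hbd
  have hzT : ∀ t ∈ Icc 0 T, ‖z t‖ ≤ ‖W t‖ + (K1 * I + K2 * S) := fun t ht => by
    have := hbd ht
    rw [hK1, hK2]
    linarith
  have hIz : ∫ s in (0 : ℝ)..T, ‖z s‖ ≤ I + T * (K1 * I + K2 * S) := by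
    have h1 : ∫ s in (0 : ℝ)..T, ‖z s‖ ≤ ∫ s in (0 : ℝ)..T, (‖W s‖ + (K1 * I + K2 * S)) :=
      intervalIntegral.integral_mono_on hθ0 (hzc.norm.intervalIntegrable _ _)
        ((by fun_prop : Continuous fun s => ‖W s‖ + (K1 * I + K2 * S)).intervalIntegrable _ _)
        fun s hs => hzT s hs
    rw [intervalIntegral.integral_add (hWc.norm.intervalIntegrable _ _)
      (continuous_const.intervalIntegrable _ _), intervalIntegral.integral_const, sub_zero,
      smul_eq_mul] at h1
    exact h1
  have hadj := adjoint_bound (D := fun s => C₁ * ‖δ s‖ ^ 2 + η' * ‖z s‖) hθ0 hbc (by fun_prop)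
    hzd hz0 hr' hq hq' hQ'
  rw [intervalIntegral.integral_add
      ((by fun_prop : Continuous fun s => C₁ * ‖δ s‖ ^ 2).intervalIntegrable _ _)
      ((by fun_prop : Continuous fun s => η' * ‖z s‖).intervalIntegrable _ _),
      intervalIntegral.integral_const_mul, intervalIntegral.integral_const_mul, ← hS] at hadj
  have hzθ : z T = curve g x₀ θ - curve f x₀ θ := by
    simp only [hz]; rw [hσθ]
  rw [← hzθ] at hlin
  set n := grad g (curve f x₀ θ) with hn
  -- The final value of q is chosen so that duality produces the term -⟨p, Γz⟩ of the end point
  -- expansion.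
  have hqz : inner ℝ (q T) (z T) = -inner ℝ p (act (Gam f (curve f x₀ θ)) (z T)) := by
    rw [hqT, inner_neg_left, inner_act_transpose]
  have hp := (abs_real_inner_le_norm p _).trans
    (mul_le_mul_of_nonneg_left hlin (norm_nonneg p))
  rw [inner_add_right, inner_add_right, real_inner_smul_right] at hp
  have hzTT := hzT T ⟨hθ0, le_rfl⟩
  set u := inner ℝ p (curve g x₀ t - curve f x₀ θ) with hu
  set i₁ := ∫ s in (0 : ℝ)..T, inner ℝ (q s) (act (B s) (δ s)) with hi₁
  set i₂ := (aPrime f (curve f x₀ θ))⁻¹ * inner ℝ p (act (PV f (curve f x₀ θ)) n) with hi₂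
  have htri : |u - (i₁ - i₂)| ≤
      |u + inner ℝ p (act (Gam f (curve f x₀ θ)) (z T)) + i₂| + |inner ℝ (q T) (z T) - i₁| := by
    have e : u - (i₁ - i₂) = (u + inner ℝ p (act (Gam f (curve f x₀ θ)) (z T)) + i₂)
        + (inner ℝ (q T) (z T) - i₁) := by rw [hqz]; ring
    rw [e]
    exact abs_add_le _ _
  refine htri.trans ((add_le_add hp hadj).trans ?_)
  have hP := norm_nonneg p
  have hWT := norm_nonneg (W T)
  have hn0 := norm_nonneg n
  have hX0 : 0 ≤ K1 * I + K2 * S := by positivity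
  have s1 : ‖p‖ * (η' * (‖z T‖ + ‖n‖)) ≤ ‖p‖ * (η' * (‖W T‖ + (K1 * I) + ‖n‖)) + ‖p‖ * K2 * S := by
    have h1 : η' * (K2 * S) ≤ 1 * (K2 * S) := by gcongr
    have h2 : ‖p‖ * (η' * (‖z T‖ + ‖n‖)) ≤ ‖p‖ * (η' * (‖W T‖ + (K1 * I + K2 * S) + ‖n‖)) := by
      gcongr
    have h3 : ‖p‖ * (η' * (K2 * S)) ≤ ‖p‖ * (1 * (K2 * S)) := by gcongr
    linarith
  have s2 : Q * (C₁ * S + η' * ∫ s in (0 : ℝ)..T, ‖z s‖) ≤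
      Q * C₁ * S + Q * (T * K2) * S + Q * (η' * (I + T * (K1 * I))) := by
    have h1 : η' * (∫ s in (0 : ℝ)..T, ‖z s‖) ≤ η' * (I + T * (K1 * I + K2 * S)) := by gcongr
    have h2 : η' * (T * (K2 * S)) ≤ 1 * (T * (K2 * S)) := by gcongr
    have h3 : Q * (C₁ * S + η' * ∫ s in (0 : ℝ)..T, ‖z s‖) ≤
        Q * (C₁ * S + (η' * (I + T * (K1 * I)) + 1 * (T * (K2 * S)))) := by
      gcongr
      linarith
    linarith
  have s3 : ‖p‖ * (η' * (‖W T‖ + (K1 * I) + ‖n‖)) + Q * (η' * (I + T * (K1 * I))) ≤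
      η * (‖W T‖ + I + ‖n‖) := by
    have h1 : ‖p‖ * (η' * (‖W T‖ + (K1 * I) + ‖n‖)) ≤
        η' * (‖p‖ * (1 + K1)) * (‖W T‖ + I + ‖n‖) := by
      have : ‖W T‖ + K1 * I + ‖n‖ ≤ (1 + K1) * (‖W T‖ + I + ‖n‖) := by
        have a1 := mul_nonneg hK10 hWT
        have a2 := mul_nonneg hK10 hn0
        linarith
      calc _ ≤ ‖p‖ * (η' * ((1 + K1) * (‖W T‖ + I + ‖n‖))) := by gcongr
        _ = _ := by ring
    have h2 : Q * (η' * (I + T * (K1 * I))) ≤ η' * (Q * (1 + T * K1)) * (‖W T‖ + I + ‖n‖) := by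
      have : I + T * (K1 * I) ≤ (1 + T * K1) * (‖W T‖ + I + ‖n‖) := by
        have a1 : 0 ≤ (1 + T * K1) * (‖W T‖ + ‖n‖) := by positivity
        linarith
      calc _ ≤ Q * (η' * ((1 + T * K1) * (‖W T‖ + I + ‖n‖))) := by gcongr
        _ = _ := by ring
    have h3 : η' * M * (‖W T‖ + I + ‖n‖) ≤ η * (‖W T‖ + I + ‖n‖) :=
      mul_le_mul_of_nonneg_right hη'M (by positivity)
    have h4 : η' * M * (‖W T‖ + I + ‖n‖) = η' * (‖p‖ * (1 + K1)) * (‖W T‖ + I + ‖n‖)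
        + η' * (Q * (1 + T * K1)) * (‖W T‖ + I + ‖n‖) := by rw [hM]; ring
    linarith
  linarith

end


/-! ### The mean and the covariance of the limit -/

section

variable {A D : ℝ → Matrix (Fin 2) (Fin 2) ℝ} {b m q : ℝ → Plane} {T : ℝ}

lemma exists_linear_mean (hA : ∀ i j, Continuous fun s => A s i j) (hb : Continuous b)
    (hT : 0 ≤ T) : ∃ m : ℝ → Plane, m 0 = 0 ∧
      ∀ t ∈ Icc 0 T, HasDerivWithinAt m (act (A t) (m t) + b t) (Icc 0 T) t :=
  exists_linear_solution
    (A := fun t => LinearMap.toContinuousLinearMap (Matrix.toLpLin 2 2 (A t)))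
    (fun _ => continuous_act_of_entries hA continuous_const) hb 0 hT

/-- The right-hand side of the linear part of the covariance equation, as a linear map. -/
noncomputable def lyapunov (M : Matrix (Fin 2) (Fin 2) ℝ) :
    (Fin 2 → Fin 2 → ℝ) →ₗ[ℝ] (Fin 2 → Fin 2 → ℝ) where
  toFun X i j := ∑ k, M i k * X k j + ∑ k, X i k * M j k
  map_add' X Y := by
    ext i j
    simp only [Pi.add_apply, Fin.sum_univ_two]
    ring
  map_smul' c X := by
    ext i j
    simp only [Pi.smul_apply, smul_eq_mul, Fin.sum_univ_two, RingHom.id_apply]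
    ring

lemma exists_linear_cov (hA : ∀ i j, Continuous fun s => A s i j)
    (hD : ∀ i j, Continuous fun s => D s i j) (hDs : ∀ s, (D s)ᵀ = D s) (hT : 0 ≤ T) :
    ∃ S : ℝ → Matrix (Fin 2) (Fin 2) ℝ, S 0 = 0 ∧ (∀ t, (S t)ᵀ = S t) ∧
      ∀ t ∈ Icc 0 T, ∀ i j, HasDerivWithinAt (fun s => S s i j)
        ((A t * S t + S t * (A t)ᵀ + D t) i j) (Icc 0 T) t := by
  obtain ⟨X, h0, hX⟩ := exists_linear_solution (E := Fin 2 → Fin 2 → ℝ)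
    (A := fun t => LinearMap.toContinuousLinearMap (lyapunov (A t)))
    (b := fun t i j => D t i j)
    (fun X => by
      refine continuous_pi fun i => continuous_pi fun j => ?_
      change Continuous fun t => ∑ k, A t i k * X k j + ∑ k, X i k * A t j k
      have := hA
      fun_prop)
    (continuous_pi fun i => continuous_pi fun j => hD i j) 0 hT
  have hX' : ∀ t ∈ Icc 0 T, ∀ i j, HasDerivWithinAt (fun s => X s i j)
      ((∑ k, A t i k * X t k j + ∑ k, X t i k * A t j k) + D t i j) (Icc 0 T) t := fun t ht i j =>
    hasDerivWithinAt_pi.1 (hasDerivWithinAt_pi.1 (hX t ht) i) j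
  -- The solution is averaged with its transpose. As D is symmetric the transpose solves the same
  -- equation, so symmetry is obtained without invoking uniqueness.
  refine ⟨fun t => Matrix.of fun i j => (X t i j + X t j i) / 2, ?_, fun t => ?_,
    fun t ht i j => ?_⟩
  · ext i j
    simp [h0]
  · ext i j
    simp [add_comm]
  · have hs : D t j i = D t i j := congrFun (congrFun (hDs t) i) j
    convert! ((hX' t ht i j).add (hX' t ht j i)).div_const 2 using 1
    simp only [Matrix.add_apply, Matrix.mul_apply, Matrix.of_apply, Matrix.transpose_apply,
      Fin.sum_univ_two, hs]
    ring

lemma integral_eq_of_hasDerivWithinAt_Icc {φ φ' : ℝ → ℝ} (hT : 0 ≤ T)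
    (h : ∀ t ∈ Icc 0 T, HasDerivWithinAt φ (φ' t) (Icc 0 T) t) (hc : Continuous φ') :
    ∫ s in (0 : ℝ)..T, φ' s = φ T - φ 0 :=
  intervalIntegral.integral_eq_sub_of_hasDerivAt_of_le hT
    (fun t ht => (h t ht).continuousWithinAt)
    (fun t ht => (h t (Ioo_subset_Icc_self ht)).hasDerivAt (Icc_mem_nhds ht.1 ht.2))
    (hc.intervalIntegrable _ _)

/-- In the derivative of ⟨q, m⟩ the terms with A cancel against the adjoint equation and only ⟨q, b⟩
remains. -/
lemma inner_linear_mean (hT : 0 ≤ T) (hb : Continuous b) (hm0 : m 0 = 0)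
    (hm : ∀ t ∈ Icc 0 T, HasDerivWithinAt m (act (A t) (m t) + b t) (Icc 0 T) t)
    (hq : Continuous q)
    (hq' : ∀ s ∈ Icc 0 T, HasDerivWithinAt q (-(act (A s)ᵀ (q s))) (Icc 0 T) s) :
    inner ℝ (q T) (m T) = ∫ s in (0 : ℝ)..T, inner ℝ (q s) (b s) := by
  have := integral_eq_of_hasDerivWithinAt_Icc (φ := fun t => (inner ℝ (q t) (m t) : ℝ))
    (φ' := fun t => (inner ℝ (q t) (b t) : ℝ)) hT (fun t ht => ?_) (hq.inner hb)
  · rw [this, hm0, inner_zero_right, sub_zero]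
  · convert! (hq' t ht).inner ℝ (hm t ht) using 1
    rw [inner_neg_left, inner_add_right, inner_act_transpose]
    ring

lemma HasDerivWithinAt.plane_apply {q' : Plane} {s : Set ℝ} {t : ℝ}
    (h : HasDerivWithinAt q q' s t) (i : Fin 2) :
    HasDerivWithinAt (fun t => q t i) (q' i) s t :=
  (EuclideanSpace.proj (𝕜 := ℝ) i).hasFDerivAt.comp_hasDerivWithinAt t h

/-- The derivative of ⟨q, Sq⟩ has two drift terms, one for each side of S; both cancel against the
adjoint equation. -/
lemma inner_linear_cov {S : ℝ → Matrix (Fin 2) (Fin 2) ℝ} (hT : 0 ≤ T)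
    (hD : ∀ i j, Continuous fun s => D s i j) (hS0 : S 0 = 0)
    (hS : ∀ t ∈ Icc 0 T, ∀ i j, HasDerivWithinAt (fun s => S s i j)
        ((A t * S t + S t * (A t)ᵀ + D t) i j) (Icc 0 T) t)
    (hq : Continuous q)
    (hq' : ∀ s ∈ Icc 0 T, HasDerivWithinAt q (-(act (A s)ᵀ (q s))) (Icc 0 T) s) :
    inner ℝ (q T) (act (S T) (q T)) = ∫ s in (0 : ℝ)..T, inner ℝ (q s) (act (D s) (q s)) := by
  have key := integral_eq_of_hasDerivWithinAt_Icc
    (φ := fun t => (inner ℝ (q t) (act (S t) (q t)) : ℝ))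
    (φ' := fun t => (inner ℝ (q t) (act (D t) (q t)) : ℝ)) hT (fun t ht => ?_)
    (hq.inner (continuous_act_of_entries hD hq))
  · rw [key]
    simp [hS0, PiLp.inner_apply, act_apply]
  · have h := fun i => HasDerivWithinAt.plane_apply (hq' t ht) i
    have h2 := fun i j => ((h i).mul (hS t ht i j)).mul (h j)
    convert! ((h2 0 0).add (h2 0 1)).add ((h2 1 0).add (h2 1 1)) using 1
    · funext s
      simp only [PiLp.inner_apply, act_apply, RCLike.inner_apply, conj_trivial, Fin.sum_univ_two,
        Pi.add_apply, Pi.mul_apply]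
      ring
    · simp only [PiLp.inner_apply, act_apply, RCLike.inner_apply, conj_trivial, Fin.sum_univ_two,
        PiLp.neg_apply, Pi.mul_apply, Matrix.add_apply, Matrix.mul_apply, Matrix.transpose_apply]
      ring

end

section

variable {f K : Plane → ℝ} {H L : Set Plane} {a : ℝ} {x₀ : Plane} {θ β : ℝ}

lemma DensityAssumptions.continuous_vBias (hf : DensityAssumptions f H L a)
    (hK : KernelAssumptions K) : Continuous (vBias f K) := by
  have h : ∀ j, Continuous fun x => vBias f K x j := fun j => by
    simp only [vBias_apply, kernelHess_eq hK, pd_eq_wd, ← wd_append]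
    have hc : ∀ w : List (Fin 2), w.length = 4 → Continuous (wd w f) := fun w hw =>
      (contDiff_wd (n := 0) w (by rw [hw]; exact hf.contDiff)).continuous
    exact continuous_const.mul ((hc _ (by simp [length_d2word])).add
      (hc _ (by simp [length_d2word])))
  have : vBias f K = fun x => WithLp.toLp 2 fun j => vBias f K x j := rfl
  rw [this]
  exact (PiLp.continuous_toLp 2 _).comp (continuous_pi h)

lemma hasDerivWithinAt_comp_sign {E : Type*} [NormedAddCommGroup E] [NormedSpace ℝ E]
    {φ : ℝ → E} {φ' : E} {σ t : ℝ} (hσ : σ = 1 ∨ σ = -1) (hσθ : σ * |θ| = θ)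
    (ht : t ∈ uIcc 0 θ) (h : HasDerivWithinAt φ φ' (Icc 0 |θ|) (σ * t)) :
    HasDerivWithinAt (fun s => φ (σ * s)) (σ • φ') (uIcc 0 θ) t := by
  refine h.scomp t (by simpa using ((hasDerivAt_id t).const_mul σ).hasDerivWithinAt) ?_
  intro s hs
  have h0 := abs_nonneg θ
  rcases hσ with rfl | rfl
  · rw [one_mul] at hσθ
    rw [uIcc_of_le (hσθ ▸ h0)] at hs
    simpa [hσθ] using hs
  · have h1 : θ ≤ 0 := by linarith
    rw [uIcc_of_ge h1] at hs
    rw [abs_of_nonpos h1]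
    exact ⟨by linarith [hs.2], by linarith [hs.1]⟩

lemma sign_mul_mem_Icc {σ t : ℝ} (hσ : σ = 1 ∨ σ = -1) (hσθ : σ * |θ| = θ)
    (ht : t ∈ uIcc 0 θ) : σ * t ∈ Icc 0 |θ| := by
  have h0 := abs_nonneg θ
  rcases hσ with rfl | rfl
  · rw [one_mul] at hσθ
    rw [uIcc_of_le (hσθ ▸ h0)] at ht
    simpa [hσθ] using ht
  · have h1 : θ ≤ 0 := by linarith
    rw [uIcc_of_ge h1] at ht
    rw [abs_of_nonpos h1]
    exact ⟨by linarith [ht.2], by linarith [ht.1]⟩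

/-- The mean and the covariance of the limit exist and are dual to the adjoint equation. -/
theorem DensityAssumptions.exists_limit_mean_cov (hf : DensityAssumptions f H L a)
    (hK : KernelAssumptions K) (hx₀ : x₀ ∈ startSet f L a) (hθ : IsFirstTime f x₀ θ) (β : ℝ)
    {σ : ℝ} (hσ : σ = 1 ∨ σ = -1) (hσθ : σ * |θ| = θ) :
    ∃ (m : ℝ → Plane) (S : ℝ → Matrix (Fin 2) (Fin 2) ℝ),
      IsLimitMean f K β x₀ θ m ∧ IsLimitCov f K x₀ θ S ∧ (S θ)ᵀ = S θ ∧
      ∀ q : ℝ → Plane, Continuous q → (∀ s ∈ Icc 0 |θ|, HasDerivWithinAt q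
          (-(act (σ • jac (V f) (curve f x₀ (σ * s)))ᵀ (q s))) (Icc 0 |θ|) s) →
        inner ℝ (q |θ|) (m θ) = √β * ∫ s in (0 : ℝ)..|θ|,
          inner ℝ (act (σ • Gtilde f (curve f x₀ (σ * s)))ᵀ (q s))
            ((2⁻¹ : ℝ) • vBias f K (curve f x₀ (σ * s))) ∧
        inner ℝ (q |θ|) (act (S θ) (q |θ|)) = ∫ s in (0 : ℝ)..|θ|,
          inner ℝ (act (σ • Gtilde f (curve f x₀ (σ * s)))ᵀ (q s))
            (act (innerCov f K (curve f x₀ (σ * s)))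
              (act (σ • Gtilde f (curve f x₀ (σ * s)))ᵀ (q s))) := by
  have htame := hf.tame
  have hV := hf.V_curve_ne_zero hx₀ hθ
  have hσσ : σ * σ = 1 := by rcases hσ with rfl | rfl <;> norm_num
  have hcc : Continuous fun s => curve f x₀ (σ * s) :=
    (htame.continuous_curve x₀).comp (by fun_prop)
  have hT := abs_nonneg θ
  set A : ℝ → Matrix (Fin 2) (Fin 2) ℝ := fun s => σ • jac (V f) (curve f x₀ (σ * s)) with hA
  set B : ℝ → Matrix (Fin 2) (Fin 3) ℝ := fun s => σ • Gtilde f (curve f x₀ (σ * s)) with hB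
  set D : ℝ → Matrix (Fin 2) (Fin 2) ℝ := fun s => diffusion f K (curve f x₀ (σ * s)) with hD
  have hAc : ∀ i j, Continuous fun s => A s i j := fun i j =>
    (continuous_iff_continuousAt.2 fun s => ContinuousAt.comp (g := fun x => jac (V f) x i j)
      (f := fun s => curve f x₀ (σ * s)) (hf.continuousAt_jac_V (hV _) i j)
      hcc.continuousAt).const_smul σ
  have hGc : ∀ i j, Continuous fun s => Gtilde f (curve f x₀ (σ * s)) i j := fun i j =>
    continuous_iff_continuousAt.2 fun s => ContinuousAt.comp (g := fun x => Gtilde f x i j)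
      (f := fun s => curve f x₀ (σ * s)) (htame.continuousAt_Gtilde (hV _) i j)
      hcc.continuousAt
  have hBc : ∀ i j, Continuous fun s => B s i j := fun i j => (hGc i j).const_smul σ
  have hIc : ∀ i j, Continuous fun s => innerCov f K (curve f x₀ (σ * s)) i j := fun i j =>
    continuous_iff_continuousAt.2 fun s => ContinuousAt.comp (g := fun x => innerCov f K x i j)
      (f := fun s => curve f x₀ (σ * s)) (continuousAt_innerCov htame hK (hV _) i j)
      hcc.continuousAt
  have hDc : ∀ i j, Continuous fun s => D s i j := by
    intro i j
    simp only [hD, diffusion, Matrix.mul_apply, Matrix.transpose_apply]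
    fun_prop
  have hDs : ∀ s, (D s)ᵀ = D s := by
    intro s
    simp only [hD, diffusion, Matrix.transpose_mul, Matrix.transpose_transpose, innerCov_symm,
      Matrix.mul_assoc]
  have hvc : Continuous fun s => vBias f K (curve f x₀ (σ * s)) :=
    (hf.continuous_vBias hK).comp hcc
  set b : ℝ → Plane := fun s => (√β / 2) • act (B s) (vBias f K (curve f x₀ (σ * s))) with hb
  have hbc : Continuous b := (continuous_act_of_entries hBc hvc).const_smul (√β / 2)
  obtain ⟨m, hm0, hm⟩ := exists_linear_mean hAc hbc hT
  obtain ⟨S, hS0, hSs, hS⟩ := exists_linear_cov hAc hDc hDs hT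
  have hσθ' : σ * θ = |θ| := by
    rw [← hσθ, ← mul_assoc, hσσ, one_mul, abs_mul, abs_abs]
    rcases hσ with rfl | rfl <;> simp
  refine ⟨fun t => m (σ * t), fun t => S (σ * t), ⟨by simp [hm0], fun t ht => ?_⟩,
    ⟨by simp [hS0], fun t ht i j => ?_⟩, hSs _, fun q hq hq' => ?_⟩
  · convert! hasDerivWithinAt_comp_sign hσ hσθ ht (hm _ (sign_mul_mem_Icc hσ hσθ ht)) using 1
    have e : σ * (σ * t) = t := by rw [← mul_assoc, hσσ, one_mul]
    simp only [hA, hb, hB, e, act_smul_left, smul_add, smul_smul]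
    rw [hσσ, one_smul, mul_comm (√β / 2) σ, ← mul_assoc, hσσ, one_mul, add_comm]
  -- For θ = 0 the sign is 0 while σ is ±1, but the time interval is a single point, where every
  -- derivative is admissible.
  · by_cases h0 : θ = 0
    · subst h0
      have : t = 0 := by simpa using ht
      rw [uIcc_self, this]
      rw [hasDerivWithinAt_iff_hasFDerivWithinAt]
      exact HasFDerivWithinAt.singleton
    have hsign : Real.sign θ = σ := by
      rcases hσ with rfl | rfl
      · rw [one_mul] at hσθ
        exact Real.sign_of_pos (lt_of_le_of_ne (hσθ ▸ hT) (Ne.symm h0))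
      · exact Real.sign_of_neg (lt_of_le_of_ne (by linarith) h0)
    convert! hasDerivWithinAt_comp_sign (φ := fun s => S s i j) hσ hσθ ht
      (hS _ (sign_mul_mem_Icc hσ hσθ ht) i j) using 1
    have e : σ * (σ * t) = t := by rw [← mul_assoc, hσσ, one_mul]
    simp only [hA, hD, e, hsign, Matrix.transpose_smul, Matrix.smul_mul, Matrix.mul_smul,
      Matrix.add_apply, Matrix.smul_apply, smul_eq_mul, mul_add]
    rw [← mul_assoc, ← mul_assoc, hσσ, one_mul, one_mul]
  · have h1 := inner_linear_mean hT hbc hm0 hm hq hq'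
    have h2 := inner_linear_cov hT hDc hS0 hS hq hq'
    simp only [hσθ']
    refine ⟨?_, ?_⟩
    · rw [h1, ← intervalIntegral.integral_const_mul]
      congr 1; funext s
      simp only [hb]
      rw [real_inner_smul_right, real_inner_smul_right, inner_act_transpose]
      ring
    · rw [h2]
      congr 1; funext s
      have e : D s = B s * innerCov f K (curve f x₀ (σ * s)) * (B s)ᵀ := by
        simp only [hD, hB, diffusion, Matrix.transpose_smul, Matrix.smul_mul, Matrix.mul_smul,
          smul_smul, hσσ, one_smul]
      rw [← inner_act_transpose, e, ← act_act, ← act_act]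

end


/-! ### Dependence of the estimators on the data -/

section

variable {f K : Plane → ℝ} {H L : Set Plane} {l : ℝ} {h : ℝ} {n : ℕ}

lemma KernelAssumptions.continuous_wd_kde (hK : KernelAssumptions K) (h : ℝ) (n : ℕ)
    {w : List (Fin 2)} (hw : w.length ≤ 3) :
    Continuous fun p : (ℕ → Plane) × Plane => wd w (kde K h n p.1) p.2 := by
  simp only [wd_kde h n _ w (hK.diffWords.mono (by omega)), kde]
  have hc := (hK.ballFun_wd w hw).cont
  have : ∀ i : ℕ, Continuous fun p : (ℕ → Plane) × Plane => wd w K (h⁻¹ • (p.2 - p.1 i)) :=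
    fun i => hc.comp (by fun_prop)
  exact continuous_const.mul (continuous_const.mul (continuous_finsetSum _ fun i _ => this i))

lemma KernelAssumptions.exists_abs_wd_kde_le (hK : KernelAssumptions K) (h : ℝ) (n : ℕ)
    {w : List (Fin 2)} (hw : w.length ≤ 3) :
    ∃ M, 0 ≤ M ∧ ∀ X x, |wd w (kde K h n X) x| ≤ M := by
  obtain ⟨M, hM0, hM⟩ := (hK.ballFun_wd w hw).bounded
  refine ⟨|h⁻¹ ^ w.length| * (|((n : ℝ) * h ^ 2)⁻¹| * (n * M)), by positivity, fun X x => ?_⟩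
  simp only [wd_kde h n _ w (hK.diffWords.mono (by omega)), kde, abs_mul]
  gcongr
  refine (Finset.abs_sum_le_sum_abs _ _).trans ((Finset.sum_le_card_nsmul _ _ M fun i _ => hM _).trans ?_)
  simp

lemma KernelAssumptions.continuous_d2_kde (hK : KernelAssumptions K) (h : ℝ) (n : ℕ) :
    Continuous fun p : (ℕ → Plane) × Plane => d2 (kde K h n p.1) p.2 := by
  have : (fun p : (ℕ → Plane) × Plane => d2 (kde K h n p.1) p.2) =
      fun p => WithLp.toLp 2 fun j => wd (d2word j) (kde K h n p.1) p.2 := by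
    funext p; ext j; simp [d2_apply]
  rw [this]
  exact (PiLp.continuous_toLp 2 _).comp (continuous_pi fun j =>
    hK.continuous_wd_kde h n (by simp [length_d2word]))

/-- The second derivatives of the estimator are Lipschitz continuous in the data, uniformly in
space. -/
lemma KernelAssumptions.exists_norm_d2_kde_sub_le (hK : KernelAssumptions K) (h : ℝ) (n : ℕ) :
    ∃ C, 0 ≤ C ∧ ∀ X Y x, ‖d2 (kde K h n X) x - d2 (kde K h n Y) x‖ ≤
      C * ∑ i ∈ Finset.range n, ‖X i - Y i‖ := by
  obtain ⟨C, hC0, hC⟩ := exists_bound_wd_kernel hK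
  set c := |h⁻¹ ^ 2| * (|((n : ℝ) * h ^ 2)⁻¹| * (2 * C * |h⁻¹|)) with hc
  refine ⟨3 * c, by positivity, fun X Y x => ?_⟩
  rw [mul_assoc]
  refine norm_d2_sub_le fun j => ?_
  rw [d2_apply, d2_apply, wd_kde h n _ _ (hK.diffWords.mono (by simp [length_d2word])),
    wd_kde h n _ _ (hK.diffWords.mono (by simp [length_d2word])), length_d2word, ← mul_sub, kde, kde,
    ← mul_sub, ← Finset.sum_sub_distrib, abs_mul, abs_mul, hc, mul_assoc, mul_assoc]
  gcongr
  refine (Finset.abs_sum_le_sum_abs _ _).trans ?_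
  rw [Finset.mul_sum]
  refine Finset.sum_le_sum fun i _ => ?_
  refine (wd_lipschitz_of_bound hK.diffWords hC (by simp [length_d2word]) _ _).trans ?_
  rw [← smul_sub, norm_smul, Real.norm_eq_abs, mul_assoc (2 * C)]
  have : ‖x - X i - (x - Y i)‖ = ‖X i - Y i‖ := by
    rw [sub_sub_sub_cancel_left, norm_sub_rev]
  rw [this]

/-- The integral curves of the estimator are continuous functions of the data and of time. -/
theorem KernelAssumptions.continuous_curve_kde (hK : KernelAssumptions K) (h : ℝ) (n : ℕ)
    (x₀ : Plane) :
    Continuous fun p : (ℕ → Plane) × ℝ => curve (kde K h n p.1) x₀ p.2 := by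
  obtain ⟨c, hc0, hc⟩ := hK.exists_norm_d2_kde_sub_le h n
  refine continuous_iff_continuousAt.2 fun ⟨X, t⟩ => ?_
  have hX := hK.tame_kde h n X
  obtain ⟨C, hC0, hC⟩ := hX.lipschitz_V
  set T := |t| + 1 with hT
  have hT0 : 0 ≤ T := by positivity
  set ε : (ℕ → Plane) → ℝ := fun Y => 24 * (c * ∑ i ∈ Finset.range n, ‖Y i - X i‖) with hε
  have hε0 : ∀ Y, 0 ≤ ε Y := fun Y => by
    have := Finset.sum_nonneg fun i (_ : i ∈ Finset.range n) => norm_nonneg (Y i - X i)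
    positivity
  have hεt : Tendsto (fun p : (ℕ → Plane) × ℝ => Real.exp (C * T) * (T * ε p.1)) (𝓝 (X, t))
      (𝓝 0) := by
    have : Continuous fun p : (ℕ → Plane) × ℝ => Real.exp (C * T) * (T * ε p.1) := by
      simp only [hε]
      fun_prop
    have h2 := this.tendsto (X, t)
    simpa [hε] using h2
  have hsmall : ∀ᶠ p : (ℕ → Plane) × ℝ in 𝓝 (X, t), Real.exp (C * T) * (T * ε p.1) < 1 :=
    hεt.eventually (gt_mem_nhds one_pos)
  have htime : ∀ᶠ p : (ℕ → Plane) × ℝ in 𝓝 (X, t), |p.2| ≤ T := by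
    have : Continuous fun p : (ℕ → Plane) × ℝ => |p.2| := by fun_prop
    exact (this.tendsto (X, t)).eventually (ge_mem_nhds (by simp [hT]))
  have hlim : Tendsto (fun p : (ℕ → Plane) × ℝ => curve (kde K h n p.1) x₀ p.2
      - curve (kde K h n X) x₀ p.2) (𝓝 (X, t)) (𝓝 0) := by
    refine squeeze_zero_norm' ?_ hεt
    filter_upwards [hsmall, htime] with p hp ht
    refine (norm_curve_sub_le hX (hK.tame_kde h n p.1) hC0 hC (ρ := 1) (hε0 p.1)
      (fun s _ x _ => (norm_G_sub_le _ _).trans ?_) hp ht).trans ?_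
    · simp only [hε]
      have := hc p.1 X x
      linarith
    · have := hε0 p.1
      gcongr
  have h2 : Tendsto (fun p : (ℕ → Plane) × ℝ => curve (kde K h n X) x₀ p.2) (𝓝 (X, t))
      (𝓝 (curve (kde K h n X) x₀ t)) :=
    ((hX.continuous_curve x₀).comp continuous_snd).tendsto (X, t)
  have h3 := hlim.add h2
  simpa [ContinuousAt] using h3

/-- The error of the second derivatives of the estimator along a curve. -/
noncomputable def d2Err (f K : Plane → ℝ) (c : ℝ → Plane) (h : ℝ) (n : ℕ) (X : ℕ → Plane)
    (s : ℝ) : Space :=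
  d2 (kde K h n X) (c s) - d2 f (c s)

/-- The accumulated error of the driving term of the linearised equation. -/
noncomputable def driftErr (f K : Plane → ℝ) (B : ℝ → Matrix (Fin 2) (Fin 3) ℝ) (c : ℝ → Plane)
    (h : ℝ) (n : ℕ) (X : ℕ → Plane) (t : ℝ) : Plane :=
  ∫ s in (0 : ℝ)..t, act (B s) (d2Err f K c h n X s)

variable {c : ℝ → Plane} {B : ℝ → Matrix (Fin 2) (Fin 3) ℝ}

lemma continuous_d2Err (hf : Tame f) (hK : KernelAssumptions K) (hc : Continuous c) (h : ℝ)
    (n : ℕ) : Continuous fun p : (ℕ → Plane) × ℝ => d2Err f K c h n p.1 p.2 := by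
  have h1 := (hK.continuous_d2_kde h n).comp
    (by fun_prop : Continuous fun p : (ℕ → Plane) × ℝ => (p.1, c p.2))
  have h2 := hf.continuous_d2.comp (hc.comp continuous_snd : Continuous fun p : (ℕ → Plane) × ℝ => c p.2)
  exact h1.sub h2

lemma exists_norm_d2Err_le (hf : DensityAssumptions f H L l) (hK : KernelAssumptions K)
    (c : ℝ → Plane) (h : ℝ) (n : ℕ) : ∃ M, 0 ≤ M ∧ ∀ X s, ‖d2Err f K c h n X s‖ ≤ M := by
  obtain ⟨C, hC0, hC⟩ := exists_bound_wd_density hf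
  choose M hM0 hM using fun j : Fin 3 =>
    hK.exists_abs_wd_kde_le h n (w := d2word j) (by simp [length_d2word])
  refine ⟨∑ j, (M j + C), Finset.sum_nonneg fun j _ => add_nonneg (hM0 j) hC0, fun X s => ?_⟩
  refine (norm_le_sum_abs _).trans (Finset.sum_le_sum fun j _ => ?_)
  rw [d2Err, PiLp.sub_apply, d2_apply, d2_apply]
  exact (abs_sub _ _).trans (add_le_add (hM j X (c s))
    (hC _ (by simp [length_d2word]) (by simp [length_d2word]) _))

lemma continuous_act_d2Err (hf : Tame f) (hK : KernelAssumptions K) (hc : Continuous c)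
    (hB : ∀ i j, Continuous fun s => B s i j) (h : ℝ) (n : ℕ) :
    Continuous fun p : (ℕ → Plane) × ℝ => act (B p.2) (d2Err f K c h n p.1 p.2) := by
  have : (fun p : (ℕ → Plane) × ℝ => act (B p.2) (d2Err f K c h n p.1 p.2)) =
      fun p => WithLp.toLp 2 fun i => ∑ j, B p.2 i j * d2Err f K c h n p.1 p.2 j := by
    funext p; ext i; simp [act_apply]
  rw [this]
  have he := continuous_d2Err hf hK hc h n
  refine (PiLp.continuous_toLp 2 _).comp (continuous_pi fun i => continuous_finsetSum _ fun j _ =>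
    ((hB i j).comp continuous_snd).mul ?_)
  exact (PiLp.continuous_apply 2 _ j).comp he

lemma continuous_driftErr (hf : Tame f) (hK : KernelAssumptions K) (hc : Continuous c)
    (hB : ∀ i j, Continuous fun s => B s i j) (h : ℝ) (n : ℕ) :
    Continuous fun p : (ℕ → Plane) × ℝ => driftErr f K B c h n p.1 p.2 := by
  refine intervalIntegral.continuous_parametric_intervalIntegral_of_continuous
    (f := fun (p : (ℕ → Plane) × ℝ) s => act (B s) (d2Err f K c h n p.1 s)) ?_ continuous_snd
  exact (continuous_act_d2Err hf hK hc hB h n).comp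
    (by fun_prop : Continuous fun q : ((ℕ → Plane) × ℝ) × ℝ => (q.1.1, q.2))

lemma exists_norm_driftErr_le (hf : DensityAssumptions f H L l) (hK : KernelAssumptions K)
    (hB : ∀ i j, Continuous fun s => B s i j) (c : ℝ → Plane) (h : ℝ) (n : ℕ) (T : ℝ) :
    ∃ M, 0 ≤ M ∧ ∀ X, ∀ t ∈ Icc 0 T, ‖driftErr f K B c h n X t‖ ≤ M := by
  obtain ⟨C, hC0, hC⟩ := exists_norm_act_le hB T
  obtain ⟨M, hM0, hM⟩ := exists_norm_d2Err_le hf hK c h n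
  refine ⟨C * M * |T|, by positivity, fun X t ht => ?_⟩
  refine (intervalIntegral.norm_integral_le_of_norm_le_const (C := C * M) fun s hs => ?_).trans ?_
  · rw [uIoc_of_le ht.1] at hs
    exact (hC s ⟨hs.1.le, hs.2.trans ht.2⟩ _).trans (mul_le_mul_of_nonneg_left (hM X s) hC0)
  · rw [sub_zero]
    have : |t| ≤ |T| := abs_le_abs_of_nonneg ht.1 ht.2
    gcongr

end


/-! ### Moments of the errors along the path -/

/-- The projection of the line onto `[0, T]`. -/
def clampTime (T s : ℝ) : ℝ := max 0 (min s T)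

lemma clampTime_mem {T : ℝ} (hT : 0 ≤ T) (s : ℝ) : clampTime T s ∈ Icc 0 T :=
  ⟨le_max_left _ _, max_le hT (min_le_right _ _)⟩

lemma clampTime_eq {T s : ℝ} (hs : s ∈ Icc 0 T) : clampTime T s = s := by
  rw [clampTime, min_eq_left hs.2, max_eq_right hs.1]

lemma continuous_clampTime (T : ℝ) : Continuous (clampTime T) := by
  unfold clampTime
  fun_prop

/-- The coefficient that represents `⟨q, B e⟩` as `⟨a, e⟩` on `[0, T]`, extended to a bounded
function. -/
noncomputable def dualCoef (B : ℝ → Matrix (Fin 2) (Fin 3) ℝ) (q : ℝ → Plane) (T s : ℝ) : Space :=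
  act (B (clampTime T s))ᵀ (q (clampTime T s))

section

variable {Ω : Type*} [MeasurableSpace Ω] {P : Measure Ω} [IsProbabilityMeasure P]
  {X : ℕ → Ω → Plane}

lemma integrable_of_continuous_data (hX : ∀ i, Measurable (X i)) {φ : (ℕ → Plane) → ℝ}
    (hφ : Continuous φ) {M : ℝ} (hM : ∀ x, |φ x| ≤ M) :
    Integrable (fun ω => φ fun i => X i ω) P :=
  Integrable.of_bound (hφ.measurable.comp (measurable_pi_lambda _ hX)).aestronglyMeasurable M
    (Eventually.of_forall fun _ => hM _)

/-- Fubini's theorem. Clamping the time makes the integrand bounded everywhere, so that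
integrability on the product follows from continuity in data and time. -/
lemma integral_intervalIntegral_le (hX : ∀ i, Measurable (X i)) {φ : (ℕ → Plane) → ℝ → ℝ}
    (hφ : Continuous fun p : (ℕ → Plane) × ℝ => φ p.1 p.2) {T M D : ℝ} (hT : 0 ≤ T)
    (hM : ∀ x, ∀ s ∈ Icc 0 T, |φ x s| ≤ M)
    (hD : ∀ s ∈ Icc 0 T, ∫ ω, φ (fun i => X i ω) s ∂P ≤ D) :
    ∫ ω, (∫ s in (0 : ℝ)..T, φ (fun i => X i ω) s) ∂P ≤ T * D := by
  set ψ : Ω → ℝ → ℝ := fun ω s => φ (fun i => X i ω) (clampTime T s) with hψ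
  have e : ∀ ω, ∫ s in (0 : ℝ)..T, φ (fun i => X i ω) s = ∫ s in Ioc 0 T, ψ ω s := by
    intro ω
    rw [intervalIntegral.integral_of_le hT]
    refine setIntegral_congr_fun measurableSet_Ioc fun s hs => ?_
    simp only [hψ, clampTime_eq (Ioc_subset_Icc_self hs)]
  have hm : Measurable (Function.uncurry ψ) := by
    have h1 : Measurable fun p : Ω × ℝ => ((fun i => X i p.1, clampTime T p.2) : (ℕ → Plane) × ℝ) :=
      (measurable_pi_lambda _ fun i => (hX i).comp measurable_fst).prodMk
        ((continuous_clampTime T).measurable.comp measurable_snd)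
    exact hφ.measurable.comp h1
  have hint : Integrable (Function.uncurry ψ) (P.prod (volume.restrict (Ioc 0 T))) :=
    Integrable.of_bound hm.aestronglyMeasurable M
      (Eventually.of_forall fun p => hM _ _ (clampTime_mem hT _))
  simp only [e]
  rw [integral_integral_swap hint]
  calc ∫ s in Ioc 0 T, ∫ ω, ψ ω s ∂P ≤ ∫ _s in Ioc 0 T, D :=
        integral_mono hint.integral_prod_right (integrable_const _)
          fun s => hD _ (clampTime_mem hT s)
    _ = T * D := by simp [hT]

lemma Continuous.along_left {A B E : Type*} [TopologicalSpace A] [TopologicalSpace B]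
    [TopologicalSpace E] {φ : A → B → E} (hφ : Continuous fun p : A × B => φ p.1 p.2) (b : B) :
    Continuous fun a => φ a b :=
  hφ.comp (Continuous.prodMk_left b)

lemma integral_sq_norm_le_sum (hX : ∀ i, Measurable (X i)) {N : ℕ}
    {v : (ℕ → Plane) → EuclideanSpace ℝ (Fin N)} (hv : Continuous v) {M : ℝ}
    (hM : ∀ x, ‖v x‖ ≤ M) {D : Fin N → ℝ} (hD : ∀ j, ∫ ω, (v (fun i => X i ω) j) ^ 2 ∂P ≤ D j) :
    ∫ ω, ‖v fun i => X i ω‖ ^ 2 ∂P ≤ ∑ j, D j := by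
  simp only [EuclideanSpace.norm_sq_eq, Real.norm_eq_abs, sq_abs]
  rw [integral_finsetSum]
  · exact Finset.sum_le_sum fun j _ => hD j
  · intro j _
    refine integrable_of_continuous_data (P := P) hX (φ := fun x => (v x j) ^ 2) (M := M ^ 2)
      (((PiLp.continuous_apply 2 _ j).comp hv).pow 2) fun x => ?_
    rw [abs_pow]
    exact pow_le_pow_left₀ (abs_nonneg _) ((abs_apply_le_norm _ j).trans (hM x)) 2

/-- Convergence to zero in probability from a bound in mean outside of small events. -/
lemma tendsto_zero_of_bound {Y : ℕ → Ω → ℝ} {κ₀ D : ℝ} (hκ₀ : 0 ≤ κ₀) (hD : 0 ≤ D)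
    (h : ∀ η > 0, ∃ (U : ℕ → Ω → ℝ) (N : ℕ → Set Ω), (∀ n, Integrable (U n) P) ∧
      (∀ n ω, 0 ≤ U n ω) ∧ (∀ᶠ n in atTop, ∫ ω, U n ω ∂P ≤ η * D) ∧
      Tendsto (fun n => P (N n)) atTop (𝓝 0) ∧
      ∀ᶠ n in atTop, ∀ ω, ω ∉ N n → |Y n ω| ≤ η * κ₀ + U n ω) {κ : ℝ} (hκ : 0 < κ) {δ : ℝ}
    (hδ : 0 < δ) : ∀ᶠ n in atTop, P.real {ω | κ < |Y n ω|} ≤ δ := by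
  -- The first entry makes the deterministic part at most κ/2. The second makes the mean of U at
  -- most κδ/4, so by Markov's inequality U reaches κ/2 with probability at most δ/2; the other δ/2
  -- is spent on the exceptional set.
  set η := min (κ / (2 * (κ₀ + 1))) (κ * δ / (4 * (D + 1))) with hη
  have hη0 : 0 < η := by positivity
  obtain ⟨U, N, hUi, hU0, hUD, hN, hY⟩ := h η hη0
  have hη1 : η * κ₀ ≤ κ / 2 := by
    have h1 : η ≤ κ / (2 * (κ₀ + 1)) := min_le_left _ _
    rw [le_div_iff₀ (by positivity)] at h1
    linarith
  have hη2 : η * D ≤ κ * δ / 4 := by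
    have h1 : η ≤ κ * δ / (4 * (D + 1)) := min_le_right _ _
    rw [le_div_iff₀ (by positivity)] at h1
    linarith
  have hN' : ∀ᶠ n in atTop, P.real (N n) ≤ δ / 2 := by
    have h1 := (ENNReal.tendsto_toReal ENNReal.zero_ne_top).comp hN
    exact h1.eventually (ge_mem_nhds (by simpa using half_pos hδ))
  filter_upwards [hUD, hN', hY] with n h1 h2 h3
  have hsub : {ω | κ < |Y n ω|} ⊆ N n ∪ {ω | κ / 2 ≤ U n ω} := by
    intro ω (hω : κ < |Y n ω|)
    by_cases hn : ω ∈ N n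
    · exact Or.inl hn
    · refine Or.inr ?_
      have := h3 ω hn
      change κ / 2 ≤ U n ω
      linarith
  have hmarkov := mul_meas_ge_le_integral_of_nonneg (Eventually.of_forall (hU0 n)) (hUi n) (κ / 2)
  have h4 : P.real {ω | κ / 2 ≤ U n ω} ≤ δ / 2 := by
    have h5 : κ / 2 * P.real {ω | κ / 2 ≤ U n ω} ≤ κ / 2 * (δ / 2) :=
      hmarkov.trans (by linarith)
    exact le_of_mul_le_mul_left h5 (by positivity)
  refine (measureReal_mono hsub).trans ((measureReal_union_le _ _).trans ?_)
  linarith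

end

/-! ### Rates of the integrated errors of the second derivatives. -/

section

variable {f K : Plane → ℝ} {H L : Set Plane} {l : ℝ} {c c' : ℝ → Plane} {T γ : ℝ}
  {B : ℝ → Matrix (Fin 2) (Fin 3) ℝ} {q : ℝ → Plane}

lemma continuous_dualCoef (hB : ∀ i j, Continuous fun s => B s i j) (hq : Continuous q) (T : ℝ) :
    Continuous (dualCoef B q T) :=
  continuous_act_of_entries (fun i j => (hB j i).comp (continuous_clampTime T))
    (hq.comp (continuous_clampTime T))

lemma exists_norm_dualCoef_le (hB : ∀ i j, Continuous fun s => B s i j) (hq : Continuous q)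
    (hT : 0 ≤ T) : ∃ A, ∀ s, ‖dualCoef B q T s‖ ≤ A := by
  obtain ⟨A, hA⟩ := (isCompact_Icc (a := (0 : ℝ)) (b := T)).exists_bound_of_continuousOn
    (continuous_dualCoef hB hq T).continuousOn
  refine ⟨A, fun s => ?_⟩
  have := hA _ (clampTime_mem hT s)
  rwa [dualCoef, clampTime_eq (clampTime_mem hT s)] at this

lemma integral_inner_act_d2Err (hf : Tame f) (hK : KernelAssumptions K) (hc : Continuous c)
    (hB : ∀ i j, Continuous fun s => B s i j) (hq : Continuous q) {U : ℝ} (hU : U ∈ Icc 0 T)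
    (h : ℝ) (n : ℕ) (X : ℕ → Plane) :
    ∫ s in (0 : ℝ)..U, inner ℝ (q s) (act (B s) (d2Err f K c h n X s)) =
      (∫ s in Ioc 0 U, inner ℝ (dualCoef B q T s) (d2 (kde K h n X) (c s)))
        - ∫ s in Ioc 0 U, inner ℝ (dualCoef B q T s) (d2 f (c s)) := by
  have ha := continuous_dualCoef hB hq T
  have h1 : Continuous fun s => (inner ℝ (dualCoef B q T s) (d2 (kde K h n X) (c s)) : ℝ) :=
    ha.inner ((hK.tame_kde h n X).continuous_d2.comp hc)
  have h2 : Continuous fun s => (inner ℝ (dualCoef B q T s) (d2 f (c s)) : ℝ) :=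
    ha.inner (hf.continuous_d2.comp hc)
  rw [intervalIntegral.integral_of_le hU.1, ← integral_sub
    (h1.integrableOn_Icc.mono_set Ioc_subset_Icc_self)
    (h2.integrableOn_Icc.mono_set Ioc_subset_Icc_self)]
  refine setIntegral_congr_fun measurableSet_Ioc fun s hs => ?_
  have hs' : s ∈ Icc 0 T := ⟨hs.1.le, hs.2.trans hU.2⟩
  change inner ℝ (q s) (act (B s) (d2Err f K c h n X s)) = _
  rw [inner_act_transpose, d2Err, inner_sub_right, dualCoef, clampTime_eq hs']

lemma inner_driftErr (hf : Tame f) (hK : KernelAssumptions K) (hc : Continuous c)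
    (hB : ∀ i j, Continuous fun s => B s i j) (p : Plane) (h : ℝ) (n : ℕ) (X : ℕ → Plane) (U : ℝ) :
    inner ℝ p (driftErr f K B c h n X U) =
      ∫ s in (0 : ℝ)..U, inner ℝ p (act (B s) (d2Err f K c h n X s)) := by
  have hi : Continuous fun s => act (B s) (d2Err f K c h n X s) :=
    (continuous_act_d2Err hf hK hc hB h n).comp (by fun_prop : Continuous fun s => (X, s))
  exact ((innerSL ℝ p).intervalIntegral_comp_comm (hi.intervalIntegrable _ _)).symm

variable {Ω : Type*} [MeasurableSpace Ω] {P : Measure Ω} [IsProbabilityMeasure P]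
  {X : ℕ → Ω → Plane} {h : ℕ → ℝ} {β : ℝ}

lemma BandwidthAssumptions.tendsto_rate_bounded (hh : BandwidthAssumptions h β) :
    Tendsto (fun n : ℕ => (n : ℝ) * h n ^ 5 * ((n : ℝ)⁻¹ * (h n)⁻¹ ^ 5 + h n ^ 4)) atTop
      (𝓝 (1 + β)) := by
  refine (tendsto_const_nhds.add hh.upper).congr' ?_
  filter_upwards [eventually_ne_atTop 0] with n hn
  have := hh.pos n
  have hn' : (n : ℝ) ≠ 0 := by exact_mod_cast hn
  field_simp

/-- The two products are (nh⁷)^(-1/2) and (nh⁹·h⁴)^(1/2). Squared errors of second derivatives are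
thus negligible at the scale √(nh⁵). -/
lemma BandwidthAssumptions.tendsto_rate_zero (hh : BandwidthAssumptions h β) :
    Tendsto (fun n : ℕ => √((n : ℝ) * h n ^ 5) * ((n : ℝ)⁻¹ * (h n)⁻¹ ^ 6 + h n ^ 4)) atTop
      (𝓝 0) := by
  have h7 : Tendsto (fun n : ℕ => (n : ℝ) * h n ^ 7) atTop atTop := by
    refine tendsto_atTop_mono' _ ?_ hh.tendsto_mul_pow_eight
    filter_upwards [hh.eventually_le_one] with n hn
    have hp := hh.pos n
    have : h n ^ 8 ≤ h n ^ 7 := pow_le_pow_of_le_one hp.le hn (by norm_num)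
    gcongr
  have h1 : Tendsto (fun n : ℕ => √((n : ℝ) * h n ^ 7)⁻¹) atTop (𝓝 0) := by
    simpa using h7.inv_tendsto_atTop.sqrt
  have h2 : Tendsto (fun n : ℕ => √((n : ℝ) * h n ^ 9 * h n ^ 4)) atTop (𝓝 0) := by
    simpa using (hh.upper.mul (hh.tendsto_zero.pow 4)).sqrt
  have h3 := h1.add h2
  rw [add_zero] at h3
  refine h3.congr' ?_
  filter_upwards [eventually_ne_atTop 0] with n hn
  have hp := hh.pos n
  have hn' : (0 : ℝ) < n := by positivity
  rw [mul_add]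
  congr 1
  · rw [Real.sqrt_eq_iff_mul_self_eq (by positivity) (by positivity)]
    have := Real.mul_self_sqrt (by positivity : 0 ≤ (n : ℝ) * h n ^ 5)
    symm
    calc √((n : ℝ) * h n ^ 5) * ((n : ℝ)⁻¹ * (h n)⁻¹ ^ 6) *
          (√((n : ℝ) * h n ^ 5) * ((n : ℝ)⁻¹ * (h n)⁻¹ ^ 6))
        = (√((n : ℝ) * h n ^ 5) * √((n : ℝ) * h n ^ 5)) * ((n : ℝ)⁻¹ * (h n)⁻¹ ^ 6) ^ 2 := by ring
      _ = ((n : ℝ) * h n ^ 7)⁻¹ := by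
        rw [this]
        field_simp
  · rw [Real.sqrt_eq_iff_mul_self_eq (by positivity) (by positivity)]
    have := Real.mul_self_sqrt (by positivity : 0 ≤ (n : ℝ) * h n ^ 5)
    symm
    calc √((n : ℝ) * h n ^ 5) * h n ^ 4 * (√((n : ℝ) * h n ^ 5) * h n ^ 4)
        = (√((n : ℝ) * h n ^ 5) * √((n : ℝ) * h n ^ 5)) * h n ^ 8 := by ring
      _ = (n : ℝ) * h n ^ 9 * h n ^ 4 := by
        rw [this]
        ring

/-- The integrated squared error of the second derivatives is negligible. -/
theorem IIDSample.tendsto_integral_sq_d2Err (hX : IIDSample f P X)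
    (hf : DensityAssumptions f H L l) (hK : KernelAssumptions K) (hh : BandwidthAssumptions h β)
    (hc : Continuous c) (hT : 0 ≤ T) :
    Tendsto (fun n : ℕ => √((n : ℝ) * h n ^ 5) *
      ∫ ω, (∫ s in (0 : ℝ)..T, ‖d2Err f K c (h n) n (fun i => X i ω) s‖ ^ 2) ∂P) atTop (𝓝 0) := by
  obtain ⟨R, hR⟩ := (isCompact_Icc (a := (0 : ℝ)) (b := T)).exists_bound_of_continuousOn
    hc.continuousOn
  choose C hC0 hC using fun j : Fin 3 =>
    hX.exists_integral_wd_kde_sub_sq_le hf hK R (w := d2word j) (by simp [length_d2word])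
  have hbound : ∀ᶠ n : ℕ in atTop, √((n : ℝ) * h n ^ 5) *
      ∫ ω, (∫ s in (0 : ℝ)..T, ‖d2Err f K c (h n) n (fun i => X i ω) s‖ ^ 2) ∂P ≤
      T * (∑ j, C j) * (√((n : ℝ) * h n ^ 5) * ((n : ℝ)⁻¹ * (h n)⁻¹ ^ 6 + h n ^ 4)) := by
    filter_upwards [eventually_ne_atTop 0, hh.eventually_le_one] with n hn h1
    have hp := hh.pos n
    obtain ⟨M, hM0, hM⟩ := exists_norm_d2Err_le hf hK c (h n) n
    have hce := continuous_d2Err hf.tame hK hc (h n) n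
    have key := integral_intervalIntegral_le (P := P) hX.meas
      (φ := fun x s => ‖d2Err f K c (h n) n x s‖ ^ 2) (T := T) (M := M ^ 2)
      (D := (∑ j, C j) * ((n : ℝ)⁻¹ * (h n)⁻¹ ^ 6 + h n ^ 4)) (by fun_prop) hT
      (fun x s _ => by
        rw [abs_of_nonneg (by positivity)]
        have := hM x s
        gcongr)
      (fun s hs => by
        rw [Finset.sum_mul]
        refine integral_sq_norm_le_sum hX.meas (v := fun x => d2Err f K c (h n) n x s) (M := M)
          (Continuous.along_left (φ := fun x s => d2Err f K c (h n) n x s) hce s) (fun x => hM x s)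
          fun j => ?_
        have := hC j (h n) hp h1 n hn (c s) (by simpa using hR s hs)
        rw [length_d2word] at this
        simpa only [d2Err, PiLp.sub_apply, d2_apply] using this)
    calc _ ≤ √((n : ℝ) * h n ^ 5) * (T * ((∑ j, C j) * ((n : ℝ)⁻¹ * (h n)⁻¹ ^ 6 + h n ^ 4))) := by
          gcongr
      _ = _ := by ring
  refine squeeze_zero' (Eventually.of_forall fun n => ?_) hbound
    (by simpa using hh.tendsto_rate_zero.const_mul (T * ∑ j, C j))
  exact mul_nonneg (Real.sqrt_nonneg _) (integral_nonneg fun ω =>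
    intervalIntegral.integral_nonneg hT fun s _ => sq_nonneg _)

/-- The accumulated error of the driving term has the rate of the limit theorem. -/
theorem IIDSample.exists_integral_sq_driftErr_le (hX : IIDSample f P X)
    (hf : DensityAssumptions f H L l) (hK : KernelAssumptions K) (hh : BandwidthAssumptions h β)
    (hc : PathData c c' T γ) (hB : ∀ i j, Continuous fun s => B s i j) :
    ∃ D, 0 ≤ D ∧ ∀ᶠ n : ℕ in atTop, ∀ t ∈ Icc 0 T, ∫ ω, (n : ℝ) * h n ^ 5 *
      ‖driftErr f K B c (h n) n (fun i => X i ω) t‖ ^ 2 ∂P ≤ D := by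
  have hT := hc.nonneg
  let e : Fin 2 → Plane := fun k => EuclideanSpace.single k 1
  choose A hA using fun k : Fin 2 => exists_norm_dualCoef_le hB (continuous_const (y := e k)) hT
  choose C hC0 hC using fun k : Fin 2 =>
    hX.exists_integral_path_sq_le hf hK hc (continuous_dualCoef hB continuous_const T) (hA k)
  have hβ := hh.nonneg
  refine ⟨(∑ k, C k) * (1 + β + 1), mul_nonneg (Finset.sum_nonneg fun k _ => hC0 k) (by linarith),
    ?_⟩
  filter_upwards [eventually_ne_atTop 0, hh.eventually_le_one,
    hh.tendsto_rate_bounded.eventually (ge_mem_nhds (lt_add_one (1 + β)))] with n hn h1 hr t ht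
  have hp := hh.pos n
  obtain ⟨M, hM0, hM⟩ := exists_norm_driftErr_le hf hK hB c (h n) n T
  have hcd := continuous_driftErr hf.tame hK hc.continuous hB (h n) n
  have hcs : Continuous fun x : ℕ → Plane => driftErr f K B c (h n) n x t :=
    Continuous.along_left (φ := fun x t => driftErr f K B c (h n) n x t) hcd t
  rw [integral_const_mul]
  have hsq : ∫ ω, ‖driftErr f K B c (h n) n (fun i => X i ω) t‖ ^ 2 ∂P ≤
      (∑ k, C k) * ((n : ℝ)⁻¹ * (h n)⁻¹ ^ 5 + h n ^ 4) := by
    rw [Finset.sum_mul]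
    refine integral_sq_norm_le_sum hX.meas (v := fun x => driftErr f K B c (h n) n x t) (M := M)
      hcs (fun x => hM x t ht) fun k => ?_
    have e2 : ∀ x : ℕ → Plane, driftErr f K B c (h n) n x t k =
        (∫ s in Ioc 0 t, inner ℝ (dualCoef B (fun _ => e k) T s) (d2 (kde K (h n) n x) (c s)))
          - ∫ s in Ioc 0 t, inner ℝ (dualCoef B (fun _ => e k) T s) (d2 f (c s)) := by
      intro x
      rw [← integral_inner_act_d2Err hf.tame hK hc.continuous hB continuous_const ht,
        ← inner_driftErr hf.tame hK hc.continuous hB]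
      simp [e, EuclideanSpace.inner_single_left]
    simp only [e2]
    exact hC k (h n) hp h1 n hn t ht
  calc _ ≤ (n : ℝ) * h n ^ 5 * ((∑ k, C k) * ((n : ℝ)⁻¹ * (h n)⁻¹ ^ 5 + h n ^ 4)) := by gcongr
    _ = (∑ k, C k) * ((n : ℝ) * h n ^ 5 * ((n : ℝ)⁻¹ * (h n)⁻¹ ^ 5 + h n ^ 4)) := by ring
    _ ≤ _ := mul_le_mul_of_nonneg_left hr (Finset.sum_nonneg fun k _ => hC0 k)

end


/-! ### The linear approximation of the estimated filament point -/

section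

variable {Ω : Type*} [MeasurableSpace Ω] {P : Measure Ω} [IsProbabilityMeasure P]
  {X : ℕ → Ω → Plane} {f K : Plane → ℝ} {H L : Set Plane} {a : ℝ} {h : ℕ → ℝ} {β : ℝ}
  {x₀ : Plane} {θ : ℝ}

lemma Continuous.along_right {A B E : Type*} [TopologicalSpace A] [TopologicalSpace B]
    [TopologicalSpace E] {φ : A → B → E} (hφ : Continuous fun p : A × B => φ p.1 p.2) (a : A) :
    Continuous fun b => φ a b :=
  hφ.comp (Continuous.prodMk_right a)

lemma KernelAssumptions.continuous_grad_kde (hK : KernelAssumptions K) (h : ℝ) (n : ℕ)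
    (x : Plane) : Continuous fun X : ℕ → Plane => grad (kde K h n X) x := by
  have : (fun X : ℕ → Plane => grad (kde K h n X) x) =
      fun X => WithLp.toLp 2 fun k => wd [k] (kde K h n X) x := by
    funext X; ext k; simp [grad_apply]
  rw [this]
  exact (PiLp.continuous_toLp 2 _).comp (continuous_pi fun k =>
    Continuous.along_left (φ := fun X x => wd [k] (kde K h n X) x)
      (hK.continuous_wd_kde h n (by simp)) x)

lemma KernelAssumptions.exists_norm_grad_kde_le (hK : KernelAssumptions K) (h : ℝ) (n : ℕ)
    (x : Plane) : ∃ M, 0 ≤ M ∧ ∀ X : ℕ → Plane, ‖grad (kde K h n X) x‖ ≤ M := by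
  choose M hM0 hM using fun k : Fin 2 => hK.exists_abs_wd_kde_le h n (w := [k]) (by simp)
  refine ⟨∑ k, M k, Finset.sum_nonneg fun k _ => hM0 k, fun X => (norm_le_sum_abs _).trans
    (Finset.sum_le_sum fun k _ => ?_)⟩
  rw [grad_apply]
  exact hM k X x

/-- The scaled error of the gradient. -/
noncomputable def gradErr (f K : Plane → ℝ) (β h : ℝ) (n : ℕ) (x : Plane) (X : ℕ → Plane) : Plane :=
  √((n : ℝ) * h ^ 5) • grad (kde K h n X) x - √β • bias f K x

lemma integrable_sq_gradErr (hX : ∀ i, Measurable (X i)) (hK : KernelAssumptions K) (β h : ℝ)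
    (n : ℕ) (x : Plane) :
    Integrable (fun ω => ‖gradErr f K β h n x fun i => X i ω‖ ^ 2) P := by
  obtain ⟨M, hM0, hM⟩ := hK.exists_norm_grad_kde_le h n x
  refine integrable_of_continuous_data hX (φ := fun y => ‖gradErr f K β h n x y‖ ^ 2)
    (M := (√((n : ℝ) * h ^ 5) * M + ‖√β • bias f K x‖) ^ 2) ?_ fun y => ?_
  · exact (((hK.continuous_grad_kde h n x).const_smul (√((n : ℝ) * h ^ 5))).sub
      continuous_const).norm.pow 2
  · rw [abs_of_nonneg (sq_nonneg _)]
    refine pow_le_pow_left₀ (norm_nonneg _) ((norm_sub_le _ _).trans ?_) 2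
    rw [norm_smul, Real.norm_eq_abs, abs_of_nonneg (Real.sqrt_nonneg _)]
    have := hM y
    gcongr

lemma IIDSample.tendsto_integral_sq_gradErr (hX : IIDSample f P X)
    (hf : DensityAssumptions f H L a) (hK : KernelAssumptions K) (hh : BandwidthAssumptions h β)
    {x : Plane} (hx : grad f x = 0) :
    Tendsto (fun n : ℕ => ∫ ω, ‖gradErr f K β (h n) n x fun i => X i ω‖ ^ 2 ∂P) atTop (𝓝 0) := by
  have hlim := tendsto_finsetSum Finset.univ fun k (_ : k ∈ (Finset.univ : Finset (Fin 2))) =>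
    hX.tendsto_integral_grad_sq hf hK hh x k
  rw [Finset.sum_const_zero] at hlim
  refine squeeze_zero (fun n => integral_nonneg fun ω => sq_nonneg _) (fun n => ?_) hlim
  obtain ⟨M, hM0, hM⟩ := hK.exists_norm_grad_kde_le (h n) n x
  refine integral_sq_norm_le_sum hX.meas (v := fun y => gradErr f K β (h n) n x y)
    (M := √((n : ℝ) * h n ^ 5) * M + ‖√β • bias f K x‖) ?_ (fun y => ?_) fun k => le_of_eq ?_
  · exact ((hK.continuous_grad_kde (h n) n x).const_smul (√((n : ℝ) * h n ^ 5))).sub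
      continuous_const
  · refine (norm_sub_le _ _).trans ?_
    rw [norm_smul, Real.norm_eq_abs, abs_of_nonneg (Real.sqrt_nonneg _)]
    have := hM y
    gcongr
  · have h0 : wd [k] f x = 0 := by rw [← grad_apply, hx]; rfl
    congr 1
    funext ω
    simp only [gradErr, PiLp.sub_apply, PiLp.smul_apply, smul_eq_mul, grad_apply, h0,
      sub_zero, bias_apply hK (hf.diffWords.mono (by norm_num)) x k]

lemma integrable_intervalIntegral_data (hX : ∀ i, Measurable (X i)) {φ : (ℕ → Plane) → ℝ → ℝ}
    (hφ : Continuous fun p : (ℕ → Plane) × ℝ => φ p.1 p.2) {T M : ℝ} (hT : 0 ≤ T)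
    (hM : ∀ x, ∀ s ∈ Icc 0 T, |φ x s| ≤ M) :
    Integrable (fun ω => ∫ s in (0 : ℝ)..T, φ (fun i => X i ω) s) P := by
  refine integrable_of_continuous_data hX (φ := fun x => ∫ s in (0 : ℝ)..T, φ x s)
    (M := M * |T - 0|)
    (intervalIntegral.continuous_parametric_intervalIntegral_of_continuous' hφ 0 T) fun x => ?_
  refine intervalIntegral.norm_integral_le_of_norm_le_const (f := φ x) fun s hs => ?_
  rw [uIoc_of_le hT] at hs
  exact hM x s (Ioc_subset_Icc_self hs)

lemma le_one_add_sq (x : ℝ) : x ≤ 1 + x ^ 2 := by nlinarith [sq_nonneg (x - 1)]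

lemma mul_le_add_div_mul_sq {c x η : ℝ} (hη : 0 < η) : c * x ≤ η + c ^ 2 / η * x ^ 2 := by
  have e : η + c ^ 2 / η * x ^ 2 = (η - c * x) ^ 2 / η + 2 * (c * x) := by
    field_simp
    ring
  have h1 : 0 ≤ (η - c * x) ^ 2 / η := by positivity
  have h2 : 0 ≤ η + c ^ 2 / η * x ^ 2 := by positivity
  linarith

/-- The scaled error of the estimated filament point differs from a linear functional of the errors
of the second derivatives along the path by a constant, up to terms that vanish in probability. -/
theorem IIDSample.tendsto_linearization (hX : IIDSample f P X) (hf : DensityAssumptions f H L a)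
    (hK : KernelAssumptions K) (hh : BandwidthAssumptions h β)
    (hx₀ : x₀ ∈ startSet f L a) (hθ : IsFirstTime f x₀ θ)
    (hpath : ∀ t : ℝ, |t| ≤ |θ| →
      ¬ (lam2 f (curve f x₀ t) = 0 ∧ dirSlope f (curve f x₀ t) = 0))
    (hflat : grad f (curve f x₀ θ) = 0) {σ : ℝ} (hσ : σ = 1 ∨ σ = -1) (hσθ : σ * |θ| = θ)
    {θhat : ℕ → Ω → ℝ}
    (hmin : ∀ᵐ ω ∂P, ∀ n, (∃ t, IsFirstTime (kde K (h n) n fun i => X i ω) x₀ t) →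
      IsFirstTime (kde K (h n) n fun i => X i ω) x₀ (θhat n ω))
    (p : Plane) {q : ℝ → Plane} (hq : Continuous q)
    (hqT : q |θ| = -(act (Gam f (curve f x₀ θ))ᵀ p))
    (hq' : ∀ s ∈ Icc 0 |θ|, HasDerivWithinAt q
      (-(act (σ • jac (V f) (curve f x₀ (σ * s)))ᵀ (q s))) (Icc 0 |θ|) s)
    {κ : ℝ} (hκ : 0 < κ) {ε : ℝ} (hε : 0 < ε) :
    ∀ᶠ n : ℕ in atTop, P.real {ω | κ < |√((n : ℝ) * h n ^ 5) *
        inner ℝ p (curve (kde K (h n) n fun i => X i ω) x₀ (θhat n ω) - curve f x₀ θ)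
      - (√((n : ℝ) * h n ^ 5) * (∫ s in (0 : ℝ)..|θ|,
          inner ℝ (q s) (act (σ • Gtilde f (curve f x₀ (σ * s)))
            (d2Err f K (fun s => curve f x₀ (σ * s)) (h n) n (fun i => X i ω) s)))
        - √β * (aPrime f (curve f x₀ θ))⁻¹ * inner ℝ p
          (act (PV f (curve f x₀ θ)) (bias f K (curve f x₀ θ))))|} ≤ ε := by
  have htame := hf.tame
  have hV := hf.V_curve_ne_zero hx₀ hθ
  have hT := abs_nonneg θ
  obtain ⟨γ, hpd⟩ := hf.exists_pathData hx₀ hθ hσ hσθ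
  have hcc : Continuous fun s => curve f x₀ (σ * s) := hpd.continuous
  have hBc : ∀ i j, Continuous fun s => (σ • Gtilde f (curve f x₀ (σ * s))) i j := fun i j =>
    (continuous_iff_continuousAt.2 fun s => ContinuousAt.comp (g := fun x => Gtilde f x i j)
      (f := fun s => curve f x₀ (σ * s)) (htame.continuousAt_Gtilde (hV _) i j)
      hcc.continuousAt).const_smul σ
  obtain ⟨R, hR⟩ := (isCompact_Icc (a := -(|θ| + 1)) (b := |θ| + 1)).exists_bound_of_continuousOn
    (htame.continuous_curve x₀).continuousOn
  have hR0 : 0 ≤ R := (norm_nonneg _).trans (hR 0 ⟨by linarith, by linarith⟩)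
  obtain ⟨C, hC0, hlin⟩ := hf.exists_linearization hx₀ hθ hpath hflat hσ hσθ (R := R + 1)
    (fun t ht => by linarith [hR t (abs_le.1 ht)]) p hq hqT hq'
  obtain ⟨D, hD0, hD⟩ := hX.exists_integral_sq_driftErr_le hf hK hh hpd hBc
  have hSlim := (hX.tendsto_integral_sq_d2Err hf hK hh hcc hT).const_mul C
  have hGlim := hX.tendsto_integral_sq_gradErr hf hK hh hflat
  rw [mul_zero] at hSlim
  set T := |θ| with hTdef
  set x' := curve f x₀ θ with hx'
  set c : ℝ → Plane := fun s => curve f x₀ (σ * s) with hc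
  set B : ℝ → Matrix (Fin 2) (Fin 3) ℝ := fun s => σ • Gtilde f (curve f x₀ (σ * s)) with hB
  set r : ℕ → ℝ := fun n => √((n : ℝ) * h n ^ 5) with hr
  have hr0 : ∀ n, 0 ≤ r n := fun n => Real.sqrt_nonneg _
  have hr2 : ∀ n : ℕ, r n ^ 2 = (n : ℝ) * h n ^ 5 := fun n => by
    have := hh.pos n
    exact Real.sq_sqrt (by positivity)
  set c₀ := |(aPrime f x')⁻¹| * ‖act (PV f x')ᵀ p‖ with hc₀
  set b₀ := ‖√β • bias f K x'‖ with hb₀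
  refine tendsto_zero_of_bound (κ₀ := 3 + T + b₀) (D := D + T * D + 1) (by positivity)
    (by positivity) (fun η hη => ?_) hκ hε
  obtain ⟨ε', hε', hg⟩ := hlin η hη
  -- U collects the part of the error that is controlled in mean. The squared errors of d² and of
  -- the gradient have vanishing expectation after scaling, and the accumulated drift errors have
  -- bounded expectation but carry the factor η.
  set U : ℕ → Ω → ℝ := fun n ω =>
    C * (r n * ∫ s in (0 : ℝ)..T, ‖d2Err f K c (h n) n (fun i => X i ω) s‖ ^ 2)
    + η * ((n : ℝ) * h n ^ 5 * ‖driftErr f K B c (h n) n (fun i => X i ω) T‖ ^ 2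
      + ∫ s in (0 : ℝ)..T, (n : ℝ) * h n ^ 5 * ‖driftErr f K B c (h n) n (fun i => X i ω) s‖ ^ 2)
    + (η + c₀ ^ 2 / η) * ‖gradErr f K β (h n) n x' fun i => X i ω‖ ^ 2 with hU
  have hSi : ∀ n, Integrable (fun ω =>
      ∫ s in (0 : ℝ)..T, ‖d2Err f K c (h n) n (fun i => X i ω) s‖ ^ 2) P := fun n => by
    obtain ⟨M, hM0, hM⟩ := exists_norm_d2Err_le hf hK c (h n) n
    refine integrable_intervalIntegral_data hX.meas
      (φ := fun x s => ‖d2Err f K c (h n) n x s‖ ^ 2) (M := M ^ 2)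
      ((continuous_d2Err htame hK hcc (h n) n).norm.pow 2) hT fun x s _ => ?_
    rw [abs_of_nonneg (sq_nonneg _)]
    exact pow_le_pow_left₀ (norm_nonneg _) (hM x s) 2
  have hWc : ∀ n : ℕ, Continuous fun p : (ℕ → Plane) × ℝ =>
      (n : ℝ) * h n ^ 5 * ‖driftErr f K B c (h n) n p.1 p.2‖ ^ 2 := fun n =>
    ((continuous_driftErr htame hK hcc hBc (h n) n).norm.pow 2).const_mul _
  have hWM : ∀ n : ℕ, ∃ M, ∀ x, ∀ s ∈ Icc 0 T,
      |(n : ℝ) * h n ^ 5 * ‖driftErr f K B c (h n) n x s‖ ^ 2| ≤ M := fun n => by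
    obtain ⟨M, hM0, hM⟩ := exists_norm_driftErr_le hf hK hBc c (h n) n T
    refine ⟨(n : ℝ) * h n ^ 5 * M ^ 2, fun x s hs => ?_⟩
    have := hh.pos n
    rw [abs_of_nonneg (by positivity)]
    exact mul_le_mul_of_nonneg_left (pow_le_pow_left₀ (norm_nonneg _) (hM x s hs) 2) (by positivity)
  have hWTi : ∀ n : ℕ, Integrable (fun ω =>
      (n : ℝ) * h n ^ 5 * ‖driftErr f K B c (h n) n (fun i => X i ω) T‖ ^ 2) P := fun n => by
    obtain ⟨M, hM⟩ := hWM n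
    exact integrable_of_continuous_data hX.meas
      (φ := fun x => (n : ℝ) * h n ^ 5 * ‖driftErr f K B c (h n) n x T‖ ^ 2) (M := M)
      (Continuous.along_left
        (φ := fun x s => (n : ℝ) * h n ^ 5 * ‖driftErr f K B c (h n) n x s‖ ^ 2) (hWc n) T)
      fun x => hM x T ⟨hT, le_rfl⟩
  have hWi : ∀ n : ℕ, Integrable (fun ω => ∫ s in (0 : ℝ)..T,
      (n : ℝ) * h n ^ 5 * ‖driftErr f K B c (h n) n (fun i => X i ω) s‖ ^ 2) P := fun n => by
    obtain ⟨M, hM⟩ := hWM n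
    exact integrable_intervalIntegral_data hX.meas
      (φ := fun x s => (n : ℝ) * h n ^ 5 * ‖driftErr f K B c (h n) n x s‖ ^ 2) (hWc n) hT hM
  have hGi : ∀ n, Integrable (fun ω => ‖gradErr f K β (h n) n x' fun i => X i ω‖ ^ 2) P :=
    fun n => integrable_sq_gradErr hX.meas hK β (h n) n x'
  have hU1 : ∀ n, Integrable (fun ω =>
      C * (r n * ∫ s in (0 : ℝ)..T, ‖d2Err f K c (h n) n (fun i => X i ω) s‖ ^ 2)) P :=
    fun n => ((hSi n).const_mul (r n)).const_mul C
  have hU2 : ∀ n : ℕ, Integrable (fun ω =>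
      η * ((n : ℝ) * h n ^ 5 * ‖driftErr f K B c (h n) n (fun i => X i ω) T‖ ^ 2
      + ∫ s in (0 : ℝ)..T, (n : ℝ) * h n ^ 5 * ‖driftErr f K B c (h n) n (fun i => X i ω) s‖ ^ 2)) P :=
    fun n => ((hWTi n).add (hWi n)).const_mul η
  have hU3 : ∀ n, Integrable (fun ω =>
      (η + c₀ ^ 2 / η) * ‖gradErr f K β (h n) n x' fun i => X i ω‖ ^ 2) P :=
    fun n => (hGi n).const_mul _
  have hI0 : ∀ n : ℕ, ∀ ω, 0 ≤ ∫ s in (0 : ℝ)..T,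
      (n : ℝ) * h n ^ 5 * ‖driftErr f K B c (h n) n (fun i => X i ω) s‖ ^ 2 := fun n ω =>
    intervalIntegral.integral_nonneg hT fun s _ => by have := hh.pos n; positivity
  have hS0 : ∀ n ω, 0 ≤ ∫ s in (0 : ℝ)..T, ‖d2Err f K c (h n) n (fun i => X i ω) s‖ ^ 2 :=
    fun n ω => intervalIntegral.integral_nonneg hT fun s _ => by positivity
  -- The exceptional set consists of the samples for which the estimator is not close to the density
  -- and of the null set on which the minimality of the estimated time may fail.
  refine ⟨U, fun n => {ω | ¬ Close f (kde K (h n) n fun i => X i ω) (R + 1) ε'} ∪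
      {ω | ¬ ∀ n, (∃ t, IsFirstTime (kde K (h n) n fun i => X i ω) x₀ t) →
        IsFirstTime (kde K (h n) n fun i => X i ω) x₀ (θhat n ω)}, fun n => ?_, fun n ω => ?_, ?_, ?_,
      Eventually.of_forall fun n ω hω => ?_⟩
  · exact ((hU1 n).add (hU2 n)).add (hU3 n)
  · have h1 := hI0 n ω
    have h2 := hS0 n ω
    have h3 := hr0 n
    have h4 := hh.pos n
    simp only [hU]
    positivity
  · have hlim : Tendsto (fun n : ℕ => C * (r n *
        ∫ ω, (∫ s in (0 : ℝ)..T, ‖d2Err f K c (h n) n (fun i => X i ω) s‖ ^ 2) ∂P)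
        + (η + c₀ ^ 2 / η) * ∫ ω, ‖gradErr f K β (h n) n x' fun i => X i ω‖ ^ 2 ∂P) atTop (𝓝 0) := by
      have h1 := hSlim.add (hGlim.const_mul (η + c₀ ^ 2 / η))
      rwa [mul_zero, add_zero] at h1
    filter_upwards [hlim.eventually (ge_mem_nhds hη), hD] with n h1 h2
    obtain ⟨M, hM⟩ := hWM n
    have h3 := h2 T ⟨hT, le_rfl⟩
    have h4 := integral_intervalIntegral_le (P := P) hX.meas
      (φ := fun x s => (n : ℝ) * h n ^ 5 * ‖driftErr f K B c (h n) n x s‖ ^ 2) (hWc n) hT hM h2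
    have e : ∫ ω, U n ω ∂P = C * (r n *
        ∫ ω, (∫ s in (0 : ℝ)..T, ‖d2Err f K c (h n) n (fun i => X i ω) s‖ ^ 2) ∂P)
        + η * ((∫ ω, (n : ℝ) * h n ^ 5 * ‖driftErr f K B c (h n) n (fun i => X i ω) T‖ ^ 2 ∂P)
          + ∫ ω, (∫ s in (0 : ℝ)..T,
            (n : ℝ) * h n ^ 5 * ‖driftErr f K B c (h n) n (fun i => X i ω) s‖ ^ 2) ∂P)
        + (η + c₀ ^ 2 / η) * ∫ ω, ‖gradErr f K β (h n) n x' fun i => X i ω‖ ^ 2 ∂P := by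
      simp only [hU]
      have hU12 : Integrable (fun ω =>
          C * (r n * ∫ s in (0 : ℝ)..T, ‖d2Err f K c (h n) n (fun i => X i ω) s‖ ^ 2)
          + η * ((n : ℝ) * h n ^ 5 * ‖driftErr f K B c (h n) n (fun i => X i ω) T‖ ^ 2
            + ∫ s in (0 : ℝ)..T,
              (n : ℝ) * h n ^ 5 * ‖driftErr f K B c (h n) n (fun i => X i ω) s‖ ^ 2)) P :=
        (hU1 n).add (hU2 n)
      rw [integral_add hU12 (hU3 n), integral_add (hU1 n) (hU2 n),
        integral_const_mul, integral_const_mul, integral_const_mul, integral_const_mul,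
        integral_add (hWTi n) (hWi n)]
    rw [e]
    have h5 := mul_le_mul_of_nonneg_left (add_le_add h3 h4) hη.le
    linarith
  · have h1 := hX.tendsto_measure_not_close hf hK hh (R := R + 1) (by linarith) hε'
    refine tendsto_of_tendsto_of_tendsto_of_le_of_le tendsto_const_nhds h1 (fun n => bot_le)
      fun n => (measure_union_le _ _).trans ?_
    rw [ae_iff.1 hmin, add_zero]
  · have hclose : Close f (kde K (h n) n fun i => X i ω) (R + 1) ε' := by
      by_contra hcon
      exact hω (Or.inl hcon)
    have hfirst : ∀ n, (∃ t, IsFirstTime (kde K (h n) n fun i => X i ω) x₀ t) →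
        IsFirstTime (kde K (h n) n fun i => X i ω) x₀ (θhat n ω) := by
      by_contra hcon
      exact hω (Or.inr hcon)
    obtain ⟨hex, hall⟩ := hg _ (hK.tame_kde (h n) n fun i => X i ω) hclose
    have hmain := hall _ (hfirst n hex) (d2Err f K c (h n) n fun i => X i ω) (fun s => rfl)
      (driftErr f K B c (h n) n fun i => X i ω) (fun t => rfl)
    set u := inner ℝ p (curve (kde K (h n) n fun i => X i ω) x₀ (θhat n ω) - x') with hu
    set i₁ := ∫ s in (0 : ℝ)..T, inner ℝ (q s) (act (σ • Gtilde f (curve f x₀ (σ * s)))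
      (d2Err f K c (h n) n (fun i => X i ω) s)) with hi₁
    set g := grad (kde K (h n) n fun i => X i ω) x' with hgdef
    set Eg := gradErr f K β (h n) n x' fun i => X i ω with hEg
    set S := ∫ s in (0 : ℝ)..T, ‖d2Err f K c (h n) n (fun i => X i ω) s‖ ^ 2 with hS
    set W := driftErr f K B c (h n) n fun i => X i ω with hW
    have hWcont : Continuous W :=
      Continuous.along_right (φ := fun x s => driftErr f K B c (h n) n x s)
        (continuous_driftErr htame hK hcc hBc (h n) n) fun i => X i ω
    have hr := hr0 n
    -- The linearization involves first powers of the errors whereas the moment bounds are for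
    -- squares; y ≤ 1 + y² converts one into the other, and the factor η in front keeps the constant
    -- 1 harmless.
    have s1 : r n * ‖W T‖ ≤ 1 + (n : ℝ) * h n ^ 5 * ‖W T‖ ^ 2 := by
      have := le_one_add_sq (r n * ‖W T‖)
      rwa [mul_pow, hr2] at this
    have s2 : r n * (∫ s in (0 : ℝ)..T, ‖W s‖) ≤
        T + ∫ s in (0 : ℝ)..T, (n : ℝ) * h n ^ 5 * ‖W s‖ ^ 2 := by
      have hc1 : Continuous fun s => (n : ℝ) * h n ^ 5 * ‖W s‖ ^ 2 := by fun_prop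
      have hc2 : Continuous fun s => r n * ‖W s‖ := by fun_prop
      have h1 : ∫ s in (0 : ℝ)..T, r n * ‖W s‖ ≤
          ∫ s in (0 : ℝ)..T, (1 + (n : ℝ) * h n ^ 5 * ‖W s‖ ^ 2) := by
        refine intervalIntegral.integral_mono_on hT (hc2.intervalIntegrable _ _)
          ((continuous_const.add hc1).intervalIntegrable _ _) fun s _ => ?_
        have := le_one_add_sq (r n * ‖W s‖)
        rwa [mul_pow, hr2] at this
      rw [intervalIntegral.integral_const_mul, intervalIntegral.integral_add
        (continuous_const.intervalIntegrable _ _) (hc1.intervalIntegrable _ _),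
        intervalIntegral.integral_const, sub_zero, smul_eq_mul, mul_one] at h1
      exact h1
    have hEgdef : Eg = r n • g - √β • bias f K x' := rfl
    have s3 : r n * ‖g‖ ≤ 1 + ‖Eg‖ ^ 2 + b₀ := by
      have h1 : r n • g = Eg + √β • bias f K x' := by rw [hEgdef]; abel
      have h2 := norm_add_le Eg (√β • bias f K x')
      rw [← h1, norm_smul, Real.norm_eq_abs, abs_of_nonneg hr] at h2
      have h3 := le_one_add_sq ‖Eg‖
      linarith
    -- This term carries no factor η, so the inequality cy ≤ η + (c²/η)y² supplies a small constant
    -- instead; the large coefficient c²/η is harmless because the mean of ‖Eg‖² tends to zero.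
    have s4 : |(aPrime f x')⁻¹ * inner ℝ p (act (PV f x') Eg)| ≤ η + c₀ ^ 2 / η * ‖Eg‖ ^ 2 := by
      refine le_trans ?_ (mul_le_add_div_mul_sq hη)
      rw [abs_mul, inner_act_transpose, hc₀, mul_assoc]
      exact mul_le_mul_of_nonneg_left (abs_real_inner_le_norm _ _) (abs_nonneg _)
    have hsplit : r n * u - (r n * i₁ - √β * (aPrime f x')⁻¹ *
        inner ℝ p (act (PV f x') (bias f K x'))) =
        r n * (u - (i₁ - (aPrime f x')⁻¹ * inner ℝ p (act (PV f x') g)))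
          - (aPrime f x')⁻¹ * inner ℝ p (act (PV f x') Eg) := by
      rw [hEgdef, act_sub, act_smul, act_smul, inner_sub_right, real_inner_smul_right,
        real_inner_smul_right]
      ring
    rw [hsplit]
    refine (abs_sub _ _).trans ?_
    rw [abs_mul, abs_of_nonneg hr]
    have s5 := mul_le_mul_of_nonneg_left hmain hr
    have s6 : η * (r n * ‖W T‖ + r n * (∫ s in (0 : ℝ)..T, ‖W s‖) + r n * ‖g‖) ≤
        η * ((1 + (n : ℝ) * h n ^ 5 * ‖W T‖ ^ 2)
          + (T + ∫ s in (0 : ℝ)..T, (n : ℝ) * h n ^ 5 * ‖W s‖ ^ 2) + (1 + ‖Eg‖ ^ 2 + b₀)) := by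
      gcongr
    have hUeq : U n ω = C * (r n * S) + η * ((n : ℝ) * h n ^ 5 * ‖W T‖ ^ 2
        + ∫ s in (0 : ℝ)..T, (n : ℝ) * h n ^ 5 * ‖W s‖ ^ 2) + (η + c₀ ^ 2 / η) * ‖Eg‖ ^ 2 := rfl
    rw [hUeq]
    linarith

end


/-! ### The limit law -/

section

lemma act_neg {p q : ℕ} (M : Matrix (Fin q) (Fin p) ℝ) (v : EuclideanSpace ℝ (Fin p)) :
    act M (-v) = -act M v := map_neg _ _

variable {f K : Plane → ℝ} {H L : Set Plane} {a : ℝ} {h : ℕ → ℝ} {β : ℝ} {x₀ : Plane} {θ : ℝ}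

lemma integral_dualCoef {B : ℝ → Matrix (Fin 2) (Fin 3) ℝ} {q : ℝ → Plane} {T : ℝ} (hT : 0 ≤ T)
    (F : ℝ → Space → ℝ) :
    ∫ s in (0 : ℝ)..T, F s (act (B s)ᵀ (q s)) = ∫ s in Ioc 0 T, F s (dualCoef B q T s) := by
  rw [intervalIntegral.integral_of_le hT]
  refine setIntegral_congr_fun measurableSet_Ioc fun s hs => ?_
  simp only [dualCoef, clampTime_eq (Ioc_subset_Icc_self hs)]

lemma posSemidef_of_inner_act {S : Matrix (Fin 2) (Fin 2) ℝ} (hS : Sᵀ = S)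
    (h : ∀ v : Plane, 0 ≤ (inner ℝ v (act S v) : ℝ)) : S.PosSemidef := by
  refine Matrix.PosSemidef.of_dotProduct_mulVec_nonneg
    (by rw [Matrix.IsHermitian, Matrix.conjTranspose_eq_transpose_of_trivial, hS]) fun v => ?_
  have := h (WithLp.toLp 2 v)
  simp only [PiLp.inner_apply, act_apply, RCLike.inner_apply, conj_trivial] at this
  simp only [dotProduct, Matrix.mulVec, star_trivial]
  exact this.trans_eq (Finset.sum_congr rfl fun i _ => mul_comm _ _)

lemma inner_act_eq_dotProduct (S : Matrix (Fin 2) (Fin 2) ℝ) (v : Plane) :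
    (inner ℝ v (act S v) : ℝ) = v.ofLp ⬝ᵥ S *ᵥ v.ofLp := by
  simp only [PiLp.inner_apply, act_apply, RCLike.inner_apply, conj_trivial, dotProduct,
    Matrix.mulVec]
  exact Finset.sum_congr rfl fun i _ => mul_comm _ _

variable {Ω : Type*} [MeasurableSpace Ω] {P : Measure Ω} [IsProbabilityMeasure P]
  {X : ℕ → Ω → Plane}

/-- Curves of the estimator are jointly continuous in the data and in time, so a random time may be
inserted. -/
lemma aemeasurable_curve_kde (hX : ∀ i, Measurable (X i)) (hK : KernelAssumptions K) (h : ℝ) (n : ℕ)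
    (x₀ : Plane) {τ : Ω → ℝ} (hτ : AEMeasurable τ P) :
    AEMeasurable (fun ω => curve (kde K h n fun i => X i ω) x₀ (τ ω)) P :=
  Measurable.comp_aemeasurable (g := fun p : (ℕ → Plane) × ℝ => curve (kde K h n p.1) x₀ p.2)
    (f := fun ω => (fun i => X i ω, τ ω)) (hK.continuous_curve_kde h n x₀).measurable
    ((measurable_pi_lambda _ hX).aemeasurable.prodMk hτ)

/-- Lévy's continuity theorem: for each p the characteristic function is computed with the adjoint
solution belonging to p. `tendsto_linearization` replaces the scaled error by a path integral minus
a constant, `tendsto_integral_cexp_path` gives the limit, and duality rewrites it through m(θ) and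
Σ(θ). -/
theorem IIDSample.tendstoInDistribution (hX : IIDSample f P X) (hf : DensityAssumptions f H L a)
    (hK : KernelAssumptions K) (hh : BandwidthAssumptions h β)
    (hx₀ : x₀ ∈ startSet f L a) (hθ : IsFirstTime f x₀ θ)
    (hpath : ∀ t : ℝ, |t| ≤ |θ| →
      ¬ (lam2 f (curve f x₀ t) = 0 ∧ dirSlope f (curve f x₀ t) = 0))
    (hflat : grad f (curve f x₀ θ) = 0) {θhat : ℕ → Ω → ℝ} (hmeas : ∀ n, AEMeasurable (θhat n) P)
    (hmin : ∀ᵐ ω ∂P, ∀ n, (∃ t, IsFirstTime (kde K (h n) n fun i => X i ω) x₀ t) →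
      IsFirstTime (kde K (h n) n fun i => X i ω) x₀ (θhat n ω)) :
    ∃ (m : ℝ → Plane) (S : ℝ → Matrix (Fin 2) (Fin 2) ℝ),
      IsLimitMean f K β x₀ θ m ∧ IsLimitCov f K x₀ θ S ∧ (S θ).PosSemidef ∧
      TendstoInDistribution
        (fun (n : ℕ) (ω : Ω) => √((n : ℝ) * h n ^ 5) •
          (curve (kde K (h n) n fun i => X i ω) x₀ (θhat n ω) - curve f x₀ θ))
        atTop id (fun _ => P)
        (multivariateGaussian
          (-(act (Gam f (curve f x₀ θ)) (m θ)) -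
            (√β * (aPrime f (curve f x₀ θ))⁻¹) •
              act (PV f (curve f x₀ θ)) (bias f K (curve f x₀ θ)))
          (Gam f (curve f x₀ θ) * S θ * (Gam f (curve f x₀ θ))ᵀ)) := by
  obtain ⟨σ, hσ, hσθ⟩ : ∃ σ : ℝ, (σ = 1 ∨ σ = -1) ∧ σ * |θ| = θ := by
    rcases le_total 0 θ with h | h
    · exact ⟨1, Or.inl rfl, by simp [abs_of_nonneg h]⟩
    · exact ⟨-1, Or.inr rfl, by simp [abs_of_nonpos h]⟩
  have htame := hf.tame
  have hV := hf.V_curve_ne_zero hx₀ hθ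
  have hT := abs_nonneg θ
  obtain ⟨γ, hpd⟩ := hf.exists_pathData hx₀ hθ hσ hσθ
  have hcc : Continuous fun s => curve f x₀ (σ * s) := hpd.continuous
  have hBc : ∀ i j, Continuous fun s => (σ • Gtilde f (curve f x₀ (σ * s))) i j := fun i j =>
    (continuous_iff_continuousAt.2 fun s => ContinuousAt.comp (g := fun x => Gtilde f x i j)
      (f := fun s => curve f x₀ (σ * s)) (htame.continuousAt_Gtilde (hV _) i j)
      hcc.continuousAt).const_smul σ
  have hAc : ∀ i j, Continuous fun s => (σ • jac (V f) (curve f x₀ (σ * s))) i j := fun i j =>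
    (continuous_iff_continuousAt.2 fun s => ContinuousAt.comp (g := fun x => jac (V f) x i j)
      (f := fun s => curve f x₀ (σ * s)) (hf.continuousAt_jac_V (hV _) i j)
      hcc.continuousAt).const_smul σ
  obtain ⟨m, S, hm, hS, hSs, hdual⟩ := hf.exists_limit_mean_cov hK hx₀ hθ β hσ hσθ
  set T := |θ| with hTdef
  set x' := curve f x₀ θ with hx'
  set c : ℝ → Plane := fun s => curve f x₀ (σ * s) with hc
  set B : ℝ → Matrix (Fin 2) (Fin 3) ℝ := fun s => σ • Gtilde f (curve f x₀ (σ * s)) with hB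
  have hvar : ∀ q : ℝ → Plane, Continuous q → (∀ s ∈ Icc 0 T, HasDerivWithinAt q
      (-(act (σ • jac (V f) (curve f x₀ (σ * s)))ᵀ (q s))) (Icc 0 T) s) →
      inner ℝ (q T) (act (S θ) (q T)) =
        pathVar f K (dualCoef B q T) c (fun s => σ • V f (curve f x₀ (σ * s))) T := by
    intro q hq hq'
    rw [(hdual q hq hq').2, pathVar_eq hK _ hσ (fun s => rfl) fun s => hV _]
    exact integral_dualCoef (B := B) hT fun s y => inner ℝ y (act (innerCov f K (c s)) y)
  -- An arbitrary v is the final value of some adjoint solution, and the quadratic form at v is then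
  -- a path variance, which is nonnegative.
  have hpsd : ∀ v : Plane, 0 ≤ (inner ℝ v (act (S θ) v) : ℝ) := by
    intro v
    obtain ⟨q, hq, hqT, hq'⟩ := exists_adjoint hAc hT v
    have h1 := hvar q hq hq'
    obtain ⟨A, hA⟩ := exists_norm_dualCoef_le (B := B) hBc hq hT
    rw [hqT] at h1
    rw [h1]
    exact hpd.pathVar_nonneg hf hK (continuous_dualCoef (B := B) hBc hq T) hA
  set Γ := Gam f x' with hΓ
  have hcov : (Γ * S θ * Γᵀ).PosSemidef := by
    refine posSemidef_of_inner_act ?_ fun v => ?_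
    · simp only [Matrix.transpose_mul, Matrix.transpose_transpose, hSs, Matrix.mul_assoc]
    · rw [← act_act, ← act_act, inner_act_transpose]
      exact hpsd _
  have hYm : ∀ n : ℕ, AEMeasurable (fun ω => √((n : ℝ) * h n ^ 5) •
      (curve (kde K (h n) n fun i => X i ω) x₀ (θhat n ω) - x')) P := fun n =>
    ((aemeasurable_curve_kde hX.meas hK (h n) n x₀ (hmeas n)).sub_const x').const_smul
      (√((n : ℝ) * h n ^ 5))
  refine ⟨m, S, hm, hS, posSemidef_of_inner_act hSs hpsd, ⟨hYm, aemeasurable_id, ?_⟩⟩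
  refine ProbabilityMeasure.tendsto_iff_tendsto_charFun.2 fun p => ?_
  simp only [ProbabilityMeasure.coe_mk, Measure.map_id]
  rw [charFun_multivariateGaussian hcov]
  -- With this final value ⟨q(|θ|), m(θ)⟩ = -⟨p, Γm(θ)⟩; the sign cancels in the quadratic form,
  -- which becomes that of ΓΣ(θ)Γᵀ at p.
  obtain ⟨q, hq, hqT, hq'⟩ := exists_adjoint hAc hT (-(act Γᵀ p))
  obtain ⟨A, hA⟩ := exists_norm_dualCoef_le (B := B) hBc hq hT
  have ha := continuous_dualCoef (B := B) hBc hq T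
  set κ := √β * (aPrime f x')⁻¹ * inner ℝ p (act (PV f x') (bias f K x')) with hκ
  have hpath' := hX.tendsto_integral_cexp_path hf hK hh hpd ha hA
  have hL : ∀ (n : ℕ) ω, (∫ s in (0 : ℝ)..T, inner ℝ (q s) (act (B s)
      (d2Err f K c (h n) n (fun i => X i ω) s))) =
      (∫ s in Ioc 0 T, inner ℝ (dualCoef B q T s) (d2 (kde K (h n) n fun i => X i ω) (c s)))
        - ∫ s in Ioc 0 T, inner ℝ (dualCoef B q T s) (d2 f (c s)) := fun n ω =>
    integral_inner_act_d2Err htame hK hcc hBc hq ⟨hT, le_rfl⟩ _ _ _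
  simp only [← hL] at hpath'
  have hLm : ∀ n : ℕ, AEMeasurable (fun ω => √((n : ℝ) * h n ^ 5) *
      (∫ s in (0 : ℝ)..T, inner ℝ (q s) (act (B s)
        (d2Err f K c (h n) n (fun i => X i ω) s)))) P := by
    intro n
    have h1 : Continuous fun x : ℕ → Plane => ∫ s in (0 : ℝ)..T, inner ℝ (q s) (act (B s)
        (d2Err f K c (h n) n x s)) :=
      intervalIntegral.continuous_parametric_intervalIntegral_of_continuous'
        (f := fun x s => inner ℝ (q s) (act (B s) (d2Err f K c (h n) n x s)))
        ((hq.comp continuous_snd).inner (continuous_act_d2Err htame hK hcc hBc (h n) n)) 0 T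
    exact ((h1.measurable.comp (measurable_pi_lambda _ hX.meas)).const_mul
      (√((n : ℝ) * h n ^ 5))).aemeasurable
  have hlim : Tendsto (fun n : ℕ => ∫ ω, Complex.exp (((√((n : ℝ) * h n ^ 5) *
      (∫ s in (0 : ℝ)..T, inner ℝ (q s) (act (B s)
        (d2Err f K c (h n) n (fun i => X i ω) s))) - κ : ℝ) : ℂ) * Complex.I) ∂P) atTop
      (𝓝 (Complex.exp ((√β * ∫ s in Ioc 0 T, inner ℝ (dualCoef B q T s)
        ((2⁻¹ : ℝ) • vBias f K (c s)) : ℝ) * Complex.I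
        - (pathVar f K (dualCoef B q T) c (fun s => σ • V f (curve f x₀ (σ * s))) T : ℝ) / 2)
        * Complex.exp (-(κ * Complex.I)))) := by
    refine (hpath'.mul_const _).congr fun n => ?_
    rw [← integral_mul_const]
    congr 1
    funext ω
    rw [← Complex.exp_add]
    congr 1
    push_cast
    ring
  have hA' := tendsto_integral_cexp_of_close (P := P)
    (A := fun (n : ℕ) ω => √((n : ℝ) * h n ^ 5) *
        inner ℝ p (curve (kde K (h n) n fun i => X i ω) x₀ (θhat n ω) - x'))
    (fun n => ?_) (fun n => (hLm n).sub_const κ)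
    (fun κ' hκ' δ hδ => hX.tendsto_linearization hf hK hh hx₀ hθ hpath hflat hσ hσθ hmin p hq hqT
      hq' hκ' hδ) hlim
  · have hmean := (hdual q hq hq').1
    have hv := hvar q hq hq'
    rw [integral_dualCoef (B := B) hT fun s y => inner ℝ y ((2⁻¹ : ℝ) • vBias f K (c s))] at hmean
    rw [← hmean, ← hv, ← Complex.exp_add] at hA'
    convert! hA' using 1
    · funext n
      rw [charFun_apply, integral_map (hYm n) (by fun_prop)]
      congr 1
      funext ω
      rw [real_inner_smul_left, real_inner_comm]
    · congr 2
      rw [← inner_act_eq_dotProduct, ← act_act, ← act_act, inner_act_transpose, hqT,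
        act_neg, inner_neg_left, inner_neg_left, inner_neg_right, neg_neg, inner_sub_right,
        inner_neg_right, real_inner_smul_right, inner_act_transpose Γ, hκ]
      push_cast
      ring
  · have h1 : Continuous fun y : Plane => (inner ℝ p y : ℝ) := by fun_prop
    exact ((h1.measurable.comp_aemeasurable
      ((aemeasurable_curve_kde hX.meas hK (h n) n x₀ (hmeas n)).sub_const x')).const_mul
      (√((n : ℝ) * h n ^ 5)))

end

end Filament

theorem corollary3p2
    (f K : Plane → ℝ) (H L : Set Plane) (a : ℝ) (h : ℕ → ℝ) (β : ℝ)
    (hf : DensityAssumptions f H L a) (hK : KernelAssumptions K)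
    (hh : BandwidthAssumptions h β)
    (x₀ : Plane) (hx₀ : x₀ ∈ startSet f L a)
    (θ : ℝ) (hθ : IsFirstTime f x₀ θ)
    (hpath : ∀ t : ℝ, |t| ≤ |θ| →
      ¬ (lam2 f (curve f x₀ t) = 0 ∧ dirSlope f (curve f x₀ t) = 0))
    (hflat : ‖grad f (curve f x₀ θ)‖ = 0)
    {Ω : Type*} [MeasurableSpace Ω] (P : Measure Ω) [IsProbabilityMeasure P]
    (X : ℕ → Ω → Plane) (hindep : iIndepFun X P)
    (hlaw : ∀ i, HasLaw (X i) (volume.withDensity fun x => ENNReal.ofReal (f x)) P)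
    (θhat : ℕ → Ω → ℝ) (hmeas : ∀ n, AEMeasurable (θhat n) P)
    (hmin : ∀ n ω,
      (∃ t, IsFirstTime (kde K (h n) n fun i => X i ω) x₀ t) →
        IsFirstTime (kde K (h n) n fun i => X i ω) x₀ (θhat n ω))
    (hempty : ∀ n ω, Theta (kde K (h n) n fun i => X i ω) x₀ = ∅ → θhat n ω = 0) :
    ∃ (m : ℝ → Plane) (S : ℝ → Matrix (Fin 2) (Fin 2) ℝ),
      IsLimitMean f K β x₀ θ m ∧ IsLimitCov f K x₀ θ S ∧ (S θ).PosSemidef ∧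
      TendstoInDistribution
        (fun (n : ℕ) (ω : Ω) => √((n : ℝ) * h n ^ 5) •
          (curve (kde K (h n) n fun i => X i ω) x₀ (θhat n ω) - curve f x₀ θ))
        atTop id (fun _ => P)
        (multivariateGaussian
          (-(act (Gam f (curve f x₀ θ)) (m θ)) -
            (√β * (aPrime f (curve f x₀ θ))⁻¹) •
              act (PV f (curve f x₀ θ)) (bias f K (curve f x₀ θ)))
          (Gam f (curve f x₀ θ) * S θ * (Gam f (curve f x₀ θ))ᵀ)) := by
  -- `HasLaw` provides only almost everywhere measurable observations. They are replaced by
  -- measurable versions, which agree with them simultaneously for all indices outside one null set.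
  have hae : ∀ i, X i =ᵐ[P] (hlaw i).aemeasurable.mk (X i) := fun i => (hlaw i).aemeasurable.ae_eq_mk
  have hall : ∀ᵐ ω ∂P, (fun i => X i ω) = fun i => (hlaw i).aemeasurable.mk (X i) ω := by
    filter_upwards [ae_all_iff.2 hae] with ω hω
    exact funext hω
  have hX := hf.iidSample (P := P) (X := fun i => (hlaw i).aemeasurable.mk (X i))
    (fun i => (hlaw i).aemeasurable.measurable_mk) (hindep.congr hae)
    fun i => (hlaw i).congr (hae i).symm
  obtain ⟨m, S, hm, hS, hpsd, hlim⟩ := hX.tendstoInDistribution hf hK hh hx₀ hθ hpath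
    (norm_eq_zero.1 hflat) hmeas (by
      filter_upwards [hall] with ω hω n
      rw [← hω]
      exact hmin n ω)
  refine ⟨m, S, hm, hS, hpsd, hlim.congr (fun n => ?_) (ae_eq_refl _)⟩
  filter_upwards [hall] with ω hω
  rw [← hω]
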